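/- Let $k$ be a field and let $H=(H,\Delta,\varepsilon,\Phi,S,\alpha,\beta)$ be a finite-dimensional quasi-Hopf algebra over $k$ (in the sense of Drinfeld; the anti-endomorphism $S$ is not assumed bijective). Write $\Phi^{-1}=x^1\otimes x^2\otimes x^3=y^1\otimes y^2\otimes y^3$ and $\Delta(h)=h_1\otimes h_2$. **Ribbon categories.** A twist on a braided category $(\mathcal C,c)$ is a natural automorphism $\theta$ of the identity functor with $\theta_{X\otimes Y}=(\theta_X\otimes\theta_Y)c_{Y,X}c_{X,Y}$. If every object has a left dual $X^*$ and $\theta_{X^*}=(\theta_X)^*$, then $\mathcal C$ is a ribbon category. An equivalence of ribbon categories is an equivalence of categories given by a braided strong monoidal functor $F$ with $F(\theta_X)=\theta_{F(X)}$; it is compatible with left duals. For a braided category $(\mathcal C,c)$ with left duals, $\mathcal R(\mathcal C,c)$ has as objects the pairs $(V,\eta_V)$ of an object $V$ and an automorphism $\eta_V$ of $V$ such that $\eta_V^{-2}$ is the composite (associators and unit constraints suppressed) $$V\xrightarrow{\mathrm{coev}_V\otimes V}V\otimes V^*\otimes V\xrightarrow{c_{V,V^*}\otimes V}V^*\otimes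 V\otimes V\xrightarrow{c_{V^*,V}\otimes V}V\otimes V^*\otimes V\xrightarrow{V\otimes \mathrm{ev}_V}V.$$ Morphisms $(V,\eta_V)\to(W,\eta_W)$ are the morphisms $f$ of $\mathcal C$ with $f\eta_V=\eta_Wf$, the tensor product is $(V,\eta_V)\otimes(W,\eta_W)=(V\otimes W,(\eta_V\otimes\eta_W)c_{W,V}c_{V,W})$, the braiding is $c$ and the twist is $\eta$. For a monoidal category $\mathcal C$ let $\overline{\mathcal C}$ be $\mathcal C$ with reversed tensor product and let $\mathfrak R_r(\mathcal C)=\overline{\mathcal R(\mathcal Z(\overline{\mathcal C}))}$, where $\mathcal Z$ is the Drinfeld centre; its objects are objects $V$ of $\mathcal C$ with a half braiding $X\otimes V\to V\otimes X$ ($X\in\mathcal C$) and an automorphism. **Modules.** ${}_H\mathcal M^{\rm fd}$ is the monoidal category of finite-dimensional left $H$-modules. Objects of ${}_H\mathcal{YD}^{H\,{\rm fd}}$ are finite-dimensional left $H$-modules $V$ with a linear map $V\to V\otimes H$, $v\mapsto v_0\otimes v_1$, such that $\varepsilon(v_1)v_0=v$, $(h_2v)_0\otimes(h_2v)_1h_1=h_1v_0\otimes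 h_2v_1$ and $$(x^2v_0)_0\otimes(x^2v_0)_1x^1\otimes x^3v_1=x^1(y^3v)_0\otimes x^2(y^3v)_{1,1}y^1\otimes x^3(y^3v)_{1,2}y^2 .$$ It is a monoidal category, with tensor product of modules, associator of ${}_H\mathcal M^{\rm fd}$ and tensor product of the half braidings $x\otimes v\mapsto v_0\otimes v_1x$, and it is braided by $\mathfrak c(v\otimes w)=w_0\otimes w_1v$. **Quantum double.** $D(H)$ is the algebra generated by elements $i(h)$, $d(\varphi)$, linear in $h\in H$ and $\varphi\in H^*$, such that $i$ is an algebra map, $d(\varepsilon)=1$ and, for $\mathbf D=\sum_j e_j\otimes d(e^j)\in H\otimes D(H)$ (dual bases), $$\mathbf D\,(h_1\otimes i(h_2))=(h_2\otimes i(h_1))\,\mathbf D\quad(h\in H),\qquad(\Delta\otimes\mathrm{id})(\mathbf D)=\Phi_{312}\,\mathbf D_{13}\,(\Phi_{132})^{-1}\,\mathbf D_{23}\,\Phi$$ (with $i$ applied to the component of $\Phi^{\pm1}$ in the third tensor factor). It has a structure of quasitriangular quasi-Hopf algebra such that $i$ preserves all the structure of the quasi-Hopf algebra $H$ and $R_D=(i\otimes\mathrm{id})(\mathbf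 D)$. **The algebra $H(\theta)$.** For a quasitriangular quasi-Hopf algebra $(A,R)$ put $u=S(R^2x^2\beta S(x^3))\alpha R^1x^1$. The algebra $A(\theta)=A[\theta]/(\theta^2-uS(u))$ is a ribbon quasi-Hopf algebra, with $A\to A(\theta)$ preserving the quasi-Hopf structure and $R$, with $\Delta(\theta)=(\theta\otimes\theta)(R_{21}R)^{-1}$, $\varepsilon(\theta)=1$, $S(\theta)=\theta$, and with ribbon element $\theta^{-1}$, by the action of which the twist of ${}_{A(\theta)}\mathcal M^{\rm fd}$ is given. **Statement.** The quasitriangular quasi-Hopf structure on $D(H)$ and the ribbon quasi-Hopf structure on $D(H)(\theta)$ just described exist, the categories $\mathfrak R_r({}_H\mathcal M^{\rm fd})$, $\mathcal R({}_H\mathcal{YD}^{H\,{\rm fd}},\mathfrak c)$ and ${}_{D(H)(\theta)}\mathcal M^{\rm fd}$ are ribbon categories, and there are equivalences of ribbon categories $$\mathfrak R_r({}_H\mathcal M^{\rm fd})\;\simeq\;\mathcal R({}_H\mathcal{YD}^{H\,{\rm fd}},\mathfrak c)\;\simeq\;{}_{D(H)(\theta)}\mathcal M^{\rm fd}.$$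 -/

import Mathlib

universe v u

noncomputable section

namespace QH

section

open TensorProduct CategoryTheory MonoidalCategory

/-- A quasi-bialgebra structure on the `k`-algebra `H`: coproduct `Δ`, counit `ε` and an invertible
reassociator `Φ ∈ H ⊗ H ⊗ H`; triple tensor products are bracketed to the right. -/
structure QuasiBialgebra (k H : Type u) [Field k] [Ring H] [Algebra k H] where
  Δ : H →ₐ[k] H ⊗[k] H
  ε : H →ₐ[k] k
  Φ : (H ⊗[k] (H ⊗[k] H))ˣ
  /-- `(id ⊗ Δ)(Δ h) = Φ (Δ ⊗ id)(Δ h) Φ⁻¹` -/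
  quasi_coassoc : ∀ h : H,
    Algebra.TensorProduct.map (.id k H) Δ (Δ h) =
      Φ.val * Algebra.TensorProduct.assoc k k k H H H
        (Algebra.TensorProduct.map Δ (.id k H) (Δ h)) * (Φ⁻¹).val
  counit_right : ∀ h : H,
    Algebra.TensorProduct.rid k k H (Algebra.TensorProduct.map (.id k H) ε (Δ h)) = h
  counit_left : ∀ h : H,
    Algebra.TensorProduct.lid k H (Algebra.TensorProduct.map ε (.id k H) (Δ h)) = h
  /-- `(1 ⊗ Φ) (id ⊗ Δ ⊗ id)(Φ) (Φ ⊗ 1) = (id ⊗ id ⊗ Δ)(Φ) (Δ ⊗ id ⊗ id)(Φ)` -/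
  cocycle :
    (1 : H) ⊗ₜ[k] Φ.val *
      Algebra.TensorProduct.map (.id k H)
        ((Algebra.TensorProduct.assoc k k k H H H).toAlgHom.comp
          (Algebra.TensorProduct.map Δ (.id k H))) Φ.val *
      Algebra.TensorProduct.map (.id k H)
        (Algebra.TensorProduct.map (.id k H) Algebra.TensorProduct.includeLeft) Φ.val =
    Algebra.TensorProduct.map (.id k H) (Algebra.TensorProduct.map (.id k H) Δ) Φ.val *
      (Algebra.TensorProduct.assoc k k k H H (H ⊗[k] H)).toAlgHom.comp
        (Algebra.TensorProduct.map Δ (.id k (H ⊗[k] H))) Φ.val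
  /-- `(id ⊗ ε ⊗ id)(Φ) = 1 ⊗ 1` -/
  counit_reassoc :
    Algebra.TensorProduct.map (.id k H)
      ((Algebra.TensorProduct.lid k H).toAlgHom.comp
        (Algebra.TensorProduct.map ε (.id k H))) Φ.val = 1

/-- A quasi-Hopf algebra: a quasi-bialgebra with an anti-endomorphism `S` of the algebra `H`
(not assumed bijective) and elements `α`, `β`. -/
structure QuasiHopf (k H : Type u) [Field k] [Ring H] [Algebra k H]
    extends QuasiBialgebra k H where
  S : H →ₗ[k] H
  S_one : S 1 = 1
  S_mul : ∀ a b : H, S (a * b) = S b * S a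
  α : H
  β : H
  /-- `S(h₁) α h₂ = ε(h) α` -/
  antipode_left : ∀ h : H,
    LinearMap.mul' k H (TensorProduct.map S (LinearMap.mulLeft k α) (Δ h)) = ε h • α
  /-- `h₁ β S(h₂) = ε(h) β` -/
  antipode_right : ∀ h : H,
    LinearMap.mul' k H (TensorProduct.map (LinearMap.mulRight k β) S (Δ h)) = ε h • β
  /-- `X¹ β S(X²) α X³ = 1`, where `Φ = X¹ ⊗ X² ⊗ X³` -/
  antipode_reassoc :
    LinearMap.mul' k H (TensorProduct.map (LinearMap.mulRight k β)
      (LinearMap.mul' k H ∘ₗ TensorProduct.map S (LinearMap.mulLeft k α)) Φ.val) = 1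
  /-- `S(x¹) α x² β S(x³) = 1`, where `Φ⁻¹ = x¹ ⊗ x² ⊗ x³` -/
  antipode_reassoc_inv :
    LinearMap.mul' k H (TensorProduct.map S
      (LinearMap.mulLeft k α ∘ₗ LinearMap.mul' k H ∘ₗ
        TensorProduct.map (LinearMap.mulRight k β) S) (Φ⁻¹).val) = 1

section Operators

variable {k H : Type u} [Field k] [Ring H] [Algebra k H]

/-- The permutation `a ⊗ b ⊗ c ↦ b ⊗ a ⊗ c` of `H ⊗ H ⊗ H`. -/
abbrev sw₁₂ (k H : Type u) [Field k] [Ring H] [Algebra k H] :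
    H ⊗[k] (H ⊗[k] H) ≃ₐ[k] H ⊗[k] (H ⊗[k] H) :=
  Algebra.TensorProduct.leftComm k H H H

/-- The permutation `a ⊗ b ⊗ c ↦ a ⊗ c ⊗ b` of `H ⊗ H ⊗ H`. -/
abbrev sw₂₃ (k H : Type u) [Field k] [Ring H] [Algebra k H] :
    H ⊗[k] (H ⊗[k] H) ≃ₐ[k] H ⊗[k] (H ⊗[k] H) :=
  Algebra.TensorProduct.congr .refl (Algebra.TensorProduct.comm k H H)

end Operators

/-- The element `t₁₂ = t¹ ⊗ t² ⊗ 1`. -/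
abbrev leg₁₂ {k H : Type u} [Field k] [Ring H] [Algebra k H] :
    H ⊗[k] H →ₐ[k] H ⊗[k] (H ⊗[k] H) :=
  Algebra.TensorProduct.map (.id k H) Algebra.TensorProduct.includeLeft

/-- The element `t₁₃ = t¹ ⊗ 1 ⊗ t²`. -/
abbrev leg₁₃ {k H : Type u} [Field k] [Ring H] [Algebra k H] :
    H ⊗[k] H →ₐ[k] H ⊗[k] (H ⊗[k] H) :=
  Algebra.TensorProduct.map (.id k H) Algebra.TensorProduct.includeRight

/-- The element `t₂₃ = 1 ⊗ t¹ ⊗ t²`. -/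
abbrev leg₂₃ {k H : Type u} [Field k] [Ring H] [Algebra k H] :
    H ⊗[k] H →ₐ[k] H ⊗[k] (H ⊗[k] H) :=
  Algebra.TensorProduct.includeRight

/-- A quasitriangular quasi-Hopf algebra `(H, R)`. -/
structure QTQuasiHopf (k H : Type u) [Field k] [Ring H] [Algebra k H]
    extends QuasiHopf k H where
  R : (H ⊗[k] H)ˣ
  /-- `(Δ ⊗ id)(R) = X²R¹x¹Y¹ ⊗ X³x³r¹Y² ⊗ X¹R²x²r²Y³`, that is
  `Φ₃₁₂ R₁₃ (Φ₁₃₂)⁻¹ R₂₃ Φ` -/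
  quasi_left :
    Algebra.TensorProduct.assoc k k k H H H (Algebra.TensorProduct.map Δ (.id k H) R.val) =
      sw₂₃ k H (sw₁₂ k H Φ.val) * leg₁₃ R.val * sw₂₃ k H (Φ⁻¹).val * leg₂₃ R.val * Φ.val
  /-- `(id ⊗ Δ)(R) = x³R¹X²r¹y¹ ⊗ x¹X¹r²y² ⊗ x²R²X³y³`, that is
  `(Φ₂₃₁)⁻¹ R₁₃ Φ₂₁₃ R₁₂ Φ⁻¹` -/
  quasi_right :
    Algebra.TensorProduct.map (.id k H) Δ R.val =
      sw₁₂ k H (sw₂₃ k H (Φ⁻¹).val) * leg₁₃ R.val * sw₁₂ k H Φ.val * leg₁₂ R.val * (Φ⁻¹).val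
  /-- `Δ^cop(h) R = R Δ(h)` -/
  almost_cocomm : ∀ h : H,
    Algebra.TensorProduct.comm k H H (Δ h) * R.val = R.val * Δ h

variable {k H : Type u} [Field k] [Ring H] [Algebra k H]

/-- The product `R₂₁ R`. -/
def QTQuasiHopf.R₂₁R (Q : QTQuasiHopf k H) : H ⊗[k] H :=
  Algebra.TensorProduct.comm k H H Q.R.val * Q.R.val

/-- `u = S(R² x² β S(x³)) α R¹ x¹`. -/
def QTQuasiHopf.u (Q : QTQuasiHopf k H) : H :=
  (LinearMap.mul' k H ∘ₗ (TensorProduct.comm k H H).toLinearMap ∘ₗ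
    TensorProduct.map (LinearMap.mulLeft k Q.α)
      (Q.S ∘ₗ LinearMap.mul' k H ∘ₗ TensorProduct.map (LinearMap.mulRight k Q.β) Q.S))
    (leg₁₂ Q.R.val * (Q.Φ⁻¹).val)

/-- An algebra map preserving all the structure of quasi-Hopf algebras. -/
structure IsQuasiHopfHom {A B : Type u} [Ring A] [Algebra k A] [Ring B] [Algebra k B]
    (Q : QuasiHopf k A) (P : QuasiHopf k B) (f : A →ₐ[k] B) : Prop where
  map_Δ : ∀ a, P.Δ (f a) = Algebra.TensorProduct.map f f (Q.Δ a)
  map_ε : ∀ a, P.ε (f a) = Q.ε a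
  map_Φ : P.Φ.val =
    Algebra.TensorProduct.map f (Algebra.TensorProduct.map f f) Q.Φ.val
  map_S : ∀ a, P.S (f a) = f (Q.S a)
  map_α : P.α = f Q.α
  map_β : P.β = f Q.β

end

section

open TensorProduct CategoryTheory MonoidalCategory

/-- For actions of `A` on `V` and of `B` on `W`, the action of `A ⊗ B` on `V ⊗ W`. -/
def tensorAct {k A B V W : Type u} [Field k] [Ring A] [Algebra k A] [Ring B] [Algebra k B]
    [AddCommGroup V] [Module k V] [AddCommGroup W] [Module k W]
    (ρ : A →ₐ[k] Module.End k V) (σ : B →ₐ[k] Module.End k W) :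
    A ⊗[k] B →ₐ[k] Module.End k (V ⊗[k] W) :=
  (Module.endTensorEndAlgHom (R := k) (S := k) (A := k)).comp (Algebra.TensorProduct.map ρ σ)

section tensorAct

variable {k A A' B B' C V V' W W' U : Type u} [Field k] [Ring A] [Algebra k A] [Ring B]
  [Algebra k B] [Ring C] [Algebra k C] [Ring A'] [Algebra k A'] [Ring B'] [Algebra k B']
  [AddCommGroup V] [Module k V] [AddCommGroup W] [Module k W] [AddCommGroup U] [Module k U]
  [AddCommGroup V'] [Module k V'] [AddCommGroup W'] [Module k W']
  (ρ : A →ₐ[k] Module.End k V) (σ : B →ₐ[k] Module.End k W) (τ : C →ₐ[k] Module.End k U)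

@[simp] lemma tensorAct_tmul (a : A) (b : B) :
    tensorAct ρ σ (a ⊗ₜ b) = TensorProduct.map (ρ a) (σ b) := rfl

lemma tensorAct_comp (f : A' →ₐ[k] A) (g : B' →ₐ[k] B) :
    tensorAct (ρ.comp f) (σ.comp g) = (tensorAct ρ σ).comp (Algebra.TensorProduct.map f g) := by
  ext <;> simp

/-- `p` intertwines the action `ρ` with the action `ρ'` along `f`. -/
def Tw (p : V →ₗ[k] V') (ρ : A →ₐ[k] Module.End k V) (ρ' : A' →ₐ[k] Module.End k V')
    (f : A →ₐ[k] A') : Prop := ∀ a v, p (ρ a v) = ρ' (f a) (p v)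

variable {ρ σ τ}

lemma Tw.map {ρ' : A' →ₐ[k] Module.End k V'} {σ' : B' →ₐ[k] Module.End k W'}
    {p : V →ₗ[k] V'} {q : W →ₗ[k] W'} {f : A →ₐ[k] A'} {g : B →ₐ[k] B'}
    (hp : Tw p ρ ρ' f) (hq : Tw q σ σ' g) :
    Tw (TensorProduct.map p q) (tensorAct ρ σ) (tensorAct ρ' σ')
      (Algebra.TensorProduct.map f g) := by
  intro t v
  induction t with
  | zero => simp
  | add x y hx hy => simp [hx, hy]
  | tmul a b =>
    induction v with
    | zero => simp
    | add x y hx hy => simp only [map_add, hx, hy]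
    | tmul v w => simp [hp a v, hq b w]

lemma Tw.id : Tw LinearMap.id ρ ρ (.id k A) := fun _ _ => rfl

lemma Tw.assoc : Tw (TensorProduct.assoc k V W U).toLinearMap (tensorAct (tensorAct ρ σ) τ)
    (tensorAct ρ (tensorAct σ τ)) (Algebra.TensorProduct.assoc k k k A B C).toAlgHom := by
  intro t v
  induction t with
  | zero => simp
  | add x y hx hy => simp only [map_add, LinearMap.add_apply, hx, hy]
  | tmul s c =>
    induction s with
    | zero => simp
    | add x y hx hy => simp only [add_tmul, map_add, LinearMap.add_apply, hx, hy]
    | tmul a b =>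
      induction v with
      | zero => simp
      | add x y hx hy => simp only [map_add, hx, hy]
      | tmul v u =>
        induction v with
        | zero => simp
        | add x y hx hy => simp only [add_tmul, map_add, hx, hy]
        | tmul v w => simp

lemma Tw.comm : Tw (TensorProduct.comm k V W).toLinearMap (tensorAct ρ σ)
    (tensorAct σ ρ) (Algebra.TensorProduct.comm k A B).toAlgHom := by
  intro t v
  induction t with
  | zero => simp
  | add x y hx hy => simp only [map_add, LinearMap.add_apply, hx, hy]
  | tmul a b =>
      induction v with
      | zero => simp
      | add x y hx hy => simp only [map_add, hx, hy]
      | tmul v w => simp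

end tensorAct

variable {k H : Type u} [Field k] [Ring H] [Algebra k H]

/-- A finite-dimensional left `H`-module: a finite-dimensional vector space with an algebra map
`H → End V`. -/
structure FDMod (Q : QuasiBialgebra k H) where
  V : Type u
  [addCommGroup : AddCommGroup V]
  [module : Module k V]
  [finite : FiniteDimensional k V]
  ρ : H →ₐ[k] Module.End k V

namespace FDMod

attribute [instance] FDMod.addCommGroup FDMod.module FDMod.finite

variable {Q : QuasiBialgebra k H}

/-- `H`-linear maps. -/
@[ext]
structure Hom (X Y : FDMod Q) where
  lin : X.V →ₗ[k] Y.V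
  comm : ∀ (h : H) (v : X.V), lin (X.ρ h v) = Y.ρ h (lin v)

instance : Category (FDMod Q) where
  Hom := Hom
  id X := ⟨LinearMap.id, fun _ _ => rfl⟩
  comp f g := ⟨g.lin ∘ₗ f.lin, fun h v => by simp [f.comm, g.comm]⟩

@[ext] lemma hom_ext {X Y : FDMod Q} {f g : X ⟶ Y} (h : ∀ v, f.lin v = g.lin v) : f = g :=
  Hom.ext (LinearMap.ext h)

@[simp] lemma id_lin (X : FDMod Q) (v : X.V) : Hom.lin (𝟙 X) v = v := rfl
@[simp] lemma comp_lin {X Y Z : FDMod Q} (f : X ⟶ Y) (g : Y ⟶ Z) (v : X.V) :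
    (f ≫ g).lin v = g.lin (f.lin v) := rfl

/-- An `H`-linear bijection is an isomorphism. -/
def isoMk {X Y : FDMod Q} (e : X.V ≃ₗ[k] Y.V) (h : ∀ a v, e (X.ρ a v) = Y.ρ a (e v)) : X ≅ Y where
  hom := ⟨e.toLinearMap, h⟩
  inv := ⟨e.symm.toLinearMap, fun a v => by
    apply e.injective; simp [h]⟩
  hom_inv_id := by ext v; exact e.symm_apply_apply v
  inv_hom_id := by ext v; exact e.apply_symm_apply v

@[simp] lemma isoMk_hom_lin {X Y : FDMod Q} (e : X.V ≃ₗ[k] Y.V) (h) (v) :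
    (isoMk e h : X ≅ Y).hom.lin v = e v := rfl
@[simp] lemma isoMk_inv_lin {X Y : FDMod Q} (e : X.V ≃ₗ[k] Y.V) (h) (v) :
    (isoMk e h : X ≅ Y).inv.lin v = e.symm v := rfl

/-- The module `V ⊗ W`, with `h (v ⊗ w) = h₁ v ⊗ h₂ w`. -/
abbrev tensor (X Y : FDMod Q) : FDMod Q := ⟨X.V ⊗[k] Y.V, (tensorAct X.ρ Y.ρ).comp Q.Δ⟩

/-- The unit object: `k` with `H` acting through the counit. -/
abbrev one : FDMod Q := ⟨k, (Algebra.lmul k k).comp Q.ε⟩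

end FDMod

end

section

open TensorProduct CategoryTheory MonoidalCategory

/-- The bijection by which an invertible element acts. -/
def unitAct {k A V : Type u} [Field k] [Ring A] [Algebra k A] [AddCommGroup V] [Module k V]
    (ρ : A →ₐ[k] Module.End k V) (a : Aˣ) : V ≃ₗ[k] V :=
  LinearEquiv.ofLinearMap (ρ a.val) (ρ (a⁻¹).val)
    (by rw [← Module.End.mul_eq_comp, ← map_mul]; simp [Module.End.one_eq_id])
    (by rw [← Module.End.mul_eq_comp, ← map_mul]; simp [Module.End.one_eq_id])

@[simp] lemma unitAct_apply {k A V : Type u} [Field k] [Ring A] [Algebra k A] [AddCommGroup V]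
    [Module k V] (ρ : A →ₐ[k] Module.End k V) (a : Aˣ) (v : V) :
    unitAct ρ a v = ρ a.val v := rfl

@[simp] lemma unitAct_symm_apply {k A V : Type u} [Field k] [Ring A] [Algebra k A]
    [AddCommGroup V] [Module k V] (ρ : A →ₐ[k] Module.End k V) (a : Aˣ) (v : V) :
    (unitAct ρ a).symm v = ρ (a⁻¹).val v := rfl

variable {k H : Type u} [Field k] [Ring H] [Algebra k H]

namespace FDMod

variable {Q : QuasiBialgebra k H}

/-- The action of `H ⊗ H ⊗ H` on `V ⊗ (W ⊗ U)`. -/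
abbrev act₃ (X Y Z : FDMod Q) := tensorAct X.ρ (tensorAct Y.ρ Z.ρ)

lemma tensor_left_ρ (X Y Z : FDMod Q) :
    tensorAct (X.tensor Y).ρ Z.ρ = (tensorAct (tensorAct X.ρ Y.ρ) Z.ρ).comp
      (Algebra.TensorProduct.map Q.Δ (.id k H)) := by
  rw [← tensorAct_comp]; rfl

lemma tensor_right_ρ {B : Type u} [Ring B] [Algebra k B] {V : Type u} [AddCommGroup V] [Module k V]
    (σ : B →ₐ[k] Module.End k V) (Y Z : FDMod Q) :
    tensorAct σ (Y.tensor Z).ρ = (tensorAct σ (tensorAct Y.ρ Z.ρ)).comp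
      (Algebra.TensorProduct.map (.id k B) Q.Δ) := by
  rw [← tensorAct_comp]; rfl

/-- `a((v ⊗ w) ⊗ u) = X¹ v ⊗ (X² w ⊗ X³ u)`. -/
def assoc (X Y Z : FDMod Q) : (X.tensor Y).tensor Z ≅ X.tensor (Y.tensor Z) :=
  isoMk (TensorProduct.assoc k X.V Y.V Z.V ≪≫ₗ unitAct (act₃ X Y Z) Q.Φ) (by
    intro h v
    have e1 : ((X.tensor Y).tensor Z).ρ h = tensorAct (tensorAct X.ρ Y.ρ) Z.ρ
        (Algebra.TensorProduct.map Q.Δ (.id k H) (Q.Δ h)) := by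
      change tensorAct (X.tensor Y).ρ Z.ρ (Q.Δ h) = _
      rw [tensor_left_ρ]; rfl
    have e2 : (X.tensor (Y.tensor Z)).ρ h = act₃ X Y Z
        (Algebra.TensorProduct.map (.id k H) Q.Δ (Q.Δ h)) := by
      change tensorAct X.ρ (Y.tensor Z).ρ (Q.Δ h) = _
      rw [tensor_right_ρ]; rfl
    have e3 : ∀ w, act₃ X Y Z (Q.Φ⁻¹).val (act₃ X Y Z Q.Φ.val w) = w := fun w => by
      rw [← Module.End.mul_apply, ← map_mul, Units.inv_mul, map_one]; rfl
    have e4 := Tw.assoc (ρ := X.ρ) (σ := Y.ρ) (τ := Z.ρ)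
      (Algebra.TensorProduct.map Q.Δ (.id k H) (Q.Δ h)) v
    rw [e1, e2, Q.quasi_coassoc, map_mul, map_mul, Module.End.mul_apply, Module.End.mul_apply]
    exact (congrArg (act₃ X Y Z Q.Φ.val) e4).trans (by rw [LinearEquiv.trans_apply, unitAct_apply, e3]; rfl))

def leftUnit (X : FDMod Q) : one.tensor X ≅ X :=
  isoMk (TensorProduct.lid k X.V) (by
    intro h v
    have key : ∀ (t : H ⊗[k] H) (v : k ⊗[k] X.V), TensorProduct.lid k X.V (tensorAct (one (Q := Q)).ρ X.ρ t v) =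
        X.ρ (Algebra.TensorProduct.lid k H (Algebra.TensorProduct.map Q.ε (.id k H) t))
          (TensorProduct.lid k X.V v) := by
      intro t v
      induction t with
      | zero => simp
      | add x y hx hy => simp only [map_add, LinearMap.add_apply, hx, hy]
      | tmul a b =>
        induction v with
        | zero => simp
        | add x y hx hy => simp only [map_add, hx, hy]
        | tmul v w =>
          simp [mul_smul]
          exact smul_comm _ _ _
    have := key (Q.Δ h) v
    rw [Q.counit_left] at this
    exact this)

def rightUnit (X : FDMod Q) : X.tensor one ≅ X :=
  isoMk (TensorProduct.rid k X.V) (by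
    intro h v
    have key : ∀ (t : H ⊗[k] H) (v : X.V ⊗[k] k), TensorProduct.rid k X.V (tensorAct X.ρ (one (Q := Q)).ρ t v) =
        X.ρ (Algebra.TensorProduct.rid k k H (Algebra.TensorProduct.map (.id k H) Q.ε t))
          (TensorProduct.rid k X.V v) := by
      intro t v
      induction t with
      | zero => simp
      | add x y hx hy => simp only [map_add, LinearMap.add_apply, hx, hy]
      | tmul a b =>
        induction v with
        | zero => simp
        | add x y hx hy => simp only [map_add, hx, hy]
        | tmul v w =>
          simp [mul_smul]
          exact smul_comm _ _ _
    have := key (Q.Δ h) v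
    rw [Q.counit_right] at this
    exact this)

lemma Hom.tw {X Y : FDMod Q} (f : X ⟶ Y) : Tw f.lin X.ρ Y.ρ (.id k H) := f.comm

/-- The tensor product of two `H`-linear maps. -/
def tensorMap {X Y X' Y' : FDMod Q} (f : X ⟶ X') (g : Y ⟶ Y') : X.tensor Y ⟶ X'.tensor Y' :=
  ⟨TensorProduct.map f.lin g.lin, fun h v => by
    have := (Hom.tw f).map (Hom.tw g) (Q.Δ h) v
    rw [Algebra.TensorProduct.map_id] at this
    exact this⟩

instance : MonoidalCategoryStruct (FDMod Q) where
  tensorObj := tensor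
  tensorHom := tensorMap
  whiskerLeft X _ _ f := tensorMap (𝟙 X) f
  whiskerRight f Y := tensorMap f (𝟙 Y)
  tensorUnit := one
  associator := assoc
  leftUnitor := leftUnit
  rightUnitor := rightUnit

section
variable (X Y Z : FDMod Q)

@[simp] lemma tensor_lin {X Y X' Y' : FDMod Q} (f : X ⟶ X') (g : Y ⟶ Y') (t : X.V ⊗[k] Y.V) :
    (f ⊗ₘ g).lin t = TensorProduct.map f.lin g.lin t := rfl
@[simp] lemma whiskerLeft_lin {Y Z : FDMod Q} (f : Y ⟶ Z) (t : X.V ⊗[k] Y.V) :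
    (X ◁ f).lin t = f.lin.lTensor X.V t := rfl
@[simp] lemma whiskerRight_lin {Y Z : FDMod Q} (f : Y ⟶ Z) (t : Y.V ⊗[k] X.V) :
    (f ▷ X).lin t = f.lin.rTensor X.V t := rfl
@[simp] lemma assoc_lin (t : (X.V ⊗[k] Y.V) ⊗[k] Z.V) :
    (α_ X Y Z).hom.lin t = act₃ X Y Z Q.Φ.val (TensorProduct.assoc k X.V Y.V Z.V t) := rfl
@[simp] lemma assoc_inv_lin (t : X.V ⊗[k] (Y.V ⊗[k] Z.V)) :
    (α_ X Y Z).inv.lin t = (TensorProduct.assoc k X.V Y.V Z.V).symm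
      (act₃ X Y Z (Q.Φ⁻¹).val t) := rfl
@[simp] lemma leftUnitor_lin (t : k ⊗[k] X.V) :
    (λ_ X).hom.lin t = TensorProduct.lid k X.V t := rfl
@[simp] lemma rightUnitor_lin (t : X.V ⊗[k] k) :
    (ρ_ X).hom.lin t = TensorProduct.rid k X.V t := rfl
@[simp] lemma leftUnitor_inv_lin (t : X.V) :
    (λ_ X).inv.lin t = (TensorProduct.lid k X.V).symm t := rfl
@[simp] lemma rightUnitor_inv_lin (t : X.V) :
    (ρ_ X).inv.lin t = (TensorProduct.rid k X.V).symm t := rfl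
end

end FDMod

end

section

open TensorProduct CategoryTheory MonoidalCategory

variable {k H : Type u} [Field k] [Ring H] [Algebra k H]

namespace FDMod
variable {Q : QuasiBialgebra k H}

lemma Tw.iso {X Y : FDMod Q} (f : X ⟶ Y) (g : Y ⟶ X) (h : f ≫ g = 𝟙 _) (v : X.V) :
    g.lin (f.lin v) = v := by rw [← comp_lin, h]; rfl

abbrev act₄ (W X Y Z : FDMod Q) := tensorAct W.ρ (act₃ X Y Z)

lemma lTensor_tensorAct {A B V W : Type u} [Ring A] [Algebra k A] [Ring B] [Algebra k B]
    [AddCommGroup V] [Module k V] [AddCommGroup W] [Module k W]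
    (ρ : A →ₐ[k] Module.End k V) (σ : B →ₐ[k] Module.End k W) (b : B) (t : V ⊗[k] W) :
    (σ b).lTensor V t = tensorAct ρ σ (1 ⊗ₜ b) t := by simp [LinearMap.lTensor]; rfl

lemma rTensor_tensorAct {A B V W : Type u} [Ring A] [Algebra k A] [Ring B] [Algebra k B]
    [AddCommGroup V] [Module k V] [AddCommGroup W] [Module k W]
    (ρ : A →ₐ[k] Module.End k V) (σ : B →ₐ[k] Module.End k W) (a : A) (t : V ⊗[k] W) :
    (ρ a).rTensor W t = tensorAct ρ σ (a ⊗ₜ 1) t := by simp [LinearMap.rTensor]; rfl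

lemma pentagon (W X Y Z : FDMod Q) :
    (α_ W X Y).hom ▷ Z ≫ (α_ W (X ⊗ Y) Z).hom ≫ W ◁ (α_ X Y Z).hom =
      (α_ (W ⊗ X) Y Z).hom ≫ (α_ W X (Y ⊗ Z)).hom := by
  ext v
  change ((W.V ⊗[k] X.V) ⊗[k] Y.V) ⊗[k] Z.V at v
  -- the purely linear part
  have e : (TensorProduct.assoc k X.V Y.V Z.V).toLinearMap.lTensor W.V ∘ₗ
      (TensorProduct.assoc k W.V (X.V ⊗[k] Y.V) Z.V).toLinearMap ∘ₗ
      (TensorProduct.assoc k W.V X.V Y.V).toLinearMap.rTensor Z.V =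
      (TensorProduct.assoc k W.V X.V (Y.V ⊗[k] Z.V)).toLinearMap ∘ₗ
      (TensorProduct.assoc k (W.V ⊗[k] X.V) Y.V Z.V).toLinearMap := by
    apply TensorProduct.ext_fourfold; intro w x y z; simp
  set a₁ := (TensorProduct.assoc k W.V X.V Y.V).toLinearMap.rTensor Z.V
  set a₂ := (TensorProduct.assoc k W.V (X.V ⊗[k] Y.V) Z.V).toLinearMap with ha₂
  set a₃ := (TensorProduct.assoc k X.V Y.V Z.V).toLinearMap.lTensor W.V with ha₃
  set b₁ := (TensorProduct.assoc k (W.V ⊗[k] X.V) Y.V Z.V).toLinearMap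
  set b₂ := (TensorProduct.assoc k W.V X.V (Y.V ⊗[k] Z.V)).toLinearMap with hb₂
  set σ := act₄ W X Y Z
  have L1 : ∀ s, ((α_ W X Y).hom ▷ Z).lin s =
      tensorAct (act₃ W X Y) Z.ρ (Q.Φ.val ⊗ₜ 1) (a₁ s) := fun s => by
    rw [← rTensor_tensorAct]
    exact congrArg (fun f => f s) (LinearMap.rTensor_comp Z.V (act₃ W X Y Q.Φ.val)
      (TensorProduct.assoc k W.V X.V Y.V).toLinearMap)
  have L2 : ∀ s, (α_ W (X ⊗ Y) Z).hom.lin s =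
      tensorAct W.ρ (tensorAct (tensorAct X.ρ Y.ρ) Z.ρ)
        (Algebra.TensorProduct.map (.id k H) (Algebra.TensorProduct.map Q.Δ (.id k H)) Q.Φ.val)
        (a₂ s) := fun s => by
    change tensorAct W.ρ (tensorAct (X.tensor Y).ρ Z.ρ) Q.Φ.val (a₂ s) = _
    rw [tensor_left_ρ]
    have := tensorAct_comp W.ρ (tensorAct (tensorAct X.ρ Y.ρ) Z.ρ) (.id k H)
      (Algebra.TensorProduct.map Q.Δ (.id k H))
    rw [AlgHom.comp_id] at this
    rw [this]; rfl
  have L3 : ∀ s, (W ◁ (α_ X Y Z).hom).lin s = σ (1 ⊗ₜ Q.Φ.val) (a₃ s) := fun s => by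
    rw [← lTensor_tensorAct]
    exact congrArg (fun f => f s) (LinearMap.lTensor_comp W.V (act₃ X Y Z Q.Φ.val)
      (TensorProduct.assoc k X.V Y.V Z.V).toLinearMap)
  have M1 : ∀ s, (α_ (W ⊗ X) Y Z).hom.lin s =
      tensorAct (tensorAct W.ρ X.ρ) (tensorAct Y.ρ Z.ρ)
        (Algebra.TensorProduct.map Q.Δ (.id k _) Q.Φ.val) (b₁ s) := fun s => by
    change tensorAct (W.tensor X).ρ (tensorAct Y.ρ Z.ρ) Q.Φ.val (b₁ s) = _
    have := tensorAct_comp (tensorAct W.ρ X.ρ) (tensorAct Y.ρ Z.ρ) Q.Δ (.id k (H ⊗[k] H))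
    rw [AlgHom.comp_id] at this
    change tensorAct ((tensorAct W.ρ X.ρ).comp Q.Δ) (tensorAct Y.ρ Z.ρ) Q.Φ.val (b₁ s) = _
    rw [this]; rfl
  have M2 : ∀ s, (α_ W X (Y ⊗ Z)).hom.lin s =
      σ (Algebra.TensorProduct.map (.id k H) (Algebra.TensorProduct.map (.id k H) Q.Δ) Q.Φ.val)
        (b₂ s) := fun s => by
    change tensorAct W.ρ (tensorAct X.ρ (Y.tensor Z).ρ) Q.Φ.val (b₂ s) = _
    rw [tensor_right_ρ]
    have := tensorAct_comp W.ρ (tensorAct X.ρ (tensorAct Y.ρ Z.ρ)) (.id k H)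
      (Algebra.TensorProduct.map (.id k H) Q.Δ)
    rw [AlgHom.comp_id] at this
    rw [this]; rfl
  have T3 : Tw a₃ (tensorAct W.ρ (tensorAct (tensorAct X.ρ Y.ρ) Z.ρ)) σ
      (Algebra.TensorProduct.map (.id k H) (Algebra.TensorProduct.assoc k k k H H H).toAlgHom) :=
    Tw.id.map Tw.assoc
  have T2 : Tw a₂ (tensorAct (tensorAct W.ρ (tensorAct X.ρ Y.ρ)) Z.ρ)
      (tensorAct W.ρ (tensorAct (tensorAct X.ρ Y.ρ) Z.ρ)) _ := Tw.assoc
  have U2 : Tw b₂ (tensorAct (tensorAct W.ρ X.ρ) (tensorAct Y.ρ Z.ρ)) σ _ := Tw.assoc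
  have A1 : ∀ t : H ⊗[k] (H ⊗[k] H), Algebra.TensorProduct.map (.id k H)
      (Algebra.TensorProduct.assoc k k k H H H).toAlgHom
      ((Algebra.TensorProduct.assoc k k k H (H ⊗[k] H) H).toAlgHom (t ⊗ₜ 1)) =
      Algebra.TensorProduct.map (.id k H)
        (Algebra.TensorProduct.map (.id k H) Algebra.TensorProduct.includeLeft) t := by
    intro t
    induction t with
    | zero => simp
    | add x y hx hy => simp only [map_add, add_tmul, hx, hy]
    | tmul a t =>
      induction t with
      | zero => simp
      | add x y hx hy => simp only [map_add, add_tmul, tmul_add, hx, hy]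
      | tmul b c => simp
  have A2 : Algebra.TensorProduct.map (.id k H) (Algebra.TensorProduct.assoc k k k H H H).toAlgHom
      (Algebra.TensorProduct.map (.id k H) (Algebra.TensorProduct.map Q.Δ (.id k H)) Q.Φ.val) =
      Algebra.TensorProduct.map (.id k H)
        ((Algebra.TensorProduct.assoc k k k H H H).toAlgHom.comp
          (Algebra.TensorProduct.map Q.Δ (.id k H))) Q.Φ.val := by
    rw [← AlgHom.comp_apply, ← Algebra.TensorProduct.map_comp, AlgHom.comp_id]
  simp only [comp_lin]
  rw [L1, L2, L3, T2, T3, T3, M1, M2, U2, A1, A2]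
  simp only [← Module.End.mul_apply, ← map_mul]
  have e' : a₃ (a₂ (a₁ v)) = b₂ (b₁ v) := congrArg (fun f => f v) e
  rw [e', ← mul_assoc]
  exact congrArg (fun t => σ t (b₂ (b₁ v))) Q.cocycle

lemma triangle (X Y : FDMod Q) :
    (α_ X (𝟙_ _) Y).hom ≫ X ◁ (λ_ Y).hom = (ρ_ X).hom ▷ Y := by
  have c := Q.counit_reassoc
  have tw : Tw (LinearMap.lTensor X.V (TensorProduct.lid k Y.V).toLinearMap)
      (act₃ X one Y) (tensorAct X.ρ Y.ρ) (Algebra.TensorProduct.map (.id k H)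
      ((Algebra.TensorProduct.lid k H).toAlgHom.comp
        (Algebra.TensorProduct.map Q.ε (.id k H)))) := by
    refine Tw.id.map ?_
    intro t v
    change k ⊗[k] Y.V at v
    induction t with
    | zero => simp
    | add x y hx hy => simp only [map_add, LinearMap.add_apply, hx, hy]
    | tmul a b =>
      induction v using TensorProduct.induction_on with
      | zero => simp
      | add x y hx hy => simp only [map_add, hx, hy]
      | tmul v w =>
        simp [mul_smul]
        exact smul_comm _ _ _
  ext v
  have := tw Q.Φ.val (TensorProduct.assoc k X.V k Y.V v)
  rw [c, map_one] at this
  refine this.trans ?_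
  change (X.V ⊗[k] k) ⊗[k] Y.V at v
  have h : LinearMap.lTensor X.V (TensorProduct.lid k Y.V).toLinearMap ∘ₗ
      (TensorProduct.assoc k X.V k Y.V).toLinearMap =
      LinearMap.rTensor Y.V (TensorProduct.rid k X.V).toLinearMap := by
    apply TensorProduct.ext_threefold; intro x a y; simp [TensorProduct.smul_tmul]
  exact congrArg (fun f => f v) h

lemma assoc_naturality {X X' Y Y' Z Z' : FDMod Q} (f : X ⟶ X') (g : Y ⟶ Y') (h : Z ⟶ Z') :
    ((f ⊗ₘ g) ⊗ₘ h) ≫ (α_ X' Y' Z').hom = (α_ X Y Z).hom ≫ (f ⊗ₘ (g ⊗ₘ h)) := by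
  ext v
  change (X.V ⊗[k] Y.V) ⊗[k] Z.V at v
  have := (Hom.tw f).map ((Hom.tw g).map (Hom.tw h)) Q.Φ.val (TensorProduct.assoc k _ _ _ v)
  rw [Algebra.TensorProduct.map_id, Algebra.TensorProduct.map_id] at this
  refine Eq.trans ?_ this.symm
  have e : (TensorProduct.assoc k X'.V Y'.V Z'.V).toLinearMap ∘ₗ
    TensorProduct.map (TensorProduct.map f.lin g.lin) h.lin = 
    TensorProduct.map f.lin (TensorProduct.map g.lin h.lin) ∘ₗ
    (TensorProduct.assoc k X.V Y.V Z.V).toLinearMap := by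
    apply TensorProduct.ext_threefold; intro x a y; simp
  exact congrArg (fun F => act₃ X' Y' Z' Q.Φ.val (F v)) e

instance : MonoidalCategory (FDMod Q) := .ofTensorHom
  (id_tensorHom_id := fun X Y => hom_ext fun v => by
    rw [tensor_lin]
    exact congrArg (fun f => f v) (TensorProduct.map_id (R := k) (M := X.V) (N := Y.V)))
  (tensorHom_comp_tensorHom := fun f₁ f₂ g₁ g₂ => hom_ext fun v =>
    (congrArg (fun f => f v) (TensorProduct.map_comp g₁.lin g₂.lin f₁.lin f₂.lin)).symm)
  (id_tensorHom := fun _ {_ _} _ => rfl)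
  (tensorHom_id := fun _ _ => rfl)
  (associator_naturality := assoc_naturality)
  (leftUnitor_naturality := fun {X Y} f => hom_ext fun v => by
    have e : (TensorProduct.lid k Y.V).toLinearMap ∘ₗ f.lin.lTensor k =
        f.lin ∘ₗ (TensorProduct.lid k X.V).toLinearMap := by
      apply TensorProduct.ext'; intro a x; simp
    exact congrArg (fun f => f v) e)
  (rightUnitor_naturality := fun {X Y} f => hom_ext fun v => by
    have e : (TensorProduct.rid k Y.V).toLinearMap ∘ₗ f.lin.rTensor k =
        f.lin ∘ₗ (TensorProduct.rid k X.V).toLinearMap := by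
      apply TensorProduct.ext'; intro a x; simp
    exact congrArg (fun f => f v) e)
  (pentagon := pentagon)
  (triangle := triangle)

end FDMod

end

section

open TensorProduct CategoryTheory MonoidalCategory

variable {k H : Type u} [Field k] [Ring H] [Algebra k H]

namespace FDMod
variable (Q : QTQuasiHopf k H)

/-- The braiding `c(v ⊗ w) = R² w ⊗ R¹ v`. -/
def braid (X Y : FDMod Q.toQuasiBialgebra) : X ⊗ Y ≅ Y ⊗ X :=
  isoMk (unitAct (tensorAct X.ρ Y.ρ) Q.R ≪≫ₗ TensorProduct.comm k X.V Y.V) (by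
    intro h v
    have e := Tw.comm (ρ := X.ρ) (σ := Y.ρ) (Q.Δ h) (tensorAct X.ρ Y.ρ Q.R.val v)
    change TensorProduct.comm k X.V Y.V
      (tensorAct X.ρ Y.ρ Q.R.val (tensorAct X.ρ Y.ρ (Q.Δ h) v)) = _
    have e2 : tensorAct X.ρ Y.ρ Q.R.val (tensorAct X.ρ Y.ρ (Q.Δ h) v) =
      tensorAct X.ρ Y.ρ (Algebra.TensorProduct.comm k H H (Q.Δ h))
        (tensorAct X.ρ Y.ρ Q.R.val v) := by
      rw [← Module.End.mul_apply, ← Module.End.mul_apply, ← map_mul, ← map_mul, Q.almost_cocomm]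
    rw [e2]
    have e3 := Tw.comm (ρ := X.ρ) (σ := Y.ρ) (Algebra.TensorProduct.comm k H H (Q.Δ h))
      (tensorAct X.ρ Y.ρ Q.R.val v)
    refine e3.trans ?_
    have e4 : (Algebra.TensorProduct.comm k H H).toAlgHom
      (Algebra.TensorProduct.comm k H H (Q.Δ h)) = Q.Δ h :=
      (Algebra.TensorProduct.comm k H H).left_inv _
    rw [e4]; rfl)

variable {Q}

lemma braid_lin (X Y : FDMod Q.toQuasiBialgebra) (t : X.V ⊗[k] Y.V) :
    (braid Q X Y).hom.lin t =
      (TensorProduct.comm k X.V Y.V).toLinearMap (tensorAct X.ρ Y.ρ Q.R.val t) := rfl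

lemma braid_nat {X Y X' Y' : FDMod Q.toQuasiBialgebra} (f : X ⟶ X') (g : Y ⟶ Y') :
    (f ⊗ₘ g) ≫ (braid Q X' Y').hom = (braid Q X Y).hom ≫ (g ⊗ₘ f) := by
  refine hom_ext fun t => ?_
  change X.V ⊗[k] Y.V at t
  have e := (Hom.tw f).map (Hom.tw g) Q.R.val t
  rw [Algebra.TensorProduct.map_id] at e
  have e2 : TensorProduct.map g.lin f.lin ∘ₗ (TensorProduct.comm k X.V Y.V).toLinearMap =
    (TensorProduct.comm k X'.V Y'.V).toLinearMap ∘ₗ TensorProduct.map f.lin g.lin := by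
      apply TensorProduct.ext'; intro a x; simp
  refine Eq.trans ?_ (congrArg (fun F => F (tensorAct X.ρ Y.ρ Q.R.val t)) e2).symm
  exact congrArg (TensorProduct.comm k X'.V Y'.V) e.symm

lemma Tw.comp {A A' A'' V V' V'' : Type u} [Ring A] [Algebra k A] [Ring A'] [Algebra k A']
    [Ring A''] [Algebra k A''] [AddCommGroup V] [Module k V] [AddCommGroup V'] [Module k V']
    [AddCommGroup V''] [Module k V''] {ρ : A →ₐ[k] Module.End k V} {ρ' : A' →ₐ[k] Module.End k V'}
    {ρ'' : A'' →ₐ[k] Module.End k V''} {p : V →ₗ[k] V'} {q : V' →ₗ[k] V''} {f : A →ₐ[k] A'}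
    {g : A' →ₐ[k] A''} (hp : Tw p ρ ρ' f) (hq : Tw q ρ' ρ'' g) :
    Tw (q ∘ₗ p) ρ ρ'' (g.comp f) := fun a v => by
  simp only [LinearMap.comp_apply, AlgHom.comp_apply]; rw [hp, hq]

lemma assoc_lin' (X Y Z : FDMod Q.toQuasiBialgebra) (t) : (α_ X Y Z).hom.lin t =
    act₃ X Y Z Q.Φ.val ((TensorProduct.assoc k X.V Y.V Z.V).toLinearMap t) := rfl

lemma assoc_inv_lin' (X Y Z : FDMod Q.toQuasiBialgebra) (t : X.V ⊗[k] (Y.V ⊗[k] Z.V)) :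
    (α_ X Y Z).inv.lin t =
      (TensorProduct.assoc k X.V Y.V Z.V).symm.toLinearMap (act₃ X Y Z (Q.Φ⁻¹).val t) := rfl

lemma braid_right_lin (X Y Z : FDMod Q.toQuasiBialgebra) (t) :
    (braid Q X (Y ⊗ Z)).hom.lin t = (TensorProduct.comm k X.V (Y.V ⊗[k] Z.V)).toLinearMap
      (act₃ X Y Z (Algebra.TensorProduct.map (.id k H) Q.Δ Q.R.val) t) := by
  rw [braid_lin]
  change (TensorProduct.comm k X.V (Y.V ⊗[k] Z.V)).toLinearMap
    (tensorAct X.ρ (Y.tensor Z).ρ Q.R.val t) = _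
  rw [tensor_right_ρ]; rfl

lemma braid_left_lin (X Y Z : FDMod Q.toQuasiBialgebra) (t) :
    (braid Q (X ⊗ Y) Z).hom.lin t = (TensorProduct.comm k (X.V ⊗[k] Y.V) Z.V).toLinearMap
      (tensorAct (tensorAct X.ρ Y.ρ) Z.ρ (Algebra.TensorProduct.map Q.Δ (.id k H) Q.R.val) t) := by
  rw [braid_lin]
  change (TensorProduct.comm k (X.V ⊗[k] Y.V) Z.V).toLinearMap
    (tensorAct (X.tensor Y).ρ Z.ρ Q.R.val t) = _
  rw [tensor_left_ρ]; rfl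

lemma braid_whiskerRight (X Y Z : FDMod Q.toQuasiBialgebra) (t) :
    ((braid Q X Y).hom ▷ Z).lin t =
      (TensorProduct.comm k X.V Y.V).toLinearMap.rTensor Z.V
        (tensorAct (tensorAct X.ρ Y.ρ) Z.ρ (Q.R.val ⊗ₜ 1) t) := by
  rw [← rTensor_tensorAct]
  exact congrArg (fun f => f t) (LinearMap.rTensor_comp Z.V
    (TensorProduct.comm k X.V Y.V).toLinearMap (tensorAct X.ρ Y.ρ Q.R.val))

lemma braid_whiskerLeft (X Y Z : FDMod Q.toQuasiBialgebra) (t) :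
    (X ◁ (braid Q Y Z).hom).lin t =
      (TensorProduct.comm k Y.V Z.V).toLinearMap.lTensor X.V
        (act₃ X Y Z (leg₂₃ Q.R.val) t) := by
  change _ = (TensorProduct.comm k Y.V Z.V).toLinearMap.lTensor X.V
        (act₃ X Y Z (1 ⊗ₜ Q.R.val) t)
  rw [← lTensor_tensorAct]
  exact congrArg (fun f => f t) (LinearMap.lTensor_comp X.V
    (TensorProduct.comm k Y.V Z.V).toLinearMap (tensorAct Y.ρ Z.ρ Q.R.val))

lemma assoc_rmul (t : H ⊗[k] H) :
    (Algebra.TensorProduct.assoc k k k H H H).toAlgHom (t ⊗ₜ 1) = leg₁₂ t := by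
  induction t with
  | zero => simp
  | add x y hx hy => simp only [map_add, add_tmul, hx, hy]
  | tmul a b => simp

lemma Tw.assoc_symm {A B C V W U : Type u} [Ring A] [Algebra k A] [Ring B] [Algebra k B]
    [Ring C] [Algebra k C] [AddCommGroup V] [Module k V] [AddCommGroup W] [Module k W]
    [AddCommGroup U] [Module k U] (ρ : A →ₐ[k] Module.End k V) (σ : B →ₐ[k] Module.End k W)
    (τ : C →ₐ[k] Module.End k U) (t : (A ⊗[k] B) ⊗[k] C) (v) :
    tensorAct (tensorAct ρ σ) τ t ((TensorProduct.assoc k V W U).symm.toLinearMap v) =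
      (TensorProduct.assoc k V W U).symm.toLinearMap
        (tensorAct ρ (tensorAct σ τ) (Algebra.TensorProduct.assoc k k k A B C t) v) := by
  have := Tw.assoc (ρ := ρ) (σ := σ) (τ := τ) t ((TensorProduct.assoc k V W U).symm v)
  apply (TensorProduct.assoc k V W U).injective
  refine this.trans ?_
  simp only [LinearEquiv.coe_coe, LinearEquiv.apply_symm_apply]; rfl

section perm

lemma ind₃ {P : H ⊗[k] (H ⊗[k] H) → Prop} (h0 : P 0) (ha : ∀ x y, P x → P y → P (x + y))
    (ht : ∀ a b c, P (a ⊗ₜ (b ⊗ₜ c))) (s : H ⊗[k] (H ⊗[k] H)) : P s := by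
  induction s with
  | zero => exact h0
  | add x y hx hy => exact ha _ _ hx hy
  | tmul a s =>
    induction s with
    | zero => rwa [tmul_zero]
    | add x y hx hy => rw [tmul_add]; exact ha _ _ hx hy
    | tmul b c => exact ht a b c

lemma sw₂₃_sw₁₂ (s : H ⊗[k] (H ⊗[k] H)) : (Algebra.TensorProduct.assoc k k k H H H).toAlgHom
    ((Algebra.TensorProduct.comm k H (H ⊗[k] H)).toAlgHom s) = sw₂₃ k H (sw₁₂ k H s) := by
  induction s using ind₃ with
  | h0 => simp
  | ha x y hx hy => simp only [map_add, hx, hy]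
  | ht a b c => simp

lemma sw₁₂_sw₂₃ (s : H ⊗[k] (H ⊗[k] H)) : (Algebra.TensorProduct.comm k (H ⊗[k] H) H).toAlgHom
    ((Algebra.TensorProduct.assoc k k k H H H).symm.toAlgHom s) = sw₁₂ k H (sw₂₃ k H s) := by
  induction s using ind₃ with
  | h0 => simp
  | ha x y hx hy => simp only [map_add, hx, hy]
  | ht a b c => simp

lemma sw₁₂_inv (s : H ⊗[k] (H ⊗[k] H)) : sw₁₂ k H (sw₁₂ k H s) = s := by
  induction s using ind₃ with
  | h0 => simp
  | ha x y hx hy => simp only [map_add, hx, hy]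
  | ht a b c => simp

lemma sw₂₃_inv (s : H ⊗[k] (H ⊗[k] H)) : sw₂₃ k H (sw₂₃ k H s) = s := by
  induction s using ind₃ with
  | h0 => simp
  | ha x y hx hy => simp only [map_add, hx, hy]
  | ht a b c => simp

lemma sw₁₂_leg₁₃ (s : H ⊗[k] H) : sw₁₂ k H (leg₁₃ s) = leg₂₃ s := by
  induction s with
  | zero => simp
  | add x y hx hy => simp only [map_add, hx, hy]
  | tmul a s => simp

lemma sw₂₃_leg₁₃ (s : H ⊗[k] H) : sw₂₃ k H (leg₁₃ s) = leg₁₂ s := by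
  induction s with
  | zero => simp
  | add x y hx hy => simp only [map_add, hx, hy]
  | tmul a s => simp

lemma sw₁₂_eq (s : (H ⊗[k] H) ⊗[k] H) : Algebra.TensorProduct.assoc k k k H H H
    (Algebra.TensorProduct.map (Algebra.TensorProduct.comm k H H).toAlgHom (.id k H) s) =
      sw₁₂ k H (Algebra.TensorProduct.assoc k k k H H H s) := by
  induction s with
  | zero => simp
  | add x y hx hy => simp only [map_add, hx, hy]
  | tmul s c =>
    induction s with
    | zero => simp
    | add x y hx hy => simp only [map_add, add_tmul, hx, hy]
    | tmul a b => simp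

lemma sw₂₃_eq (s : H ⊗[k] (H ⊗[k] H)) : Algebra.TensorProduct.map (.id k H)
    (Algebra.TensorProduct.comm k H H).toAlgHom s = sw₂₃ k H s := rfl

end perm

lemma Tw.assoc_symm' {A B C V W U : Type u} [Ring A] [Algebra k A] [Ring B] [Algebra k B]
    [Ring C] [Algebra k C] [AddCommGroup V] [Module k V] [AddCommGroup W] [Module k W]
    [AddCommGroup U] [Module k U] (ρ : A →ₐ[k] Module.End k V) (σ : B →ₐ[k] Module.End k W)
    (τ : C →ₐ[k] Module.End k U) :
    Tw (TensorProduct.assoc k V W U).symm.toLinearMap (tensorAct ρ (tensorAct σ τ))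
      (tensorAct (tensorAct ρ σ) τ) (Algebra.TensorProduct.assoc k k k A B C).symm.toAlgHom :=
  fun t v => by
    refine Eq.trans ?_ (Tw.assoc_symm ρ σ τ _ v).symm
    exact congrArg (fun s => (TensorProduct.assoc k V W U).symm.toLinearMap
      (tensorAct ρ (tensorAct σ τ) s v))
      ((Algebra.TensorProduct.assoc k k k A B C).apply_symm_apply t).symm

lemma hexagon_forward (X Y Z : FDMod Q.toQuasiBialgebra) :
    (α_ X Y Z).hom ≫ (braid Q X (Y ⊗ Z)).hom ≫ (α_ Y Z X).hom =
      ((braid Q X Y).hom ▷ Z) ≫ (α_ Y X Z).hom ≫ (Y ◁ (braid Q X Z).hom) := by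
  refine hom_ext fun t => ?_
  change (X.V ⊗[k] Y.V) ⊗[k] Z.V at t
  set a₀ := (TensorProduct.assoc k X.V Y.V Z.V).toLinearMap with ha₀
  set a₁ := (TensorProduct.assoc k Y.V Z.V X.V).toLinearMap with ha₁
  set a₂ := (TensorProduct.assoc k Y.V X.V Z.V).toLinearMap with ha₂
  set c₀ := (TensorProduct.comm k X.V (Y.V ⊗[k] Z.V)).toLinearMap with hc₀
  set c₁ := (TensorProduct.comm k X.V Z.V).toLinearMap.lTensor Y.V with hc₁
  set c₂ := (TensorProduct.comm k X.V Y.V).toLinearMap.rTensor Z.V with hc₂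
  have e : a₁ ∘ₗ c₀ ∘ₗ a₀ = c₁ ∘ₗ a₂ ∘ₗ c₂ := by
    apply TensorProduct.ext_threefold; intro x y z; simp [ha₁, hc₀, ha₀, hc₁, ha₂, hc₂]
  have e' : a₁ (c₀ (a₀ t)) = c₁ (a₂ (c₂ t)) := congrArg (fun f => f t) e
  have Ta₁ : Tw a₁ (tensorAct (tensorAct Y.ρ Z.ρ) X.ρ) (act₃ Y Z X) _ := Tw.assoc
  have Tc₀ : Tw c₀ (act₃ X Y Z) (tensorAct (tensorAct Y.ρ Z.ρ) X.ρ) _ := Tw.comm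
  have Ta₂ : Tw a₂ (tensorAct (tensorAct Y.ρ X.ρ) Z.ρ) (act₃ Y X Z) _ := Tw.assoc
  have Tc₁ : Tw c₁ (act₃ Y X Z) (act₃ Y Z X) _ := Tw.id.map Tw.comm
  have Tc₂ : Tw c₂ (tensorAct (tensorAct X.ρ Y.ρ) Z.ρ) (tensorAct (tensorAct Y.ρ X.ρ) Z.ρ) _ :=
    Tw.comm.map Tw.id
  simp only [comp_lin]
  rw [assoc_lin', braid_right_lin, assoc_lin', braid_whiskerRight, assoc_lin', braid_whiskerLeft,
    Tc₀, Tc₀, Ta₁, Ta₁, Tc₁, Tc₁, Tc₂, Ta₂, Tc₁, e']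
  simp only [← Module.End.mul_apply, ← map_mul]
  refine congrArg (fun t' => act₃ Y Z X t' (c₁ (a₂ (c₂ t)))) ?_
  have r2 : (Algebra.TensorProduct.assoc k k k H H H).toAlgHom
      (Algebra.TensorProduct.map (Algebra.TensorProduct.comm k H H).toAlgHom (.id k H)
        (Q.R.val ⊗ₜ 1)) = sw₁₂ k H (leg₁₂ Q.R.val) :=
    (sw₁₂_eq _).trans (congrArg _ (assoc_rmul _))
  rw [sw₂₃_sw₁₂, sw₂₃_eq, r2, Q.quasi_right]
  simp only [map_mul, sw₁₂_inv, sw₂₃_inv, sw₁₂_leg₁₃, mul_assoc]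
  rw [← map_mul (sw₂₃ k H), ← map_mul (sw₁₂ k H), Units.inv_mul, map_one, map_one, mul_one,
    Units.mul_inv_cancel_left]

lemma hexagon_reverse (X Y Z : FDMod Q.toQuasiBialgebra) :
    (α_ X Y Z).inv ≫ (braid Q (X ⊗ Y) Z).hom ≫ (α_ Z X Y).inv =
      (X ◁ (braid Q Y Z).hom) ≫ (α_ X Z Y).inv ≫ ((braid Q X Z).hom ▷ Y) := by
  refine hom_ext fun t => ?_
  change X.V ⊗[k] (Y.V ⊗[k] Z.V) at t
  set a₀ := (TensorProduct.assoc k X.V Y.V Z.V).symm.toLinearMap with ha₀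
  set a₁ := (TensorProduct.assoc k Z.V X.V Y.V).symm.toLinearMap with ha₁
  set a₂ := (TensorProduct.assoc k X.V Z.V Y.V).symm.toLinearMap with ha₂
  set c₀ := (TensorProduct.comm k (X.V ⊗[k] Y.V) Z.V).toLinearMap with hc₀
  set c₁ := (TensorProduct.comm k Y.V Z.V).toLinearMap.lTensor X.V with hc₁
  set c₂ := (TensorProduct.comm k X.V Z.V).toLinearMap.rTensor Y.V with hc₂
  have e : a₁ ∘ₗ c₀ ∘ₗ a₀ = c₂ ∘ₗ a₂ ∘ₗ c₁ := by
    apply TensorProduct.ext; ext x y z; simp [ha₁, hc₀, ha₀, hc₁, ha₂, hc₂]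
  have e' : a₁ (c₀ (a₀ t)) = c₂ (a₂ (c₁ t)) := congrArg (fun f => f t) e
  have Ta₀ : Tw a₀ (act₃ X Y Z) (tensorAct (tensorAct X.ρ Y.ρ) Z.ρ) _ := Tw.assoc_symm' _ _ _
  have Ta₁ : Tw a₁ (act₃ Z X Y) (tensorAct (tensorAct Z.ρ X.ρ) Y.ρ) _ := Tw.assoc_symm' _ _ _
  have Ta₂ : Tw a₂ (act₃ X Z Y) (tensorAct (tensorAct X.ρ Z.ρ) Y.ρ) _ := Tw.assoc_symm' _ _ _
  have Tc₀ : Tw c₀ (tensorAct (tensorAct X.ρ Y.ρ) Z.ρ) (act₃ Z X Y) _ := Tw.comm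
  have Tc₁ : Tw c₁ (act₃ X Y Z) (act₃ X Z Y) _ := Tw.id.map Tw.comm
  have Tc₂ : Tw c₂ (tensorAct (tensorAct X.ρ Z.ρ) Y.ρ) (tensorAct (tensorAct Z.ρ X.ρ) Y.ρ) _ :=
    Tw.comm.map Tw.id
  simp only [comp_lin]
  rw [assoc_inv_lin', braid_left_lin, assoc_inv_lin', braid_whiskerRight, assoc_inv_lin',
    braid_whiskerLeft, Tc₁, Ta₀, Tc₀, Tc₀, Ta₁, Ta₁, Ta₁, Ta₂, Ta₂, Tc₂, Tc₂, Tc₂, e']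
  simp only [← Module.End.mul_apply, ← map_mul]
  refine congrArg (fun t' => tensorAct (tensorAct Z.ρ X.ρ) Y.ρ t' (c₂ (a₂ (c₁ t)))) ?_
  apply (Algebra.TensorProduct.assoc k k k H H H).injective
  have ap : ∀ s, Algebra.TensorProduct.assoc k k k H H H
      ((Algebra.TensorProduct.assoc k k k H H H).symm.toAlgHom s) = s :=
    (Algebra.TensorProduct.assoc k k k H H H).apply_symm_apply
  have pa : ∀ s, (Algebra.TensorProduct.comm k (H ⊗[k] H) H).toAlgHom s =
      sw₁₂ k H (sw₂₃ k H (Algebra.TensorProduct.assoc k k k H H H s)) := fun s => by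
    rw [← sw₁₂_sw₂₃]
    exact congrArg _ ((Algebra.TensorProduct.assoc k k k H H H).symm_apply_apply s).symm
  have ar : Algebra.TensorProduct.assoc k k k H H H (Q.R.val ⊗ₜ 1) = leg₁₂ Q.R.val :=
    assoc_rmul _
  rw [sw₂₃_eq]
  simp only [map_mul, ap, pa, ar, sw₁₂_eq, Q.quasi_left, sw₁₂_inv, sw₂₃_inv, sw₂₃_leg₁₃, mul_assoc]
  rw [← map_mul (sw₁₂ k H) (sw₂₃ k H Q.Φ.val), ← map_mul (sw₂₃ k H) Q.Φ.val, Units.mul_inv, map_one,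
    map_one, mul_one, Units.inv_mul_cancel_left]

instance : BraidedCategory (FDMod Q.toQuasiBialgebra) where
  braiding := braid Q
  braiding_naturality_right X _ _ f := braid_nat (𝟙 X) f
  braiding_naturality_left f Z := braid_nat f (𝟙 Z)
  hexagon_forward := hexagon_forward
  hexagon_reverse := hexagon_reverse

end FDMod

end

section

open CategoryTheory MonoidalCategory

section HalfInv
variable {C : Type u} [Category.{v} C] [MonoidalCategory C] {V : C} (b : ∀ X : C, X ⊗ V ⟶ V ⊗ X)

/-- The candidate for the inverse of a half braiding at an object `X` with left dual `Y`. -/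
def halfInv (X Y : C) [ExactPairing X Y] : V ⊗ X ⟶ X ⊗ V :=
  𝟙 _ ⊗≫ η_ X Y ▷ (V ⊗ X) ⊗≫ X ◁ (b Y ▷ X) ⊗≫ (X ⊗ V) ◁ ε_ X Y ⊗≫ 𝟙 _

lemma halfInv_spec
    (nat : ∀ {X Y : C} (f : X ⟶ Y), f ▷ V ≫ b Y = b X ≫ V ◁ f)
    (unit : b (𝟙_ C) = (λ_ V).hom ≫ (ρ_ V).inv)
    (ten : ∀ X Y : C, b (X ⊗ Y) = (α_ X Y V).hom ≫ X ◁ b Y ≫ (α_ X V Y).inv ≫ b X ▷ Y ≫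
      (α_ V X Y).hom) (X Y : C) [ExactPairing X Y] :
    b X ≫ halfInv b X Y = 𝟙 _ ∧ halfInv b X Y ≫ b X = 𝟙 _ := by
  have z : 𝟙 _ ⊗≫ η_ X Y ▷ X ⊗≫ X ◁ ε_ X Y ⊗≫ 𝟙 _ = 𝟙 X := by
    have := ExactPairing.evaluation_coevaluation X Y
    calc _ = (λ_ X).inv ≫ (η_ X Y ▷ X ≫ (α_ X Y X).hom ≫ X ◁ ε_ X Y) ≫ (ρ_ X).hom := by monoidal
      _ = _ := by rw [this]; simp
  constructor
  · calc b X ≫ halfInv b X Y = 𝟙 _ ⊗≫ (𝟙_ C ◁ b X ≫ η_ X Y ▷ (V ⊗ X)) ⊗≫ X ◁ (b Y ▷ X) ⊗≫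
          (X ⊗ V) ◁ ε_ X Y ⊗≫ 𝟙 _ := by unfold halfInv; monoidal
      _ = 𝟙 _ ⊗≫ η_ X Y ▷ (X ⊗ V) ⊗≫ X ◁ ((α_ Y X V).hom ≫ Y ◁ b X ≫ (α_ Y V X).inv ≫ b Y ▷ X ≫
          (α_ V Y X).hom) ⊗≫ (X ⊗ V) ◁ ε_ X Y ⊗≫ 𝟙 _ := by
            rw [whisker_exchange]; monoidal
      _ = 𝟙 _ ⊗≫ η_ X Y ▷ (X ⊗ V) ⊗≫ X ◁ (b (Y ⊗ X) ≫ V ◁ ε_ X Y) ⊗≫ 𝟙 _ := by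
            rw [← ten]; monoidal
      _ = (𝟙 _ ⊗≫ η_ X Y ▷ X ⊗≫ X ◁ ε_ X Y ⊗≫ 𝟙 _) ▷ V := by
            rw [← nat, unit]; monoidal
      _ = _ := by rw [z]; simp
  · calc halfInv b X Y ≫ b X = 𝟙 _ ⊗≫ η_ X Y ▷ (V ⊗ X) ⊗≫ X ◁ (b Y ▷ X) ⊗≫
          ((X ⊗ V) ◁ ε_ X Y ≫ b X ▷ (𝟙_ C)) ⊗≫ 𝟙 _ := by unfold halfInv; monoidal
      _ = 𝟙 _ ⊗≫ η_ X Y ▷ (V ⊗ X) ⊗≫ ((α_ X Y V).hom ≫ X ◁ b Y ≫ (α_ X V Y).inv ≫ b X ▷ Y ≫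
          (α_ V X Y).hom) ▷ X ⊗≫ (V ⊗ X) ◁ ε_ X Y ⊗≫ 𝟙 _ := by
            rw [whisker_exchange]; monoidal
      _ = 𝟙 _ ⊗≫ (η_ X Y ▷ V ≫ b (X ⊗ Y)) ▷ X ⊗≫ (V ⊗ X) ◁ ε_ X Y ⊗≫ 𝟙 _ := by
            rw [← ten]; monoidal
      _ = V ◁ (𝟙 _ ⊗≫ η_ X Y ▷ X ⊗≫ X ◁ ε_ X Y ⊗≫ 𝟙 _) := by
            rw [nat, unit]; monoidal
      _ = _ := by rw [z]; simp

end HalfInv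

end

section

open TensorProduct CategoryTheory MonoidalCategory

variable {k H : Type u} [Field k] [Ring H] [Algebra k H]

namespace FDMod
variable {Q : QuasiHopf k H}

/-- The left dual `V^*`, with `(h φ)(v) = φ(S(h) v)`. -/
abbrev dual (X : FDMod Q.toQuasiBialgebra) : FDMod Q.toQuasiBialgebra where
  V := Module.Dual k X.V
  ρ := AlgHom.ofLinearMap (Module.Dual.transpose (R := k) ∘ₗ X.ρ.toLinearMap ∘ₗ Q.S)
    (by ext; simp [Q.S_one, Module.Dual.transpose_apply])
    (fun a b => by ext; simp [Q.S_mul, Module.Dual.transpose_apply])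

@[simp] lemma dual_ρ (X : FDMod Q.toQuasiBialgebra) (h : H) (φ : Module.Dual k X.V) (v : X.V) :
    (dual X).ρ h φ v = φ (X.ρ (Q.S h) v) := rfl

/-- `V ⊗ V^* → End V`. -/
def toEnd (V : Type u) [AddCommGroup V] [Module k V] :
    V ⊗[k] Module.Dual k V →ₗ[k] Module.End k V :=
  dualTensorHom k V V ∘ₗ (TensorProduct.comm k V (Module.Dual k V)).toLinearMap

@[simp] lemma toEnd_tmul {V : Type u} [AddCommGroup V] [Module k V] (v : V) (φ : Module.Dual k V)
    (w : V) : toEnd (k := k) V (v ⊗ₜ φ) w = φ w • v := by simp [toEnd]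

lemma toEnd_injective (V : Type u) [AddCommGroup V] [Module k V] [FiniteDimensional k V] :
    Function.Injective (toEnd (k := k) V) := by
  unfold toEnd
  rw [LinearMap.coe_comp]
  refine Function.Injective.comp ?_ (TensorProduct.comm k V (Module.Dual k V)).injective
  exact (dualTensorHomEquiv k V V).injective

lemma toEnd_act (X : FDMod Q.toQuasiBialgebra) (t : H ⊗[k] H) (s : X.V ⊗[k] Module.Dual k X.V)
    (β : H) (hs : toEnd X.V s = X.ρ β) : toEnd X.V (tensorAct X.ρ (dual X).ρ t s) =
      X.ρ (LinearMap.mul' k H (TensorProduct.map (LinearMap.mulRight k β) Q.S t)) := by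
  induction t with
  | zero => simp
  | add x y hx hy => simp only [map_add, LinearMap.add_apply, hx, hy]
  | tmul a b =>
    have : ∀ s, toEnd X.V (tensorAct X.ρ (dual X).ρ (a ⊗ₜ b) s) =
        X.ρ a * toEnd X.V s * X.ρ (Q.S b) := by
      intro s
      induction s with
      | zero => simp
      | add x y hx hy => simp only [map_add, hx, hy, mul_add, add_mul]
      | tmul v φ => ext w; simp; rfl
    rw [this, hs]; simp

/-- `ev(φ ⊗ v) = φ(α v)`. -/
def ev (X : FDMod Q.toQuasiBialgebra) : dual X ⊗ X ⟶ 𝟙_ _ where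
  lin := contractLeft k X.V ∘ₗ (X.ρ Q.α).lTensor (Module.Dual k X.V)
  comm h v := by
    have key : ∀ (t : H ⊗[k] H) (v : Module.Dual k X.V ⊗[k] X.V),
        contractLeft k X.V ((X.ρ Q.α).lTensor _ (tensorAct (dual X).ρ X.ρ t v)) =
        contractLeft k X.V ((X.ρ (LinearMap.mul' k H
          (TensorProduct.map Q.S (LinearMap.mulLeft k Q.α) t))).lTensor _ v) := by
      intro t v
      induction t with
      | zero => simp
      | add x y hx hy => simp only [map_add, LinearMap.add_apply, LinearMap.lTensor_add, hx, hy]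
      | tmul a b =>
        induction v with
        | zero => simp
        | add x y hx hy => simp only [map_add, hx, hy]
        | tmul φ v => simp; rfl
    refine (key (Q.Δ h) v).trans ?_
    rw [Q.antipode_left, map_smul, LinearMap.lTensor_smul, LinearMap.smul_apply, map_smul]
    rfl

lemma toEnd_coev (X : FDMod Q.toQuasiBialgebra) (c : k) :
    toEnd X.V ((X.ρ Q.β).rTensor (Module.Dual k X.V) (coevaluation k X.V c)) = X.ρ (c • Q.β) := by
  have h1 : toEnd X.V (coevaluation k X.V 1) = 1 := by
    ext w
    rw [coevaluation_apply_one, map_sum, LinearMap.sum_apply]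
    simp only [toEnd_tmul]
    exact (Module.Basis.ofVectorSpace k X.V).sum_repr w
  have h2 : ∀ s, toEnd X.V ((X.ρ Q.β).rTensor (Module.Dual k X.V) s) =
      X.ρ Q.β * toEnd X.V s := fun s => by
    induction s with
    | zero => simp
    | add x y hx hy => simp only [map_add, hx, hy, mul_add]
    | tmul v φ => ext w; simp
  have h3 : coevaluation k X.V c = c • coevaluation k X.V 1 := by
    rw [← map_smul, smul_eq_mul, mul_one]
  rw [h2, h3, map_smul, h1]; simp

/-- `coev(1) = ∑ β e_i ⊗ e^i`. -/
def coev (X : FDMod Q.toQuasiBialgebra) : 𝟙_ _ ⟶ X ⊗ dual X where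
  lin := (X.ρ Q.β).rTensor (Module.Dual k X.V) ∘ₗ coevaluation k X.V
  comm h c := by
    change k at c
    apply toEnd_injective
    refine (toEnd_coev X (Q.ε h * c)).trans ?_
    have h3 : coevaluation k X.V c = c • coevaluation k X.V 1 := by
      rw [← map_smul, smul_eq_mul, mul_one]
    rw [LinearMap.comp_apply, h3, map_smul, map_smul]
    have := toEnd_act X (Q.Δ h) _ (1 • Q.β) (by simpa using toEnd_coev X 1)
    rw [one_smul, Q.antipode_right] at this
    have e5 : ∀ z, toEnd X.V (tensorAct X.ρ (dual X).ρ (Q.Δ h) (c • z)) =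
        c • toEnd X.V (tensorAct X.ρ (dual X).ρ (Q.Δ h) z) := fun z => by
      rw [map_smul, map_smul]
    refine Eq.trans ?_ ((e5 _).trans (congrArg (fun f => c • f) this)).symm
    rw [mul_comm, mul_smul]; simp

lemma toEnd_coev' (X : FDMod Q.toQuasiBialgebra) (c : k) :
    toEnd X.V ((coev X).lin c) = X.ρ (c • Q.β) := toEnd_coev X c

instance (X : FDMod Q.toQuasiBialgebra) : ExactPairing X (dual X) where
  evaluation' := ev X
  coevaluation' := coev X
  coevaluation_evaluation' := by
    refine hom_ext fun t => ?_
    change Module.Dual k X.V ⊗[k] k at t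
    have key : ∀ (t : H ⊗[k] (H ⊗[k] H)) (s : X.V ⊗[k] Module.Dual k X.V) (φ : Module.Dual k X.V)
        (b : H) (hb : toEnd X.V s = X.ρ b),
        (λ_ (dual X)).hom.lin ((ev X ▷ dual X).lin ((TensorProduct.assoc k _ _ _).symm
          (act₃ (dual X) X (dual X) t (φ ⊗ₜ s)))) =
        φ ∘ₗ X.ρ (LinearMap.mul' k H (TensorProduct.map Q.S
          (LinearMap.mulLeft k Q.α ∘ₗ LinearMap.mul' k H ∘ₗ
            TensorProduct.map (LinearMap.mulRight k b) Q.S) t)) := by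
      intro t s φ b hb
      induction t using ind₃ with
      | h0 => simp
      | ha x y hx hy => simp only [map_add, LinearMap.add_apply, LinearMap.comp_add, hx, hy]
      | ht p q r =>
        have : ∀ s : X.V ⊗[k] Module.Dual k X.V,
          (λ_ (dual X)).hom.lin ((ev X ▷ dual X).lin ((TensorProduct.assoc k _ _ _).symm
            (act₃ (dual X) X (dual X) (p ⊗ₜ (q ⊗ₜ r)) (φ ⊗ₜ s)))) =
          φ ∘ₗ (X.ρ (Q.S p * (Q.α * q)) * toEnd X.V s * X.ρ (Q.S r)) := by
          intro s
          induction s with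
          | zero => simp
          | add x y hx hy =>
            simp only [map_add, tmul_add, mul_add, add_mul, LinearMap.comp_add, hx, hy]
          | tmul w ψ =>
            ext v
            simp [ev]
            exact mul_comm _ _
        rw [this, hb]; simp [mul_assoc]
    induction t using TensorProduct.induction_on with
    | zero => simp
    | add x y hx hy => simp only [map_add, hx, hy]
    | tmul φ c =>
      have e : φ ⊗ₜ[k] c = (c • φ) ⊗ₜ[k] (1 : k) := by
        rw [smul_tmul, smul_eq_mul, mul_one]
      rw [e]
      have := key (Q.Φ⁻¹).val ((coev X).lin (1 : k)) (c • φ) Q.β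
        ((toEnd_coev' X (1 : k)).trans (by rw [one_smul]))
      rw [Q.antipode_reassoc_inv, map_one X.ρ] at this
      apply (TensorProduct.lid k (Module.Dual k X.V)).injective
      refine this.trans ?_
      rw [comp_lin, rightUnitor_lin, leftUnitor_inv_lin, LinearEquiv.apply_symm_apply,
        TensorProduct.rid_tmul, one_smul]
      rfl
  evaluation_coevaluation' := by
    refine hom_ext fun t => ?_
    change k ⊗[k] X.V at t
    have key : ∀ (t : H ⊗[k] (H ⊗[k] H)) (s : X.V ⊗[k] Module.Dual k X.V) (v : X.V) (b : H)
        (hb : toEnd X.V s = X.ρ b),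
        (ρ_ X).hom.lin ((X ◁ ev X).lin (act₃ X (dual X) X t
          (TensorProduct.assoc k _ _ _ (s ⊗ₜ v)))) =
        X.ρ (LinearMap.mul' k H (TensorProduct.map (LinearMap.mulRight k b)
          (LinearMap.mul' k H ∘ₗ TensorProduct.map Q.S (LinearMap.mulLeft k Q.α)) t)) v := by
      intro t s v b hb
      induction t using ind₃ with
      | h0 => simp
      | ha x y hx hy => simp only [map_add, LinearMap.add_apply, hx, hy]
      | ht p q r =>
        have : ∀ s : X.V ⊗[k] Module.Dual k X.V,
          (ρ_ X).hom.lin ((X ◁ ev X).lin (act₃ X (dual X) X (p ⊗ₜ (q ⊗ₜ r))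
          (TensorProduct.assoc k _ _ _ (s ⊗ₜ v)))) = X.ρ p (toEnd X.V s (X.ρ (Q.S q * (Q.α * r)) v)) := by
          intro s
          induction s with
          | zero => simp
          | add x y hx hy => simp only [map_add, add_tmul, LinearMap.add_apply, hx, hy]
          | tmul w φ => simp [ev]; rfl
        rw [this, hb]; simp
    induction t using TensorProduct.induction_on with
    | zero => simp
    | add x y hx hy => simp only [map_add, hx, hy]
    | tmul c v =>
      have e : c ⊗ₜ[k] v = (1 : k) ⊗ₜ[k] (c • v) := by
        rw [tmul_smul, smul_tmul', smul_eq_mul, mul_one]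
      rw [e]
      have := key Q.Φ.val ((coev X).lin (1 : k)) (c • v) Q.β ((toEnd_coev' X (1 : k)).trans (by rw [one_smul]))
      rw [Q.antipode_reassoc, map_one X.ρ] at this
      apply (TensorProduct.rid k X.V).injective
      refine this.trans ?_
      rw [comp_lin, leftUnitor_lin, rightUnitor_inv_lin, LinearEquiv.apply_symm_apply,
        TensorProduct.lid_tmul, one_smul]
      rfl

end FDMod

end

section

open CategoryTheory MonoidalCategory

section HB
variable {C : Type u} [Category.{v} C] [MonoidalCategory C]

/-- The axioms of a half braiding `b_X : X ⊗ V ⟶ V ⊗ X`, invertibility apart. -/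
structure IsHB {V : C} (b : ∀ X : C, X ⊗ V ⟶ V ⊗ X) : Prop where
  nat : ∀ {X Y : C} (f : X ⟶ Y), f ▷ V ≫ b Y = b X ≫ V ◁ f
  unit : b (𝟙_ C) = (λ_ V).hom ≫ (ρ_ V).inv
  ten : ∀ X Y : C, b (X ⊗ Y) = (α_ X Y V).hom ≫ X ◁ b Y ≫ (α_ X V Y).inv ≫ b X ▷ Y ≫
      (α_ V X Y).hom

variable {V W U : C} {b : ∀ X : C, X ⊗ V ⟶ V ⊗ X} {c : ∀ X : C, X ⊗ W ⟶ W ⊗ X}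
  {d : ∀ X : C, X ⊗ U ⟶ U ⊗ X}

/-- The tensor product of two half braidings. -/
def tensorHB (b : ∀ X : C, X ⊗ V ⟶ V ⊗ X) (c : ∀ X : C, X ⊗ W ⟶ W ⊗ X) (X : C) :
    X ⊗ (V ⊗ W) ⟶ (V ⊗ W) ⊗ X :=
  (α_ X V W).inv ≫ b X ▷ W ≫ (α_ V X W).hom ≫ V ◁ c X ≫ (α_ V W X).inv

lemma IsHB.tensor (hb : IsHB b) (hc : IsHB c) : IsHB (tensorHB b c) where
  nat {X Y} f := by
    calc _ = 𝟙 _ ⊗≫ (f ▷ V ≫ b Y) ▷ W ⊗≫ V ◁ c Y ⊗≫ 𝟙 _ := by unfold tensorHB; monoidal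
      _ = 𝟙 _ ⊗≫ b X ▷ W ⊗≫ V ◁ (f ▷ W ≫ c Y) ⊗≫ 𝟙 _ := by rw [hb.nat]; monoidal
      _ = _ := by rw [hc.nat]; unfold tensorHB; monoidal
  unit := by unfold tensorHB; rw [hb.unit, hc.unit]; monoidal
  ten X Y := by
    calc _ = 𝟙 _ ⊗≫ X ◁ b Y ▷ W ⊗≫ (b X ▷ (Y ⊗ W) ≫ (V ⊗ X) ◁ c Y) ⊗≫ V ◁ c X ▷ Y ⊗≫ 𝟙 _ := by
          unfold tensorHB; rw [hb.ten, hc.ten]; monoidal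
      _ = _ := by rw [← whisker_exchange]; unfold tensorHB; monoidal

lemma IsHB.one : IsHB (V := 𝟙_ C) (fun X => (ρ_ X).hom ≫ (λ_ X).inv) where
  nat f := by monoidal
  unit := by monoidal
  ten X Y := by monoidal

lemma tensorHB_assoc (X : C) :
    tensorHB (tensorHB b c) d X ≫ (α_ V W U).hom ▷ X =
      X ◁ (α_ V W U).hom ≫ tensorHB b (tensorHB c d) X := by
  unfold tensorHB; monoidal

lemma tensorHB_left (X : C) :
    tensorHB (fun X => (ρ_ X).hom ≫ (λ_ X).inv) b X ≫ (λ_ V).hom ▷ X = X ◁ (λ_ V).hom ≫ b X := by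
  unfold tensorHB; monoidal

lemma tensorHB_right (X : C) :
    tensorHB b (fun X => (ρ_ X).hom ≫ (λ_ X).inv) X ≫ (ρ_ V).hom ▷ X = X ◁ (ρ_ V).hom ≫ b X := by
  unfold tensorHB; monoidal

lemma tensorHB_hex (X : C) :
    (α_ X V W).hom ≫ tensorHB b c X ≫ (α_ V W X).hom =
      b X ▷ W ≫ (α_ V X W).hom ≫ V ◁ c X := by
  unfold tensorHB; simp

lemma tensorHB_yb (hc : IsHB c) (X : C) :
    tensorHB b c X ≫ c V ▷ X = X ◁ c V ≫ tensorHB c b X := by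
  calc _ = 𝟙 _ ⊗≫ b X ▷ W ⊗≫ c (V ⊗ X) ⊗≫ 𝟙 _ := by unfold tensorHB; rw [hc.ten]; monoidal
    _ = 𝟙 _ ⊗≫ (b X ▷ W ≫ c (V ⊗ X)) ⊗≫ 𝟙 _ := by monoidal
    _ = _ := by rw [hc.nat, hc.ten]; unfold tensorHB; monoidal

lemma tensorHB_map {V' W' : C} {b' : ∀ X : C, X ⊗ V' ⟶ V' ⊗ X} {c' : ∀ X : C, X ⊗ W' ⟶ W' ⊗ X}
    {f : V ⟶ V'} {g : W ⟶ W'} (X : C) (hf : b X ≫ f ▷ X = X ◁ f ≫ b' X)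
    (hg : c X ≫ g ▷ X = X ◁ g ≫ c' X) :
    tensorHB b c X ≫ (f ⊗ₘ g) ▷ X = X ◁ (f ⊗ₘ g) ≫ tensorHB b' c' X := by
  rw [MonoidalCategory.tensorHom_def]
  calc _ = 𝟙 _ ⊗≫ b X ▷ W ⊗≫ (V ◁ c X ≫ f ▷ (W ⊗ X)) ⊗≫ V' ◁ g ▷ X ⊗≫ 𝟙 _ := by
        unfold tensorHB; monoidal
    _ = 𝟙 _ ⊗≫ (b X ≫ f ▷ X) ▷ W ⊗≫ V' ◁ (c X ≫ g ▷ X) ⊗≫ 𝟙 _ := by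
        rw [whisker_exchange]; monoidal
    _ = 𝟙 _ ⊗≫ X ◁ f ▷ W ⊗≫ (b' X ▷ W ≫ (V' ⊗ X) ◁ g) ⊗≫ V' ◁ c' X ⊗≫ 𝟙 _ := by
        rw [hf, hg]; monoidal
    _ = _ := by rw [← whisker_exchange]; unfold tensorHB; monoidal

end HB

end

section

open TensorProduct CategoryTheory MonoidalCategory

variable {k H : Type u} [Field k] [Ring H] [Algebra k H]

/-- `h ⊗ x ↦ h x`. -/
def actMap {V : Type u} [AddCommGroup V] [Module k V] (ρ : H →ₐ[k] Module.End k V) :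
    H ⊗[k] V →ₗ[k] V := TensorProduct.lift ρ.toLinearMap

@[simp] lemma actMap_tmul {V : Type u} [AddCommGroup V] [Module k V] (ρ : H →ₐ[k] Module.End k V)
    (h : H) (v : V) : actMap ρ (h ⊗ₜ v) = ρ h v := rfl

/-- The map `X ⊗ V → V ⊗ X`, `x ⊗ v ↦ v₀ ⊗ v₁ x`, defined by a linear map `δ : V → V ⊗ H`,
`δ(v) = v₀ ⊗ v₁`, and an action `σ` of `H` on `X`. -/
def halfBraid {X V : Type u} [AddCommGroup X] [Module k X] [AddCommGroup V] [Module k V]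
    (σ : H →ₐ[k] Module.End k X) (δ : V →ₗ[k] V ⊗[k] H) : X ⊗[k] V →ₗ[k] V ⊗[k] X :=
  (actMap σ).lTensor V ∘ₗ (TensorProduct.assoc k V H X).toLinearMap ∘ₗ δ.rTensor X ∘ₗ
    (TensorProduct.comm k X V).toLinearMap

lemma halfBraid_tmul {X V : Type u} [AddCommGroup X] [Module k X] [AddCommGroup V] [Module k V]
    (σ : H →ₐ[k] Module.End k X) (δ : V →ₗ[k] V ⊗[k] H) (x : X) (v : V) :
    halfBraid σ δ (x ⊗ₜ v) = (LinearMap.applyₗ x ∘ₗ σ.toLinearMap).lTensor V (δ v) := by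
  simp only [halfBraid, LinearMap.comp_apply, LinearEquiv.coe_coe, TensorProduct.comm_tmul,
    LinearMap.rTensor_tmul]
  generalize δ v = t
  induction t with
  | zero => simp
  | add x y hx hy => simp only [add_tmul, map_add, hx, hy]
  | tmul v h => simp

lemma halfBraid_nat {X Y V : Type u} [AddCommGroup X] [Module k X] [AddCommGroup Y] [Module k Y]
    [AddCommGroup V] [Module k V] (σ : H →ₐ[k] Module.End k X) (τ : H →ₐ[k] Module.End k Y)
    (δ : V →ₗ[k] V ⊗[k] H) (f : X →ₗ[k] Y) (hf : ∀ h x, f (σ h x) = τ h (f x)) (t : X ⊗[k] V) :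
    halfBraid τ δ (f.rTensor V t) = f.lTensor V (halfBraid σ δ t) := by
  induction t with
  | zero => simp
  | add x y hx hy => simp only [map_add, hx, hy]
  | tmul x v =>
    rw [LinearMap.rTensor_tmul, halfBraid_tmul, halfBraid_tmul, ← LinearMap.lTensor_comp_apply]
    congr 2
    ext h; simp [hf]

lemma halfBraid_one {V : Type u} [AddCommGroup V] [Module k V] (δ : V →ₗ[k] V ⊗[k] H) (v : V) :
    halfBraid (Algebra.lmul k H) δ (1 ⊗ₜ v) = δ v := by
  rw [halfBraid_tmul]
  have : (LinearMap.applyₗ (1 : H) ∘ₗ (Algebra.lmul k H).toLinearMap : H →ₗ[k] H) = .id := by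
    ext; simp
  rw [this]; simp

section nat
variable {C : Type*} [Category* C] [MonoidalCategory C] {V : C} (b : ∀ X : C, X ⊗ V ⟶ V ⊗ X)

/-- The two sides of the tensor axiom of a half braiding. -/
def tenL (X Y : C) : X ⊗ (Y ⊗ V) ⟶ (V ⊗ X) ⊗ Y := X ◁ b Y ≫ (α_ X V Y).inv ≫ b X ▷ Y

/-- The two sides of the tensor axiom of a half braiding. -/
def tenR (X Y : C) : X ⊗ (Y ⊗ V) ⟶ (V ⊗ X) ⊗ Y :=
  (α_ X Y V).inv ≫ b (X ⊗ Y) ≫ (α_ V X Y).inv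

variable {b}

lemma tenL_nat (nat : ∀ {X Y : C} (f : X ⟶ Y), f ▷ V ≫ b Y = b X ≫ V ◁ f)
    {X Y X' Y' : C} (f : X ⟶ X') (g : Y ⟶ Y') :
    (f ⊗ₘ (g ▷ V)) ≫ tenL b X' Y' = tenL b X Y ≫ ((V ◁ f) ⊗ₘ g) := by
  unfold tenL
  rw [MonoidalCategory.tensorHom_def, MonoidalCategory.tensorHom_def']
  calc _ = 𝟙 _ ⊗≫ f ▷ (Y ⊗ V) ⊗≫ X' ◁ (g ▷ V ≫ b Y') ⊗≫ b X' ▷ Y' ⊗≫ 𝟙 _ := by monoidal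
    _ = 𝟙 _ ⊗≫ (f ▷ (Y ⊗ V) ≫ X' ◁ b Y) ⊗≫ ((X' ⊗ V) ◁ g ≫ b X' ▷ Y') ⊗≫ 𝟙 _ := by
      rw [nat]; monoidal
    _ = 𝟙 _ ⊗≫ X ◁ b Y ⊗≫ (f ▷ V ≫ b X') ▷ Y ⊗≫ (V ⊗ X') ◁ g ⊗≫ 𝟙 _ := by
      rw [← whisker_exchange f (b Y), whisker_exchange (b X') g]; monoidal
    _ = 𝟙 _ ⊗≫ X ◁ b Y ⊗≫ b X ▷ Y ⊗≫ ((V ◁ f) ▷ Y ≫ (V ⊗ X') ◁ g) ⊗≫ 𝟙 _ := by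
      rw [nat]; monoidal
    _ = _ := by rw [← whisker_exchange]; monoidal

lemma tenR_nat (nat : ∀ {X Y : C} (f : X ⟶ Y), f ▷ V ≫ b Y = b X ≫ V ◁ f)
    {X Y X' Y' : C} (f : X ⟶ X') (g : Y ⟶ Y') :
    (f ⊗ₘ (g ▷ V)) ≫ tenR b X' Y' = tenR b X Y ≫ ((V ◁ f) ⊗ₘ g) := by
  unfold tenR
  calc _ = 𝟙 _ ⊗≫ ((f ⊗ₘ g) ▷ V ≫ b (X' ⊗ Y')) ⊗≫ 𝟙 _ := by
        rw [MonoidalCategory.tensorHom_def, MonoidalCategory.tensorHom_def]; monoidal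
    _ = _ := by
        rw [nat, MonoidalCategory.tensorHom_def, MonoidalCategory.tensorHom_def]; monoidal

end nat

variable (Q : QuasiHopf k H)

/-- A finite-dimensional Yetter-Drinfeld module in `_H YD^H`: a left `H`-module `V` with a linear
map `v ↦ v₀ ⊗ v₁`, `V → V ⊗ H`. -/
structure YD extends FDMod Q.toQuasiBialgebra where
  coact : V →ₗ[k] V ⊗[k] H
  /-- `ε(v₁) v₀ = v` -/
  coact_counit : ∀ v, TensorProduct.rid k V (Q.ε.toLinearMap.lTensor V (coact v)) = v
  /-- `(x² v₀)₀ ⊗ (x² v₀)₁ x¹ ⊗ x³ v₁ =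
  x¹ (y³ v)₀ ⊗ x² (y³ v)₁₁ y¹ ⊗ x³ (y³ v)₁₂ y²`, with `Φ⁻¹ = x¹ ⊗ x² ⊗ x³ = y¹ ⊗ y² ⊗ y³` -/
  coact_coassoc : ∀ v,
    (halfBraid (Algebra.lmul k H) coact).rTensor H
      ((TensorProduct.assoc k H V H).symm
        (tensorAct (Algebra.lmul k H) (tensorAct ρ (Algebra.lmul k H)) (Q.Φ⁻¹).val
          (1 ⊗ₜ coact v))) =
    (TensorProduct.assoc k V H H).symm
      (tensorAct ρ (tensorAct (Algebra.lmul k H) (Algebra.lmul k H)) (Q.Φ⁻¹).val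
        (halfBraid ((Algebra.lmul k (H ⊗[k] H)).comp Q.Δ) coact
          ((TensorProduct.assoc k H H V).symm
            (tensorAct (Algebra.lmul k H) (tensorAct (Algebra.lmul k H) ρ) (Q.Φ⁻¹).val
              (1 ⊗ₜ (1 ⊗ₜ v))))))
  /-- `(h₂ v)₀ ⊗ (h₂ v)₁ h₁ = h₁ v₀ ⊗ h₂ v₁` -/
  coact_compat : ∀ (h : H) (v : V),
    halfBraid (Algebra.lmul k H) coact (tensorAct (Algebra.lmul k H) ρ (Q.Δ h) (1 ⊗ₜ v)) =
      tensorAct ρ (Algebra.lmul k H) (Q.Δ h) (coact v)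

namespace YD
variable {Q}

/-- The half braiding `X ⊗ V → V ⊗ X`, `x ⊗ v ↦ v₀ ⊗ v₁ x`. -/
def half (V : YD Q) (X : FDMod Q.toQuasiBialgebra) : X ⊗ V.toFDMod ⟶ V.toFDMod ⊗ X where
  lin := halfBraid X.ρ V.coact
  comm h t := by
    change X.V ⊗[k] V.V at t
    change halfBraid X.ρ V.coact (tensorAct X.ρ V.ρ (Q.Δ h) t) =
      tensorAct V.ρ X.ρ (Q.Δ h) (halfBraid X.ρ V.coact t)
    induction t with
    | zero => simp
    | add x y hx hy => simp only [map_add, hx, hy]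
    | tmul x v =>
      let f : H →ₗ[k] X.V := LinearMap.applyₗ x ∘ₗ X.ρ.toLinearMap
      have hf : Tw f (Algebra.lmul k H) X.ρ (.id k H) := fun a b => by simp [f]
      have e1 : x ⊗ₜ[k] v = f.rTensor V.V (1 ⊗ₜ[k] v) := by simp [f]
      have e2 := hf.map (Tw.id (ρ := V.ρ)) (Q.Δ h) (1 ⊗ₜ v)
      rw [Algebra.TensorProduct.map_id] at e2
      have e3 := (Tw.id (ρ := V.ρ)).map hf (Q.Δ h) (V.coact v)
      rw [Algebra.TensorProduct.map_id] at e3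
      rw [e1]
      refine (congrArg (halfBraid X.ρ V.coact) e2.symm).trans ?_
      refine (halfBraid_nat _ _ _ f hf _).trans ?_
      rw [V.coact_compat, halfBraid_nat _ _ _ f hf, halfBraid_one]
      exact e3

lemma half_unit (V : YD Q) : V.half (𝟙_ _) = (λ_ V.toFDMod).hom ≫ (ρ_ V.toFDMod).inv :=
  FDMod.hom_ext fun t => by
    change k ⊗[k] V.V at t
    change halfBraid (FDMod.one (Q := Q.toQuasiBialgebra)).ρ V.coact t =
      (TensorProduct.rid k V.V).symm (TensorProduct.lid k V.V t)
    apply (TensorProduct.rid k V.V).injective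
    rw [LinearEquiv.apply_symm_apply]
    induction t with
    | zero => simp
    | add x y hx hy => simp only [map_add, hx, hy]
    | tmul c v =>
      rw [halfBraid_tmul, TensorProduct.lid_tmul]
      have e : LinearMap.applyₗ c ∘ₗ (FDMod.one (Q := Q.toQuasiBialgebra)).ρ.toLinearMap =
          c • Q.ε.toLinearMap := by ext h; simp [mul_comm]
      refine (congrArg (fun f : H →ₗ[k] k => TensorProduct.rid k V.V (f.lTensor V.V (V.coact v))) e).trans ?_
      simp only [LinearMap.lTensor_smul, LinearMap.smul_apply, map_smul, V.coact_counit]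

section
variable [Module.Finite k H]

/-- The regular module. -/
abbrev reg : FDMod Q.toQuasiBialgebra := ⟨H, Algebra.lmul k H⟩

/-- The map `h ↦ h x`. -/
def orbit {X : FDMod Q.toQuasiBialgebra} (x : X.V) : reg ⟶ X :=
  ⟨LinearMap.applyₗ x ∘ₗ X.ρ.toLinearMap, fun a b => by
    have : ∀ b : H, X.ρ (a * b) x = X.ρ a (X.ρ b x) := fun b => by rw [map_mul]; rfl
    exact this b⟩

lemma tenR_reg (V : FDMod Q.toQuasiBialgebra) (δ : V.V →ₗ[k] V.V ⊗[k] H)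
    (b : ∀ X : FDMod Q.toQuasiBialgebra, X ⊗ V ⟶ V ⊗ X) (hb : ∀ X, (b X).lin = halfBraid X.ρ δ)
    (v : V.V) : (tenR b reg reg).lin ((1 : H) ⊗ₜ ((1 : H) ⊗ₜ v)) =
      (TensorProduct.assoc k V.V H H).symm
      (tensorAct V.ρ (tensorAct (Algebra.lmul k H) (Algebra.lmul k H)) (Q.Φ⁻¹).val
        (halfBraid ((Algebra.lmul k (H ⊗[k] H)).comp Q.Δ) δ
          ((TensorProduct.assoc k H H V.V).symm
            (tensorAct (Algebra.lmul k H) (tensorAct (Algebra.lmul k H) V.ρ) (Q.Φ⁻¹).val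
              (1 ⊗ₜ (1 ⊗ₜ v)))))) := by
  have e2 : tensorAct (Algebra.lmul k H) (Algebra.lmul k H) = Algebra.lmul k (H ⊗[k] H) := by
    ext <;> simp
  rw [← e2]
  unfold tenR
  rw [FDMod.comp_lin, FDMod.comp_lin, hb]
  rfl

lemma half_ten (V : YD Q) (X Y : FDMod Q.toQuasiBialgebra) :
    tenL V.half X Y = tenR V.half X Y := by
  refine FDMod.hom_ext fun t => ?_
  change X.V ⊗[k] (Y.V ⊗[k] V.V) at t
  have nat : ∀ {X Y : FDMod Q.toQuasiBialgebra} (f : X ⟶ Y),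
    f ▷ V.toFDMod ≫ V.half Y = V.half X ≫ V.toFDMod ◁ f :=
      fun f => FDMod.hom_ext fun t => halfBraid_nat _ _ _ _ f.comm t
  have e0 : ∀ v : V.V, (tenL V.half reg reg).lin ((1 : H) ⊗ₜ ((1 : H) ⊗ₜ v)) =
      (tenR V.half reg reg).lin ((1 : H) ⊗ₜ ((1 : H) ⊗ₜ v)) := fun v => by
    have e1 : (reg ◁ V.half reg).lin ((1 : H) ⊗ₜ ((1 : H) ⊗ₜ v)) = (1 : H) ⊗ₜ[k] V.coact v :=
      congrArg (fun s => (1 : H) ⊗ₜ[k] s) (halfBraid_one V.coact v)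
    refine (congrArg (fun s => (V.half reg ▷ reg).lin ((α_ reg V.toFDMod reg).inv.lin s)) e1).trans ?_
    refine (V.coact_coassoc v).trans ?_
    exact (tenR_reg V.toFDMod V.coact V.half (fun _ => rfl) v).symm
  induction t using TensorProduct.induction_on with
  | zero => simp
  | add x y hx hy => simp only [map_add, hx, hy]
  | tmul x t =>
    induction t using TensorProduct.induction_on with
    | zero => simp
    | add x y hx hy => simp only [map_add, tmul_add, hx, hy]
    | tmul y v =>
      have e1 := congrArg (fun f => f.lin ((1 : H) ⊗ₜ[k] ((1 : H) ⊗ₜ[k] v)))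
        (tenL_nat nat (orbit (X := X) x) (orbit (X := Y) y))
      have e2 := congrArg (fun f => f.lin ((1 : H) ⊗ₜ[k] ((1 : H) ⊗ₜ[k] v)))
        (tenR_nat nat (orbit (X := X) x) (orbit (X := Y) y))
      have e3 : (orbit (X := X) x ⊗ₘ (orbit (X := Y) y ▷ V.toFDMod)).lin
        ((1 : H) ⊗ₜ[k] ((1 : H) ⊗ₜ[k] v)) = x ⊗ₜ[k] (y ⊗ₜ[k] v) := by
        change (X.ρ 1 x) ⊗ₜ[k] ((Y.ρ 1 y) ⊗ₜ[k] v) = _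
        simp
      simp only [FDMod.comp_lin, e3, e0] at e1 e2
      exact e1.trans e2.symm

lemma half_isHB (V : YD Q) : IsHB V.half where
  nat f := FDMod.hom_ext fun t => halfBraid_nat _ _ _ _ f.comm t
  unit := half_unit V
  ten X Y := by
    have := half_ten V X Y
    unfold tenL tenR at this
    calc V.half (X ⊗ Y) = (α_ X Y V.toFDMod).hom ≫ ((α_ X Y V.toFDMod).inv ≫ V.half (X ⊗ Y) ≫
          (α_ V.toFDMod X Y).inv) ≫ (α_ V.toFDMod X Y).hom := by simp
      _ = _ := by rw [← this]; simp

instance (V : YD Q) (X : FDMod Q.toQuasiBialgebra) : IsIso (V.half X) :=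
  ⟨halfInv V.half X (FDMod.dual X), halfInv_spec _ V.half_isHB.nat V.half_isHB.unit
    V.half_isHB.ten X _⟩

lemma half_eq_aux {V : FDMod Q.toQuasiBialgebra}
    {b : ∀ X : FDMod Q.toQuasiBialgebra, X ⊗ V ⟶ V ⊗ X} (hb : IsHB b)
    (X : FDMod Q.toQuasiBialgebra) (t : X.V ⊗[k] V.V) :
    halfBraid X.ρ ((b reg).lin ∘ₗ TensorProduct.mk k H V.V 1) t = (b X).lin t := by
  induction t with
  | zero => simp
  | add x y hx hy => simp only [map_add, hx, hy]
  | tmul x v =>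
    rw [halfBraid_tmul]
    have := congrArg (fun f => f.lin ((1 : H) ⊗ₜ[k] v)) (hb.nat (orbit (X := X) x))
    refine this.symm.trans ?_
    change (b X).lin ((X.ρ 1 x) ⊗ₜ v) = _
    simp

/-- A natural half braiding defines a Yetter-Drinfeld module: the coaction is
`v ↦ b_H(1 ⊗ v)`. -/
def ofHB (V : FDMod Q.toQuasiBialgebra) (b : ∀ X : FDMod Q.toQuasiBialgebra, X ⊗ V ⟶ V ⊗ X)
    (hb : IsHB b) : YD Q where
  toFDMod := V
  coact := (b reg).lin ∘ₗ TensorProduct.mk k H V.V 1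
  coact_counit v := by
    have h := half_eq_aux hb FDMod.one ((1 : k) ⊗ₜ v)
    have u : (b (𝟙_ _)).lin ((1 : k) ⊗ₜ[k] v) =
        (TensorProduct.rid k V.V).symm (TensorProduct.lid k V.V ((1 : k) ⊗ₜ[k] v)) :=
      congrArg (fun f => f.lin ((1 : k) ⊗ₜ[k] v)) hb.unit
    have h' := congrArg (TensorProduct.rid k V.V) (h.trans u)
    rw [LinearEquiv.apply_symm_apply, TensorProduct.lid_tmul, one_smul, halfBraid_tmul] at h'
    refine Eq.trans ?_ h'
    have e : Q.ε.toLinearMap =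
      LinearMap.applyₗ (1 : k) ∘ₗ (FDMod.one (Q := Q.toQuasiBialgebra)).ρ.toLinearMap := by
        ext h; simp
    rw [e]
  coact_coassoc v := by
    have e1 := tenR_reg V ((b reg).lin ∘ₗ TensorProduct.mk k H V.V 1) b
      (fun X => LinearMap.ext fun t => (half_eq_aux hb X t).symm) v
    refine Eq.trans ?_ e1
    have e2 : tenL b reg reg = tenR b reg reg := by
      unfold tenL tenR; rw [hb.ten]; simp
    rw [← e2]
    unfold tenL
    rw [FDMod.comp_lin, FDMod.comp_lin]
    have e3 : (b reg).lin = halfBraid (Algebra.lmul k H) ((b reg).lin ∘ₗ TensorProduct.mk k H V.V 1) :=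
      LinearMap.ext fun t => (half_eq_aux hb reg t).symm
    exact congrArg (fun f : H ⊗[k] V.V →ₗ[k] V.V ⊗[k] H => f.rTensor H _) e3.symm
  coact_compat h v := by
    refine (half_eq_aux hb reg _).trans ?_
    exact (b reg).comm h _

end

end YD

end

section

open TensorProduct CategoryTheory MonoidalCategory

variable {k H : Type u} [Field k] [Ring H] [Algebra k H]
namespace YD
variable {Q : QuasiHopf k H}

/-- `H`-linear and `H`-colinear maps. -/
@[ext]
structure Hom (V W : YD Q) where
  hom : V.toFDMod ⟶ W.toFDMod
  colin : ∀ v, hom.lin.rTensor H (V.coact v) = W.coact (hom.lin v)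

instance : Category (YD Q) where
  Hom := Hom
  id V := ⟨𝟙 _, fun v => LinearMap.rTensor_id_apply _ _ _⟩
  comp {U V W} f g := ⟨f.hom ≫ g.hom, fun v => by
    rw [FDMod.comp_lin, ← g.colin, ← f.colin]
    exact LinearMap.rTensor_comp_apply _ _ _ _⟩

/-- The functor forgetting the coaction. -/
def forget (Q : QuasiHopf k H) : YD Q ⥤ FDMod Q.toQuasiBialgebra where
  obj V := V.toFDMod
  map f := f.hom

instance : (forget Q).Faithful where
  map_injective h := Hom.ext h

lemma colin_of_half [Module.Finite k H] {V W : YD Q} (f : V.toFDMod ⟶ W.toFDMod)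
    (h : V.half reg ≫ f ▷ reg = reg ◁ f ≫ W.half reg) (v : V.V) :
    f.lin.rTensor H (V.coact v) = W.coact (f.lin v) := by
  have := congrArg (fun f => f.lin ((1 : H) ⊗ₜ[k] v)) h
  have e1 : (V.half reg).lin ((1 : H) ⊗ₜ[k] v) = V.coact v := halfBraid_one V.coact v
  have e2 : (W.half reg).lin ((1 : H) ⊗ₜ[k] f.lin v) = W.coact (f.lin v) :=
    halfBraid_one W.coact _
  rw [← e2, ← e1]; exact this

lemma Hom.half {V W : YD Q} (f : V ⟶ W) (X : FDMod Q.toQuasiBialgebra) :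
    V.half X ≫ f.hom ▷ X = X ◁ f.hom ≫ W.half X := FDMod.hom_ext fun t => by
  change X.V ⊗[k] V.V at t
  induction t using TensorProduct.induction_on with
  | zero => simp
  | add x y hx hy => simp only [map_add, hx, hy]
  | tmul x v =>
    change f.hom.lin.rTensor X.V (halfBraid X.ρ V.coact (x ⊗ₜ v)) =
      halfBraid X.ρ W.coact (x ⊗ₜ f.hom.lin v)
    rw [halfBraid_tmul, halfBraid_tmul, ← f.colin]
    generalize V.coact v = t
    induction t with
    | zero => simp
    | add x y hx hy => simp only [map_add, hx, hy]
    | tmul v h => simp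

variable [Module.Finite k H]

@[simp] lemma ofHB_half (V : FDMod Q.toQuasiBialgebra)
    (b : ∀ X : FDMod Q.toQuasiBialgebra, X ⊗ V ⟶ V ⊗ X) (hb : IsHB b) : (ofHB V b hb).half = b :=
  funext fun X => FDMod.hom_ext fun t => half_eq_aux hb X t

/-- An `H`-linear map compatible with the half braidings is colinear. -/
def homMk {V W : YD Q} (f : V.toFDMod ⟶ W.toFDMod)
    (h : ∀ X, V.half X ≫ f ▷ X = X ◁ f ≫ W.half X) : V ⟶ W :=
  ⟨f, colin_of_half f (h reg)⟩

def isoMk {V W : YD Q} (f : V.toFDMod ≅ W.toFDMod)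
    (h : ∀ X, V.half X ≫ f.hom ▷ X = X ◁ f.hom ≫ W.half X) : V ≅ W where
  hom := homMk f.hom h
  inv := homMk f.inv fun X => by
    have := h X
    rw [← cancel_mono (f.hom ▷ X), Category.assoc, Category.assoc, h X]
    simp [← comp_whiskerRight, ← whiskerLeft_comp_assoc]
  hom_inv_id := Hom.ext f.hom_inv_id
  inv_hom_id := Hom.ext f.inv_hom_id

/-- The tensor product `V ⊗ W`, with coaction
`v ⊗ w ↦ x¹X¹(y²v)₀ ⊗ x²(X³y³w)₀ ⊗ x³(X³y³w)₁X²(y²v)₁y¹`. -/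
def tensor (V W : YD Q) : YD Q :=
  ofHB (V.toFDMod ⊗ W.toFDMod) (tensorHB V.half W.half) (V.half_isHB.tensor W.half_isHB)

/-- The unit object `k`, with coaction `1 ↦ 1 ⊗ 1`. -/
def one : YD Q := ofHB (𝟙_ _) _ IsHB.one

lemma tensor_half (V W : YD Q) (X) : (tensor V W).half X = tensorHB V.half W.half X :=
  congrFun (ofHB_half _ _ _) X

lemma tensor_half' (V W : YD Q) : (tensor V W).half = tensorHB V.half W.half :=
  ofHB_half _ _ _

lemma one_half : (one (Q := Q)).half = fun X => (ρ_ X).hom ≫ (λ_ X).inv := ofHB_half _ _ _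

/-- The tensor product of morphisms. -/
def tensorMap {V W V' W' : YD Q} (f : V ⟶ V') (g : W ⟶ W') : tensor V W ⟶ tensor V' W' :=
  homMk (f.hom ⊗ₘ g.hom) fun X => by
    rw [tensor_half, tensor_half]
    exact tensorHB_map X (f.half X) (g.half X)

instance : MonoidalCategoryStruct (YD Q) where
  tensorObj := tensor
  tensorHom := tensorMap
  whiskerLeft X _ _ f := tensorMap (𝟙 X) f
  whiskerRight f Y := tensorMap f (𝟙 Y)
  tensorUnit := one
  associator X Y Z := isoMk (α_ X.toFDMod Y.toFDMod Z.toFDMod) fun U => by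
    rw [tensor_half, tensor_half, tensor_half', tensor_half']
    exact tensorHB_assoc U
  leftUnitor X := isoMk (λ_ X.toFDMod) fun U => by
    rw [tensor_half, one_half]
    exact tensorHB_left U
  rightUnitor X := isoMk (ρ_ X.toFDMod) fun U => by
    rw [tensor_half, one_half]
    exact tensorHB_right U

/-- The tensor product of Yetter-Drinfeld modules is that of the underlying modules. -/
def forgetData : Monoidal.InducingFunctorData (forget Q) where
  μIso X Y := Iso.refl (X.toFDMod ⊗ Y.toFDMod)
  εIso := Iso.refl (𝟙_ (FDMod Q.toQuasiBialgebra))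
  whiskerLeft_eq X _ _ f := by
    change 𝟙 X.toFDMod ⊗ₘ f.hom = 𝟙 _ ≫ (X.toFDMod ◁ f.hom) ≫ 𝟙 _
    rw [id_tensorHom, Category.id_comp]; exact (Category.comp_id _).symm
  whiskerRight_eq f Y := by
    change f.hom ⊗ₘ 𝟙 Y.toFDMod = 𝟙 _ ≫ (f.hom ▷ Y.toFDMod) ≫ 𝟙 _
    rw [tensorHom_id, Category.id_comp]; exact (Category.comp_id _).symm
  tensorHom_eq f g := by
    change f.hom ⊗ₘ g.hom = 𝟙 _ ≫ (f.hom ⊗ₘ g.hom) ≫ 𝟙 _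
    rw [Category.id_comp]; exact (Category.comp_id _).symm
  associator_eq X Y Z := by
    change (α_ X.toFDMod Y.toFDMod Z.toFDMod).hom =
      (𝟙 _ ≫ (𝟙 (X.toFDMod ⊗ Y.toFDMod) ⊗ₘ 𝟙 Z.toFDMod)) ≫
        (α_ X.toFDMod Y.toFDMod Z.toFDMod).hom ≫
          ((𝟙 X.toFDMod ⊗ₘ 𝟙 (Y.toFDMod ⊗ Z.toFDMod)) ≫ 𝟙 _)
    simp
  leftUnitor_eq X := by
    change (λ_ X.toFDMod).hom = (𝟙 _ ≫ (𝟙 (𝟙_ _) ⊗ₘ 𝟙 X.toFDMod)) ≫ (λ_ X.toFDMod).hom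
    simp
  rightUnitor_eq X := by
    change (ρ_ X.toFDMod).hom = (𝟙 _ ≫ (𝟙 X.toFDMod ⊗ₘ 𝟙 (𝟙_ _))) ≫ (ρ_ X.toFDMod).hom
    simp

instance : MonoidalCategory (YD Q) := Monoidal.induced (forget Q) forgetData

/-- The braiding `𝔠(v ⊗ w) = w₀ ⊗ w₁ v`. -/
def braid (V W : YD Q) : V ⊗ W ≅ W ⊗ V :=
  isoMk (asIso (W.half V.toFDMod) : V.toFDMod ⊗ W.toFDMod ≅ W.toFDMod ⊗ V.toFDMod) fun X => by
    change (tensor V W).half X ≫ _ = _ ≫ (tensor W V).half X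
    rw [tensor_half, tensor_half]
    exact tensorHB_yb W.half_isHB X

instance : BraidedCategory (YD Q) where
  braiding := braid
  braiding_naturality_right X _ _ f := Hom.ext (by
    change (𝟙 X.toFDMod ⊗ₘ f.hom) ≫ _ = half _ _ ≫ (f.hom ⊗ₘ 𝟙 X.toFDMod)
    rw [id_tensorHom, tensorHom_id]
    exact (f.half X.toFDMod).symm)
  braiding_naturality_left f Z := Hom.ext (by
    change (f.hom ⊗ₘ 𝟙 Z.toFDMod) ≫ _ = half _ _ ≫ (𝟙 Z.toFDMod ⊗ₘ f.hom)
    rw [id_tensorHom, tensorHom_id]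
    exact Z.half_isHB.nat f.hom)
  hexagon_forward X Y Z := Hom.ext (by
    change (α_ X.toFDMod Y.toFDMod Z.toFDMod).hom ≫ (tensor Y Z).half X.toFDMod ≫
      (α_ Y.toFDMod Z.toFDMod X.toFDMod).hom =
        (Y.half X.toFDMod ⊗ₘ 𝟙 Z.toFDMod) ≫ (α_ Y.toFDMod X.toFDMod Z.toFDMod).hom ≫
        (𝟙 Y.toFDMod ⊗ₘ Z.half X.toFDMod)
    rw [id_tensorHom, tensorHom_id, tensor_half]
    exact tensorHB_hex X.toFDMod)
  hexagon_reverse X Y Z := Hom.ext (by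
    change (α_ X.toFDMod Y.toFDMod Z.toFDMod).inv ≫ Z.half (X.toFDMod ⊗ Y.toFDMod) ≫
      (α_ Z.toFDMod X.toFDMod Y.toFDMod).inv =
        (𝟙 X.toFDMod ⊗ₘ Z.half Y.toFDMod) ≫ (α_ X.toFDMod Z.toFDMod Y.toFDMod).inv ≫
        (Z.half X.toFDMod ⊗ₘ 𝟙 Y.toFDMod)
    rw [id_tensorHom, tensorHom_id]
    exact (half_ten Z _ _).symm)

end YD

end

section

open CategoryTheory MonoidalCategory

/-- A twist on a braided category: natural automorphisms `θ_X` with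
`θ_{X ⊗ Y} = (θ_X ⊗ θ_Y) c_{Y,X} c_{X,Y}`. A braided category with a twist is a balanced category. -/
structure Twist (C : Type u) [Category.{v} C] [MonoidalCategory C] [BraidedCategory C] where
  θ : ∀ X : C, X ≅ X
  natural : ∀ {X Y : C} (f : X ⟶ Y), f ≫ (θ Y).hom = (θ X).hom ≫ f
  tensor : ∀ X Y : C, (θ (X ⊗ Y)).hom =
    (β_ X Y).hom ≫ (β_ Y X).hom ≫ ((θ X).hom ⊗ₘ (θ Y).hom)

/-- A balanced category is ribbon if every object has a left dual `X^*` (with evaluation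
`X^* ⊗ X ⟶ 𝟙` and coevaluation `𝟙 ⟶ X ⊗ X^*`; this is `Xᘁ`, a right dual, in the terminology of
Mathlib) and `θ_{X^*} = (θ_X)^*`. -/
def Twist.IsRibbon {C : Type u} [Category.{v} C] [MonoidalCategory C] [BraidedCategory C]
    (T : Twist C) : Prop :=
  (∀ X : C, Nonempty (HasRightDual X)) ∧
    ∀ (X : C) [HasRightDual X], (T.θ (Xᘁ)).hom = ((T.θ X).hom)ᘁ

/-- The twist on the reversed category `Cᴹᵒᵖ`. -/
def Twist.mop {C : Type u} [Category.{v} C] [MonoidalCategory C] [BraidedCategory C]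
    (T : Twist C) : Twist Cᴹᵒᵖ where
  θ X := (T.θ X.unmop).mop
  natural f := congrArg Quiver.Hom.mop (T.natural f.unmop)
  tensor X Y := MonoidalOpposite.hom_ext ((T.tensor Y.unmop X.unmop).trans (by simp))

variable (C : Type u) [Category.{v} C] [MonoidalCategory C] [BraidedCategory C]

/-- Objects of `C` with an automorphism. -/
structure Twisted where
  obj : C
  η : obj ≅ obj

namespace Twisted

variable {C}

/-- Morphisms compatible with the given automorphisms. -/
@[ext]
structure Hom (X Y : Twisted C) where
  hom : X.obj ⟶ Y.obj
  comm : hom ≫ Y.η.hom = X.η.hom ≫ hom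

instance : Category (Twisted C) where
  Hom := Hom
  id X := ⟨𝟙 X.obj, by simp⟩
  comp f g := ⟨f.hom ≫ g.hom, by rw [Category.assoc, g.comm, ← Category.assoc, f.comm,
    Category.assoc]⟩

/-- The functor forgetting the automorphism. -/
def forget (C : Type u) [Category.{v} C] [MonoidalCategory C] [BraidedCategory C] :
    Twisted C ⥤ C where
  obj X := X.obj
  map f := f.hom

instance : (forget C).Faithful where
  map_injective h := Hom.ext h

def isoMk {X Y : Twisted C} (e : X.obj ≅ Y.obj) (h : e.hom ≫ Y.η.hom = X.η.hom ≫ e.hom) :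
    X ≅ Y where
  hom := ⟨e.hom, h⟩
  inv := ⟨e.inv, by rw [Iso.inv_comp_eq, ← Category.assoc, h]; simp⟩
  hom_inv_id := Hom.ext e.hom_inv_id
  inv_hom_id := Hom.ext e.inv_hom_id

/-- The tensor product, with `η_{X ⊗ Y} = (η_X ⊗ η_Y) c_{Y,X} c_{X,Y}`. -/
def tensor (X Y : Twisted C) : Twisted C :=
  ⟨X.obj ⊗ Y.obj, β_ X.obj Y.obj ≪≫ β_ Y.obj X.obj ≪≫ (X.η ⊗ᵢ Y.η)⟩

def tensorMap {X Y X' Y' : Twisted C} (f : X ⟶ X') (g : Y ⟶ Y') : tensor X Y ⟶ tensor X' Y' :=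
  ⟨f.hom ⊗ₘ g.hom, by simp [tensor, f.comm, g.comm]⟩

lemma double_assoc (X Y Z : C) :
    (α_ X Y Z).hom ≫ ((β_ X (Y ⊗ Z)).hom ≫ (β_ (Y ⊗ Z) X).hom) ≫
        X ◁ ((β_ Y Z).hom ≫ (β_ Z Y).hom) =
      (((β_ (X ⊗ Y) Z).hom ≫ (β_ Z (X ⊗ Y)).hom) ≫ ((β_ X Y).hom ≫ (β_ Y X).hom) ▷ Z) ≫
        (α_ X Y Z).hom := by
  have n1 := BraidedCategory.braiding_naturality_left ((β_ Y Z).hom ≫ (β_ Z Y).hom) X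
  have n2 := BraidedCategory.braiding_naturality_right Z ((β_ X Y).hom ≫ (β_ Y X).hom)
  have y1 := BraidedCategory.yang_baxter' X Y Z
  have y2 := BraidedCategory.yang_baxter' Z Y X
  calc _ = (α_ X Y Z).hom ≫ (β_ X (Y ⊗ Z)).hom ≫
        ((β_ Y Z).hom ≫ (β_ Z Y).hom) ▷ X ≫ (β_ (Y ⊗ Z) X).hom := by rw [n1, Category.assoc]
    _ = 𝟙 _ ⊗≫ ((β_ X Y).hom ▷ Z ⊗≫ Y ◁ (β_ X Z).hom ⊗≫ (β_ Y Z).hom ▷ X) ⊗≫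
        ((β_ Z Y).hom ▷ X ⊗≫ Y ◁ (β_ Z X).hom ⊗≫ (β_ Y X).hom ▷ Z) ⊗≫ 𝟙 _ := by
        rw [BraidedCategory.braiding_tensor_right_hom, BraidedCategory.braiding_tensor_left_hom]
        monoidal
    _ = ((β_ (X ⊗ Y) Z).hom ≫ (Z ◁ ((β_ X Y).hom ≫ (β_ Y X).hom) ≫ (β_ Z (X ⊗ Y)).hom)) ≫
        (α_ X Y Z).hom := by
        rw [y1, y2, BraidedCategory.braiding_tensor_right_hom,
          BraidedCategory.braiding_tensor_left_hom]
        monoidal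
    _ = _ := by rw [n2]; simp only [Category.assoc]

lemma assoc_comm (X Y Z : Twisted C) :
    (α_ X.obj Y.obj Z.obj).hom ≫ (tensor X (tensor Y Z)).η.hom =
      (tensor (tensor X Y) Z).η.hom ≫ (α_ X.obj Y.obj Z.obj).hom := by
  have h := double_assoc X.obj Y.obj Z.obj
  calc _ = ((α_ X.obj Y.obj Z.obj).hom ≫ ((β_ X.obj (Y.obj ⊗ Z.obj)).hom ≫
        (β_ (Y.obj ⊗ Z.obj) X.obj).hom) ≫ X.obj ◁ ((β_ Y.obj Z.obj).hom ≫ (β_ Z.obj Y.obj).hom)) ≫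
        (X.η.hom ⊗ₘ (Y.η.hom ⊗ₘ Z.η.hom)) := by
        simp [tensor, whiskerLeft_comp_tensorHom]
    _ = (((β_ (X.obj ⊗ Y.obj) Z.obj).hom ≫ (β_ Z.obj (X.obj ⊗ Y.obj)).hom) ≫
          ((β_ X.obj Y.obj).hom ≫ (β_ Y.obj X.obj).hom) ▷ Z.obj ≫
          ((X.η.hom ⊗ₘ Y.η.hom) ⊗ₘ Z.η.hom)) ≫ (α_ X.obj Y.obj Z.obj).hom := by
        rw [h]; simp only [Category.assoc, associator_naturality]
    _ = _ := by
        rw [whiskerRight_comp_tensorHom]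
        simp only [tensor, Iso.trans_hom, tensorIso_hom, Category.assoc]

instance : MonoidalCategoryStruct (Twisted C) where
  tensorObj := tensor
  tensorHom := tensorMap
  whiskerLeft X _ _ f := tensorMap (𝟙 X) f
  whiskerRight f Y := tensorMap f (𝟙 Y)
  tensorUnit := ⟨𝟙_ C, Iso.refl _⟩
  associator X Y Z := isoMk (α_ X.obj Y.obj Z.obj) (assoc_comm X Y Z)
  leftUnitor X := isoMk (λ_ X.obj) (by simp [tensor])
  rightUnitor X := isoMk (ρ_ X.obj) (by simp [tensor])

/-- The tensor product of objects with automorphism is that of the underlying objects. -/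
def forgetData : Monoidal.InducingFunctorData (forget C) where
  μIso X Y := Iso.refl (X.obj ⊗ Y.obj)
  εIso := Iso.refl (𝟙_ C)
  whiskerLeft_eq X _ _ f := by
    change 𝟙 X.obj ⊗ₘ f.hom = 𝟙 _ ≫ (X.obj ◁ f.hom) ≫ 𝟙 _
    simp
  whiskerRight_eq f Y := by
    change f.hom ⊗ₘ 𝟙 Y.obj = 𝟙 _ ≫ (f.hom ▷ Y.obj) ≫ 𝟙 _
    simp
  tensorHom_eq f g := by
    change f.hom ⊗ₘ g.hom = 𝟙 _ ≫ (f.hom ⊗ₘ g.hom) ≫ 𝟙 _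
    simp
  associator_eq X Y Z := by
    change (α_ X.obj Y.obj Z.obj).hom =
      (𝟙 _ ≫ (𝟙 (X.obj ⊗ Y.obj) ⊗ₘ 𝟙 Z.obj)) ≫
        (α_ X.obj Y.obj Z.obj).hom ≫ ((𝟙 X.obj ⊗ₘ 𝟙 (Y.obj ⊗ Z.obj)) ≫ 𝟙 _)
    simp
  leftUnitor_eq X := by
    change (λ_ X.obj).hom = (𝟙 _ ≫ (𝟙 (𝟙_ C) ⊗ₘ 𝟙 X.obj)) ≫ (λ_ X.obj).hom
    simp
  rightUnitor_eq X := by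
    change (ρ_ X.obj).hom = (𝟙 _ ≫ (𝟙 X.obj ⊗ₘ 𝟙 (𝟙_ C))) ≫ (ρ_ X.obj).hom
    simp

instance : MonoidalCategory (Twisted C) := Monoidal.induced (forget C) forgetData

instance : (forget C).Monoidal := Monoidal.fromInducedMonoidal (forget C) forgetData

instance : BraidedCategory (Twisted C) :=
  .ofFaithful (forget C)
    (fun X Y => isoMk (β_ X.obj Y.obj) (by
      change (β_ X.obj Y.obj).hom ≫ (tensor Y X).η.hom = (tensor X Y).η.hom ≫ (β_ X.obj Y.obj).hom
      simp [tensor]))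
    (fun X Y => by
      change 𝟙 (X.obj ⊗ Y.obj) ≫ (β_ X.obj Y.obj).hom = (β_ X.obj Y.obj).hom ≫ 𝟙 (Y.obj ⊗ X.obj)
      simp)

/-- The twist given by the automorphisms `η_X`. -/
def twist (C : Type u) [Category.{v} C] [MonoidalCategory C] [BraidedCategory C] :
    Twist (Twisted C) where
  θ X := isoMk X.η rfl
  natural f := Hom.ext f.comm
  tensor _ _ := rfl

/-- The condition `η_V^{-2} = (V ⊗ ev) (c_{V^*,V} ⊗ V) (c_{V,V^*} ⊗ V) (coev ⊗ V)`, where `V^*` is a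
left dual of `V`. -/
def rib (C : Type u) [Category.{v} C] [MonoidalCategory C] [BraidedCategory C] :
    ObjectProperty (Twisted C) := fun X =>
  ∃ (D : C) (_ : ExactPairing X.obj D),
    X.η.inv ≫ X.η.inv = (λ_ X.obj).inv ≫ η_ X.obj D ▷ X.obj ≫ (β_ X.obj D).hom ▷ X.obj ≫
      (β_ D X.obj).hom ▷ X.obj ≫ (α_ X.obj D X.obj).hom ≫ X.obj ◁ ε_ X.obj D ≫ (ρ_ X.obj).hom

end Twisted

end

section

open CategoryTheory MonoidalCategory

namespace Twisted
variable {C : Type u} [Category.{v} C] [MonoidalCategory C]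

section bend
variable {V D : C} [ExactPairing V D]

lemma zig (V D : C) [ExactPairing V D] :
    𝟙 _ ⊗≫ η_ V D ▷ V ⊗≫ V ◁ ε_ V D ⊗≫ 𝟙 _ = 𝟙 V := by
  calc _ = (λ_ V).inv ≫ (η_ V D ▷ V ≫ (α_ V D V).hom ≫ V ◁ ε_ V D) ≫ (ρ_ V).hom := by monoidal
    _ = _ := by rw [ExactPairing.evaluation_coevaluation]; simp

lemma zag (V D : C) [ExactPairing V D] :
    𝟙 _ ⊗≫ D ◁ η_ V D ⊗≫ ε_ V D ▷ D ⊗≫ 𝟙 _ = 𝟙 D := by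
  calc _ = (ρ_ D).inv ≫ (D ◁ η_ V D ≫ (α_ D V D).inv ≫ ε_ V D ▷ D) ≫ (λ_ D).hom := by monoidal
    _ = _ := by rw [ExactPairing.coevaluation_evaluation]; simp

lemma bend (f : V ⊗ D ⟶ V ⊗ D) (p : V ⟶ V) :
    p = 𝟙 _ ⊗≫ (η_ V D ≫ f) ▷ V ⊗≫ V ◁ ε_ V D ⊗≫ 𝟙 _ ↔ η_ V D ≫ f = η_ V D ≫ p ▷ D := by
  constructor
  · intro h
    have : η_ V D ≫ p ▷ D = 𝟙 _ ⊗≫ (𝟙_ C ◁ η_ V D ≫ (η_ V D ≫ f) ▷ (V ⊗ D)) ⊗≫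
        V ◁ ε_ V D ▷ D ⊗≫ 𝟙 _ := by
      conv_lhs => rw [h]
      monoidal
    rw [this, whisker_exchange]
    symm
    calc _ = (η_ V D ≫ f) ⊗≫ V ◁ (𝟙 D ⊗≫ D ◁ η_ V D ⊗≫ ε_ V D ▷ D ⊗≫ 𝟙 D) ⊗≫ 𝟙 _ := by monoidal
      _ = _ := by rw [zag]; monoidal
  · intro h
    rw [h]
    symm
    calc _ = 𝟙 _ ⊗≫ η_ V D ▷ V ⊗≫ (p ▷ (D ⊗ V) ≫ V ◁ ε_ V D) ⊗≫ 𝟙 _ := by monoidal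
      _ = (𝟙 _ ⊗≫ η_ V D ▷ V ⊗≫ V ◁ ε_ V D ⊗≫ 𝟙 _) ≫ p := by
        rw [← whisker_exchange]; monoidal
      _ = p := by rw [zig]; simp

end bend

/-- The coevaluation of a tensor product of dual pairs. -/
abbrev co (V W D E : C) [ExactPairing V D] [ExactPairing W E] : 𝟙_ C ⟶ (V ⊗ W) ⊗ (E ⊗ D) :=
  η_ V D ≫ (ρ_ V).inv ▷ D ≫ (V ◁ η_ W E) ▷ D ≫ (α_ V W E).inv ▷ D ≫ (α_ (V ⊗ W) E D).hom

lemma co_eq (V W D E : C) [ExactPairing V D] [ExactPairing W E] :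
    η_ (V ⊗ W) (E ⊗ D) = co V W D E := by
  rw [ExactPairing.tensor_coevaluation]; unfold co; monoidal

lemma co_tensor {V W D E : C} [ExactPairing V D] [ExactPairing W E] {f : V ⟶ V} {g : W ⟶ W}
    {f' : D ⟶ D} {g' : E ⟶ E} (hf : η_ V D ≫ f ▷ D = η_ V D ≫ V ◁ f')
    (hg : η_ W E ≫ g ▷ E = η_ W E ≫ W ◁ g') :
    co V W D E ≫ (f ⊗ₘ g) ▷ (E ⊗ D) = co V W D E ≫ (V ⊗ W) ◁ (g' ⊗ₘ f') := by
  rw [MonoidalCategory.tensorHom_def, MonoidalCategory.tensorHom_def]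
  calc _ = 𝟙 _ ⊗≫ η_ V D ⊗≫ (V ◁ η_ W E ≫ f ▷ (W ⊗ E)) ▷ D ⊗≫ V ◁ (g ▷ E) ▷ D ⊗≫ 𝟙 _ := by
        unfold co; monoidal
    _ = 𝟙 _ ⊗≫ (η_ V D ≫ f ▷ D) ⊗≫ V ◁ (η_ W E ≫ g ▷ E) ▷ D ⊗≫ 𝟙 _ := by
        rw [whisker_exchange]; monoidal
    _ = 𝟙 _ ⊗≫ η_ V D ⊗≫ V ◁ (𝟙_ C ◁ f' ≫ (η_ W E ≫ W ◁ g') ▷ D) ⊗≫ 𝟙 _ := by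
        rw [hf, hg]; monoidal
    _ = 𝟙 _ ⊗≫ η_ V D ⊗≫ V ◁ ((η_ W E ≫ W ◁ g') ▷ D ≫ (W ⊗ E) ◁ f') ⊗≫ 𝟙 _ := by
        rw [whisker_exchange]
    _ = _ := by unfold co; monoidal

lemma exists_mate {V D : C} [ExactPairing V D] (η : V ≅ V) :
    ∃ ζ : D ≅ D, η_ V D ≫ η.hom ▷ D = η_ V D ≫ V ◁ ζ.hom := by
  let _ : HasRightDual V := ⟨D⟩
  refine ⟨⟨(η.hom)ᘁ, (η.inv)ᘁ, ?_, ?_⟩, (coevaluation_comp_rightAdjointMate η.hom).symm⟩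
  · rw [← comp_rightAdjointMate, Iso.inv_hom_id, rightAdjointMate_id]; rfl
  · rw [← comp_rightAdjointMate, Iso.hom_inv_id, rightAdjointMate_id]; rfl

variable [BraidedCategory C]

lemma co_braid (V W D E : C) [ExactPairing V D] [ExactPairing W E] :
    co V W D E ≫ (β_ V W).hom ▷ (E ⊗ D) = co W V E D ≫ (W ⊗ V) ◁ (β_ D E).hom := by
  have n1 := BraidedCategory.braiding_naturality_right V (η_ W E)
  have n2 := BraidedCategory.braiding_naturality_left (η_ V D) E
  rw [BraidedCategory.braiding_tensor_right_hom] at n1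
  rw [BraidedCategory.braiding_tensor_left_hom] at n2
  have m1 : 𝟙 V ⊗≫ V ◁ η_ W E ⊗≫ (β_ V W).hom ▷ E ⊗≫ 𝟙 (W ⊗ (V ⊗ E)) =
      𝟙 V ⊗≫ η_ W E ▷ V ⊗≫ W ◁ (β_ V E).inv ⊗≫ 𝟙 (W ⊗ (V ⊗ E)) := by
    calc _ = 𝟙 V ⊗≫ V ◁ η_ W E ⊗≫ (β_ V W).hom ▷ E ⊗≫ W ◁ ((β_ V E).hom ≫ (β_ V E).inv) ⊗≫
          𝟙 (W ⊗ (V ⊗ E)) := by rw [Iso.hom_inv_id]; monoidal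
      _ = 𝟙 V ⊗≫ (V ◁ η_ W E ≫ (α_ V W E).inv ≫ (β_ V W).hom ▷ E ≫ (α_ W V E).hom ≫
          W ◁ (β_ V E).hom ≫ (α_ W E V).inv) ⊗≫ W ◁ (β_ V E).inv ⊗≫ 𝟙 (W ⊗ (V ⊗ E)) := by monoidal
      _ = _ := by rw [n1, braiding_tensorUnit_right]; monoidal
  have m2 : 𝟙 E ⊗≫ E ◁ η_ V D ⊗≫ (β_ V E).inv ▷ D ⊗≫ 𝟙 (V ⊗ (E ⊗ D)) =
      𝟙 E ⊗≫ η_ V D ▷ E ⊗≫ V ◁ (β_ D E).hom ⊗≫ 𝟙 (V ⊗ (E ⊗ D)) := by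
    symm
    calc _ = 𝟙 E ⊗≫ η_ V D ▷ E ⊗≫ V ◁ (β_ D E).hom ⊗≫ ((β_ V E).hom ≫ (β_ V E).inv) ▷ D ⊗≫
          𝟙 (V ⊗ (E ⊗ D)) := by rw [Iso.hom_inv_id]; monoidal
      _ = 𝟙 E ⊗≫ (η_ V D ▷ E ≫ (α_ V D E).hom ≫ V ◁ (β_ D E).hom ≫ (α_ V E D).inv ≫
          (β_ V E).hom ▷ D ≫ (α_ E V D).hom) ⊗≫ (β_ V E).inv ▷ D ⊗≫ 𝟙 (V ⊗ (E ⊗ D)) := by monoidal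
      _ = _ := by rw [n2, braiding_tensorUnit_left]; monoidal
  calc _ = 𝟙 _ ⊗≫ η_ V D ⊗≫ (𝟙 V ⊗≫ V ◁ η_ W E ⊗≫ (β_ V W).hom ▷ E ⊗≫ 𝟙 (W ⊗ (V ⊗ E))) ▷ D ⊗≫ 𝟙 _ := by
        unfold co; monoidal
    _ = 𝟙 _ ⊗≫ (𝟙_ C ◁ η_ V D ≫ η_ W E ▷ (V ⊗ D)) ⊗≫ W ◁ (β_ V E).inv ▷ D ⊗≫ 𝟙 _ := by
        rw [m1]; monoidal
    _ = 𝟙 _ ⊗≫ η_ W E ⊗≫ W ◁ (𝟙 E ⊗≫ E ◁ η_ V D ⊗≫ (β_ V E).inv ▷ D ⊗≫ 𝟙 (V ⊗ (E ⊗ D))) ⊗≫ 𝟙 _ := by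
        rw [whisker_exchange]; monoidal
    _ = _ := by rw [m2]; unfold co; monoidal

lemma double_nat {V V' W W' : C} (f : V ⟶ V') (g : W ⟶ W') :
    (f ⊗ₘ g) ≫ (β_ V' W').hom ≫ (β_ W' V').hom = ((β_ V W).hom ≫ (β_ W V).hom) ≫ (f ⊗ₘ g) := by
  simp

lemma co_double (V W D E : C) [ExactPairing V D] [ExactPairing W E] :
    co V W D E ≫ ((β_ V W).hom ≫ (β_ W V).hom) ▷ (E ⊗ D) =
      co V W D E ≫ (V ⊗ W) ◁ ((β_ E D).hom ≫ (β_ D E).hom) := by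
  rw [comp_whiskerRight, ← Category.assoc, co_braid, Category.assoc, whisker_exchange,
    ← Category.assoc, co_braid, Category.assoc, ← MonoidalCategory.whiskerLeft_comp]

lemma rib_eq_iff {V D : C} [ExactPairing V D] (η : V ≅ V) (ζ : D ≅ D)
    (h : η_ V D ≫ η.hom ▷ D = η_ V D ≫ V ◁ ζ.hom) :
    (η.inv ≫ η.inv = (λ_ V).inv ≫ η_ V D ▷ V ≫ (β_ V D).hom ▷ V ≫
      (β_ D V).hom ▷ V ≫ (α_ V D V).hom ≫ V ◁ ε_ V D ≫ (ρ_ V).hom) ↔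
    η_ V D ≫ (β_ V D).hom ≫ (β_ D V).hom ≫ (η.hom ⊗ₘ ζ.hom) = η_ V D := by
  have e1 : (λ_ V).inv ≫ η_ V D ▷ V ≫ (β_ V D).hom ▷ V ≫
      (β_ D V).hom ▷ V ≫ (α_ V D V).hom ≫ V ◁ ε_ V D ≫ (ρ_ V).hom =
      𝟙 _ ⊗≫ (η_ V D ≫ (β_ V D).hom ≫ (β_ D V).hom) ▷ V ⊗≫ V ◁ ε_ V D ⊗≫ 𝟙 _ := by monoidal
  rw [e1, bend]
  have e2 : η_ V D ≫ (β_ V D).hom ≫ (β_ D V).hom ≫ (η.hom ⊗ₘ ζ.hom) =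
      (η_ V D ≫ (β_ V D).hom ≫ (β_ D V).hom) ≫ (η.hom ≫ η.hom) ▷ D := by
    calc _ = η_ V D ≫ ((β_ V D).hom ≫ (β_ D V).hom) ≫ (η.hom ⊗ₘ ζ.hom) := by simp
      _ = (η_ V D ≫ V ◁ ζ.hom) ≫ η.hom ▷ D ≫ (β_ V D).hom ≫ (β_ D V).hom := by
          rw [← double_nat, MonoidalCategory.tensorHom_def']; simp only [Category.assoc]
      _ = η_ V D ≫ ((η.hom ≫ η.hom) ⊗ₘ 𝟙 D) ≫ (β_ V D).hom ≫ (β_ D V).hom := by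
          rw [← h]; simp
      _ = _ := by rw [double_nat]; simp
  rw [e2]
  constructor
  · intro h'
    rw [h', Category.assoc, ← comp_whiskerRight]
    simp
  · intro h'
    have := congrArg (fun f => f ≫ (η.inv ≫ η.inv) ▷ D) h'
    simp only [Category.assoc, ← comp_whiskerRight] at this
    rw [← this]
    simp

lemma tensor_double {V W D E : C} [ExactPairing V D] [ExactPairing W E] {f : V ⟶ V} {g : W ⟶ W}
    {f' : D ⟶ D} {g' : E ⟶ E} (hf : η_ V D ≫ f ▷ D = η_ V D ≫ V ◁ f')
    (hg : η_ W E ≫ g ▷ E = η_ W E ≫ W ◁ g') :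
    co V W D E ≫ ((β_ V W).hom ≫ (β_ W V).hom ≫ (f ⊗ₘ g)) ▷ (E ⊗ D) =
      co V W D E ≫ (V ⊗ W) ◁ ((β_ E D).hom ≫ (β_ D E).hom ≫ (g' ⊗ₘ f')) := by
  have e2 : (β_ E D).hom ≫ (β_ D E).hom ≫ (g' ⊗ₘ f') =
      (g' ⊗ₘ f') ≫ (β_ E D).hom ≫ (β_ D E).hom := by rw [double_nat, Category.assoc]
  rw [e2, ← Category.assoc, comp_whiskerRight, ← Category.assoc, co_double, Category.assoc,
    whisker_exchange, ← Category.assoc, co_tensor hf hg, Category.assoc,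
    ← MonoidalCategory.whiskerLeft_comp]

lemma rib_tensor (X Y : Twisted C) (hX : rib C X) (hY : rib C Y) : rib C (X ⊗ Y) := by
  obtain ⟨D, pD, hD⟩ := hX
  obtain ⟨E, pE, hE⟩ := hY
  obtain ⟨ζ, hζ⟩ := exists_mate (D := D) X.η
  obtain ⟨ξ, hξ⟩ := exists_mate (D := E) Y.η
  rw [rib_eq_iff X.η ζ hζ] at hD
  rw [rib_eq_iff Y.η ξ hξ] at hE
  let X' : Twisted C := ⟨D, ζ⟩
  let Y' : Twisted C := ⟨E, ξ⟩
  let cX : 𝟙_ (Twisted C) ⟶ X ⊗ X' := ⟨η_ X.obj D, hD.trans (Category.id_comp _).symm⟩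
  let cY : 𝟙_ (Twisted C) ⟶ Y ⊗ Y' := ⟨η_ Y.obj E, hE.trans (Category.id_comp _).symm⟩
  let c : 𝟙_ (Twisted C) ⟶ (X ⊗ Y) ⊗ (Y' ⊗ X') :=
    cX ≫ (ρ_ X).inv ▷ X' ≫ (X ◁ cY) ▷ X' ≫ (α_ X Y Y').inv ▷ X' ≫ (α_ (X ⊗ Y) Y' X').hom
  have hc : c.hom = co X.obj Y.obj D E := by
    change η_ X.obj D ≫ ((ρ_ X.obj).inv ⊗ₘ 𝟙 D) ≫ ((𝟙 X.obj ⊗ₘ η_ Y.obj E) ⊗ₘ 𝟙 D) ≫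
      ((α_ X.obj Y.obj E).inv ⊗ₘ 𝟙 D) ≫ (α_ (X.obj ⊗ Y.obj) E D).hom = _
    simp only [tensorHom_id, id_tensorHom]
  have h1 : co X.obj Y.obj D E ≫ (tensor (tensor X Y) (tensor Y' X')).η.hom =
      co X.obj Y.obj D E := by
    have := c.comm
    rw [hc] at this
    exact this.trans (Category.id_comp _)
  let p : ExactPairing (X.obj ⊗ Y.obj) (E ⊗ D) := inferInstance
  have h2 : η_ (X.obj ⊗ Y.obj) (E ⊗ D) ≫ (tensor X Y).η.hom ▷ (E ⊗ D) =
      η_ (X.obj ⊗ Y.obj) (E ⊗ D) ≫ (X.obj ⊗ Y.obj) ◁ (tensor Y' X').η.hom :=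
    (congrArg (fun f => f ≫ _) (co_eq ..)).trans
      ((tensor_double hζ hξ).trans (congrArg (fun f => f ≫ _) (co_eq ..)).symm)
  refine ⟨E ⊗ D, p, (@rib_eq_iff C _ _ _ (X.obj ⊗ Y.obj) (E ⊗ D) p (tensor X Y).η
    (tensor Y' X').η h2).2 ?_⟩
  exact (congrArg (fun f => f ≫ _) (co_eq ..)).trans (h1.trans (co_eq ..).symm)

lemma rib_unit : rib C (𝟙_ _) := by
  let p : ExactPairing (𝟙_ C) (𝟙_ C) := inferInstance
  refine ⟨𝟙_ C, p, (@rib_eq_iff C _ _ _ (𝟙_ C) (𝟙_ C) p (Iso.refl _) (Iso.refl _) ?_).2 ?_⟩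
  · simp
  · simp [unitors_inv_equal]

instance : (rib C).IsMonoidal where
  prop_unit := rib_unit
  prop_tensor X Y hX hY := rib_tensor X Y hX hY

end Twisted

end

section

open TensorProduct CategoryTheory MonoidalCategory

section
variable (C : Type u) [Category.{v} C] [MonoidalCategory C] [BraidedCategory C]

/-- The category `R(C, c)` attached to a braided category `(C, c)`: pairs `(V, η_V)` of an object
and an automorphism of it, such that `η_V^{-2}` is the composite in `Twisted.rib`; a full monoidal
subcategory of `Twisted C`, braided by `c`. -/
abbrev Ribb : Type _ := (Twisted.rib C).FullSubcategory

/-- The twist `η_V` of `R(C, c)`. -/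
def Ribb.twist : Twist (Ribb C) where
  θ X := (Twisted.rib C).isoMk ((Twisted.twist C).θ X.obj)
  natural f := ObjectProperty.hom_ext _ ((Twisted.twist C).natural f.hom)
  tensor X Y := ObjectProperty.hom_ext _ ((Twisted.twist C).tensor X.obj Y.obj)

/-- The category `R_r(C)`: for the reversed category `Cᴹᵒᵖ` one takes its centre, then `R` of it,
and reverses the tensor product of the result. Its objects are objects `V` of `C` with a half
braiding `X ⊗ V ⟶ V ⊗ X` (`X` in `C`) and an automorphism. -/
abbrev RibbRight (C : Type u) [Category.{v} C] [MonoidalCategory C] : Type _ :=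
  (Ribb (Center Cᴹᵒᵖ))ᴹᵒᵖ

/-- The twist of `R_r(C)`. -/
def RibbRight.twist (C : Type u) [Category.{v} C] [MonoidalCategory C] : Twist (RibbRight C) :=
  (Ribb.twist (Center Cᴹᵒᵖ)).mop

end

section
variable {C : Type*} [Category* C] [MonoidalCategory C] [BraidedCategory C]
  {D : Type*} [Category* D] [MonoidalCategory D] [BraidedCategory D]

open Functor.LaxMonoidal Functor.OplaxMonoidal in
/-- `C` and `D`, with twists `T` and `T'`, are equivalent as ribbon categories: there is an
equivalence `F` that is a braided (strong) monoidal functor, preserves twists, `F(θ_V) = θ_{F(V)}`,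
and is compatible with duality: `F` maps left duals to left duals. -/
def RibbonEquivalent (T : Twist C) (T' : Twist D) : Prop :=
  ∃ (e : C ≌ D) (_ : e.functor.Braided),
    (∀ V : C, e.functor.map (T.θ V).hom = (T'.θ (e.functor.obj V)).hom) ∧
    ∀ (V W : C) [ExactPairing V W],
      ∃ _ : ExactPairing (e.functor.obj V) (e.functor.obj W),
        η_ (e.functor.obj V) (e.functor.obj W) =
          ε e.functor ≫ e.functor.map (η_ V W) ≫ δ e.functor V W ∧
        ε_ (e.functor.obj V) (e.functor.obj W) =
          μ e.functor W V ≫ e.functor.map (ε_ V W) ≫ η e.functor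

end

section
variable {k H : Type u} [Field k] [Ring H] [Algebra k H]

/-- A ribbon element: an invertible central `η` with `Δ(η) = (η ⊗ η) R₂₁ R` and `S(η) = η`. A
quasitriangular quasi-Hopf algebra with such an element is a ribbon quasi-Hopf algebra. -/
structure RibbonElement (Q : QTQuasiHopf k H) where
  η : Hˣ
  central : ∀ h : H, η.val * h = h * η.val
  comul : Q.Δ η.val = (η.val ⊗ₜ[k] η.val) * Q.R₂₁R
  antipode : Q.S η.val = η.val

lemma FDMod.braid_braid {Q : QTQuasiHopf k H} (X Y : FDMod Q.toQuasiBialgebra)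
    (t : X.V ⊗[k] Y.V) : ((β_ X Y).hom ≫ (β_ Y X).hom).lin t = tensorAct X.ρ Y.ρ Q.R₂₁R t := by
  rw [FDMod.comp_lin]
  refine (Tw.comm (ρ := Y.ρ) (σ := X.ρ) Q.R.val
    ((TensorProduct.comm k X.V Y.V) (tensorAct X.ρ Y.ρ Q.R.val t))).trans ?_
  unfold QTQuasiHopf.R₂₁R
  rw [map_mul, Module.End.mul_apply]
  exact congrArg _ ((TensorProduct.comm k X.V Y.V).symm_apply_apply _)

/-- The twist of the category of finite-dimensional modules given by the action of a ribbon
element. -/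
def RibbonElement.twist {Q : QTQuasiHopf k H} (v : RibbonElement Q) :
    Twist (FDMod Q.toQuasiBialgebra) where
  θ X := FDMod.isoMk (unitAct X.ρ v.η) fun h x => by
    simp only [unitAct_apply]
    rw [← Module.End.mul_apply, ← Module.End.mul_apply, ← map_mul, ← map_mul, v.central]
  natural f := FDMod.hom_ext fun x => (f.comm v.η.val x).symm
  tensor X Y := FDMod.hom_ext fun t => by
    change X.V ⊗[k] Y.V at t
    change tensorAct X.ρ Y.ρ (Q.Δ v.η.val) t = _
    rw [v.comul, map_mul, Module.End.mul_apply, ← FDMod.braid_braid, ← Category.assoc]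
    rfl

/-- `φ ⊗ id : H ⊗ T → T`. -/
def slice {T : Type u} [AddCommGroup T] [Module k T] (φ : Module.Dual k H) : H ⊗[k] T →ₗ[k] T :=
  (TensorProduct.lid k T).toLinearMap ∘ₗ φ.rTensor T

/-- `∑ e_i ⊗ f(e^i)`, for a basis `e_i` of `H` and the dual basis `e^i` of `H^*`. -/
def canon [Module.Finite k H] {T : Type u} [AddCommGroup T] [Module k T]
    (f : Module.Dual k H →ₗ[k] T) : H ⊗[k] T :=
  f.lTensor H (coevaluation k H 1)

variable (k H) in
/-- The free algebra on the vector space `H ⊕ H^*`. -/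
abbrev DoubleGen : Type u := TensorAlgebra k (H × Module.Dual k H)

/-- The generators `i(h)`. -/
abbrev genH : H →ₗ[k] DoubleGen k H := TensorAlgebra.ι k ∘ₗ LinearMap.inl k H (Module.Dual k H)

/-- The generators `d(φ)`. -/
abbrev genD : Module.Dual k H →ₗ[k] DoubleGen k H :=
  TensorAlgebra.ι k ∘ₗ LinearMap.inr k H (Module.Dual k H)

variable [Module.Finite k H]

/-- The defining relations of the quantum double; equalities in `H ⊗ D(H)` and `H ⊗ H ⊗ D(H)` are
imposed by applying all linear forms to the factors `H`. -/
inductive DoubleRel (Q : QuasiHopf k H) : DoubleGen k H → DoubleGen k H → Prop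
  | one : DoubleRel Q (genH 1) 1
  | mul (a b : H) : DoubleRel Q (genH (a * b)) (genH a * genH b)
  /-- `(ε ⊗ id)(𝐃) = 1` -/
  | counit : DoubleRel Q (genD Q.ε.toLinearMap) 1
  /-- `𝐃 (h₁ ⊗ i(h₂)) = (h₂ ⊗ i(h₁)) 𝐃` -/
  | comm (h : H) (φ : Module.Dual k H) : DoubleRel Q
      (slice φ (canon genD * genH.lTensor H (Q.Δ h)))
      (slice φ (genH.lTensor H (TensorProduct.comm k H H (Q.Δ h)) * canon genD))
  /-- `(Δ ⊗ id)(𝐃) = Φ₃₁₂ 𝐃₁₃ (Φ₁₃₂)⁻¹ 𝐃₂₃ Φ` -/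
  | hex (φ ψ : Module.Dual k H) : DoubleRel Q
      (slice ψ (slice φ (TensorProduct.assoc k H H _ (Q.Δ.toLinearMap.rTensor _ (canon genD)))))
      (slice ψ (slice φ
        ((genH.lTensor H).lTensor H (sw₂₃ k H (sw₁₂ k H Q.Φ.val)) *
          Algebra.TensorProduct.map (.id k H) Algebra.TensorProduct.includeRight (canon genD) *
          (genH.lTensor H).lTensor H (sw₂₃ k H (Q.Φ⁻¹).val) *
          (1 : H) ⊗ₜ[k] canon genD * (genH.lTensor H).lTensor H Q.Φ.val)))

/-- The quantum double `D(H)`, generated by a copy `i(H)` of `H` and the coefficients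
`d(φ) = (φ ⊗ id)(𝐃)`, `φ ∈ H^*`, of a universal element `𝐃 = ∑ e_i ⊗ d(e^i) ∈ H ⊗ D(H)`. -/
def QuantumDouble (Q : QuasiHopf k H) : Type u := RingQuot (DoubleRel Q)

namespace QuantumDouble
variable (Q : QuasiHopf k H)

instance : Ring (QuantumDouble Q) := inferInstanceAs (Ring (RingQuot (DoubleRel Q)))
instance : Algebra k (QuantumDouble Q) := inferInstanceAs (Algebra k (RingQuot (DoubleRel Q)))

/-- The quotient map. -/
def mk : DoubleGen k H →ₐ[k] QuantumDouble Q := RingQuot.mkAlgHom k (DoubleRel Q)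

/-- The algebra map `i : H → D(H)`. -/
def incl : H →ₐ[k] QuantumDouble Q :=
  AlgHom.ofLinearMap ((mk Q).toLinearMap ∘ₗ genH)
    ((RingQuot.mkAlgHom_rel k DoubleRel.one).trans (map_one _))
    fun a b => (RingQuot.mkAlgHom_rel k (DoubleRel.mul a b)).trans (map_mul _ _ _)

/-- The element `R_D = (i ⊗ id)(𝐃)`. -/
def R : QuantumDouble Q ⊗[k] QuantumDouble Q :=
  (incl Q).toLinearMap.rTensor _ (canon ((mk Q).toLinearMap ∘ₗ genD))

/-- The structure of a quasitriangular quasi-Hopf algebra on `D(H)`: the one that extends the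
structure of `H` and has `R_D` as its `R`-matrix. It is unique, the coproduct of the generators
`d(φ)` being determined by `(id ⊗ Δ)(R_D)`. -/
structure IsStructure (QD : QTQuasiHopf k (QuantumDouble Q)) : Prop where
  hom : IsQuasiHopfHom Q QD.toQuasiHopf (incl Q)
  R_eq : QD.R.val = R Q

end QuantumDouble
end

section
variable {k H : Type u} [Field k] [Ring H] [Algebra k H]

/-- The relation `θ² = u S(u)`. -/
inductive ThetaRel (Q : QTQuasiHopf k H) : Polynomial H → Polynomial H → Prop
  | sq : ThetaRel Q (Polynomial.X ^ 2) (Polynomial.C (Q.u * Q.S Q.u))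

/-- The algebra `H(θ) = H[θ] / (θ² - u S(u))`. -/
def Theta (Q : QTQuasiHopf k H) : Type u := RingQuot (ThetaRel Q)

namespace Theta
variable (Q : QTQuasiHopf k H)

instance : Ring (Theta Q) := inferInstanceAs (Ring (RingQuot (ThetaRel Q)))
instance : Algebra k (Theta Q) := inferInstanceAs (Algebra k (RingQuot (ThetaRel Q)))

/-- The algebra map `H → H(θ)`. -/
def incl : H →ₐ[k] Theta Q :=
  (RingQuot.mkAlgHom k (ThetaRel Q)).comp Polynomial.CAlgHom

/-- The element `θ`. -/
def θ : Theta Q := RingQuot.mkAlgHom k (ThetaRel Q) Polynomial.X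

/-- The structure of a ribbon quasi-Hopf algebra on `H(θ)`: it extends the structure of `H`, has
the same `R`-matrix, `Δ(θ) = (θ ⊗ θ) (R₂₁ R)⁻¹`, `ε(θ) = 1`, `S(θ) = θ`, and the ribbon element is
`θ⁻¹`. -/
structure IsStructure (Qθ : QTQuasiHopf k (Theta Q)) (v : RibbonElement Qθ) : Prop where
  hom : IsQuasiHopfHom Q.toQuasiHopf Qθ.toQuasiHopf (incl Q)
  R_eq : Qθ.R.val = Algebra.TensorProduct.map (incl Q) (incl Q) Q.R.val
  comul : Qθ.Δ (θ Q) * Qθ.R₂₁R = θ Q ⊗ₜ[k] θ Q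
  counit : Qθ.ε (θ Q) = 1
  antipode : Qθ.S (θ Q) = θ Q
  ribbon : (v.η⁻¹).val = θ Q

end Theta
end

end

end QH

end

/-!
The proof is an instance of Tannaka reconstruction: no formula for the comultiplication or the
antipode of `D(H)` or of `H(θ)` is ever needed, only the monoidal structure, the braiding and the
duals of the categories which turn out to be their categories of modules.

*The antipode.* By Fitting's lemma, and because a module is determined by its left dual, the
antipode of a finite-dimensional quasi-Hopf algebra is bijective (`QuasiHopf.S_bijective`). Hence
every module is itself a left dual (`FDMod.exists_predual`), so half braidings which are natural
and multiplicative are invertible (`IsHBRev.isIso`), and the dual of a Yetter-Drinfeld module is a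
Yetter-Drinfeld module (`YD.dual`): its half braiding is the inverse of the mate of the given one.

*The double.* The elements `i(a) d(φ) i(b)` span `D(H)`, which is therefore finite-dimensional
(`QuantumDouble.finite`). This comes down to writing `d(φ) i(a) d(ψ)` in this form
(`IsDoublePair.sandwich_mem`). The hexagon relation does it for the combinations of such products
that are described by `Φ⁻¹`, and the pentagon identity, bent with the inverse antipode, shows that
those generate all of them (`QuasiHopf.middle_mem`). By the universal property of `D(H)`, its
finite-dimensional modules are the Yetter-Drinfeld modules, the coaction being the action of `𝐃`
(`YD.toRep`, `QuantumDouble.toYD`).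

*Reconstruction.* Let `A → B` be an algebra map from a quasi-Hopf algebra. Functorial actions of
`B` on tensor products and duals of its modules, extending those of `A` and compatible with the
associator, evaluation and coevaluation of `A`, come from a quasi-Hopf structure on `B`
(`TensorData.quasiHopf`): `Δ(b) = b (1 ⊗ 1)` in the square of the regular module, and the antipode
is read off from the dual of the regular module. Applied to tensor products and duals of
Yetter-Drinfeld modules this gives the quasi-Hopf structure on `D(H)`; the braiding of the regular
module gives the remaining axioms for `R_D` (`QuantumDouble.qt`).

*Ribbon categories.* For a braided category `C` with duals, the condition on `η_V` says that the
coevaluation is invariant under the twists (`Twisted.rib_iff_coev`). So the duals of `C` are duals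
in `R(C, c)`, which is a ribbon category (`Ribb.isRibbon`), and `R` sends braided equivalences to
ribbon equivalences (`Ribb.ribbonEquivalent`). This applies to the centre and the Yetter-Drinfeld
modules (`YD.ribbonEquivalent_center`), where reversing the tensor product is harmless by the
braiding (`ribbonEquivalent_mop`), and to Yetter-Drinfeld modules and `D(H)`-modules
(`QuantumDouble.ofYD`).

*Adjoining `θ`.* The composite which defines `R(C, c)` acts on the modules over a quasitriangular
quasi-Hopf algebra by `u S(u)` (`FDMod.loop_lin`, `QTQuasiHopf.loopElt_eq`). So an object `(V,
η_V)` of `R` of the category of modules is a module over `H(θ)` on which `θ` acts by `η_V⁻¹`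
(`Theta.toRep`, `Theta.ofRep`). Reconstruction applies again and gives the ribbon quasi-Hopf
structure on `H(θ)` (`Theta.qt`, `Theta.ribbonElement`) together with the equivalence
(`Theta.ribbonEquivalent`).
-/

noncomputable section

namespace QH

open TensorProduct CategoryTheory MonoidalCategory

/-! ### The antipode is bijective -/

section Antipode

variable {k H : Type u} [Field k] [Ring H] [Algebra k H]

namespace FDMod
variable {Q : QuasiHopf k H}

/-- The restriction of a module along an algebra endomorphism. -/
abbrev restr (f : H →ₐ[k] H) (X : FDMod Q.toQuasiBialgebra) : FDMod Q.toQuasiBialgebra :=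
  ⟨X.V, X.ρ.comp f⟩

/-- An object is determined by its left dual. -/
lemma nonempty_iso_of_dual_iso {X Y : FDMod Q.toQuasiBialgebra} (i : dual X ≅ dual Y) :
    Nonempty (X ≅ Y) := by
  let p : ExactPairing X (dual X) := inferInstance
  let q : ExactPairing Y (dual X) := exactPairingCongrRight i
  exact ⟨leftDualIso p q⟩

end FDMod

namespace QuasiHopf
variable (Q : QuasiHopf k H)

/-- The square of the antipode, as an algebra map. -/
def SS : H →ₐ[k] H :=
  AlgHom.ofLinearMap (Q.S ∘ₗ Q.S) (by simp [Q.S_one]) (by intro a b; simp [Q.S_mul])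

lemma SS_apply (h : H) : Q.SS h = Q.S (Q.S h) := rfl

variable {Q}

/-- The bidual of a module is its restriction along `S²`. -/
def bidualIso (X : FDMod Q.toQuasiBialgebra) : FDMod.restr Q.SS X ≅ FDMod.dual (FDMod.dual X) :=
  FDMod.isoMk (Module.evalEquiv k X.V) (by
    intro h v
    refine LinearMap.ext fun φ => ?_
    rfl)

lemma nonempty_iso_of_restr (n : ℕ) : ∀ {X Y : FDMod Q.toQuasiBialgebra},
    (FDMod.restr (Q.SS ^ n) X ≅ FDMod.restr (Q.SS ^ n) Y) → Nonempty (X ≅ Y) := by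
  induction n with
  | zero => intro X Y e; exact ⟨e⟩
  | succ n ih =>
    intro X Y e
    have e' : FDMod.restr Q.SS (FDMod.restr (Q.SS ^ n) X) ≅
        FDMod.restr Q.SS (FDMod.restr (Q.SS ^ n) Y) := by
      have : ∀ X : FDMod Q.toQuasiBialgebra, FDMod.restr (Q.SS ^ (n + 1)) X =
          FDMod.restr Q.SS (FDMod.restr (Q.SS ^ n) X) := fun X => by rw [pow_succ]; rfl
      rw [← this, ← this]; exact e
    obtain ⟨i⟩ := FDMod.nonempty_iso_of_dual_iso
      ((bidualIso _).symm ≪≫ e' ≪≫ bidualIso _)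
    obtain ⟨j⟩ := FDMod.nonempty_iso_of_dual_iso i
    exact ih j

variable (Q)

/-- The antipode of a finite-dimensional quasi-Hopf algebra is bijective: by Fitting's lemma there
is an algebra endomorphism `r` with `S²ⁿ r = S²ⁿ` that kills the kernel of `S²ⁿ`; the regular module
and its restriction along `r` have the same iterated dual, hence are isomorphic, so `r` is
injective. -/
theorem S_bijective [Module.Finite k H] : Function.Bijective Q.S := by
  have hpow : ∀ n, (Q.SS ^ n).toLinearMap = Q.SS.toLinearMap ^ n := fun n => by
    induction n with
    | zero => rfl
    | succ n ih => rw [pow_succ, pow_succ, ← ih]; rfl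
  -- Fitting: `H` is the direct sum of the kernel and the range of `f = S²ⁿ`
  obtain ⟨n, hn, hn1⟩ := (Q.SS.toLinearMap.eventually_isCompl_ker_pow_range_pow.and
    (Filter.eventually_ge_atTop 1)).exists
  rw [← hpow] at hn
  set f := Q.SS ^ n with hf
  let g : f.range →ₐ[k] f.range := f.rangeRestrict.comp f.range.val
  have ginj : Function.Injective g := by
    rw [injective_iff_map_eq_zero]
    intro x hx
    have hx' : f x.1 = 0 := congrArg Subtype.val hx
    have := (Submodule.disjoint_def.1 hn.disjoint) x.1 hx' x.2
    exact Subtype.ext this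
  have gbij : Function.Bijective g :=
    ⟨ginj, (LinearMap.injective_iff_surjective (f := g.toLinearMap)).1 ginj⟩
  let e := AlgEquiv.ofBijective g gbij
  -- `r` is `f`, followed by the inverse of `f` on the range of `f`
  let r : H →ₐ[k] H := f.range.val.comp (e.symm.toAlgHom.comp f.rangeRestrict)
  have hr : r.comp f = f := by
    ext x
    have : f.rangeRestrict (f x) = e (f.rangeRestrict x) := rfl
    change (e.symm (f.rangeRestrict (f x))).1 = f x
    rw [this, AlgEquiv.symm_apply_apply]; rfl
  let X : FDMod Q.toQuasiBialgebra := YD.reg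
  have key : FDMod.restr f (FDMod.restr r X) = FDMod.restr f X := by
    change (⟨H, ((Algebra.lmul k H).comp r).comp f⟩ : FDMod Q.toQuasiBialgebra) = _
    rw [AlgHom.comp_assoc, hr]
  -- restriction along `f` is the `2n`-fold dual, and an object is determined by its dual
  obtain ⟨i⟩ := nonempty_iso_of_restr n (eqToIso key)
  have rinj : ∀ h, r h = 0 → h = 0 := fun h hh => by
    have h1 : i.inv.lin (h * 1) = r h * i.inv.lin 1 := i.inv.comm h (1 : H)
    rw [hh, zero_mul, mul_one] at h1
    have h2 : i.hom.lin (i.inv.lin h) = h := FDMod.Tw.iso i.inv i.hom i.inv_hom_id h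
    rw [← h2, h1, map_zero]
  have finj : ∀ h, f h = 0 → h = 0 := fun h hh => rinj h (by
    have : f.rangeRestrict h = 0 := Subtype.ext hh
    change (e.symm (f.rangeRestrict h)).1 = 0
    rw [this, map_zero]; rfl)
  have Sinj : Function.Injective Q.S := by
    rw [← LinearMap.ker_eq_bot, LinearMap.ker_eq_bot']
    intro h hh
    obtain ⟨m, rfl⟩ := Nat.exists_eq_add_of_le hn1
    refine finj h ?_
    have : Q.SS h = 0 := by rw [SS_apply, hh, map_zero]
    change (Q.SS ^ (1 + m)) h = 0
    rw [add_comm, pow_succ]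
    change (Q.SS ^ m) (Q.SS h) = 0
    rw [this, map_zero]
  exact ⟨Sinj, LinearMap.injective_iff_surjective.1 Sinj⟩

/-- The inverse of the antipode. -/
def Sinv [Module.Finite k H] : H →ₗ[k] H :=
  (LinearEquiv.ofBijective Q.S Q.S_bijective).symm.toLinearMap

section
variable [Module.Finite k H]

@[simp] lemma S_Sinv (h : H) : Q.S (Q.Sinv h) = h :=
  (LinearEquiv.ofBijective Q.S Q.S_bijective).apply_symm_apply h

@[simp] lemma Sinv_S (h : H) : Q.Sinv (Q.S h) = h :=
  (LinearEquiv.ofBijective Q.S Q.S_bijective).symm_apply_apply h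

lemma Sinv_one : Q.Sinv 1 = 1 := Q.S_bijective.1 (by rw [S_Sinv, Q.S_one])

lemma Sinv_mul (a b : H) : Q.Sinv (a * b) = Q.Sinv b * Q.Sinv a :=
  Q.S_bijective.1 (by simp [Q.S_mul])

end

end QuasiHopf

/-- As the antipode is bijective, every module is a left dual: of the linear dual on which `H` acts
through the inverse of the antipode. -/
lemma FDMod.exists_predual [Module.Finite k H] {Q : QuasiHopf k H} (X : FDMod Q.toQuasiBialgebra) :
    ∃ Y : FDMod Q.toQuasiBialgebra, Nonempty (ExactPairing Y X) := by
  let Y : FDMod Q.toQuasiBialgebra := ⟨Module.Dual k X.V,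
    AlgHom.ofLinearMap (Module.Dual.transpose (R := k) ∘ₗ X.ρ.toLinearMap ∘ₗ Q.Sinv)
    (by ext; simp [Q.Sinv_one, Module.Dual.transpose_apply])
    (fun a b => by ext; simp [Q.Sinv_mul, Module.Dual.transpose_apply])⟩
  let i : X ≅ FDMod.dual Y := FDMod.isoMk (Module.evalEquiv k X.V) (by
    intro h v
    refine LinearMap.ext fun φ => ?_
    change φ (X.ρ h v) = φ (X.ρ (Q.Sinv (Q.S h)) v)
    rw [Q.Sinv_S])
  have key : ∀ Y : FDMod Q.toQuasiBialgebra, (X ≅ FDMod.dual Y) → Nonempty (ExactPairing Y X) :=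
    fun Y i => ⟨exactPairingCongrRight i⟩
  exact ⟨Y, key Y i⟩

end Antipode

/-! ### The universal property of the quantum double -/

section DoubleUniversal

variable {k H : Type u} [Field k] [Ring H] [Algebra k H]

@[simp] lemma slice_tmul {T : Type u} [AddCommGroup T] [Module k T] (φ : Module.Dual k H)
    (h : H) (t : T) : slice φ (h ⊗ₜ t) = φ h • t := by simp [slice]

lemma slice_lTensor {T T' : Type u} [AddCommGroup T] [Module k T] [AddCommGroup T'] [Module k T']
    (f : T →ₗ[k] T') (φ : Module.Dual k H) (s : H ⊗[k] T) :
    slice φ (f.lTensor H s) = f (slice φ s) := by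
  induction s with
  | zero => simp
  | add x y hx hy => simp only [map_add, hx, hy]
  | tmul h t => simp

lemma map_lTensor_incl {T T' : Type u} [Ring T] [Algebra k T] [Ring T'] [Algebra k T']
    (f : T →ₐ[k] T') (s : H ⊗[k] T) :
    f.toLinearMap.lTensor H s = Algebra.TensorProduct.map (.id k H) f s := rfl

/-- Linear forms on the first factor separate the elements of `H ⊗ T`. -/
lemma slice_ext {T : Type u} [AddCommGroup T] [Module k T] [Module.Finite k H] {s t : H ⊗[k] T}
    (h : ∀ φ, slice φ s = slice φ t) : s = t := by
  let b := Module.finBasis k H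
  have key : ∀ s : H ⊗[k] T, s = ∑ i, b i ⊗ₜ slice (b.coord i) s := fun s => by
    induction s with
    | zero => simp
    | add x y hx hy =>
      conv_lhs => rw [hx, hy]
      simp only [map_add, tmul_add, Finset.sum_add_distrib]
    | tmul a t =>
      simp only [slice_tmul, ← smul_tmul, ← sum_tmul]
      congr 1
      exact (b.sum_repr a).symm
  rw [key s, key t]
  simp only [h]

section
variable [Module.Finite k H]

lemma canon_comp {T T' : Type u} [AddCommGroup T] [Module k T] [AddCommGroup T'] [Module k T']
    (f : T →ₗ[k] T') (d : Module.Dual k H →ₗ[k] T) : canon (f ∘ₗ d) = f.lTensor H (canon d) := by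
  simp [canon, LinearMap.lTensor_comp]

lemma canon_eq_sum {T : Type u} [AddCommGroup T] [Module k T] (d : Module.Dual k H →ₗ[k] T) :
    canon d = ∑ i, Module.Basis.ofVectorSpace k H i ⊗ₜ[k]
      d ((Module.Basis.ofVectorSpace k H).coord i) := by
  simp [canon, coevaluation_apply_one, map_sum]

/-- `(φ ⊗ id)(∑ e_i ⊗ d(e^i)) = d(φ)`. -/
@[simp] lemma slice_canon {T : Type u} [AddCommGroup T] [Module k T] (d : Module.Dual k H →ₗ[k] T)
    (φ : Module.Dual k H) : slice φ (canon d) = d φ := by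
  rw [canon_eq_sum, map_sum]
  simp only [slice_tmul, ← map_smul, ← map_sum]
  congr 1
  generalize Module.Basis.ofVectorSpace k H = b
  refine b.ext fun j => ?_
  simp

/-- A pair `(i, d)` of maps to an algebra `T` that satisfies the defining relations of the quantum
double; these are the data of an algebra map `D(H) → T`. -/
structure IsDoublePair (Q : QuasiHopf k H) {T : Type u} [Ring T] [Algebra k T] (i : H →ₐ[k] T)
    (d : Module.Dual k H →ₗ[k] T) : Prop where
  counit : d Q.ε.toLinearMap = 1
  comm : ∀ h : H, canon d * i.toLinearMap.lTensor H (Q.Δ h) =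
    i.toLinearMap.lTensor H (TensorProduct.comm k H H (Q.Δ h)) * canon d
  hex : TensorProduct.assoc k H H _ (Q.Δ.toLinearMap.rTensor _ (canon d)) =
    (i.toLinearMap.lTensor H).lTensor H (sw₂₃ k H (sw₁₂ k H Q.Φ.val)) *
      Algebra.TensorProduct.map (.id k H) Algebra.TensorProduct.includeRight (canon d) *
      (i.toLinearMap.lTensor H).lTensor H (sw₂₃ k H (Q.Φ⁻¹).val) *
      (1 : H) ⊗ₜ[k] canon d * (i.toLinearMap.lTensor H).lTensor H Q.Φ.val

section transport
variable {T T' : Type u} [Ring T] [Algebra k T] [Ring T'] [Algebra k T'] (f : T →ₐ[k] T')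
  (Q : QuasiHopf k H) (i : H →ₗ[k] T) (d : Module.Dual k H →ₗ[k] T)

lemma slice_comm_left (h : H) (φ : Module.Dual k H) :
    f (slice φ (canon d * i.lTensor H (Q.Δ h))) =
      slice φ (canon (f.toLinearMap ∘ₗ d) * (f.toLinearMap ∘ₗ i).lTensor H (Q.Δ h)) := by
  refine (slice_lTensor f.toLinearMap φ _).symm.trans ?_
  rw [map_lTensor_incl, map_mul, canon_comp, LinearMap.lTensor_comp]
  rfl

lemma slice_comm_right (h : H) (φ : Module.Dual k H) :
    f (slice φ (i.lTensor H (TensorProduct.comm k H H (Q.Δ h)) * canon d)) =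
      slice φ ((f.toLinearMap ∘ₗ i).lTensor H (TensorProduct.comm k H H (Q.Δ h)) *
        canon (f.toLinearMap ∘ₗ d)) := by
  refine (slice_lTensor f.toLinearMap φ _).symm.trans ?_
  rw [map_lTensor_incl, map_mul, canon_comp, LinearMap.lTensor_comp]
  rfl

lemma slice_hex_left (φ ψ : Module.Dual k H) :
    f (slice ψ (slice φ (TensorProduct.assoc k H H _ (Q.Δ.toLinearMap.rTensor _ (canon d))))) =
      slice ψ (slice φ (TensorProduct.assoc k H H _
        (Q.Δ.toLinearMap.rTensor _ (canon (f.toLinearMap ∘ₗ d))))) := by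
  refine (slice_lTensor f.toLinearMap ψ _).symm.trans ?_
  rw [← slice_lTensor, canon_comp]
  congr 2
  generalize canon d = s
  induction s with
  | zero => simp
  | add x y hx hy => simp only [map_add, hx, hy]
  | tmul a t =>
    simp only [LinearMap.rTensor_tmul, LinearMap.lTensor_tmul]
    generalize Q.Δ.toLinearMap a = s
    induction s with
    | zero => simp
    | add x y hx hy => simp only [map_add, add_tmul, hx, hy]
    | tmul a b => simp

lemma slice_hex_right (φ ψ : Module.Dual k H) (p q r : H ⊗[k] (H ⊗[k] H)) :
    f (slice ψ (slice φ ((i.lTensor H).lTensor H p *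
          Algebra.TensorProduct.map (.id k H) Algebra.TensorProduct.includeRight (canon d) *
          (i.lTensor H).lTensor H q *
          (1 : H) ⊗ₜ[k] canon d * (i.lTensor H).lTensor H r))) =
      slice ψ (slice φ (((f.toLinearMap ∘ₗ i).lTensor H).lTensor H p *
          Algebra.TensorProduct.map (.id k H) Algebra.TensorProduct.includeRight
            (canon (f.toLinearMap ∘ₗ d)) *
          ((f.toLinearMap ∘ₗ i).lTensor H).lTensor H q *
          (1 : H) ⊗ₜ[k] canon (f.toLinearMap ∘ₗ d) *
          ((f.toLinearMap ∘ₗ i).lTensor H).lTensor H r)) := by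
  refine (slice_lTensor f.toLinearMap ψ _).symm.trans ?_
  rw [← slice_lTensor, canon_comp]
  congr 2
  have e1 : ∀ s : H ⊗[k] (H ⊗[k] T), (f.toLinearMap.lTensor H).lTensor H s =
    Algebra.TensorProduct.map (.id k H) (Algebra.TensorProduct.map (.id k H) f) s := fun _ => rfl
  have e2 : ∀ s : H ⊗[k] T, Algebra.TensorProduct.map (.id k H)
      (Algebra.TensorProduct.map (.id k H) f)
      (Algebra.TensorProduct.map (.id k H) Algebra.TensorProduct.includeRight s) =
      Algebra.TensorProduct.map (.id k H) Algebra.TensorProduct.includeRight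
        (f.toLinearMap.lTensor H s) := fun s => by
    induction s with
    | zero => simp
    | add x y hx hy => simp only [map_add, hx, hy]
    | tmul a t => simp
  rw [e1]
  simp only [map_mul, e2, LinearMap.lTensor_comp]
  simp only [← e1, LinearMap.lTensor_tmul, LinearMap.comp_apply]

end transport

namespace QuantumDouble
variable (Q : QuasiHopf k H)

/-- The generators `d(φ)` of the quantum double. -/
def gen : Module.Dual k H →ₗ[k] QuantumDouble Q := (mk Q).toLinearMap ∘ₗ genD

lemma isDoublePair : IsDoublePair Q (incl Q) (gen Q) where
  counit := (RingQuot.mkAlgHom_rel k DoubleRel.counit).trans (map_one _)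
  comm h := slice_ext fun φ => by
    have := RingQuot.mkAlgHom_rel k (DoubleRel.comm (Q := Q) h φ)
    exact (slice_comm_left (mk Q) Q genH genD h φ).symm.trans
      (this.trans (slice_comm_right (mk Q) Q genH genD h φ))
  hex := slice_ext fun φ => slice_ext fun ψ => by
    have := RingQuot.mkAlgHom_rel k (DoubleRel.hex (Q := Q) φ ψ)
    exact (slice_hex_left (mk Q) Q genD φ ψ).symm.trans
      (this.trans (slice_hex_right (mk Q) genH genD φ ψ _ _ _))

variable {Q} in
/-- The algebra map `D(H) → T` given by a pair that satisfies the relations. -/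
def lift {T : Type u} [Ring T] [Algebra k T] {i : H →ₐ[k] T} {d : Module.Dual k H →ₗ[k] T}
    (h : IsDoublePair Q i d) : QuantumDouble Q →ₐ[k] T :=
  RingQuot.liftAlgHom k ⟨TensorAlgebra.lift k (i.toLinearMap.coprod d), by
    set f := TensorAlgebra.lift k (i.toLinearMap.coprod d) with hf
    have e1 : f.toLinearMap ∘ₗ genH = i.toLinearMap := by ext a; simp [hf]
    have e2 : f.toLinearMap ∘ₗ genD = d := by ext a; simp [hf]
    have e1' : ∀ a, f (genH a) = i a := fun a => congrArg (fun g => g a) e1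
    have e2' : ∀ a, f (genD a) = d a := fun a => congrArg (fun g => g a) e2
    intro x y hxy
    cases hxy with
    | one => rw [e1', map_one, map_one]
    | mul a b =>
      exact (e1' _).trans ((map_mul i a b).trans
        ((map_mul f _ _).trans (congrArg₂ _ (e1' a) (e1' b))).symm)
    | counit => rw [e2', h.counit, map_one]
    | comm a φ =>
      rw [slice_comm_left, slice_comm_right, e1, e2, h.comm]
    | hex φ ψ =>
      rw [slice_hex_left, slice_hex_right, e1, e2, h.hex]⟩

variable {Q}

lemma lift_incl {T : Type u} [Ring T] [Algebra k T] {i : H →ₐ[k] T}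
    {d : Module.Dual k H →ₗ[k] T} (h : IsDoublePair Q i d) (a : H) : lift h (incl Q a) = i a := by
  refine (RingQuot.liftAlgHom_mkAlgHom_apply k _ _ _).trans ?_
  simp

lemma lift_gen {T : Type u} [Ring T] [Algebra k T] {i : H →ₐ[k] T}
    {d : Module.Dual k H →ₗ[k] T} (h : IsDoublePair Q i d) (φ) : lift h (gen Q φ) = d φ := by
  refine (RingQuot.liftAlgHom_mkAlgHom_apply k _ _ _).trans ?_
  simp

/-- Induction on the elements of the quantum double. -/
lemma induction {P : QuantumDouble Q → Prop} (hone : P 1)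
    (hadd : ∀ a b, P a → P b → P (a + b)) (hsmul : ∀ (c : k) a, P a → P (c • a))
    (hincl : ∀ h a, P a → P (incl Q h * a)) (hgen : ∀ φ a, P a → P (gen Q φ * a))
    (a : QuantumDouble Q) : P a := by
  obtain ⟨t, rfl⟩ := RingQuot.mkAlgHom_surjective k (DoubleRel Q) a
  have key : ∀ b, P b → P (mk Q t * b) := by
    induction t using TensorAlgebra.induction with
    | algebraMap r =>
      intro b hb
      rw [AlgHom.commutes, ← Algebra.smul_def]; exact hsmul _ _ hb
    | ι x =>
      intro b hb
      have : TensorAlgebra.ι k x = genH x.1 + genD x.2 := by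
        simp [← map_add]
      rw [this, map_add, add_mul]
      exact hadd _ _ (hincl x.1 b hb) (hgen x.2 b hb)
    | mul x y hx hy => intro b hb; rw [map_mul, mul_assoc]; exact hx _ (hy _ hb)
    | add x y hx hy => intro b hb; rw [map_add, add_mul]; exact hadd _ _ (hx _ hb) (hy _ hb)
  have := key 1 hone
  rwa [mul_one] at this

end QuantumDouble
end

end DoubleUniversal

/-! ### The pentagon, bent by the antipode -/

section Generation

variable {k H : Type u} [Field k] [Ring H] [Algebra k H]

instance : Ring (H ⊗[k] (H ⊗[k] (H ⊗[k] H))) := inferInstance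
instance : NonUnitalNonAssocSemiring (H ⊗[k] (H ⊗[k] (H ⊗[k] H))) := inferInstance
instance : NonAssocSemiring (H ⊗[k] (H ⊗[k] (H ⊗[k] H))) := inferInstance
instance : Semiring (H ⊗[k] (H ⊗[k] (H ⊗[k] H))) := inferInstance

lemma ind₄ {P : H ⊗[k] (H ⊗[k] (H ⊗[k] H)) → Prop} (h0 : P 0)
    (ha : ∀ x y, P x → P y → P (x + y)) (ht : ∀ a b c d, P (a ⊗ₜ (b ⊗ₜ (c ⊗ₜ d))))
    (s : H ⊗[k] (H ⊗[k] (H ⊗[k] H))) : P s := by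
  induction s with
  | zero => exact h0
  | add x y hx hy => exact ha _ _ hx hy
  | tmul a s =>
    induction s using FDMod.ind₃ with
    | h0 => rwa [tmul_zero]
    | ha x y hx hy => rw [tmul_add]; exact ha _ _ hx hy
    | ht b c d => exact ht a b c d

lemma map_mul_map_inv {A B : Type u} [Ring A] [Algebra k A] [Ring B] [Algebra k B] (f : A →ₐ[k] B)
    (u : Aˣ) : f u.val * f (u⁻¹).val = 1 := by rw [← map_mul, Units.mul_inv, map_one]

lemma map_inv_mul_map {A B : Type u} [Ring A] [Algebra k A] [Ring B] [Algebra k B] (f : A →ₐ[k] B)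
    (u : Aˣ) : f (u⁻¹).val * f u.val = 1 := by rw [← map_mul, Units.inv_mul, map_one]

namespace QuasiBialgebra
variable (Q : QuasiBialgebra k H)

/-- The map `Δ ⊗ id` with values in the tensor product bracketed to the right. -/
abbrev Δl (B : Type u) [Ring B] [Algebra k B] : H ⊗[k] B →ₐ[k] H ⊗[k] (H ⊗[k] B) :=
  (Algebra.TensorProduct.assoc k k k H H B).toAlgHom.comp (Algebra.TensorProduct.map Q.Δ (.id k B))

lemma Δl_tmul (B : Type u) [Ring B] [Algebra k B] (h : H) (b : B) :
    Q.Δl B (h ⊗ₜ b) = Algebra.TensorProduct.assoc k k k H H B (Q.Δ h ⊗ₜ b) := rfl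

/-- `(id ⊗ id ⊗ ε)(Φ) = 1`. -/
lemma counit_reassoc_right [Module.Finite k H] :
    Algebra.TensorProduct.map (.id k H) ((Algebra.TensorProduct.rid k k H).toAlgHom.comp
      (Algebra.TensorProduct.map (.id k H) Q.ε)) Q.Φ.val = 1 := by
  let X : FDMod Q := ⟨H, Algebra.lmul k H⟩
  have h := congrArg (fun f => f.lin (((1 : H) ⊗ₜ[k] (1 : H)) ⊗ₜ[k] (1 : k)))
    (rightUnitor_tensor_hom X X)
  have h1 : ∀ t : H ⊗[k] (H ⊗[k] H), (X ◁ (ρ_ X).hom).lin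
      (FDMod.act₃ X X (𝟙_ _) t ((1 : H) ⊗ₜ[k] ((1 : H) ⊗ₜ[k] (1 : k)))) =
      Algebra.TensorProduct.map (.id k H) ((Algebra.TensorProduct.rid k k H).toAlgHom.comp
        (Algebra.TensorProduct.map (.id k H) Q.ε)) t := fun t => by
    induction t using FDMod.ind₃ with
    | h0 => simp
    | ha x y hx hy => simp only [map_add, LinearMap.add_apply, hx, hy]
    | ht a b c =>
      change (a * 1) ⊗ₜ[k] ((Q.ε c * 1) • (b * 1)) = a ⊗ₜ[k] _
      simp
  refine (h1 _).symm.trans (h.symm.trans ?_)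
  change ((1 : k) • ((1 : H) ⊗ₜ[k] (1 : H))) = 1
  rw [one_smul]; rfl

/-- `(id ⊗ ε ⊗ id)(Φ⁻¹) = 1`. -/
lemma counit_reassoc_inv : Algebra.TensorProduct.map (.id k H)
      ((Algebra.TensorProduct.lid k H).toAlgHom.comp
        (Algebra.TensorProduct.map Q.ε (.id k H))) (Q.Φ⁻¹).val = 1 := by
  set f := Algebra.TensorProduct.map (.id k H)
      ((Algebra.TensorProduct.lid k H).toAlgHom.comp
        (Algebra.TensorProduct.map Q.ε (.id k H)))
  have h : f Q.Φ.val * f (Q.Φ⁻¹).val = 1 := map_mul_map_inv _ _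
  rwa [show f Q.Φ.val = 1 from Q.counit_reassoc, one_mul] at h

/-- `(id ⊗ id ⊗ ε)(Φ⁻¹) = 1`. -/
lemma counit_reassoc_right_inv [Module.Finite k H] :
    Algebra.TensorProduct.map (.id k H) ((Algebra.TensorProduct.rid k k H).toAlgHom.comp
      (Algebra.TensorProduct.map (.id k H) Q.ε)) (Q.Φ⁻¹).val = 1 := by
  set f := Algebra.TensorProduct.map (.id k H) ((Algebra.TensorProduct.rid k k H).toAlgHom.comp
      (Algebra.TensorProduct.map (.id k H) Q.ε))
  have h : f Q.Φ.val * f (Q.Φ⁻¹).val = 1 := map_mul_map_inv _ _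
  rwa [show f Q.Φ.val = 1 from Q.counit_reassoc_right, one_mul] at h

/-- `t ⊗ 1`. -/
abbrev leg₁₂₃ : H ⊗[k] (H ⊗[k] H) →ₐ[k] H ⊗[k] (H ⊗[k] (H ⊗[k] H)) :=
  Algebra.TensorProduct.map (.id k H)
    (Algebra.TensorProduct.map (.id k H) Algebra.TensorProduct.includeLeft)

/-- The pentagon relation, solved for `(Δ ⊗ id ⊗ id)(Φ) (Φ⁻¹ ⊗ 1)`. -/
lemma pentagon_left : Q.Δl (H ⊗[k] H) Q.Φ.val * leg₁₂₃ (Q.Φ⁻¹).val =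
    Algebra.TensorProduct.map (.id k H) (Algebra.TensorProduct.map (.id k H) Q.Δ) (Q.Φ⁻¹).val *
      ((1 : H) ⊗ₜ[k] Q.Φ.val *
        Algebra.TensorProduct.map (.id k H) (Q.Δl H) Q.Φ.val) := by
  set f := Algebra.TensorProduct.map (.id k H) (Algebra.TensorProduct.map (.id k H) Q.Δ)
  have h : f (Q.Φ⁻¹).val * f Q.Φ.val = 1 := map_inv_mul_map _ _
  have h' : leg₁₂₃ Q.Φ.val * leg₁₂₃ (Q.Φ⁻¹).val = 1 := map_mul_map_inv _ _
  calc _ = f (Q.Φ⁻¹).val * (f Q.Φ.val * Q.Δl (H ⊗[k] H) Q.Φ.val) * leg₁₂₃ (Q.Φ⁻¹).val := by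
        rw [← mul_assoc (f _) (f _), h, one_mul]
    _ = f (Q.Φ⁻¹).val * ((1 : H) ⊗ₜ[k] Q.Φ.val *
        Algebra.TensorProduct.map (.id k H) (Q.Δl H) Q.Φ.val) *
        (leg₁₂₃ Q.Φ.val * leg₁₂₃ (Q.Φ⁻¹).val) := by
        rw [show f Q.Φ.val * Q.Δl (H ⊗[k] H) Q.Φ.val = _ from Q.cocycle.symm]
        simp only [mul_assoc]
    _ = _ := by rw [h', mul_one]

/-- The pentagon relation, solved for `(Φ ⊗ 1) (Δ ⊗ id ⊗ id)(Φ⁻¹)`. -/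
lemma pentagon_right : leg₁₂₃ Q.Φ.val * Q.Δl (H ⊗[k] H) (Q.Φ⁻¹).val =
    Algebra.TensorProduct.map (.id k H) (Q.Δl H) (Q.Φ⁻¹).val * ((1 : H) ⊗ₜ[k] (Q.Φ⁻¹).val) *
      Algebra.TensorProduct.map (.id k H) (Algebra.TensorProduct.map (.id k H) Q.Δ) Q.Φ.val := by
  set f := Algebra.TensorProduct.map (.id k H) (Algebra.TensorProduct.map (.id k H) Q.Δ)
  set g := Algebra.TensorProduct.map (.id k H) (Q.Δl H)
  have hg : g (Q.Φ⁻¹).val * g Q.Φ.val = 1 := map_inv_mul_map _ _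
  have h1 : ((1 : H) ⊗ₜ[k] (Q.Φ⁻¹).val) * ((1 : H) ⊗ₜ[k] Q.Φ.val) = 1 := by simp; rfl
  have hd : Q.Δl (H ⊗[k] H) Q.Φ.val * Q.Δl (H ⊗[k] H) (Q.Φ⁻¹).val = 1 := map_mul_map_inv _ _
  have hc : ((1 : H) ⊗ₜ[k] Q.Φ.val) * g Q.Φ.val * leg₁₂₃ Q.Φ.val =
    f Q.Φ.val * Q.Δl (H ⊗[k] H) Q.Φ.val := Q.cocycle
  calc _ = g (Q.Φ⁻¹).val * (((1 : H) ⊗ₜ[k] (Q.Φ⁻¹).val) * ((1 : H) ⊗ₜ[k] Q.Φ.val)) * g Q.Φ.val *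
        leg₁₂₃ Q.Φ.val * Q.Δl (H ⊗[k] H) (Q.Φ⁻¹).val := by rw [h1, mul_one, hg, one_mul]
    _ = g (Q.Φ⁻¹).val * ((1 : H) ⊗ₜ[k] (Q.Φ⁻¹).val) * (((1 : H) ⊗ₜ[k] Q.Φ.val) * g Q.Φ.val *
        leg₁₂₃ Q.Φ.val) * Q.Δl (H ⊗[k] H) (Q.Φ⁻¹).val := by simp only [mul_assoc]
    _ = g (Q.Φ⁻¹).val * ((1 : H) ⊗ₜ[k] (Q.Φ⁻¹).val) * f Q.Φ.val *
        (Q.Δl (H ⊗[k] H) Q.Φ.val * Q.Δl (H ⊗[k] H) (Q.Φ⁻¹).val) := by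
        rw [hc]; simp only [mul_assoc]
    _ = _ := by rw [hd, mul_one]

end QuasiBialgebra

namespace QuasiHopf
variable (Q : QuasiHopf k H)

/-- `c ⊗ d ↦ c β S(d)`. -/
def cup : H ⊗[k] H →ₗ[k] H :=
  LinearMap.mul' k H ∘ₗ TensorProduct.map (LinearMap.mulRight k Q.β) Q.S

@[simp] lemma cup_tmul (c d : H) : Q.cup (c ⊗ₜ d) = c * Q.β * Q.S d := rfl

lemma cup_mul (t : H ⊗[k] H) (c d : H) : Q.cup (c ⊗ₜ d * t) = c * Q.cup t * Q.S d := by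
  induction t with
  | zero => simp
  | add x y hx hy => simp only [add_mul, map_add, hx, hy, mul_add]
  | tmul a b => simp [Q.S_mul, mul_assoc]

lemma cup_mul_Δ (h : H) (t : H ⊗[k] H) : Q.cup (t * Q.Δ h) = Q.ε h • Q.cup t := by
  induction t with
  | zero => simp
  | add x y hx hy => simp only [add_mul, map_add, hx, hy, smul_add]
  | tmul c d =>
    rw [cup_mul, show Q.cup (Q.Δ h) = _ from Q.antipode_right h]
    simp

/-- `cup` in the last two of four factors. -/
abbrev cup₄ : H ⊗[k] (H ⊗[k] (H ⊗[k] H)) →ₗ[k] H ⊗[k] (H ⊗[k] H) := (Q.cup.lTensor H).lTensor H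

lemma cup₄_mul_Δ (x : H ⊗[k] (H ⊗[k] H)) (w) : Q.cup₄ (w * Algebra.TensorProduct.map (.id k H)
      (Algebra.TensorProduct.map (.id k H) Q.Δ) x) =
    Q.cup₄ w * leg₁₂ (Algebra.TensorProduct.map (.id k H)
      ((Algebra.TensorProduct.rid k k H).toAlgHom.comp
        (Algebra.TensorProduct.map (.id k H) Q.ε)) x) := by
  induction x using FDMod.ind₃ with
  | h0 => simp
  | ha x y hx hy => simp only [map_add, mul_add, hx, hy]
  | ht a b c =>
    induction w using ind₄ with
    | h0 => simp
    | ha x y hx hy => simp only [map_add, add_mul, hx, hy]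
    | ht p q r s =>
      simp only [Algebra.TensorProduct.map_tmul, Algebra.TensorProduct.tmul_mul_tmul,
        LinearMap.lTensor_tmul, cup_mul_Δ, AlgHom.coe_id, id_eq, AlgHom.comp_apply]
      simp [tmul_smul]

lemma cup₄_leg_mul (x : H ⊗[k] (H ⊗[k] H)) (w) : Q.cup₄ (QuasiBialgebra.leg₁₂₃ x * w) =
    x * Q.cup₄ w := by
  induction x using FDMod.ind₃ with
  | h0 => simp
  | ha x y hx hy => simp only [map_add, add_mul, hx, hy]
  | ht a b c =>
    induction w using ind₄ with
    | h0 => simp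
    | ha x y hx hy => simp only [map_add, mul_add, hx, hy]
    | ht p q r s => simp [mul_assoc]

lemma cup₄_Δl (t : H ⊗[k] (H ⊗[k] H)) : Q.cup₄ (Q.Δl (H ⊗[k] H) t) =
    Q.Δl H (Q.cup.lTensor H t) := by
  induction t with
  | zero => simp
  | add x y hx hy => simp only [map_add, hx, hy]
  | tmul a w =>
    rw [LinearMap.lTensor_tmul, QuasiBialgebra.Δl_tmul, QuasiBialgebra.Δl_tmul]
    generalize Q.Δ a = s
    induction s with
    | zero => simp
    | add x y hx hy => simp only [map_add, add_tmul, hx, hy]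
    | tmul a b => simp

variable [Module.Finite k H]

/-- `c ⊗ d ↦ S⁻¹(α d) c`. -/
def cap : H ⊗[k] H →ₗ[k] H :=
  LinearMap.mul' k H ∘ₗ TensorProduct.map (Q.Sinv ∘ₗ LinearMap.mulLeft k Q.α) .id ∘ₗ
    (TensorProduct.comm k H H).toLinearMap

@[simp] lemma cap_tmul (c d : H) : Q.cap (c ⊗ₜ d) = Q.Sinv (Q.α * d) * c := rfl

lemma cap_mul (t : H ⊗[k] H) (c d : H) : Q.cap (t * c ⊗ₜ d) = Q.Sinv d * Q.cap t * c := by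
  induction t with
  | zero => simp
  | add x y hx hy => simp only [add_mul, map_add, hx, hy, mul_add]
  | tmul a b => simp [Sinv_mul, mul_assoc]

lemma cap_eq (t : H ⊗[k] H) : Q.cap t = Q.Sinv (LinearMap.mul' k H
    (TensorProduct.map Q.S (LinearMap.mulLeft k Q.α) t)) := by
  induction t with
  | zero => simp
  | add x y hx hy => simp only [map_add, hx, hy]
  | tmul a b => simp [Sinv_mul]

lemma cap_Δ_mul (h : H) (t : H ⊗[k] H) : Q.cap (Q.Δ h * t) = Q.ε h • Q.cap t := by
  induction t with
  | zero => simp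
  | add x y hx hy => simp only [mul_add, map_add, hx, hy, smul_add]
  | tmul c d =>
    rw [cap_mul, cap_eq, Q.antipode_left, map_smul, cap_tmul, Sinv_mul]
    simp

/-- `cap` in the last two of four factors. -/
abbrev cap₄ : H ⊗[k] (H ⊗[k] (H ⊗[k] H)) →ₗ[k] H ⊗[k] (H ⊗[k] H) := (Q.cap.lTensor H).lTensor H

lemma cap₄_Δ_mul (x : H ⊗[k] (H ⊗[k] H)) (w) : Q.cap₄ (Algebra.TensorProduct.map (.id k H)
      (Algebra.TensorProduct.map (.id k H) Q.Δ) x * w) =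
    leg₁₂ (Algebra.TensorProduct.map (.id k H) ((Algebra.TensorProduct.rid k k H).toAlgHom.comp
      (Algebra.TensorProduct.map (.id k H) Q.ε)) x) * Q.cap₄ w := by
  induction x using FDMod.ind₃ with
  | h0 => simp
  | ha x y hx hy => simp only [map_add, add_mul, hx, hy]
  | ht a b c =>
    induction w using ind₄ with
    | h0 => simp
    | ha x y hx hy => simp only [map_add, mul_add, hx, hy]
    | ht p q r s =>
      simp only [Algebra.TensorProduct.map_tmul, Algebra.TensorProduct.tmul_mul_tmul,
        LinearMap.lTensor_tmul, cap_Δ_mul, AlgHom.coe_id, id_eq, AlgHom.comp_apply]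
      simp [tmul_smul]

/-- The element `t¹ ⊗ X¹ t²₁ ⊗ S⁻¹(α X³ t³) X² t²₂`, where `Φ = X¹ ⊗ X² ⊗ X³`. -/
def bendΦ (t : H ⊗[k] (H ⊗[k] H)) : H ⊗[k] (H ⊗[k] H) :=
  Q.cap₄ ((1 : H) ⊗ₜ[k] Q.Φ.val * Algebra.TensorProduct.map (.id k H) (Q.Δl H) t)

lemma bendΦ_add (s t : H ⊗[k] (H ⊗[k] H)) : Q.bendΦ (s + t) = Q.bendΦ s + Q.bendΦ t := by
  simp only [bendΦ, map_add, mul_add]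

lemma cap₄_mul_Δl (w : H ⊗[k] (H ⊗[k] (H ⊗[k] H))) (a b c : H) :
    Q.cap₄ (w * a ⊗ₜ[k] Q.Δl H (b ⊗ₜ c)) =
      (1 : H) ⊗ₜ[k] ((1 : H) ⊗ₜ[k] Q.Sinv c) * Q.cap₄ w * a ⊗ₜ[k] Q.Δ b := by
  rw [QuasiBialgebra.Δl_tmul]
  generalize Q.Δ b = s
  induction s with
  | zero => simp
  | add x y hx hy => simp only [map_add, add_tmul, tmul_add, mul_add, hx, hy]
  | tmul p q =>
    induction w using ind₄ with
    | h0 => simp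
    | ha x y hx hy => simp only [map_add, add_mul, mul_add, hx, hy]
    | ht x y r s => simp [Sinv_mul, mul_assoc]

lemma bendΦ_mul (t : H ⊗[k] (H ⊗[k] H)) (a b c : H) : Q.bendΦ (t * a ⊗ₜ (b ⊗ₜ c)) =
    (1 : H) ⊗ₜ[k] ((1 : H) ⊗ₜ[k] Q.Sinv c) * Q.bendΦ t * a ⊗ₜ[k] Q.Δ b := by
  unfold bendΦ
  rw [map_mul (Algebra.TensorProduct.map (.id k H) (Q.Δl H)), ← mul_assoc,
    Algebra.TensorProduct.map_tmul, cap₄_mul_Δl]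
  rfl

/-- `(x¹ ⊗ x² β S(x³))` for `Φ⁻¹ = x¹ ⊗ x² ⊗ x³`. -/
def cupΦ : H ⊗[k] H := Q.cup.lTensor H (Q.Φ⁻¹).val

/-- The zigzag relation `S(x¹) α x² β S(x³) = 1`, read through the inverse of the antipode. -/
lemma cap_cupΦ : Q.cap Q.cupΦ = 1 := by
  have e : ∀ t : H ⊗[k] (H ⊗[k] H), Q.cap (Q.cup.lTensor H t) =
      Q.Sinv (LinearMap.mul' k H (TensorProduct.map Q.S
      (LinearMap.mulLeft k Q.α ∘ₗ LinearMap.mul' k H ∘ₗ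
        TensorProduct.map (LinearMap.mulRight k Q.β) Q.S) t)) := fun t => by
    induction t using FDMod.ind₃ with
    | h0 => simp
    | ha x y hx hy => simp only [map_add, hx, hy]
    | ht a b c => simp [Sinv_mul]
  rw [cupΦ, e, Q.antipode_reassoc_inv, Sinv_one]

lemma cap_cup₄ (s t : H ⊗[k] (H ⊗[k] H)) :
    Q.cap.lTensor H (Q.cup₄ (Algebra.TensorProduct.map (.id k H) (Q.Δl H) s * (1 : H) ⊗ₜ[k] t)) =
      Algebra.TensorProduct.map (.id k H) ((Algebra.TensorProduct.lid k H).toAlgHom.comp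
        (Algebra.TensorProduct.map Q.ε (.id k H))) s *
        (1 : H) ⊗ₜ[k] Q.cap (Q.cup.lTensor H t) := by
  induction s using FDMod.ind₃ with
  | h0 => simp
  | ha x y hx hy => simp only [map_add, add_mul, hx, hy]
  | ht a b c =>
    have e : ∀ u : H ⊗[k] H, Q.cup.lTensor H
        (Algebra.TensorProduct.assoc k k k H H H (u ⊗ₜ c) * t) =
        u * Q.cup.lTensor H t * (1 : H) ⊗ₜ Q.S c := fun u => by
      induction u with
      | zero => simp
      | add x y hx hy => simp only [map_add, add_tmul, add_mul, hx, hy]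
      | tmul p q =>
        induction t with
        | zero => simp
        | add x y hx hy => simp only [map_add, mul_add, add_mul, hx, hy]
        | tmul y w => simp [cup_mul]
    rw [Algebra.TensorProduct.map_tmul, Algebra.TensorProduct.tmul_mul_tmul, LinearMap.lTensor_tmul,
      LinearMap.lTensor_tmul, QuasiBialgebra.Δl_tmul, e, cap_mul, cap_Δ_mul]
    simp

/-- The element `X¹ t¹₁ ⊗ S⁻¹(α X³ t²) X² t¹₂`, where `Φ = X¹ ⊗ X² ⊗ X³`. -/
def bendΦ' (t : H ⊗[k] H) : H ⊗[k] H := Q.cap.lTensor H (Q.Φ.val * Q.Δl H t)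

lemma bendΦ'_Δ_mul (h : H) (t : H ⊗[k] H) : Q.bendΦ' (Q.Δ h * t) = h ⊗ₜ[k] 1 * Q.bendΦ' t := by
  have e : Q.Φ.val * Q.Δl H (Q.Δ h * t) =
      Algebra.TensorProduct.map (.id k H) Q.Δ (Q.Δ h) * (Q.Φ.val * Q.Δl H t) := by
    rw [Q.quasi_coassoc, map_mul]
    simp only [mul_assoc]
    rw [Units.inv_mul_cancel_left]; rfl
  have e2 : ∀ (s : H ⊗[k] H) (w : H ⊗[k] (H ⊗[k] H)), Q.cap.lTensor H
      (Algebra.TensorProduct.map (.id k H) Q.Δ s * w) =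
      (Algebra.TensorProduct.rid k k H (Algebra.TensorProduct.map (.id k H) Q.ε s)) ⊗ₜ[k] 1 *
        Q.cap.lTensor H w := fun s w => by
    induction s with
    | zero => simp
    | add x y hx hy => simp only [map_add, add_mul, add_tmul, hx, hy]
    | tmul a b =>
      induction w with
      | zero => simp
      | add x y hx hy => simp only [map_add, mul_add, hx, hy]
      | tmul p w => simp [cap_Δ_mul, smul_tmul]
  rw [bendΦ', e, e2, Q.counit_right]; rfl

lemma bendΦ'_cupΦ : Q.bendΦ' Q.cupΦ = 1 := by
  rw [bendΦ', cupΦ, ← cup₄_Δl, ← cup₄_leg_mul, Q.pentagon_right, cup₄_mul_Δ,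
    Q.counit_reassoc_right, map_one, mul_one, cap_cup₄, Q.counit_reassoc_inv, one_mul,
    show Q.cap (Q.cup.lTensor H (Q.Φ⁻¹).val) = 1 from Q.cap_cupΦ]
  rfl

lemma bendΦ_one_tmul (t : H ⊗[k] H) : Q.bendΦ ((1 : H) ⊗ₜ t) = (1 : H) ⊗ₜ Q.bendΦ' t := by
  simp [bendΦ, bendΦ']

/-- A subspace of `H ⊗ H ⊗ H` that contains `Φ⁻¹` and is stable under left multiplication by
`Δ(h) ⊗ g` and right multiplication by `g ⊗ Δ(h)` contains the middle factor. The pentagon, bent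
down by the inverse antipode in its last two factors, puts `bendΦ Φ`, hence the range of
`bendΦ`, into the subspace. -/
lemma middle_mem {P : Submodule k (H ⊗[k] (H ⊗[k] H))} (hΦ : (Q.Φ⁻¹).val ∈ P)
    (hl : ∀ h g t, t ∈ P → Q.Δl H (h ⊗ₜ g) * t ∈ P)
    (hr : ∀ g h t, t ∈ P → t * g ⊗ₜ Q.Δ h ∈ P) (h : H) : (1 : H) ⊗ₜ[k] (h ⊗ₜ[k] (1 : H)) ∈ P := by
  -- `cap₄` turns the fourth leg of `t` into a left multiplication on the third leg
  have h1 : ∀ t s, s ∈ P →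
      Q.cap₄ (Q.Δl (H ⊗[k] H) t * QuasiBialgebra.leg₁₂₃ s) ∈ P := fun t s hs => by
    induction t using FDMod.ind₃ with
    | h0 => simp
    | ha x y hx hy => rw [map_add, add_mul, map_add]; exact P.add_mem hx hy
    | ht a b c =>
      convert hl a (Q.Sinv (Q.α * c) * b) s hs using 1
      rw [QuasiBialgebra.Δl_tmul, QuasiBialgebra.Δl_tmul]
      generalize Q.Δ a = u
      clear hs
      induction u with
      | zero => simp
      | add x y hx hy => simp only [map_add, add_tmul, add_mul, hx, hy]
      | tmul p q =>
        induction s using FDMod.ind₃ with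
        | h0 => simp
        | ha x y hx hy => simp only [map_add, mul_add, hx, hy]
        | ht x y z => simp [mul_assoc]
  have h2 : Q.bendΦ Q.Φ.val ∈ P := by
    have := h1 Q.Φ.val _ hΦ
    rw [Q.pentagon_left, cap₄_Δ_mul, Q.counit_reassoc_right_inv, map_one, one_mul] at this
    exact this
  have h3 : ∀ w, Q.bendΦ (Q.Φ.val * w) ∈ P := fun w => by
    induction w using FDMod.ind₃ with
    | h0 => rw [mul_zero]; simp [bendΦ]
    | ha x y hx hy => rw [mul_add, bendΦ_add]; exact P.add_mem hx hy
    | ht a b c =>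
      rw [bendΦ_mul]
      refine hr _ _ _ ?_
      have := hl 1 (Q.Sinv c) _ h2
      rw [QuasiBialgebra.Δl_tmul, map_one] at this
      exact this
  -- `X¹ t¹₁ ⊗ S⁻¹(α X³ t²) X² t¹₂ = h ⊗ 1` for `t = Δ(h) (x¹ ⊗ x² β S(x³))`
  have h4 := h3 ((Q.Φ⁻¹).val * (1 : H) ⊗ₜ (Q.Δ h * Q.cupΦ))
  rw [Units.mul_inv_cancel_left, bendΦ_one_tmul, bendΦ'_Δ_mul, bendΦ'_cupΦ, mul_one] at h4
  exact h4

end QuasiHopf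

end Generation

/-! ### The quantum double is finite-dimensional -/

section DoubleFinite

variable {k H : Type u} [Field k] [Ring H] [Algebra k H]

lemma slice_slice_mul {T : Type u} [Ring T] [Algebra k T] (φ ψ : Module.Dual k H) (a b : H) (c : T)
    (t : H ⊗[k] (H ⊗[k] T)) : slice ψ (slice φ (a ⊗ₜ[k] (b ⊗ₜ[k] c) * t)) =
      c * slice (ψ ∘ₗ LinearMap.mulLeft k b) (slice (φ ∘ₗ LinearMap.mulLeft k a) t) := by
  induction t with
  | zero => simp
  | add x y hx hy => simp only [map_add, mul_add, hx, hy]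
  | tmul p t =>
    induction t with
    | zero => simp
    | add x y hx hy => simp only [map_add, mul_add, tmul_add, hx, hy]
    | tmul q t => simp

lemma slice_mul_slice {T : Type u} [Ring T] [Algebra k T] (φ ψ : Module.Dual k H) (a b : H) (c : T)
    (t : H ⊗[k] (H ⊗[k] T)) : slice ψ (slice φ (t * a ⊗ₜ[k] (b ⊗ₜ[k] c))) =
      slice (ψ ∘ₗ LinearMap.mulRight k b) (slice (φ ∘ₗ LinearMap.mulRight k a) t) * c := by
  induction t with
  | zero => simp
  | add x y hx hy => simp only [map_add, add_mul, hx, hy]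
  | tmul p t =>
    induction t with
    | zero => simp
    | add x y hx hy => simp only [map_add, add_mul, tmul_add, hx, hy]
    | tmul q t => simp

namespace IsDoublePair
variable {T : Type u} [Ring T] [Algebra k T] {i : H →ₐ[k] T}
  {d : Module.Dual k H →ₗ[k] T}

variable (i d) in
/-- The span of the elements `i(a) d(φ) i(b)`. -/
def triSpan : Submodule k T :=
  LinearMap.range (LinearMap.mul' k T ∘ₗ TensorProduct.map i.toLinearMap
    (LinearMap.mul' k T ∘ₗ TensorProduct.map d i.toLinearMap))

lemma mem_triSpan (a : H) (φ : Module.Dual k H) (b : H) : i a * (d φ * i b) ∈ triSpan i d :=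
  ⟨a ⊗ₜ (φ ⊗ₜ b), rfl⟩

lemma triSpan_induction {P : T → Prop} (h0 : P 0) (hadd : ∀ x y, P x → P y → P (x + y))
    (h : ∀ a φ b, P (i a * (d φ * i b))) (t : T) (ht : t ∈ triSpan i d) : P t := by
  obtain ⟨s, rfl⟩ := ht
  induction s with
  | zero => simpa using h0
  | add x y hx hy => rw [map_add]; exact hadd _ _ hx hy
  | tmul a s =>
    induction s with
    | zero => simpa using h0
    | add x y hx hy => rw [tmul_add, map_add]; exact hadd _ _ hx hy
    | tmul φ b => exact h a φ b

lemma left_mem {t : T} (ht : t ∈ triSpan i d) (a : H) : i a * t ∈ triSpan i d := by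
  refine triSpan_induction (P := fun t => i a * t ∈ triSpan i d) (by simp) (fun x y hx hy => ?_)
      (fun b φ c => ?_) t ht
  · rw [mul_add]; exact Submodule.add_mem _ hx hy
  · rw [← mul_assoc, ← map_mul]; exact mem_triSpan _ _ _

lemma right_mem {t : T} (ht : t ∈ triSpan i d) (a : H) : t * i a ∈ triSpan i d := by
  refine triSpan_induction (P := fun t => t * i a ∈ triSpan i d) (by simp) (fun x y hx hy => ?_)
      (fun b φ c => ?_) t ht
  · rw [add_mul]; exact Submodule.add_mem _ hx hy
  · rw [mul_assoc, mul_assoc, ← map_mul]; exact mem_triSpan _ _ _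

lemma gen_mem (φ : Module.Dual k H) : d φ ∈ triSpan i d := by
  have := mem_triSpan (i := i) (d := d) 1 φ 1
  rwa [map_one, one_mul, mul_one] at this

variable (i d) in
/-- The elements of `H ⊗ H ⊗ T` with coefficients in `triSpan`. -/
def triSpan₃ : Submodule k (H ⊗[k] (H ⊗[k] T)) :=
  ⨅ φ : Module.Dual k H, ⨅ ψ : Module.Dual k H, (triSpan i d).comap (slice ψ ∘ₗ slice φ)

lemma mem_triSpan₃ {t : H ⊗[k] (H ⊗[k] T)} :
    t ∈ triSpan₃ i d ↔ ∀ φ ψ, slice ψ (slice φ t) ∈ triSpan i d := by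
  simp [triSpan₃]

variable (i) in
/-- The embedding `H ⊗ H ⊗ H → H ⊗ H ⊗ T`. -/
abbrev emb : H ⊗[k] (H ⊗[k] H) →ₐ[k] H ⊗[k] (H ⊗[k] T) :=
  Algebra.TensorProduct.map (.id k H) (Algebra.TensorProduct.map (.id k H) i)

lemma emb_mul_mem {t : H ⊗[k] (H ⊗[k] T)} (ht : t ∈ triSpan₃ i d) (s : H ⊗[k] (H ⊗[k] H)) :
    emb i s * t ∈ triSpan₃ i d := by
  induction s using FDMod.ind₃ with
  | h0 => simp
  | ha x y hx hy => rw [map_add, add_mul]; exact Submodule.add_mem _ hx hy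
  | ht a b c =>
    rw [mem_triSpan₃] at ht ⊢
    intro φ ψ
    refine (slice_slice_mul φ ψ a b (i c) t).symm ▸ left_mem (ht _ _) c

lemma mul_emb_mem {t : H ⊗[k] (H ⊗[k] T)} (ht : t ∈ triSpan₃ i d) (s : H ⊗[k] (H ⊗[k] H)) :
    t * emb i s ∈ triSpan₃ i d := by
  induction s using FDMod.ind₃ with
  | h0 => simp
  | ha x y hx hy => rw [map_add, mul_add]; exact Submodule.add_mem _ hx hy
  | ht a b c =>
    rw [mem_triSpan₃] at ht ⊢
    intro φ ψ
    refine (slice_mul_slice φ ψ a b (i c) t).symm ▸ right_mem (ht _ _) c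

variable [Module.Finite k H]

/-- `𝐃₁₃`. -/
abbrev D₁₃ (d : Module.Dual k H →ₗ[k] T) : H ⊗[k] (H ⊗[k] T) :=
  Algebra.TensorProduct.map (.id k H) Algebra.TensorProduct.includeRight (canon d)

lemma slice_sandwich (φ ψ : Module.Dual k H) (a : H) :
    slice ψ (slice φ (D₁₃ d * (1 : H) ⊗ₜ[k] ((1 : H) ⊗ₜ[k] i a) * (1 : H) ⊗ₜ[k] canon d)) =
      d φ * i a * d ψ := by
  have e : ∀ s s' : H ⊗[k] T, slice ψ (slice φ (Algebra.TensorProduct.map (.id k H)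
      Algebra.TensorProduct.includeRight s * (1 : H) ⊗ₜ[k] ((1 : H) ⊗ₜ[k] i a) *
      (1 : H) ⊗ₜ[k] s')) = slice φ s * i a * slice ψ s' := fun s s' => by
    induction s with
    | zero => simp
    | add x y hx hy => simp only [map_add, add_mul, hx, hy]
    | tmul p t =>
      induction s' with
      | zero => simp
      | add x y hx hy => simp only [map_add, mul_add, tmul_add, hx, hy]
      | tmul q t' => simp [smul_comm (ψ q) (φ p)]
  rw [e, slice_canon, slice_canon]

lemma Δ_mem (Q : QuasiHopf k H) (φ ψ : Module.Dual k H) : slice ψ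
    (slice φ (TensorProduct.assoc k H H _
    (Q.Δ.toLinearMap.rTensor _ (canon d)))) ∈ triSpan i d := by
  have e : ∀ s : H ⊗[k] T, ∃ χ : Module.Dual k H, slice ψ (slice φ (TensorProduct.assoc k H H _
    (Q.Δ.toLinearMap.rTensor _ s))) = slice χ s := fun s => by
    refine ⟨ψ ∘ₗ slice φ ∘ₗ Q.Δ.toLinearMap, ?_⟩
    induction s with
    | zero => simp
    | add x y hx hy => simp only [map_add, hx, hy]
    | tmul p t =>
      simp only [LinearMap.rTensor_tmul, slice_tmul, LinearMap.comp_apply]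
      generalize Q.Δ.toLinearMap p = u
      induction u with
      | zero => simp
      | add x y hx hy => simp only [map_add, add_tmul, add_smul, hx, hy]
      | tmul a b => simp [mul_smul]
  obtain ⟨χ, hχ⟩ := e (canon d)
  rw [hχ, slice_canon]
  exact gen_mem _

lemma emb_mul_D₁₃ {Q : QuasiHopf k H} (h : IsDoublePair Q i d) (a g : H) :
    ∃ s, D₁₃ d * emb i (sw₂₃ k H (Q.Δl H (a ⊗ₜ g))) = emb i s * D₁₃ d := by
  let J : H ⊗[k] T →ₐ[k] H ⊗[k] (H ⊗[k] T) :=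
    Algebra.TensorProduct.map (.id k H) Algebra.TensorProduct.includeRight
  let G : H ⊗[k] (H ⊗[k] T) := (1 : H) ⊗ₜ (g ⊗ₜ (1 : T))
  have e1 : ∀ u : H ⊗[k] H,
      emb i (sw₂₃ k H (Algebra.TensorProduct.assoc k k k H H H (u ⊗ₜ g))) =
        J (i.toLinearMap.lTensor H u) * G := fun u => by
    induction u with
    | zero => simp
    | add x y hx hy => simp only [map_add, add_tmul, add_mul, hx, hy]
    | tmul a b => simp [J, G]
  have e2 : ∀ x, J x * G = G * J x := fun x => by
    induction x with
    | zero => simp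
    | add x y hx hy => simp only [map_add, add_mul, mul_add, hx, hy]
    | tmul a b => simp [J, G]
  have e3 : ∀ u : H ⊗[k] H, G * J (i.toLinearMap.lTensor H u) =
      emb i ((1 : H) ⊗ₜ (g ⊗ₜ (1 : H)) * leg₁₃ u) := fun u => by
    induction u with
    | zero => simp
    | add x y hx hy => simp only [map_add, mul_add, hx, hy]
    | tmul a b => simp [J, G]
  refine ⟨(1 : H) ⊗ₜ (g ⊗ₜ (1 : H)) * leg₁₃ (TensorProduct.comm k H H (Q.Δ a)), ?_⟩
  rw [QuasiBialgebra.Δl_tmul, e1, ← mul_assoc, show D₁₃ d = J (canon d) from rfl, ← map_mul,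
    h.comm, map_mul, mul_assoc, e2, ← mul_assoc, e2, e3]

lemma emb_mul_D₂₃ {Q : QuasiHopf k H} (h : IsDoublePair Q i d) (g a : H) :
    emb i (sw₂₃ k H (g ⊗ₜ Q.Δ a)) * (1 : H) ⊗ₜ[k] canon d =
      (1 : H) ⊗ₜ[k] canon d * emb i (g ⊗ₜ Q.Δ a) := by
  refine Eq.trans ?_ ((congrArg (fun x => g ⊗ₜ[k] x) (h.comm a).symm).trans ?_)
  · exact (Algebra.TensorProduct.tmul_mul_tmul _ _ _ _).trans (by rw [mul_one]; rfl)
  · exact ((Algebra.TensorProduct.tmul_mul_tmul _ _ _ _).trans (by rw [one_mul]; rfl)).symm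

/-- The hexagon relation, solved for `𝐃₁₃ (Φ₁₃₂)⁻¹ 𝐃₂₃`. -/
lemma hex_iff (Q : QuasiHopf k H) :
    TensorProduct.assoc k H H _ (Q.Δ.toLinearMap.rTensor _ (canon d)) =
      (i.toLinearMap.lTensor H).lTensor H (sw₂₃ k H (sw₁₂ k H Q.Φ.val)) *
        Algebra.TensorProduct.map (.id k H) Algebra.TensorProduct.includeRight (canon d) *
        (i.toLinearMap.lTensor H).lTensor H (sw₂₃ k H (Q.Φ⁻¹).val) *
        (1 : H) ⊗ₜ[k] canon d * (i.toLinearMap.lTensor H).lTensor H Q.Φ.val ↔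
    D₁₃ d * emb i (sw₂₃ k H (Q.Φ⁻¹).val) * (1 : H) ⊗ₜ[k] canon d =
      emb i (sw₂₃ k H (sw₁₂ k H (Q.Φ⁻¹).val)) * Q.Δl T (canon d) * emb i (Q.Φ⁻¹).val := by
  let f := (emb i).comp ((sw₂₃ k H).toAlgHom.comp (sw₁₂ k H).toAlgHom)
  change Q.Δl T (canon d) = f Q.Φ.val * D₁₃ d * emb i (sw₂₃ k H (Q.Φ⁻¹).val) *
    (1 : H) ⊗ₜ[k] canon d * emb i Q.Φ.val ↔ _ = f (Q.Φ⁻¹).val * _ * _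
  generalize Q.Δl T (canon d) = x
  rw [mul_assoc (f Q.Φ.val), mul_assoc (f Q.Φ.val)]
  generalize D₁₃ d * emb i (sw₂₃ k H (Q.Φ⁻¹).val) * (1 : H) ⊗ₜ[k] canon d = y
  have h1 := map_inv_mul_map f Q.Φ
  have h2 := map_mul_map_inv f Q.Φ
  have h3 := map_inv_mul_map (emb i) Q.Φ
  have h4 := map_mul_map_inv (emb i) Q.Φ
  constructor
  · rintro rfl
    rw [← mul_assoc, ← mul_assoc, h1, one_mul, mul_assoc, h4, mul_one]
  · rintro rfl
    rw [← mul_assoc, ← mul_assoc, h2, one_mul, mul_assoc, h3, mul_one]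

lemma hex_inv {Q : QuasiHopf k H} (h : IsDoublePair Q i d) :
    D₁₃ d * emb i (sw₂₃ k H (Q.Φ⁻¹).val) * (1 : H) ⊗ₜ[k] canon d =
      emb i (sw₂₃ k H (sw₁₂ k H (Q.Φ⁻¹).val)) * Q.Δl T (canon d) * emb i (Q.Φ⁻¹).val :=
  (hex_iff Q).1 h.hex

/-- The key to the finiteness of the quantum double: the elements `i(a) d(φ) i(b)` span a
subspace containing the products `d(φ) i(a) d(ψ)`. -/
lemma sandwich_mem {Q : QuasiHopf k H} (h : IsDoublePair Q i d) (φ ψ : Module.Dual k H) (a : H) :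
    d φ * i a * d ψ ∈ triSpan i d := by
  let F : H ⊗[k] (H ⊗[k] H) →ₗ[k] H ⊗[k] (H ⊗[k] T) :=
    LinearMap.mulRight k ((1 : H) ⊗ₜ[k] canon d) ∘ₗ LinearMap.mulLeft k (D₁₃ d) ∘ₗ
      (emb i).toLinearMap ∘ₗ (sw₂₃ k H).toLinearMap
  have hF : ∀ s, F s = D₁₃ d * emb i (sw₂₃ k H s) * (1 : H) ⊗ₜ[k] canon d := fun s => rfl
  -- the tensors `s` for which the coefficients of `𝐃₁₃ s₁₃₂ 𝐃₂₃` lie in the span: they include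
  -- `Φ⁻¹` by the hexagon relation, and the commutation of `𝐃` with `Δ` gives the stability
  have key := Q.middle_mem (P := (triSpan₃ i d).comap F) ?_ ?_ ?_ a
  · rw [← slice_sandwich]
    have := (mem_triSpan₃.1 key) φ ψ
    rw [hF] at this
    convert this using 6
    simp
  · have hm : Q.Δl T (canon d) ∈ triSpan₃ i d := mem_triSpan₃.2 (Δ_mem Q)
    rw [Submodule.mem_comap, hF, h.hex_inv]
    exact mul_emb_mem (emb_mul_mem hm _) _
  · intro a g t ht
    rw [Submodule.mem_comap, hF] at ht ⊢
    obtain ⟨s, hs⟩ := h.emb_mul_D₁₃ a g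
    rw [map_mul, map_mul, ← mul_assoc, hs, mul_assoc, mul_assoc]
    rw [mul_assoc] at ht
    exact emb_mul_mem ht s
  · intro g a t ht
    rw [Submodule.mem_comap, hF] at ht ⊢
    rw [map_mul, map_mul, ← mul_assoc, mul_assoc, h.emb_mul_D₂₃, ← mul_assoc]
    exact mul_emb_mem ht _

end IsDoublePair

/-- `D(H)` is spanned by the elements `i(a) d(φ) i(b)`, hence finite-dimensional. -/
instance QuantumDouble.finite [Module.Finite k H] (Q : QuasiHopf k H) :
    Module.Finite k (QuantumDouble Q) := by
  have h := QuantumDouble.isDoublePair Q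
  have htop : IsDoublePair.triSpan (QuantumDouble.incl Q) (QuantumDouble.gen Q) = ⊤ := by
    rw [eq_top_iff]
    intro a _
    induction a using QuantumDouble.induction with
    | hone => rw [← h.counit]; exact IsDoublePair.gen_mem _
    | hadd a b ha hb => exact Submodule.add_mem _ (ha trivial) (hb trivial)
    | hsmul c a ha => exact Submodule.smul_mem _ c (ha trivial)
    | hincl b a ha => exact IsDoublePair.left_mem (ha trivial) b
    | hgen φ a ha =>
      refine IsDoublePair.triSpan_induction (P := fun t => QuantumDouble.gen Q φ * t ∈ _) (by simp)
          (fun x y hx hy => ?_) (fun a ψ b => ?_) a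
        (ha trivial)
      · rw [mul_add]; exact Submodule.add_mem _ hx hy
      · rw [← mul_assoc, ← mul_assoc]
        exact IsDoublePair.right_mem (h.sandwich_mem φ ψ a) b
  refine ⟨?_⟩
  rw [← htop, IsDoublePair.triSpan, LinearMap.range_eq_map]
  exact Module.Finite.fg_top.map _

end DoubleFinite

/-! ### Mates of half braidings -/

section DualHalfBraiding
variable {C : Type u} [Category.{v} C] [MonoidalCategory C] {D : C} (m : ∀ X : C, D ⊗ X ⟶ X ⊗ D)

/-- The axioms of a half braiding of the reversed category, invertibility apart. -/
structure IsHBRev : Prop where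
  nat : ∀ {X Y : C} (f : X ⟶ Y), D ◁ f ≫ m Y = m X ≫ f ▷ D
  unit : m (𝟙_ C) = (ρ_ D).hom ≫ (λ_ D).inv
  ten : ∀ X Y : C, m (X ⊗ Y) = (α_ D X Y).inv ≫ m X ▷ Y ≫ (α_ X D Y).hom ≫ X ◁ m Y ≫
      (α_ X Y D).inv

/-- The inverse of a reversed half braiding at an object `X` that is a left dual of `Y`. -/
def halfInvRev (X Y : C) [ExactPairing Y X] : X ⊗ D ⟶ D ⊗ X :=
  𝟙 _ ⊗≫ (X ⊗ D) ◁ η_ Y X ⊗≫ X ◁ m Y ▷ X ⊗≫ ε_ Y X ▷ (D ⊗ X) ⊗≫ 𝟙 _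

variable {m}

/-- A reversed half braiding is invertible at each object that is a left dual: the inverse is given
by the reversed half braiding at the object it is dual to. -/
lemma IsHBRev.isIso (h : IsHBRev m) (X Y : C) [ExactPairing Y X] : IsIso (m X) := by
  refine ⟨halfInvRev m X Y, ?_, ?_⟩
  · calc m X ≫ halfInvRev m X Y = 𝟙 _ ⊗≫ (m X ▷ 𝟙_ C ≫ (X ⊗ D) ◁ η_ Y X) ⊗≫ X ◁ m Y ▷ X ⊗≫
          ε_ Y X ▷ (D ⊗ X) ⊗≫ 𝟙 _ := by unfold halfInvRev; monoidal
      _ = 𝟙 _ ⊗≫ (D ⊗ X) ◁ η_ Y X ⊗≫ ((α_ D X Y).inv ≫ m X ▷ Y ≫ (α_ X D Y).hom ≫ X ◁ m Y ≫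
          (α_ X Y D).inv) ▷ X ⊗≫ ε_ Y X ▷ (D ⊗ X) ⊗≫ 𝟙 _ := by
            rw [← whisker_exchange]; monoidal
      _ = 𝟙 _ ⊗≫ (D ⊗ X) ◁ η_ Y X ⊗≫ (m (X ⊗ Y) ≫ ε_ Y X ▷ D) ▷ X ⊗≫ 𝟙 _ := by
            rw [← h.ten]; monoidal
      _ = D ◁ (𝟙 _ ⊗≫ X ◁ η_ Y X ⊗≫ ε_ Y X ▷ X ⊗≫ 𝟙 _) := by
            rw [← h.nat, h.unit]; monoidal
      _ = _ := by rw [Twisted.zag]; simp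
  · calc halfInvRev m X Y ≫ m X = 𝟙 _ ⊗≫ (X ⊗ D) ◁ η_ Y X ⊗≫ X ◁ m Y ▷ X ⊗≫
          (ε_ Y X ▷ (D ⊗ X) ≫ 𝟙_ C ◁ m X) ⊗≫ 𝟙 _ := by unfold halfInvRev; monoidal
      _ = 𝟙 _ ⊗≫ (X ⊗ D) ◁ η_ Y X ⊗≫ X ◁ ((α_ D Y X).inv ≫ m Y ▷ X ≫ (α_ Y D X).hom ≫ Y ◁ m X ≫
          (α_ Y X D).inv) ⊗≫ ε_ Y X ▷ (X ⊗ D) ⊗≫ 𝟙 _ := by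
            rw [← whisker_exchange]; monoidal
      _ = 𝟙 _ ⊗≫ X ◁ (D ◁ η_ Y X ≫ m (Y ⊗ X)) ⊗≫ ε_ Y X ▷ (X ⊗ D) ⊗≫ 𝟙 _ := by
            rw [← h.ten]; monoidal
      _ = (𝟙 _ ⊗≫ X ◁ η_ Y X ⊗≫ ε_ Y X ▷ X ⊗≫ 𝟙 _) ▷ D := by
            rw [h.nat, h.unit]; monoidal
      _ = _ := by rw [Twisted.zag]; simp

/-- The inverse of an invertible reversed half braiding is a half braiding. -/
lemma IsHBRev.inv (h : IsHBRev m) [∀ X, IsIso (m X)] :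
    IsHB (fun X => CategoryTheory.inv (m X)) where
  nat f := by rw [IsIso.eq_inv_comp, ← Category.assoc, ← h.nat]; simp
  unit := by
    rw [IsIso.inv_eq_of_hom_inv_id]
    rw [h.unit]; simp
  ten X Y := by
    rw [IsIso.inv_eq_of_hom_inv_id]
    rw [h.ten]
    simp only [Category.assoc, Iso.inv_hom_id_assoc]
    rw [← MonoidalCategory.whiskerLeft_comp_assoc, IsIso.hom_inv_id]
    simp only [MonoidalCategory.whiskerLeft_id, Category.id_comp, Iso.hom_inv_id_assoc]
    rw [← comp_whiskerRight_assoc, IsIso.hom_inv_id]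
    simp

variable {V : C} [ExactPairing V D] {b : ∀ X : C, X ⊗ V ⟶ V ⊗ X}

variable (D b) in
/-- The mate `V^* ⊗ X ⟶ X ⊗ V^*` of a half braiding `X ⊗ V ⟶ V ⊗ X`. -/
def mateHB (X : C) : D ⊗ X ⟶ X ⊗ D :=
  𝟙 _ ⊗≫ (D ⊗ X) ◁ η_ V D ⊗≫ D ◁ b X ▷ D ⊗≫ ε_ V D ▷ (X ⊗ D) ⊗≫ 𝟙 _

lemma mateHB_isHBRev (h : IsHB b) : IsHBRev (mateHB D b) where
  nat {X Y} f := by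
    calc _ = 𝟙 _ ⊗≫ D ◁ (f ▷ 𝟙_ C ≫ Y ◁ η_ V D) ⊗≫ D ◁ b Y ▷ D ⊗≫ ε_ V D ▷ (Y ⊗ D) ⊗≫ 𝟙 _ := by
          unfold mateHB; monoidal
      _ = 𝟙 _ ⊗≫ (D ⊗ X) ◁ η_ V D ⊗≫ D ◁ (f ▷ V ≫ b Y) ▷ D ⊗≫ ε_ V D ▷ (Y ⊗ D) ⊗≫ 𝟙 _ := by
          rw [← whisker_exchange]; monoidal
      _ = 𝟙 _ ⊗≫ (D ⊗ X) ◁ η_ V D ⊗≫ D ◁ b X ▷ D ⊗≫ ((D ⊗ V) ◁ (f ▷ D) ≫ ε_ V D ▷ (Y ⊗ D)) ⊗≫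
          𝟙 _ := by
          rw [h.nat]; monoidal
      _ = _ := by rw [whisker_exchange]; unfold mateHB; monoidal
  unit := by
    calc _ = (ρ_ D).hom ≫ (𝟙 _ ⊗≫ D ◁ η_ V D ⊗≫ ε_ V D ▷ D ⊗≫ 𝟙 _) ≫ (λ_ D).inv := by
          unfold mateHB; rw [h.unit]; monoidal
      _ = _ := by rw [Twisted.zag]; simp
  ten X Y := by
    symm
    calc _ = 𝟙 _ ⊗≫ (D ⊗ X) ◁ η_ V D ▷ Y ⊗≫ D ◁ b X ▷ (D ⊗ Y) ⊗≫
          (ε_ V D ▷ (X ⊗ (D ⊗ Y) ⊗ 𝟙_ C) ≫ 𝟙_ C ◁ (X ◁ ((D ⊗ Y) ◁ η_ V D))) ⊗≫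
          X ◁ D ◁ b Y ▷ D ⊗≫ X ◁ ε_ V D ▷ (Y ⊗ D) ⊗≫ 𝟙 _ := by
          unfold mateHB; monoidal
      _ = 𝟙 _ ⊗≫ (D ⊗ X) ◁ η_ V D ▷ Y ⊗≫
          D ◁ (b X ▷ ((D ⊗ Y) ⊗ 𝟙_ C) ≫ (V ⊗ X) ◁ ((D ⊗ Y) ◁ η_ V D)) ⊗≫
          ε_ V D ▷ (X ⊗ ((D ⊗ Y) ⊗ (V ⊗ D))) ⊗≫
          X ◁ D ◁ b Y ▷ D ⊗≫ X ◁ ε_ V D ▷ (Y ⊗ D) ⊗≫ 𝟙 _ := by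
          rw [← whisker_exchange (ε_ V D) (X ◁ ((D ⊗ Y) ◁ η_ V D))]; monoidal
      _ = 𝟙 _ ⊗≫ D ◁ X ◁ (η_ V D ▷ (Y ⊗ 𝟙_ C) ≫ (V ⊗ D) ◁ (Y ◁ η_ V D)) ⊗≫
          D ◁ b X ▷ (D ⊗ Y ⊗ V ⊗ D) ⊗≫
          (ε_ V D ▷ (X ⊗ (D ⊗ (Y ⊗ V)) ⊗ D) ≫ 𝟙_ C ◁ (X ◁ ((D ◁ b Y) ▷ D))) ⊗≫
          X ◁ ε_ V D ▷ (Y ⊗ D) ⊗≫ 𝟙 _ := by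
          rw [← whisker_exchange (b X) ((D ⊗ Y) ◁ η_ V D)]; monoidal
      _ = 𝟙 _ ⊗≫ D ◁ X ◁ Y ◁ η_ V D ⊗≫ D ◁ X ◁ η_ V D ▷ ((Y ⊗ V) ⊗ D) ⊗≫
          D ◁ (b X ▷ (D ⊗ (Y ⊗ V)) ≫ (V ⊗ X) ◁ (D ◁ b Y)) ▷ D ⊗≫
          (ε_ V D ▷ (X ⊗ ((D ⊗ V) ⊗ (Y ⊗ D))) ≫ 𝟙_ C ◁ (X ◁ ε_ V D ▷ (Y ⊗ D))) ⊗≫ 𝟙 _ := by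
          rw [← whisker_exchange (η_ V D) (Y ◁ η_ V D),
            ← whisker_exchange (ε_ V D) (X ◁ ((D ◁ b Y) ▷ D))]; monoidal
      _ = 𝟙 _ ⊗≫ D ◁ X ◁ Y ◁ η_ V D ⊗≫ D ◁ X ◁ (η_ V D ▷ (Y ⊗ V) ≫ (V ⊗ D) ◁ b Y) ▷ D ⊗≫
          D ◁ (b X ▷ ((D ⊗ V) ⊗ Y) ≫ (V ⊗ X) ◁ (ε_ V D ▷ Y)) ▷ D ⊗≫
          ε_ V D ▷ (X ⊗ Y ⊗ D) ⊗≫ 𝟙 _ := by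
          rw [← whisker_exchange (b X) (D ◁ b Y),
            ← whisker_exchange (ε_ V D) (X ◁ ε_ V D ▷ (Y ⊗ D))]; monoidal
      _ = 𝟙 _ ⊗≫ D ◁ X ◁ Y ◁ η_ V D ⊗≫ D ◁ X ◁ b Y ▷ D ⊗≫
          D ◁ X ◁ (𝟙 V ⊗≫ η_ V D ▷ V ⊗≫ V ◁ ε_ V D ⊗≫ 𝟙 V) ▷ (Y ⊗ D) ⊗≫
          D ◁ b X ▷ (Y ⊗ D) ⊗≫ ε_ V D ▷ (X ⊗ Y ⊗ D) ⊗≫ 𝟙 _ := by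
          rw [← whisker_exchange (η_ V D) (b Y), ← whisker_exchange (b X) (ε_ V D ▷ Y)]; monoidal
      _ = 𝟙 _ ⊗≫ (D ⊗ X ⊗ Y) ◁ η_ V D ⊗≫ D ◁ ((α_ X Y V).hom ≫ X ◁ b Y ≫ (α_ X V Y).inv ≫
          b X ▷ Y ≫ (α_ V X Y).hom) ▷ D ⊗≫ ε_ V D ▷ ((X ⊗ Y) ⊗ D) ⊗≫ 𝟙 _ := by
          rw [Twisted.zig]; monoidal
      _ = _ := by rw [← h.ten]; unfold mateHB; monoidal

/-- The evaluation is compatible with a half braiding and its mate. -/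
lemma mateHB_ev (X : C) : mateHB D b X ▷ V ≫ (α_ X D V).hom ≫ X ◁ ε_ V D =
    (α_ D X V).hom ≫ D ◁ b X ≫ (α_ D V X).inv ≫ ε_ V D ▷ X ≫ (λ_ X).hom ≫ (ρ_ X).inv := by
  calc _ = 𝟙 _ ⊗≫ D ◁ X ◁ η_ V D ▷ V ⊗≫ D ◁ b X ▷ (D ⊗ V) ⊗≫
        (ε_ V D ▷ (X ⊗ (D ⊗ V)) ≫ 𝟙_ C ◁ (X ◁ ε_ V D)) ⊗≫ 𝟙 _ := by unfold mateHB; monoidal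
    _ = 𝟙 _ ⊗≫ D ◁ X ◁ η_ V D ▷ V ⊗≫ D ◁ (b X ▷ (D ⊗ V) ≫ (V ⊗ X) ◁ ε_ V D) ⊗≫
        ε_ V D ▷ X ⊗≫ 𝟙 _ := by
        rw [← whisker_exchange (ε_ V D) (X ◁ ε_ V D)]; monoidal
    _ = 𝟙 _ ⊗≫ D ◁ X ◁ (𝟙 V ⊗≫ η_ V D ▷ V ⊗≫ V ◁ ε_ V D ⊗≫ 𝟙 V) ⊗≫ D ◁ b X ⊗≫
        ε_ V D ▷ X ⊗≫ 𝟙 _ := by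
        rw [← whisker_exchange (b X) (ε_ V D)]; monoidal
    _ = _ := by rw [Twisted.zig]; monoidal

/-- The coevaluation is compatible with a half braiding and its mate. -/
lemma mateHB_coev (X : C) : (λ_ X).inv ≫ η_ V D ▷ X ≫ (α_ V D X).hom ≫ V ◁ mateHB D b X =
    (ρ_ X).inv ≫ X ◁ η_ V D ≫ (α_ X V D).inv ≫ b X ▷ D ≫ (α_ V X D).hom := by
  calc _ = 𝟙 _ ⊗≫ (η_ V D ▷ (X ⊗ 𝟙_ C) ≫ (V ⊗ D) ◁ (X ◁ η_ V D)) ⊗≫ V ◁ D ◁ b X ▷ D ⊗≫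
        V ◁ ε_ V D ▷ (X ⊗ D) ⊗≫ 𝟙 _ := by unfold mateHB; monoidal
    _ = 𝟙 _ ⊗≫ X ◁ η_ V D ⊗≫ (η_ V D ▷ (X ⊗ V) ≫ (V ⊗ D) ◁ b X) ▷ D ⊗≫
        V ◁ ε_ V D ▷ (X ⊗ D) ⊗≫ 𝟙 _ := by
        rw [← whisker_exchange (η_ V D) (X ◁ η_ V D)]; monoidal
    _ = 𝟙 _ ⊗≫ X ◁ η_ V D ⊗≫ b X ▷ D ⊗≫
        (𝟙 V ⊗≫ η_ V D ▷ V ⊗≫ V ◁ ε_ V D ⊗≫ 𝟙 V) ▷ (X ⊗ D) ⊗≫ 𝟙 _ := by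
        rw [← whisker_exchange (η_ V D) (b X)]; monoidal
    _ = _ := by rw [Twisted.zig]; monoidal

end DualHalfBraiding

/-! ### Yetter-Drinfeld modules as modules over the quantum double -/

section HalfBraidingElement

variable {k H T : Type u} [Field k] [Ring H] [Algebra k H] [Ring T] [Algebra k T]

lemma Tw.eq {A V V' : Type u} [Ring A] [Algebra k A] [AddCommGroup V] [Module k V]
    [AddCommGroup V'] [Module k V'] {A' : Type u} [Ring A'] [Algebra k A']
    {ρ : A →ₐ[k] Module.End k V} {ρ' : A' →ₐ[k] Module.End k V'} {p : V →ₗ[k] V'} {f : A →ₐ[k] A'}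
    (h : Tw p ρ ρ' f) (a : A) (v : V) : ρ' (f a) (p v) = p (ρ a v) := (h a v).symm

variable {Q : QuasiBialgebra k H} {V : FDMod Q} {i : H →ₐ[k] T} {τ : T →ₐ[k] Module.End k V.V}
  (hV : V.ρ = τ.comp i) {c : H ⊗[k] T} {b : ∀ X : FDMod Q, X ⊗ V ⟶ V ⊗ X}
  (hb : ∀ X : FDMod Q, (b X).lin =
    (TensorProduct.comm k X.V V.V).toLinearMap ∘ₗ tensorAct X.ρ τ c)

/-- The permutation `x ⊗ y ⊗ v ↦ v ⊗ x ⊗ y`. -/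
def rot (X Y V : Type u) [AddCommGroup X] [Module k X] [AddCommGroup Y] [Module k Y]
    [AddCommGroup V] [Module k V] : X ⊗[k] (Y ⊗[k] V) ≃ₗ[k] (V ⊗[k] X) ⊗[k] Y :=
  (TensorProduct.assoc k X Y V).symm ≪≫ₗ TensorProduct.comm k (X ⊗[k] Y) V ≪≫ₗ
    (TensorProduct.assoc k V X Y).symm

include hV hb in
lemma tenR_lin (X Y : FDMod Q) (t : X.V ⊗[k] (Y.V ⊗[k] V.V)) : (tenR b X Y).lin t =
    rot X.V Y.V V.V (tensorAct X.ρ (tensorAct Y.ρ τ)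
      (IsDoublePair.emb i (sw₂₃ k H (sw₁₂ k H (Q.Φ⁻¹).val)) * Q.Δl T c *
        IsDoublePair.emb i (Q.Φ⁻¹).val) t) := by
  unfold tenR
  simp only [FDMod.comp_lin]
  have e1 : ∀ t, (α_ X Y V).inv.lin t = (TensorProduct.assoc k X.V Y.V V.V).symm.toLinearMap
      (tensorAct X.ρ (tensorAct Y.ρ τ) (IsDoublePair.emb i (Q.Φ⁻¹).val) t) := fun t => by
    change (TensorProduct.assoc k X.V Y.V V.V).symm.toLinearMap
      (tensorAct X.ρ (tensorAct Y.ρ V.ρ) (Q.Φ⁻¹).val t) = _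
    rw [hV]
    have h1 := tensorAct_comp Y.ρ τ (.id k H) i
    have h2 := tensorAct_comp X.ρ (tensorAct Y.ρ τ) (.id k H)
        (Algebra.TensorProduct.map (.id k H) i)
    rw [AlgHom.comp_id] at h1 h2
    rw [h1, h2]; rfl
  have e2 : ∀ s, (b (X ⊗ Y)).lin s = (TensorProduct.comm k (X.V ⊗[k] Y.V) V.V).toLinearMap
      (tensorAct (tensorAct X.ρ Y.ρ) τ (Algebra.TensorProduct.map Q.Δ (.id k T) c) s) := fun s => by
    rw [hb]
    change (TensorProduct.comm k (X.V ⊗[k] Y.V) V.V).toLinearMap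
      (tensorAct (X.tensor Y).ρ τ c s) = _
    have h2 := tensorAct_comp (tensorAct X.ρ Y.ρ) τ Q.Δ (.id k T)
    rw [AlgHom.comp_id] at h2
    change (TensorProduct.comm k (X.V ⊗[k] Y.V) V.V).toLinearMap
      (tensorAct ((tensorAct X.ρ Y.ρ).comp Q.Δ) τ c s) = _
    rw [h2]; rfl
  have e3 : ∀ s, (α_ V X Y).inv.lin s = (TensorProduct.assoc k V.V X.V Y.V).symm.toLinearMap
      (tensorAct τ (tensorAct X.ρ Y.ρ) (Algebra.TensorProduct.map i (.id k _) (Q.Φ⁻¹).val) s) :=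
    fun s => by
      change (TensorProduct.assoc k V.V X.V Y.V).symm.toLinearMap
        (tensorAct V.ρ (tensorAct X.ρ Y.ρ) (Q.Φ⁻¹).val s) = _
      rw [hV]
      have h2 := tensorAct_comp τ (tensorAct X.ρ Y.ρ) i (.id k (H ⊗[k] H))
      rw [AlgHom.comp_id] at h2
      rw [h2]; rfl
  have e4 : ∀ w s, tensorAct τ (tensorAct X.ρ Y.ρ) w
      ((TensorProduct.comm k (X.V ⊗[k] Y.V) V.V).toLinearMap s) =
      (TensorProduct.comm k (X.V ⊗[k] Y.V) V.V).toLinearMap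
        (tensorAct (tensorAct X.ρ Y.ρ) τ ((Algebra.TensorProduct.comm k T (H ⊗[k] H)) w) s) :=
    fun w s => by
      rw [Tw.comm]
      congr 2
      exact ((Algebra.TensorProduct.comm k T (H ⊗[k] H)).symm_apply_apply w).symm
  have e5 : ∀ t : H ⊗[k] (H ⊗[k] H), Algebra.TensorProduct.assoc k k k H H T
      ((Algebra.TensorProduct.comm k T (H ⊗[k] H)) (Algebra.TensorProduct.map i (.id k _) t)) =
      IsDoublePair.emb i (sw₂₃ k H (sw₁₂ k H t)) := fun t => by
    induction t using FDMod.ind₃ with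
    | h0 => simp
    | ha x y hx hy => simp only [map_add, hx, hy]
    | ht a b c => simp
  rw [e1, e2, e3, e4, FDMod.Tw.assoc_symm, FDMod.Tw.assoc_symm, e5]
  simp only [← Module.End.mul_apply, ← map_mul, ← mul_assoc]
  rfl

include hV hb in
lemma tenL_lin (X Y : FDMod Q) (t : X.V ⊗[k] (Y.V ⊗[k] V.V)) : (tenL b X Y).lin t =
    rot X.V Y.V V.V (tensorAct X.ρ (tensorAct Y.ρ τ)
      (Algebra.TensorProduct.map (.id k H) Algebra.TensorProduct.includeRight c *
        IsDoublePair.emb i (sw₂₃ k H (Q.Φ⁻¹).val) * (1 : H) ⊗ₜ[k] c) t) := by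
  unfold tenL
  simp only [FDMod.comp_lin]
  set c₁ := (TensorProduct.comm k Y.V V.V).toLinearMap.lTensor X.V with hc₁
  set a₂ := (TensorProduct.assoc k X.V V.V Y.V).symm.toLinearMap with ha₂
  set c₂ := (TensorProduct.comm k X.V V.V).toLinearMap.rTensor Y.V with hc₂
  have e0 : c₂ ∘ₗ a₂ ∘ₗ c₁ = (rot X.V Y.V V.V).toLinearMap := by
    apply TensorProduct.ext; ext x y z; simp [hc₁, ha₂, hc₂, rot]
  have e0' : ∀ s, rot X.V Y.V V.V s = c₂ (a₂ (c₁ s)) := fun s => congrArg (fun f => f s) e0.symm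
  have e1 : (X ◁ b Y).lin t = c₁ (tensorAct X.ρ (tensorAct Y.ρ τ) ((1 : H) ⊗ₜ c) t) := by
    rw [FDMod.whiskerLeft_lin, hb, LinearMap.lTensor_comp, LinearMap.comp_apply,
      FDMod.lTensor_tensorAct X.ρ]
  have e2 : ∀ s, (α_ X V Y).inv.lin (c₁ s) = a₂ (c₁ (tensorAct X.ρ (tensorAct Y.ρ τ)
      (IsDoublePair.emb i (sw₂₃ k H (Q.Φ⁻¹).val)) s)) := fun s => by
    change a₂ (tensorAct X.ρ (tensorAct V.ρ Y.ρ) (Q.Φ⁻¹).val (c₁ s)) = _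
    have tw : Tw c₁ (tensorAct X.ρ (tensorAct Y.ρ V.ρ)) (tensorAct X.ρ (tensorAct V.ρ Y.ρ))
      (Algebra.TensorProduct.map (.id k H) (Algebra.TensorProduct.comm k H H).toAlgHom) :=
      Tw.id.map Tw.comm
    have h0 := tw.eq (sw₂₃ k H (Q.Φ⁻¹).val) s
    rw [show Algebra.TensorProduct.map (.id k H) (Algebra.TensorProduct.comm k H H).toAlgHom
      (sw₂₃ k H (Q.Φ⁻¹).val) = _ from FDMod.sw₂₃_inv (Q.Φ⁻¹).val] at h0
    rw [h0, hV]
    have h1 := tensorAct_comp Y.ρ τ (.id k H) i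
    have h2 := tensorAct_comp X.ρ (tensorAct Y.ρ τ) (.id k H)
        (Algebra.TensorProduct.map (.id k H) i)
    rw [AlgHom.comp_id] at h1 h2
    rw [h1, h2]; rfl
  have e3 : ∀ s, (b X ▷ Y).lin (a₂ (c₁ s)) = c₂ (a₂ (c₁ (tensorAct X.ρ (tensorAct Y.ρ τ)
      (Algebra.TensorProduct.map (.id k H) Algebra.TensorProduct.includeRight c) s))) := fun s => by
    rw [FDMod.whiskerRight_lin, hb, LinearMap.rTensor_comp, LinearMap.comp_apply,
      FDMod.rTensor_tensorAct (tensorAct X.ρ τ) Y.ρ, FDMod.Tw.assoc_symm]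
    congr 2
    have tw : Tw c₁ (tensorAct X.ρ (tensorAct Y.ρ τ)) (tensorAct X.ρ (tensorAct τ Y.ρ))
      (Algebra.TensorProduct.map (.id k H) (Algebra.TensorProduct.comm k H T).toAlgHom) :=
      Tw.id.map Tw.comm
    rw [← tw.eq]
    congr 2
    clear e1 hb
    induction c with
    | zero => simp
    | add x y hx hy => simp only [map_add, add_tmul, hx, hy]
    | tmul a b => simp
  rw [e1, e2, e3, e0']
  simp only [← Module.End.mul_apply, ← map_mul, ← mul_assoc]

end HalfBraidingElement

section YDRep

variable {k H : Type u} [Field k] [Ring H] [Algebra k H]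

/-- A finite-dimensional representation of an algebra. -/
structure AlgRep (k B : Type u) [Field k] [Ring B] [Algebra k B] where
  V : Type u
  [addCommGroup : AddCommGroup V]
  [module : Module k V]
  [finite : FiniteDimensional k V]
  ρ : B →ₐ[k] Module.End k V

attribute [instance] AlgRep.addCommGroup AlgRep.module AlgRep.finite

/-- `f` intertwines the actions of two representations. -/
abbrev AlgRep.Intertwines {B : Type u} [Ring B] [Algebra k B] (X Y : AlgRep k B)
    (f : X.V →ₗ[k] Y.V) :
    Prop := ∀ b v, f (X.ρ b v) = Y.ρ b (f v)

lemma tensorAct_lmul {B : Type u} [Ring B] [Algebra k B] (s t : H ⊗[k] B) :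
    tensorAct (Algebra.lmul k H) (Algebra.lmul k B) s t = s * t := by
  have : tensorAct (Algebra.lmul k H) (Algebra.lmul k B) = Algebra.lmul k (H ⊗[k] B) := by
    ext <;> simp
  rw [this]; rfl

/-- Elements of `H ⊗ End V` are determined by their action on the elements `1 ⊗ v`. -/
lemma tensorAct_end_ext {B V : Type u} [Ring B] [Algebra k B] [AddCommGroup V] [Module k V]
    {s t : B ⊗[k] Module.End k V} [Module.Finite k B] [FiniteDimensional k V]
    (h : ∀ v : V, tensorAct (Algebra.lmul k B) (.id k _) s (1 ⊗ₜ v) =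
      tensorAct (Algebra.lmul k B) (.id k _) t (1 ⊗ₜ v)) : s = t := by
  refine slice_ext fun φ => LinearMap.ext fun v => ?_
  have key : ∀ s : B ⊗[k] Module.End k V, slice φ s v =
      slice φ (tensorAct (Algebra.lmul k B) (.id k _) s ((1 : B) ⊗ₜ[k] v)) := fun s => by
    induction s with
    | zero => simp
    | add x y hx hy => simp only [map_add, LinearMap.add_apply, hx, hy]
    | tmul a f => simp
  rw [key, key, h]

lemma comm_rTensor {V W X : Type u} [AddCommGroup V] [Module k V] [AddCommGroup W] [Module k W]
    [AddCommGroup X] [Module k X] (f : V →ₗ[k] W) (t : V ⊗[k] X) :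
    TensorProduct.comm k W X (f.rTensor X t) = f.lTensor X (TensorProduct.comm k V X t) := by
  induction t with
  | zero => simp
  | add x y hx hy => simp only [map_add, hx, hy]
  | tmul v x => simp

lemma comm_lTensor {V W X : Type u} [AddCommGroup V] [Module k V] [AddCommGroup W] [Module k W]
    [AddCommGroup X] [Module k X] (f : V →ₗ[k] W) (t : X ⊗[k] V) :
    TensorProduct.comm k X W (f.lTensor X t) = f.rTensor X (TensorProduct.comm k X V t) := by
  induction t with
  | zero => simp
  | add x y hx hy => simp only [map_add, hx, hy]
  | tmul v x => simp

variable [Module.Finite k H] {Q : QuasiHopf k H}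

namespace QuantumDouble

/-- The `H`-module underlying a `D(H)`-module. -/
abbrev res (X : AlgRep k (QuantumDouble Q)) : FDMod Q.toQuasiBialgebra := ⟨X.V, X.ρ.comp (incl Q)⟩

lemma comm_canon (h : H) : canon (gen Q) * Algebra.TensorProduct.map (.id k H) (incl Q) (Q.Δ h) =
    Algebra.TensorProduct.map (.id k H) (incl Q) (TensorProduct.comm k H H (Q.Δ h)) *
      canon (gen Q) := (isDoublePair Q).comm h

/-- The action of `𝐃`, followed by the flip, is a half braiding. -/
def halfHom (V : AlgRep k (QuantumDouble Q)) (X : FDMod Q.toQuasiBialgebra) :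
    X ⊗ res V ⟶ res V ⊗ X where
  lin := (TensorProduct.comm k X.V V.V).toLinearMap ∘ₗ tensorAct X.ρ V.ρ (canon (gen Q))
  comm h t := by
    change X.V ⊗[k] V.V at t
    have e1 : ∀ s : H ⊗[k] H, tensorAct X.ρ (res V).ρ s = tensorAct X.ρ V.ρ
        (Algebra.TensorProduct.map (.id k H) (incl Q) s) := fun s => by
      have h1 := tensorAct_comp X.ρ V.ρ (.id k H) (incl Q)
      rw [AlgHom.comp_id] at h1
      change tensorAct X.ρ (V.ρ.comp (incl Q)) s = _
      rw [h1]; rfl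
    have e2 : (X ⊗ res V).ρ h t = tensorAct X.ρ V.ρ
        (Algebra.TensorProduct.map (.id k H) (incl Q) (Q.Δ h)) t := by
      rw [← e1]; rfl
    have e3 : ∀ s, (res V ⊗ X).ρ h ((TensorProduct.comm k X.V V.V) s) =
        (TensorProduct.comm k X.V V.V) (tensorAct X.ρ V.ρ (Algebra.TensorProduct.map (.id k H)
          (incl Q) (TensorProduct.comm k H H (Q.Δ h))) s) := fun s => by
      rw [← e1]
      refine Eq.trans ?_ (Tw.comm (ρ := X.ρ) (σ := (res V).ρ)
        (TensorProduct.comm k H H (Q.Δ h)) s).symm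
      have : (Algebra.TensorProduct.comm k H H).toAlgHom (TensorProduct.comm k H H (Q.Δ h)) =
        Q.Δ h := (Algebra.TensorProduct.comm k H H).left_inv _
      rw [this]; rfl
    simp only [LinearMap.comp_apply, LinearEquiv.coe_coe]
    rw [e2, e3, ← Module.End.mul_apply, ← map_mul, comm_canon, map_mul, Module.End.mul_apply]

lemma halfHom_isHB (V : AlgRep k (QuantumDouble Q)) : IsHB (halfHom V) where
  nat {X Y} f := FDMod.hom_ext fun t => by
    have h1 := (FDMod.Hom.tw f).map (Tw.id (ρ := V.ρ)) (canon (gen Q)) t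
    rw [Algebra.TensorProduct.map_id] at h1
    change TensorProduct.comm k Y.V V.V (tensorAct Y.ρ V.ρ (canon (gen Q))
      (f.lin.rTensor V.V t)) = f.lin.lTensor V.V (TensorProduct.comm k X.V V.V
        (tensorAct X.ρ V.ρ (canon (gen Q)) t))
    refine (congrArg _ h1.symm).trans ?_
    exact comm_rTensor f.lin _
  unit := FDMod.hom_ext fun t => by
    change k ⊗[k] V.V at t
    have key : ∀ (s : H ⊗[k] QuantumDouble Q) (t : k ⊗[k] V.V), TensorProduct.rid k V.V
        (TensorProduct.comm k k V.V (tensorAct (FDMod.one (Q := Q.toQuasiBialgebra)).ρ V.ρ s t)) =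
        V.ρ (slice Q.ε.toLinearMap s) (TensorProduct.lid k V.V t) := fun s t => by
      induction s with
      | zero => simp
      | add x y hx hy => simp only [map_add, LinearMap.add_apply, hx, hy]
      | tmul a b =>
        induction t with
        | zero => simp
        | add x y hx hy => simp only [map_add, hx, hy]
        | tmul c v =>
          simp [mul_smul]
          exact smul_comm _ _ _
    apply (TensorProduct.rid k V.V).injective
    refine (key _ t).trans ?_
    rw [slice_canon, (isDoublePair Q).counit, map_one]
    exact ((TensorProduct.rid k V.V).apply_symm_apply _).symm
  ten X Y := by
    have h : tenL (halfHom V) X Y = tenR (halfHom V) X Y := FDMod.hom_ext fun t => by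
      rw [tenL_lin (i := incl Q) (τ := V.ρ) rfl (fun _ => rfl),
        tenR_lin (i := incl Q) (τ := V.ρ) rfl (fun _ => rfl), (isDoublePair Q).hex_inv]
    unfold tenL tenR at h
    calc _ = (α_ X Y (res V)).hom ≫ ((α_ X Y (res V)).inv ≫ halfHom V (X ⊗ Y) ≫
          (α_ (res V) X Y).inv) ≫ (α_ (res V) X Y).hom := by simp
      _ = _ := by rw [← h]; simp

/-- The Yetter-Drinfeld module defined by a `D(H)`-module. -/
def toYD (V : AlgRep k (QuantumDouble Q)) : YD Q := YD.ofHB (res V) (halfHom V) (halfHom_isHB V)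

lemma toYD_half (V : AlgRep k (QuantumDouble Q)) : (toYD V).half = halfHom V := YD.ofHB_half _ _ _

end QuantumDouble

namespace YD

/-- The endomorphism `v ↦ φ(v₁) v₀` of a Yetter-Drinfeld module. -/
def dAct (V : YD Q) : Module.Dual k H →ₗ[k] Module.End k V.V :=
  LinearMap.mk₂ k (fun φ v => TensorProduct.rid k V.V (φ.lTensor V.V (V.coact v)))
    (by intro φ ψ v; simp [LinearMap.lTensor_add]) (by intro c φ v; simp [LinearMap.lTensor_smul])
    (by intro φ v w; simp) (by intro c φ v; simp)

lemma half_lin (V : YD Q) (X : FDMod Q.toQuasiBialgebra) : (V.half X).lin =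
    (TensorProduct.comm k X.V V.V).toLinearMap ∘ₗ tensorAct X.ρ (.id k _) (canon V.dAct) := by
  refine TensorProduct.ext' fun x v => ?_
  change halfBraid X.ρ V.coact (x ⊗ₜ v) = _
  rw [halfBraid_tmul, canon_eq_sum]
  generalize Module.Basis.ofVectorSpace k H = b
  simp only [map_sum, LinearMap.comp_apply, LinearMap.sum_apply, tensorAct_tmul,
    TensorProduct.map_tmul, LinearEquiv.coe_coe, TensorProduct.comm_tmul, AlgHom.coe_id, id_eq,
    YD.dAct, LinearMap.mk₂_apply]
  generalize V.coact v = t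
  induction t with
  | zero => simp
  | add x y hx hy => simp only [map_add, add_tmul, Finset.sum_add_distrib, hx, hy]
  | tmul w h =>
    simp only [LinearMap.lTensor_tmul, TensorProduct.rid_tmul, LinearMap.comp_apply,
      smul_tmul, ← tmul_sum]
    congr 1
    conv_lhs => rw [← b.sum_repr h]
    simp only [map_sum, map_smul]
    exact Finset.sum_congr rfl fun j _ => by simp

lemma isDoublePair (V : YD Q) : IsDoublePair Q V.ρ V.dAct where
  counit := LinearMap.ext fun v => V.coact_counit v
  comm h := tensorAct_end_ext fun v => by
    have e1 : ∀ (s : H ⊗[k] H) t, tensorAct (Algebra.lmul k H) V.ρ s t =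
        tensorAct (Algebra.lmul k H) (.id k _) (V.ρ.toLinearMap.lTensor H s) t := fun s t => by
      have h1 := tensorAct_comp (Algebra.lmul k H) (.id k _) (.id k H) V.ρ
      rw [AlgHom.comp_id, AlgHom.id_comp] at h1
      rw [h1]; rfl
    have h1 := (V.half reg).comm h ((1 : H) ⊗ₜ v)
    rw [half_lin] at h1
    have h2 := congrArg (TensorProduct.comm k H V.V).symm h1
    have e3 : ∀ s, (TensorProduct.comm k H V.V).symm ((V.toFDMod ⊗ reg).ρ h
        (TensorProduct.comm k H V.V s)) =
        tensorAct (Algebra.lmul k H) V.ρ (TensorProduct.comm k H H (Q.Δ h)) s := fun s => by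
      apply (TensorProduct.comm k H V.V).injective
      rw [LinearEquiv.apply_symm_apply]
      refine Eq.trans ?_ (Tw.comm (ρ := Algebra.lmul k H) (σ := V.ρ)
        (TensorProduct.comm k H H (Q.Δ h)) s).symm
      have : (Algebra.TensorProduct.comm k H H).toAlgHom (TensorProduct.comm k H H (Q.Δ h)) =
        Q.Δ h := (Algebra.TensorProduct.comm k H H).left_inv _
      rw [this]; rfl
    rw [map_mul, map_mul, Module.End.mul_apply, Module.End.mul_apply, ← e1, ← e1, ← e3]
    refine Eq.trans ?_ h2
    exact ((TensorProduct.comm k H V.V).symm_apply_apply _).symm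
  hex := (IsDoublePair.hex_iff Q).2 (by
    have h1 := fun v : V.V => congrArg (fun f => f.lin ((1 : H) ⊗ₜ[k] ((1 : H) ⊗ₜ[k] v)))
      (half_ten V reg reg)
    refine slice_ext fun φ => slice_ext fun ψ => LinearMap.ext fun v => ?_
    have key : ∀ s : H ⊗[k] (H ⊗[k] Module.End k V.V), slice ψ (slice φ s) v =
        slice ψ (slice φ (tensorAct (Algebra.lmul k H) (tensorAct (Algebra.lmul k H) (.id k _)) s
          ((1 : H) ⊗ₜ[k] ((1 : H) ⊗ₜ[k] v)))) := fun s => by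
      induction s with
      | zero => simp
      | add x y hx hy => simp only [map_add, LinearMap.add_apply, hx, hy]
      | tmul a s =>
        induction s with
        | zero => simp
        | add x y hx hy => simp only [map_add, tmul_add, LinearMap.add_apply, hx, hy]
        | tmul b f => simp
    have h2 := h1 v
    simp only at h2
    rw [tenL_lin (i := V.ρ) (τ := .id k _) (AlgHom.id_comp _).symm (half_lin V),
      tenR_lin (i := V.ρ) (τ := .id k _) (AlgHom.id_comp _).symm (half_lin V)] at h2
    rw [key, key]
    exact congrArg (fun x => slice ψ (slice φ x)) ((rot H H V.V).injective h2))

/-- The `D(H)`-module defined by a Yetter-Drinfeld module. -/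
abbrev toRep (V : YD Q) : AlgRep k (QuantumDouble Q) := ⟨V.V, QuantumDouble.lift V.isDoublePair⟩

lemma toRep_incl (V : YD Q) (h : H) : V.toRep.ρ (QuantumDouble.incl Q h) = V.ρ h :=
  QuantumDouble.lift_incl V.isDoublePair h

lemma toRep_gen (V : YD Q) (φ : Module.Dual k H) : V.toRep.ρ (QuantumDouble.gen Q φ) = V.dAct φ :=
  QuantumDouble.lift_gen V.isDoublePair φ

/-- The half braidings of a Yetter-Drinfeld module are given by the action of `𝐃`. -/
lemma half_eq (V : YD Q) (X : FDMod Q.toQuasiBialgebra) (t : X.V ⊗[k] V.V) : (V.half X).lin t =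
    TensorProduct.comm k X.V V.V (tensorAct X.ρ V.toRep.ρ (canon (QuantumDouble.gen Q)) t) := by
  have e : V.dAct = V.toRep.ρ.toLinearMap ∘ₗ QuantumDouble.gen Q :=
    LinearMap.ext fun φ => (toRep_gen V φ).symm
  have h1 := tensorAct_comp X.ρ (.id k _) (.id k H) V.toRep.ρ
  rw [AlgHom.comp_id, AlgHom.id_comp] at h1
  rw [half_lin, e, canon_comp]
  exact congrArg (fun f => TensorProduct.comm k X.V V.V (f (canon (QuantumDouble.gen Q)) t)) h1.symm

/-- A morphism of Yetter-Drinfeld modules is `D(H)`-linear. -/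
lemma Hom.intertwines {V W : YD Q} (f : V ⟶ W) : AlgRep.Intertwines V.toRep W.toRep f.hom.lin := by
  intro b
  induction b using QuantumDouble.induction with
  | hone => intro v; rw [map_one, map_one]; rfl
  | hadd a b ha hb => intro v; simp only [map_add, LinearMap.add_apply, ha, hb]
  | hsmul c a ha => intro v; simp only [map_smul, LinearMap.smul_apply, ha]
  | hincl h a ha =>
    intro v
    rw [map_mul, map_mul, toRep_incl, toRep_incl, Module.End.mul_apply, Module.End.mul_apply, ← ha]
    exact f.hom.comm h _
  | hgen φ a ha =>
    intro v
    rw [map_mul, map_mul, toRep_gen, toRep_gen, Module.End.mul_apply, Module.End.mul_apply, ← ha]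
    generalize V.toRep.ρ a v = w
    change V.V at w
    change f.hom.lin (TensorProduct.rid k V.V (φ.lTensor V.V (V.coact w))) =
      TensorProduct.rid k W.V (φ.lTensor W.V (W.coact (f.hom.lin w)))
    rw [← f.colin]
    generalize V.coact w = t
    induction t with
    | zero => simp
    | add x y hx hy => simp only [map_add, hx, hy]
    | tmul v h => simp

/-- A `D(H)`-linear map is a morphism of Yetter-Drinfeld modules. -/
def homOfIntertwines {V W : YD Q} (f : V.V →ₗ[k] W.V) (h : AlgRep.Intertwines V.toRep W.toRep f) :
    V ⟶ W :=
  homMk ⟨f, fun a v => by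
    have := h (QuantumDouble.incl Q a) v
    rwa [toRep_incl, toRep_incl] at this⟩ fun X => FDMod.hom_ext fun t => by
    change X.V ⊗[k] V.V at t
    change f.rTensor X.V ((V.half X).lin t) = (W.half X).lin (f.lTensor X.V t)
    rw [half_eq, half_eq, ← comm_lTensor]
    have h1 := (Tw.id (ρ := X.ρ)).map (f := .id k H) (g := .id k (QuantumDouble Q)) h
      (canon (QuantumDouble.gen Q)) t
    rw [Algebra.TensorProduct.map_id] at h1
    exact congrArg (TensorProduct.comm k X.V W.V) h1

/-- Passing from `D(H)`-modules to Yetter-Drinfeld modules and back gives the same action. -/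
lemma toRep_toYD (V : AlgRep k (QuantumDouble Q)) (b : QuantumDouble Q) :
    (QuantumDouble.toYD V).toRep.ρ b = V.ρ b := by
  have hg : ∀ φ : Module.Dual k H, (QuantumDouble.toYD V).dAct φ = V.ρ (QuantumDouble.gen Q φ) :=
    fun φ => LinearMap.ext fun v => by
      have key : ∀ (s : H ⊗[k] QuantumDouble Q) (v : V.V), TensorProduct.rid k V.V (φ.lTensor V.V
          (TensorProduct.comm k H V.V (tensorAct (Algebra.lmul k H) V.ρ s ((1 : H) ⊗ₜ v)))) =
          V.ρ (slice φ s) v := fun s v => by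
        induction s with
        | zero => simp
        | add x y hx hy => simp only [map_add, LinearMap.add_apply, hx, hy]
        | tmul a b => simp
      exact (key _ v).trans (congrArg (fun b => V.ρ b v) (slice_canon _ _))
  induction b using QuantumDouble.induction with
  | hone => rw [map_one, map_one]; rfl
  | hadd a b ha hb => rw [map_add, map_add, ha, hb]; rfl
  | hsmul c a ha => rw [map_smul, map_smul, ha]; rfl
  | hincl h a ha => rw [map_mul, map_mul, ha, toRep_incl]; rfl
  | hgen φ a ha => rw [map_mul, map_mul, ha, toRep_gen, hg]; rfl

end YD

end YDRep

/-! ### Duals of Yetter-Drinfeld modules -/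

section
variable {C : Type u} [Category.{v} C] [MonoidalCategory C] {V D : C} [ExactPairing V D]
  {b : ∀ X : C, X ⊗ V ⟶ V ⊗ X} [∀ X, IsIso (mateHB D b X)]

/-- The evaluation is a morphism for the half braidings of `V^* ⊗ V`. -/
lemma tensorHB_ev (X : C) : tensorHB (fun X => inv (mateHB D b X)) b X ≫ ε_ V D ▷ X =
    X ◁ ε_ V D ≫ (ρ_ X).hom ≫ (λ_ X).inv := by
  have h := mateHB_ev (D := D) (b := b) X
  have h2 : X ◁ ε_ V D = (α_ X D V).inv ≫ inv (mateHB D b X ▷ V) ≫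
    ((α_ D X V).hom ≫ D ◁ b X ≫ (α_ D V X).inv ≫ ε_ V D ▷ X ≫ (λ_ X).hom ≫ (ρ_ X).inv) := by
    rw [← h]; simp
  rw [h2]
  unfold tensorHB
  simp

/-- The coevaluation is a morphism for the half braidings of `V ⊗ V^*`. -/
lemma tensorHB_coev (X : C) : ((ρ_ X).hom ≫ (λ_ X).inv) ≫ η_ V D ▷ X =
    X ◁ η_ V D ≫ tensorHB b (fun X => inv (mateHB D b X)) X := by
  have h := mateHB_coev (D := D) (b := b) X
  have h2 : X ◁ η_ V D ≫ (α_ X V D).inv ≫ b X ▷ D ≫ (α_ V X D).hom = (ρ_ X).hom ≫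
    ((λ_ X).inv ≫ η_ V D ▷ X ≫ (α_ V D X).hom ≫ V ◁ mateHB D b X) := by
    rw [h]; simp
  unfold tensorHB
  have h3 : X ◁ η_ V D ≫ (α_ X V D).inv ≫ b X ▷ D ≫ (α_ V X D).hom ≫ V ◁ inv (mateHB D b X) ≫
      (α_ V D X).inv = (X ◁ η_ V D ≫ (α_ X V D).inv ≫ b X ▷ D ≫ (α_ V X D).hom) ≫
      V ◁ inv (mateHB D b X) ≫ (α_ V D X).inv := by simp
  rw [h3, h2]
  simp

end

namespace YD
variable {k H : Type u} [Field k] [Ring H] [Algebra k H] [Module.Finite k H] {Q : QuasiHopf k H}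

/-- The mate is invertible because every module is a left dual. -/
instance isIso_mateHB (V : YD Q) (X : FDMod Q.toQuasiBialgebra) :
    IsIso (mateHB (FDMod.dual V.toFDMod) V.half X) := by
  obtain ⟨Y, ⟨p⟩⟩ := FDMod.exists_predual X
  exact (mateHB_isHBRev V.half_isHB).isIso X Y

/-- The left dual of a Yetter-Drinfeld module: the dual module, with the inverse of the mate of the
half braiding. -/
def dual (V : YD Q) : YD Q :=
  ofHB (FDMod.dual V.toFDMod) (fun X => inv (mateHB (FDMod.dual V.toFDMod) V.half X))
    (mateHB_isHBRev V.half_isHB).inv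

lemma dual_half (V : YD Q) :
    (dual V).half = fun X => inv (mateHB (FDMod.dual V.toFDMod) V.half X) := ofHB_half _ _ _

/-- The evaluation. -/
def ev (V : YD Q) : dual V ⊗ V ⟶ 𝟙_ (YD Q) :=
  homMk (FDMod.ev V.toFDMod) fun X => by
    change (tensor (dual V) V).half X ≫ _ = _ ≫ one.half X
    rw [tensor_half, one_half, dual_half]
    exact tensorHB_ev (D := FDMod.dual V.toFDMod) (V := V.toFDMod) X

/-- The coevaluation. -/
def coev (V : YD Q) : 𝟙_ (YD Q) ⟶ V ⊗ dual V :=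
  homMk (FDMod.coev V.toFDMod) fun X => by
    change one.half X ≫ _ = _ ≫ (tensor V (dual V)).half X
    rw [tensor_half, one_half, dual_half]
    exact tensorHB_coev X

instance (V : YD Q) : ExactPairing V (dual V) where
  evaluation' := ev V
  coevaluation' := coev V
  coevaluation_evaluation' := Hom.ext (by
    change (𝟙 (FDMod.dual V.toFDMod) ⊗ₘ FDMod.coev V.toFDMod) ≫
      (α_ (FDMod.dual V.toFDMod) V.toFDMod (FDMod.dual V.toFDMod)).inv ≫
      (FDMod.ev V.toFDMod ⊗ₘ 𝟙 (FDMod.dual V.toFDMod)) =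
      (ρ_ (FDMod.dual V.toFDMod)).hom ≫ (λ_ (FDMod.dual V.toFDMod)).inv
    rw [id_tensorHom, tensorHom_id]
    exact ExactPairing.coevaluation_evaluation V.toFDMod (FDMod.dual V.toFDMod))
  evaluation_coevaluation' := Hom.ext (by
    change (FDMod.coev V.toFDMod ⊗ₘ 𝟙 V.toFDMod) ≫
      (α_ V.toFDMod (FDMod.dual V.toFDMod) V.toFDMod).hom ≫
      (𝟙 V.toFDMod ⊗ₘ FDMod.ev V.toFDMod) =
      (λ_ V.toFDMod).hom ≫ (ρ_ V.toFDMod).inv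
    rw [id_tensorHom, tensorHom_id]
    exact ExactPairing.evaluation_coevaluation V.toFDMod (FDMod.dual V.toFDMod))

end YD

/-! ### Reconstruction of quasi-Hopf structures from actions -/

section Reconstruction

variable {k A B : Type u} [Field k] [Ring A] [Algebra k A] [Ring B] [Algebra k B]

lemma lmul₂ (k A B : Type u) [Field k] [Ring A] [Algebra k A] [Ring B] [Algebra k B] :
    tensorAct (Algebra.lmul k A) (Algebra.lmul k B) = Algebra.lmul k (A ⊗[k] B) := by
  ext <;> simp

/-- The regular representation. -/
abbrev AlgRep.reg (k B : Type u) [Field k] [Ring B] [Algebra k B] [Module.Finite k B] :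
    AlgRep k B := ⟨B, Algebra.lmul k B⟩

/-- Functorial actions of `B` on tensor products, on duals and on `k`, for representations of `B`,
which extend those given by a quasi-Hopf structure on `A` along `j : A → B` and are compatible with
the associator, the unit constraints, evaluation and coevaluation of `A`. -/
structure TensorData (Q : QuasiHopf k A) (j : A →ₐ[k] B) where
  one : B →ₐ[k] k
  ten : ∀ X Y : AlgRep k B, B →ₐ[k] Module.End k (X.V ⊗[k] Y.V)
  dual : ∀ X : AlgRep k B, B →ₐ[k] Module.End k (Module.Dual k X.V)
  one_res : ∀ a, one (j a) = Q.ε a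
  ten_res : ∀ X Y a, ten X Y (j a) = tensorAct X.ρ Y.ρ (Algebra.TensorProduct.map j j (Q.Δ a))
  dual_res : ∀ X a φ, dual X (j a) φ = φ ∘ₗ X.ρ (j (Q.S a))
  ten_nat : ∀ {X Y X' Y' : AlgRep k B} (f : X.V →ₗ[k] X'.V) (g : Y.V →ₗ[k] Y'.V),
    X.Intertwines X' f → Y.Intertwines Y' g → ∀ b t,
      TensorProduct.map f g (ten X Y b t) = ten X' Y' b (TensorProduct.map f g t)
  dual_nat : ∀ {X Y : AlgRep k B} (f : X.V →ₗ[k] Y.V), X.Intertwines Y f → ∀ b φ,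
    dual X b (φ ∘ₗ f) = dual Y b φ ∘ₗ f
  assoc : ∀ (X Y Z : AlgRep k B) b t,
    tensorAct X.ρ (tensorAct Y.ρ Z.ρ)
        (Algebra.TensorProduct.map j (Algebra.TensorProduct.map j j) Q.Φ.val)
        (TensorProduct.assoc k X.V Y.V Z.V (ten ⟨X.V ⊗[k] Y.V, ten X Y⟩ Z b t)) =
      ten X ⟨Y.V ⊗[k] Z.V, ten Y Z⟩ b (tensorAct X.ρ (tensorAct Y.ρ Z.ρ)
        (Algebra.TensorProduct.map j (Algebra.TensorProduct.map j j) Q.Φ.val)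
        (TensorProduct.assoc k X.V Y.V Z.V t))
  lid : ∀ (X : AlgRep k B) b t, TensorProduct.lid k X.V
    (ten ⟨k, (Algebra.lmul k k).comp one⟩ X b t) = X.ρ b (TensorProduct.lid k X.V t)
  rid : ∀ (X : AlgRep k B) b t, TensorProduct.rid k X.V
    (ten X ⟨k, (Algebra.lmul k k).comp one⟩ b t) = X.ρ b (TensorProduct.rid k X.V t)
  ev : ∀ (X : AlgRep k B) b t, contractLeft k X.V ((X.ρ (j Q.α)).lTensor _
    (ten ⟨Module.Dual k X.V, dual X⟩ X b t)) =
      one b * contractLeft k X.V ((X.ρ (j Q.α)).lTensor _ t)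
  coev : ∀ (X : AlgRep k B) b, ten X ⟨Module.Dual k X.V, dual X⟩ b
    ((X.ρ (j Q.β)).rTensor _ (coevaluation k X.V 1)) =
      one b • (X.ρ (j Q.β)).rTensor _ (coevaluation k X.V 1)

namespace TensorData

variable {Q : QuasiHopf k A} {j : A →ₐ[k] B}

lemma toEnd_tensorAct {V : Type u} [AddCommGroup V] [Module k V] (ρ : B →ₐ[k] Module.End k V)
    (σ : B →ₐ[k] Module.End k (Module.Dual k V)) (S : B →ₗ[k] B)
    (hσ : ∀ b φ, σ b φ = φ ∘ₗ ρ (S b)) (t : B ⊗[k] B) (s : V ⊗[k] Module.Dual k V) (c : B)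
    (hs : FDMod.toEnd V s = ρ c) : FDMod.toEnd V (tensorAct ρ σ t s) =
      ρ (LinearMap.mul' k B (TensorProduct.map (LinearMap.mulRight k c) S t)) := by
  induction t with
  | zero => simp
  | add x y hx hy => simp only [map_add, LinearMap.add_apply, hx, hy]
  | tmul a b =>
    have : ∀ s, FDMod.toEnd V (tensorAct ρ σ (a ⊗ₜ b) s) =
        ρ a * FDMod.toEnd V s * ρ (S b) := by
      intro s
      induction s with
      | zero => simp
      | add x y hx hy => simp only [map_add, hx, hy, mul_add, add_mul]
      | tmul v φ => ext w; simp [hσ]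
    rw [this, hs]; simp

lemma toEnd_coevaluation {V : Type u} [AddCommGroup V] [Module k V] [FiniteDimensional k V]
    (f : Module.End k V) :
    FDMod.toEnd V (f.rTensor (Module.Dual k V) (coevaluation k V 1)) = f := by
  rw [coevaluation_apply_one]
  simp only [map_sum, LinearMap.rTensor_tmul]
  refine LinearMap.ext fun w => ?_
  rw [LinearMap.sum_apply]
  simp only [FDMod.toEnd_tmul, ← map_smul, ← map_sum]
  congr 1
  exact (Module.Basis.ofVectorSpace k V).sum_repr w

/-- The image of the reassociator. -/
def Φ : (B ⊗[k] (B ⊗[k] B))ˣ :=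
  Units.map (Algebra.TensorProduct.map j (Algebra.TensorProduct.map j j)).toRingHom.toMonoidHom Q.Φ

lemma Φ_val : (TensorData.Φ (Q := Q) (j := j)).val =
    Algebra.TensorProduct.map j (Algebra.TensorProduct.map j j) Q.Φ.val := rfl

lemma Φ_inv_val : ((TensorData.Φ (Q := Q) (j := j))⁻¹).val =
    Algebra.TensorProduct.map j (Algebra.TensorProduct.map j j) (Q.Φ⁻¹).val := rfl

variable [Module.Finite k B] (T : TensorData Q j)

/-- The map `b ↦ b x` is linear over `B`. -/
lemma intertwines_orbit (X : AlgRep k B) (x : X.V) :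
    (AlgRep.reg k B).Intertwines X (LinearMap.applyₗ x ∘ₗ X.ρ.toLinearMap) := fun b c => by
  have : X.ρ (b * c) x = X.ρ b (X.ρ c x) := by rw [map_mul]; rfl
  exact this

/-- The coproduct `b (1 ⊗ 1)`. -/
def Δelt (b : B) : B ⊗[k] B :=
  T.ten (AlgRep.reg k B) (AlgRep.reg k B) b ((1 : B) ⊗ₜ[k] (1 : B))

/-- By naturality, applied to the maps `b ↦ b x` and `b ↦ b y`, the action on a tensor product is
determined by the action on `1 ⊗ 1` in the tensor square of the regular representation. -/
lemma ten_eq (X Y : AlgRep k B) (b : B) : T.ten X Y b = tensorAct X.ρ Y.ρ (T.Δelt b) := by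
  refine TensorProduct.ext' fun x y => ?_
  have h := T.ten_nat _ _ (intertwines_orbit X x) (intertwines_orbit Y y) b
    ((1 : B) ⊗ₜ[k] (1 : B))
  have e : TensorProduct.map (LinearMap.applyₗ x ∘ₗ X.ρ.toLinearMap)
      (LinearMap.applyₗ y ∘ₗ Y.ρ.toLinearMap) ((1 : B) ⊗ₜ[k] (1 : B)) = x ⊗ₜ[k] y := by
    simp
  rw [← e]
  refine h.symm.trans ?_
  rw [e]
  have key : ∀ s : B ⊗[k] B, TensorProduct.map (LinearMap.applyₗ x ∘ₗ X.ρ.toLinearMap)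
      (LinearMap.applyₗ y ∘ₗ Y.ρ.toLinearMap) s = tensorAct X.ρ Y.ρ s (x ⊗ₜ[k] y) := fun s => by
    induction s with
    | zero => simp
    | add x y hx hy => simp only [map_add, LinearMap.add_apply, hx, hy]
    | tmul a b => simp
  exact key _

/-- The coproduct. -/
def Δ : B →ₐ[k] B ⊗[k] B :=
  AlgHom.ofLinearMap
    (LinearMap.applyₗ ((1 : B) ⊗ₜ[k] (1 : B)) ∘ₗ
      (T.ten (AlgRep.reg k B) (AlgRep.reg k B)).toLinearMap)
    (by
      change T.ten (AlgRep.reg k B) (AlgRep.reg k B) 1 ((1 : B) ⊗ₜ[k] (1 : B)) = _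
      rw [map_one]; rfl)
    (fun a b => by
      change T.ten (AlgRep.reg k B) (AlgRep.reg k B) (a * b) ((1 : B) ⊗ₜ[k] (1 : B)) =
        T.Δelt a * T.Δelt b
      rw [map_mul, ← tensorAct_lmul, ← T.ten_eq (AlgRep.reg k B) (AlgRep.reg k B)]
      rfl)

lemma ten_eq' (X Y : AlgRep k B) : T.ten X Y = (tensorAct X.ρ Y.ρ).comp T.Δ :=
  AlgHom.ext fun b => T.ten_eq X Y b

/-- The antipode, given by `φ(S b) = (b φ)(1)`. -/
def S : B →ₗ[k] B :=
  (Module.evalEquiv k B).symm.toLinearMap ∘ₗ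
    LinearMap.llcomp k _ _ _ (LinearMap.applyₗ (1 : B)) ∘ₗ (T.dual (AlgRep.reg k B)).toLinearMap

lemma apply_S (φ : Module.Dual k B) (b : B) : φ (T.S b) = T.dual (AlgRep.reg k B) b φ (1 : B) := by
  rw [← Module.Dual.eval_apply k B (T.S b) φ]
  change Module.evalEquiv k B ((Module.evalEquiv k B).symm _) φ = _
  rw [LinearEquiv.apply_symm_apply]
  rfl

/-- By naturality, applied to the maps `b ↦ b x`, the action on a dual is determined by that on the
dual of the regular representation. -/
lemma dual_eq (X : AlgRep k B) (b : B) (φ : Module.Dual k X.V) :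
    T.dual X b φ = φ ∘ₗ X.ρ (T.S b) := LinearMap.ext fun x => by
  have h := congrArg (fun f => f (1 : B)) (T.dual_nat _ (intertwines_orbit X x) b φ)
  have h2 := T.apply_S (φ ∘ₗ LinearMap.applyₗ x ∘ₗ X.ρ.toLinearMap) b
  refine Eq.trans ?_ (h2.trans h).symm
  simp

lemma dual_ext {x y : B} (h : ∀ φ : Module.Dual k B, φ x = φ y) : x = y :=
  (Module.evalEquiv k B).injective (LinearMap.ext h)

lemma S_one : T.S 1 = 1 := dual_ext fun φ => by rw [apply_S, map_one (T.dual _)]; rfl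

lemma S_mul (a b : B) : T.S (a * b) = T.S b * T.S a := dual_ext fun φ => by
  rw [apply_S, map_mul, Module.End.mul_apply, dual_eq, dual_eq]
  change φ (T.S b * (T.S a * 1)) = _
  rw [mul_one]

lemma Δ_res (a : A) : T.Δ (j a) = Algebra.TensorProduct.map j j (Q.Δ a) := by
  change T.ten (AlgRep.reg k B) (AlgRep.reg k B) (j a) ((1 : B) ⊗ₜ[k] (1 : B)) = _
  rw [T.ten_res]
  exact (tensorAct_lmul _ _).trans (mul_one _)

lemma S_res (a : A) : T.S (j a) = j (Q.S a) := dual_ext fun φ => by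
  rw [apply_S, T.dual_res]
  change φ (j (Q.S a) * 1) = _
  rw [mul_one]

lemma quasi_coassoc (b : B) :
    Algebra.TensorProduct.map (.id k B) T.Δ (T.Δ b) =
      (TensorData.Φ (Q := Q) (j := j)).val * Algebra.TensorProduct.assoc k k k B B B
        (Algebra.TensorProduct.map T.Δ (.id k B) (T.Δ b)) *
          ((TensorData.Φ (Q := Q) (j := j))⁻¹).val := by
  rw [Units.eq_mul_inv_iff_mul_eq]
  have h := T.assoc (AlgRep.reg k B) (AlgRep.reg k B) (AlgRep.reg k B) b
    (((1 : B) ⊗ₜ[k] (1 : B)) ⊗ₜ[k] (1 : B))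
  have e1 : tensorAct ((tensorAct (Algebra.lmul k B) (Algebra.lmul k B)).comp T.Δ)
      (Algebra.lmul k B) =
      (Algebra.lmul k ((B ⊗[k] B) ⊗[k] B)).comp (Algebra.TensorProduct.map T.Δ (.id k B)) := by
    have h1 := tensorAct_comp (Algebra.lmul k (B ⊗[k] B)) (Algebra.lmul k B) T.Δ (.id k B)
    rw [AlgHom.comp_id] at h1
    rw [lmul₂, h1, lmul₂]
  have e2 : tensorAct (Algebra.lmul k B)
      ((tensorAct (Algebra.lmul k B) (Algebra.lmul k B)).comp T.Δ) =
      (Algebra.lmul k (B ⊗[k] (B ⊗[k] B))).comp (Algebra.TensorProduct.map (.id k B) T.Δ) := by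
    have h1 := tensorAct_comp (Algebra.lmul k B) (Algebra.lmul k (B ⊗[k] B)) (.id k B) T.Δ
    rw [AlgHom.comp_id] at h1
    rw [lmul₂, h1, lmul₂]
  simp only [T.ten_eq'] at h
  rw [AlgHom.comp_apply, AlgHom.comp_apply, e1, e2, lmul₂, lmul₂] at h
  have h' : Algebra.TensorProduct.map j (Algebra.TensorProduct.map j j) Q.Φ.val *
      TensorProduct.assoc k B B B (Algebra.TensorProduct.map T.Δ (.id k B) (T.Δ b) * 1) =
      Algebra.TensorProduct.map (.id k B) T.Δ (T.Δ b) *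
        (Algebra.TensorProduct.map j (Algebra.TensorProduct.map j j) Q.Φ.val * 1) := h
  rw [mul_one, mul_one] at h'
  exact h'.symm

lemma counit_right (b : B) : Algebra.TensorProduct.rid k k B
    (Algebra.TensorProduct.map (.id k B) T.one (T.Δ b)) = b := by
  have h := T.rid (AlgRep.reg k B) b ((1 : B) ⊗ₜ[k] (1 : k))
  rw [T.ten_eq'] at h
  have key : ∀ s : B ⊗[k] B, TensorProduct.rid k B (tensorAct (Algebra.lmul k B)
      ((Algebra.lmul k k).comp T.one) s ((1 : B) ⊗ₜ[k] (1 : k))) =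
      Algebra.TensorProduct.rid k k B (Algebra.TensorProduct.map (.id k B) T.one s) := fun s => by
    induction s with
    | zero => simp
    | add x y hx hy => simp only [map_add, LinearMap.add_apply, hx, hy]
    | tmul a b => simp
  refine (key _).symm.trans (h.trans ?_)
  rw [TensorProduct.rid_tmul, one_smul]
  exact mul_one b

lemma counit_left (b : B) : Algebra.TensorProduct.lid k B
    (Algebra.TensorProduct.map T.one (.id k B) (T.Δ b)) = b := by
  have h := T.lid (AlgRep.reg k B) b ((1 : k) ⊗ₜ[k] (1 : B))
  rw [T.ten_eq'] at h
  have key : ∀ s : B ⊗[k] B, TensorProduct.lid k B (tensorAct ((Algebra.lmul k k).comp T.one)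
      (Algebra.lmul k B) s ((1 : k) ⊗ₜ[k] (1 : B))) =
      Algebra.TensorProduct.lid k B (Algebra.TensorProduct.map T.one (.id k B) s) := fun s => by
    induction s with
    | zero => simp
    | add x y hx hy => simp only [map_add, LinearMap.add_apply, hx, hy]
    | tmul a b => simp
  refine (key _).symm.trans (h.trans ?_)
  rw [TensorProduct.lid_tmul, one_smul]
  exact mul_one b

lemma antipode_left (b : B) : LinearMap.mul' k B (TensorProduct.map T.S
    (LinearMap.mulLeft k (j Q.α)) (T.Δ b)) = T.one b • j Q.α := dual_ext fun φ => by
  have h := T.ev (AlgRep.reg k B) b (φ ⊗ₜ[k] (1 : B))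
  rw [T.ten_eq'] at h
  have key : ∀ s : B ⊗[k] B, contractLeft k B ((Algebra.lmul k B (j Q.α)).lTensor _
      (tensorAct (T.dual (AlgRep.reg k B)) (Algebra.lmul k B) s (φ ⊗ₜ[k] (1 : B)))) =
      φ (LinearMap.mul' k B (TensorProduct.map T.S (LinearMap.mulLeft k (j Q.α)) s)) := fun s => by
    induction s with
    | zero => simp
    | add x y hx hy => simp only [map_add, LinearMap.add_apply, hx, hy]
    | tmul a b => simp [T.dual_eq]
  refine (key _).symm.trans (h.trans ?_)
  simp

lemma antipode_right (b : B) : LinearMap.mul' k B (TensorProduct.map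
    (LinearMap.mulRight k (j Q.β)) T.S (T.Δ b)) = T.one b • j Q.β := by
  have h := congrArg (FDMod.toEnd B) (T.coev (AlgRep.reg k B) b)
  rw [T.ten_eq'] at h
  have h1 := toEnd_tensorAct (Algebra.lmul k B) (T.dual (AlgRep.reg k B)) T.S
    (T.dual_eq (AlgRep.reg k B)) (T.Δ b) _ (j Q.β)
    (toEnd_coevaluation (Algebra.lmul k B (j Q.β)))
  have h2 := h1.symm.trans (h.trans ((map_smul _ _ _).trans
    (congrArg _ (toEnd_coevaluation (Algebra.lmul k B (j Q.β))))))
  have h3 := congrArg (fun f => f (1 : B)) h2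
  simpa using h3

lemma cocycle : (1 : B) ⊗ₜ[k] (TensorData.Φ (Q := Q) (j := j)).val *
      Algebra.TensorProduct.map (.id k B)
        ((Algebra.TensorProduct.assoc k k k B B B).toAlgHom.comp
          (Algebra.TensorProduct.map T.Δ (.id k B))) (TensorData.Φ (Q := Q) (j := j)).val *
      Algebra.TensorProduct.map (.id k B)
        (Algebra.TensorProduct.map (.id k B) Algebra.TensorProduct.includeLeft)
          (TensorData.Φ (Q := Q) (j := j)).val =
    Algebra.TensorProduct.map (.id k B) (Algebra.TensorProduct.map (.id k B) T.Δ)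
      (TensorData.Φ (Q := Q) (j := j)).val *
      (Algebra.TensorProduct.assoc k k k B B (B ⊗[k] B)).toAlgHom.comp
        (Algebra.TensorProduct.map T.Δ (.id k (B ⊗[k] B)))
          (TensorData.Φ (Q := Q) (j := j)).val := by
  have h := congrArg (Algebra.TensorProduct.map j (Algebra.TensorProduct.map j
    (Algebra.TensorProduct.map j j))) Q.cocycle
  simp only [map_mul] at h
  rw [Φ_val]
  have e2 : ∀ t : A ⊗[k] (A ⊗[k] A), Algebra.TensorProduct.map (.id k B)
        ((Algebra.TensorProduct.assoc k k k B B B).toAlgHom.comp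
          (Algebra.TensorProduct.map T.Δ (.id k B)))
        (Algebra.TensorProduct.map j (Algebra.TensorProduct.map j j) t) =
      Algebra.TensorProduct.map j (Algebra.TensorProduct.map j (Algebra.TensorProduct.map j j))
        (Algebra.TensorProduct.map (.id k A)
          ((Algebra.TensorProduct.assoc k k k A A A).toAlgHom.comp
          (Algebra.TensorProduct.map Q.Δ (.id k A))) t) := fun t => by
    induction t using FDMod.ind₃ with
    | h0 => simp
    | ha x y hx hy => simp only [map_add, hx, hy]
    | ht a b c =>
      simp only [Algebra.TensorProduct.map_tmul, AlgHom.comp_apply, AlgHom.coe_id, id_eq, T.Δ_res]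
      congr 1
      generalize Q.Δ b = s
      induction s with
      | zero => simp
      | add x y hx hy => simp only [map_add, add_tmul, hx, hy]
      | tmul x y => simp
  have e3 : ∀ t : A ⊗[k] (A ⊗[k] A), Algebra.TensorProduct.map (.id k B)
        (Algebra.TensorProduct.map (.id k B) Algebra.TensorProduct.includeLeft)
        (Algebra.TensorProduct.map j (Algebra.TensorProduct.map j j) t) =
      Algebra.TensorProduct.map j (Algebra.TensorProduct.map j (Algebra.TensorProduct.map j j))
        (Algebra.TensorProduct.map (.id k A) (Algebra.TensorProduct.map (.id k A)
          Algebra.TensorProduct.includeLeft) t) := fun t => by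
    induction t using FDMod.ind₃ with
    | h0 => simp
    | ha x y hx hy => simp only [map_add, hx, hy]
    | ht a b c => simp
  have e4 : ∀ t : A ⊗[k] (A ⊗[k] A), Algebra.TensorProduct.map (.id k B)
        (Algebra.TensorProduct.map (.id k B) T.Δ)
        (Algebra.TensorProduct.map j (Algebra.TensorProduct.map j j) t) =
      Algebra.TensorProduct.map j (Algebra.TensorProduct.map j (Algebra.TensorProduct.map j j))
        (Algebra.TensorProduct.map (.id k A) (Algebra.TensorProduct.map (.id k A) Q.Δ) t) :=
    fun t => by
    induction t using FDMod.ind₃ with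
    | h0 => simp
    | ha x y hx hy => simp only [map_add, hx, hy]
    | ht a b c => simp [T.Δ_res]
  have e5 : ∀ t : A ⊗[k] (A ⊗[k] A), (Algebra.TensorProduct.assoc k k k B B
      (B ⊗[k] B)).toAlgHom.comp
        (Algebra.TensorProduct.map T.Δ (.id k (B ⊗[k] B)))
        (Algebra.TensorProduct.map j (Algebra.TensorProduct.map j j) t) =
      Algebra.TensorProduct.map j (Algebra.TensorProduct.map j (Algebra.TensorProduct.map j j))
        ((Algebra.TensorProduct.assoc k k k A A (A ⊗[k] A)).toAlgHom.comp
        (Algebra.TensorProduct.map Q.Δ (.id k (A ⊗[k] A))) t) := fun t => by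
    induction t using FDMod.ind₃ with
    | h0 => simp
    | ha x y hx hy => simp only [map_add, hx, hy]
    | ht a b c =>
      simp only [Algebra.TensorProduct.map_tmul, AlgHom.comp_apply, AlgHom.coe_id, id_eq, T.Δ_res]
      generalize Q.Δ a = s
      induction s with
      | zero => simp
      | add x y hx hy => simp only [map_add, add_tmul, hx, hy]
      | tmul x y => simp
  rw [e2, e3, e4, e5]
  refine Eq.trans ?_ h
  simp

/-- A quasi-Hopf structure on `B`, reconstructed from the actions of `B` on tensor products and
duals. -/
def quasiHopf : QuasiHopf k B where
  Δ := T.Δ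
  ε := T.one
  Φ := TensorData.Φ (Q := Q) (j := j)
  quasi_coassoc := T.quasi_coassoc
  counit_right := T.counit_right
  counit_left := T.counit_left
  cocycle := T.cocycle
  counit_reassoc := by
    have h := congrArg (Algebra.TensorProduct.map j j) Q.counit_reassoc
    rw [map_one] at h
    refine Eq.trans ?_ h
    rw [Φ_val]
    generalize Q.Φ.val = t
    induction t using FDMod.ind₃ with
    | h0 => simp
    | ha x y hx hy => simp only [map_add, hx, hy]
    | ht a b c => simp [T.one_res]
  S := T.S
  S_one := T.S_one
  S_mul := T.S_mul
  α := j Q.α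
  β := j Q.β
  antipode_left := T.antipode_left
  antipode_right := T.antipode_right
  antipode_reassoc := by
    have h := congrArg j Q.antipode_reassoc
    rw [map_one] at h
    refine Eq.trans ?_ h
    rw [Φ_val]
    generalize Q.Φ.val = t
    induction t using FDMod.ind₃ with
    | h0 => simp
    | ha x y hx hy => simp only [map_add, hx, hy]
    | ht a b c => simp [T.S_res]
  antipode_reassoc_inv := by
    have h := congrArg j Q.antipode_reassoc_inv
    rw [map_one] at h
    refine Eq.trans ?_ h
    rw [Φ_inv_val]
    generalize (Q.Φ⁻¹).val = t
    induction t using FDMod.ind₃ with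
    | h0 => simp
    | ha x y hx hy => simp only [map_add, hx, hy]
    | ht a b c => simp [T.S_res]

lemma isQuasiHopfHom : IsQuasiHopfHom Q T.quasiHopf j where
  map_Δ := T.Δ_res
  map_ε := T.one_res
  map_Φ := rfl
  map_S := T.S_res
  map_α := rfl
  map_β := rfl

end TensorData
end Reconstruction

/-! ### Tensor products and duals of modules over the quantum double -/

section
variable {C : Type u} [Category.{v} C] [MonoidalCategory C] {V D W E : C} [ExactPairing V D]
  [ExactPairing W E]

/-- A map compatible with a morphism under evaluation is also compatible with it under
coevaluation. -/
lemma coev_of_ev {f : V ⟶ W} {g : E ⟶ D} (h : g ▷ V ≫ ε_ V D = E ◁ f ≫ ε_ W E) :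
    η_ V D ≫ f ▷ D = η_ W E ≫ W ◁ g := by
  symm
  calc η_ W E ≫ W ◁ g = η_ W E ≫ W ◁ (g ≫ 𝟙 D) := by simp
    _ = η_ W E ≫ W ◁ (g ≫ (𝟙 D ⊗≫ D ◁ η_ V D ⊗≫ ε_ V D ▷ D ⊗≫ 𝟙 D)) := by rw [Twisted.zag]
    _ = η_ W E ≫ W ◁ (𝟙 E ⊗≫ (g ▷ 𝟙_ C ≫ D ◁ η_ V D) ⊗≫ ε_ V D ▷ D ⊗≫ 𝟙 D) := by monoidal
    _ = 𝟙 _ ⊗≫ η_ W E ⊗≫ W ◁ E ◁ η_ V D ⊗≫ W ◁ (g ▷ V ≫ ε_ V D) ▷ D ⊗≫ 𝟙 _ := by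
        rw [← whisker_exchange]; monoidal
    _ = 𝟙 _ ⊗≫ (η_ W E ▷ 𝟙_ C ≫ (W ⊗ E) ◁ (η_ V D ≫ f ▷ D)) ⊗≫ W ◁ ε_ W E ▷ D ⊗≫ 𝟙 _ := by
        rw [h]; monoidal
    _ = (η_ V D ≫ f ▷ D) ⊗≫ (𝟙 W ⊗≫ η_ W E ▷ W ⊗≫ W ◁ ε_ W E ⊗≫ 𝟙 W) ▷ D := by
        rw [← whisker_exchange]; monoidal
    _ = _ := by rw [Twisted.zig]; monoidal

lemma mateHB_map {b : ∀ X : C, X ⊗ V ⟶ V ⊗ X} {c : ∀ X : C, X ⊗ W ⟶ W ⊗ X} {f : V ⟶ W} {g : E ⟶ D}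
    (h : g ▷ V ≫ ε_ V D = E ◁ f ≫ ε_ W E) (X : C) (hf : b X ≫ f ▷ X = X ◁ f ≫ c X) :
    mateHB E c X ≫ X ◁ g = g ▷ X ≫ mateHB D b X := by
  symm
  calc _ = 𝟙 _ ⊗≫ (g ▷ (X ⊗ 𝟙_ C) ≫ D ◁ (X ◁ η_ V D)) ⊗≫ D ◁ b X ▷ D ⊗≫ ε_ V D ▷ (X ⊗ D)
      ⊗≫ 𝟙 _ := by
        unfold mateHB; monoidal
    _ = 𝟙 _ ⊗≫ E ◁ X ◁ η_ V D ⊗≫ (g ▷ (X ⊗ V) ≫ D ◁ b X) ▷ D ⊗≫ ε_ V D ▷ (X ⊗ D) ⊗≫ 𝟙 _ := by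
        rw [← whisker_exchange]; monoidal
    _ = 𝟙 _ ⊗≫ E ◁ X ◁ η_ V D ⊗≫ E ◁ b X ▷ D ⊗≫ (g ▷ V ≫ ε_ V D) ▷ (X ⊗ D) ⊗≫ 𝟙 _ := by
        rw [← whisker_exchange]; monoidal
    _ = 𝟙 _ ⊗≫ E ◁ X ◁ η_ V D ⊗≫ E ◁ (b X ≫ f ▷ X) ▷ D ⊗≫ ε_ W E ▷ (X ⊗ D) ⊗≫ 𝟙 _ := by
        rw [h]; monoidal
    _ = 𝟙 _ ⊗≫ E ◁ X ◁ (η_ V D ≫ f ▷ D) ⊗≫ E ◁ c X ▷ D ⊗≫ ε_ W E ▷ (X ⊗ D) ⊗≫ 𝟙 _ := by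
        rw [hf]; monoidal
    _ = 𝟙 _ ⊗≫ E ◁ X ◁ η_ W E ⊗≫ E ◁ (X ◁ W ◁ g ≫ (α_ X W D).inv ≫ c X ▷ D) ⊗≫
          ε_ W E ▷ (X ⊗ D) ⊗≫ 𝟙 _ := by
        rw [coev_of_ev h]; monoidal
    _ = 𝟙 _ ⊗≫ E ◁ X ◁ η_ W E ⊗≫ E ◁ ((X ⊗ W) ◁ g ≫ c X ▷ D) ⊗≫
          ε_ W E ▷ (X ⊗ D) ⊗≫ 𝟙 _ := by monoidal
    _ = 𝟙 _ ⊗≫ E ◁ X ◁ η_ W E ⊗≫ E ◁ c X ▷ E ⊗≫ ((E ⊗ W) ◁ (X ◁ g) ≫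
          ε_ W E ▷ (X ⊗ D)) ⊗≫ 𝟙 _ := by rw [whisker_exchange]; monoidal
    _ = _ := by rw [whisker_exchange]; unfold mateHB; monoidal

end

section DoubleRepresentations

variable {k H : Type u} [Field k] [Ring H] [Algebra k H]

/-- The transpose of an `H`-linear map. -/
def FDMod.transpose {Q : QuasiHopf k H} {X Y : FDMod Q.toQuasiBialgebra} (f : X ⟶ Y) :
    FDMod.dual Y ⟶ FDMod.dual X where
  lin := Module.Dual.transpose (R := k) f.lin
  comm h φ := LinearMap.ext fun v => by
    change φ (Y.ρ (Q.S h) (f.lin v)) = φ (f.lin (X.ρ (Q.S h) v))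
    rw [f.comm]

lemma FDMod.transpose_ev {Q : QuasiHopf k H} {X Y : FDMod Q.toQuasiBialgebra} (f : X ⟶ Y) :
    FDMod.transpose f ▷ X ≫ ε_ X (FDMod.dual X) = FDMod.dual Y ◁ f ≫ ε_ Y (FDMod.dual Y) :=
  FDMod.hom_ext fun t => by
    change Module.Dual k Y.V ⊗[k] X.V at t
    induction t with
    | zero => simp
    | add x y hx hy => simp only [map_add, hx, hy]
    | tmul φ v =>
      change φ (f.lin (X.ρ Q.α v)) = φ (Y.ρ Q.α (f.lin v))
      rw [f.comm]

variable [Module.Finite k H] {Q : QuasiHopf k H}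

/-- The transpose of a morphism of Yetter-Drinfeld modules. -/
def YD.transpose {V W : YD Q} (f : V ⟶ W) : YD.dual W ⟶ YD.dual V :=
  YD.homMk (FDMod.transpose f.hom) fun X => by
    rw [YD.dual_half, YD.dual_half]
    have h := mateHB_map (FDMod.transpose_ev f.hom) X (f.half X)
    change inv (mateHB (FDMod.dual W.toFDMod) W.half X) ≫ FDMod.transpose f.hom ▷ X =
      X ◁ FDMod.transpose f.hom ≫ inv (mateHB (FDMod.dual V.toFDMod) V.half X)
    rw [IsIso.inv_comp_eq, ← Category.assoc, h, Category.assoc, IsIso.hom_inv_id, Category.comp_id]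

namespace QuantumDouble

/-- A `D(H)`-linear map into the module of a Yetter-Drinfeld module is a morphism of
Yetter-Drinfeld modules. -/
def homTo (X : AlgRep k (QuantumDouble Q)) (V : YD Q) (f : X.V →ₗ[k] V.V)
    (hf : X.Intertwines V.toRep f) : toYD X ⟶ V :=
  YD.homOfIntertwines f fun b x => by rw [YD.toRep_toYD]; exact hf b x

/-- The action of `D(H)` on a tensor product of two modules. -/
def ten (X Y : AlgRep k (QuantumDouble Q)) : QuantumDouble Q →ₐ[k] Module.End k (X.V ⊗[k] Y.V) :=
  (YD.tensor (toYD X) (toYD Y)).toRep.ρ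

lemma ten_to {X Y : AlgRep k (QuantumDouble Q)} {V W : YD Q} {f : X.V →ₗ[k] V.V}
    {g : Y.V →ₗ[k] W.V} (hf : X.Intertwines V.toRep f) (hg : Y.Intertwines W.toRep g)
    (b : QuantumDouble Q) (t : X.V ⊗[k] Y.V) : TensorProduct.map f g (ten X Y b t) =
      (YD.tensor V W).toRep.ρ b (TensorProduct.map f g t) :=
  YD.Hom.intertwines (YD.tensorMap (homTo X V f hf) (homTo Y W g hg)) b t

/-- The action of `D(H)` on the dual of a module. -/
def dual (X : AlgRep k (QuantumDouble Q)) :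
    QuantumDouble Q →ₐ[k] Module.End k (Module.Dual k X.V) :=
  (YD.dual (toYD X)).toRep.ρ

variable (Q) in
/-- The action of `D(H)` on the unit object. -/
def unitRep : QuantumDouble Q →ₐ[k] Module.End k k := (YD.one (Q := Q)).toRep.ρ

variable (Q) in
lemma unitRep_eq (b : QuantumDouble Q) (c : k) : unitRep Q b c = unitRep Q b 1 * c := by
  have := (unitRep Q b).map_smul c (1 : k)
  rw [smul_eq_mul, mul_one, smul_eq_mul, mul_comm] at this
  exact this

variable (Q) in
/-- The counit of `D(H)`, given by the action on the unit object. -/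
def counit : QuantumDouble Q →ₐ[k] k :=
  AlgHom.ofLinearMap (LinearMap.applyₗ (1 : k) ∘ₗ (unitRep Q).toLinearMap)
    (by
      change unitRep Q 1 (1 : k) = 1
      rw [map_one (unitRep Q)]; rfl)
    (fun a b => by
      change unitRep Q (a * b) (1 : k) = unitRep Q a (1 : k) * unitRep Q b (1 : k)
      rw [map_mul, ← unitRep_eq]; rfl)

variable (Q) in
lemma unitRep_apply (b : QuantumDouble Q) (c : k) : unitRep Q b c = counit Q b * c :=
    unitRep_eq Q b c

lemma map_id_apply {V W : Type u} [AddCommGroup V] [Module k V] [AddCommGroup W] [Module k W]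
    (t : V ⊗[k] W) : TensorProduct.map (LinearMap.id : V →ₗ[k] V) (LinearMap.id : W →ₗ[k] W)
        t = t := by
  rw [TensorProduct.map_id]; rfl

lemma ten_id (V W : YD Q) (σ : QuantumDouble Q →ₐ[k] Module.End k V.V)
    (τ : QuantumDouble Q →ₐ[k] Module.End k W.V) (hσ : ∀ b x, σ b x = V.toRep.ρ b x)
    (hτ : ∀ b x, τ b x = W.toRep.ρ b x) (b : QuantumDouble Q) (t : V.V ⊗[k] W.V) :
    ten ⟨V.V, σ⟩ ⟨W.V, τ⟩ b t = (YD.tensor V W).toRep.ρ b t := by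
  have h1 := ten_to (X := ⟨V.V, σ⟩) (Y := ⟨W.V, τ⟩) (V := V) (W := W) (f := LinearMap.id)
    (g := LinearMap.id) hσ hτ b t
  exact (map_id_apply _).symm.trans (h1.trans (congrArg _ (map_id_apply _)))

lemma toRep_toYD_id (X : AlgRep k (QuantumDouble Q)) (b : QuantumDouble Q) (x : X.V) :
    X.ρ b x = (toYD X).toRep.ρ b x :=
  congrArg (fun f => f x) (YD.toRep_toYD X b).symm

variable (Q) in
/-- The actions of `D(H)` on tensor products and duals of Yetter-Drinfeld modules. -/
def tensorData : TensorData Q (incl Q) where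
  one := counit Q
  ten := ten
  dual := dual
  one_res a := by
    have h : (YD.one (Q := Q)).toRep.ρ (incl Q a) = _ := YD.toRep_incl YD.one a
    have h2 := congrArg (fun f => f (1 : k)) h
    refine h2.trans ?_
    change Q.ε a * 1 = _
    rw [mul_one]
  ten_res X Y a := by
    refine (YD.toRep_incl (YD.tensor (toYD X) (toYD Y)) a).trans ?_
    change tensorAct (X.ρ.comp (incl Q)) (Y.ρ.comp (incl Q)) (Q.Δ a) = _
    rw [tensorAct_comp]; rfl
  dual_res X a φ := congrArg (fun f => f φ) (YD.toRep_incl (YD.dual (toYD X)) a)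
  ten_nat {X Y X' Y'} f g hf hg b t := ten_to (V := toYD X') (W := toYD Y') (f := f) (g := g)
    (fun b x => by rw [YD.toRep_toYD]; exact hf b x)
        (fun b x => by rw [YD.toRep_toYD]; exact hg b x) b t
  dual_nat {X Y} f hf b φ :=
    (YD.Hom.intertwines (YD.transpose (homTo X (toYD Y) f
      (fun b x => by rw [YD.toRep_toYD]; exact hf b x))) b φ).symm
  assoc X Y Z b t := by
    have h1 := ten_id (YD.tensor (toYD X) (toYD Y)) (toYD Z) (ten X Y) Z.ρ (fun _ _ => rfl)
      (toRep_toYD_id Z)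
    have h2 := ten_id (toYD X) (YD.tensor (toYD Y) (toYD Z)) X.ρ (ten Y Z) (toRep_toYD_id X)
      (fun _ _ => rfl)
    have e : ∀ s : H ⊗[k] (H ⊗[k] H), FDMod.act₃ (res X) (res Y) (res Z) s =
        tensorAct X.ρ (tensorAct Y.ρ Z.ρ) (Algebra.TensorProduct.map (incl Q)
          (Algebra.TensorProduct.map (incl Q) (incl Q)) s) := fun s => by
      change tensorAct (X.ρ.comp (incl Q)) (tensorAct (Y.ρ.comp (incl Q)) (Z.ρ.comp (incl Q))) s = _
      rw [tensorAct_comp, tensorAct_comp]; rfl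
    have h3 := YD.Hom.intertwines (α_ (toYD X) (toYD Y) (toYD Z)).hom b t
    rw [← e]
    exact (congrArg (α_ (res X) (res Y) (res Z)).hom.lin (h1 b t)).trans (h3.trans (h2 b _).symm)
  lid X b t := by
    have h1 := ten_id YD.one (toYD X) ((Algebra.lmul k k).comp (counit Q)) X.ρ
      (fun b c => (unitRep_apply Q b c).symm) (toRep_toYD_id X)
    have h3 := YD.Hom.intertwines (λ_ (toYD X)).hom b t
    rw [YD.toRep_toYD] at h3
    exact (congrArg (TensorProduct.lid k X.V) (h1 b t)).trans h3
  rid X b t := by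
    have h1 := ten_id (toYD X) YD.one X.ρ ((Algebra.lmul k k).comp (counit Q)) (toRep_toYD_id X)
      (fun b c => (unitRep_apply Q b c).symm)
    have h3 := YD.Hom.intertwines (ρ_ (toYD X)).hom b t
    rw [YD.toRep_toYD] at h3
    exact (congrArg (TensorProduct.rid k X.V) (h1 b t)).trans h3
  ev X b t := by
    have h1 := ten_id (YD.dual (toYD X)) (toYD X) (dual X) X.ρ (fun _ _ => rfl) (toRep_toYD_id X)
    have h3 := YD.Hom.intertwines (YD.ev (toYD X)) b t
    exact (congrArg (FDMod.ev (res X)).lin (h1 b t)).trans (h3.trans (unitRep_apply Q b _))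
  coev X b := by
    have h1 := ten_id (toYD X) (YD.dual (toYD X)) X.ρ (dual X) (toRep_toYD_id X) (fun _ _ => rfl)
    have h3 := YD.Hom.intertwines (YD.coev (toYD X)) b (1 : k)
    refine (h1 b _).trans (h3.symm.trans ?_)
    exact (congrArg (FDMod.coev (res X)).lin (unitRep_apply Q b 1)).trans
      (map_smul (FDMod.coev (res X)).lin (counit Q b) (1 : k))

end QuantumDouble

end DoubleRepresentations

/-! ### The quasitriangular structure of the quantum double -/

section DoubleQuasitriangular

variable {k H : Type u} [Field k] [Ring H] [Algebra k H]

lemma flip_rTensor {B : Type u} [Ring B] [Algebra k B] (r : B ⊗[k] B) (t : (B ⊗[k] B) ⊗[k] B) :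
    TensorProduct.assoc k B B B (((TensorProduct.comm k B B).toLinearMap ∘ₗ
      LinearMap.mulLeft k r).rTensor B t) =
      sw₁₂ k B (leg₁₂ r * Algebra.TensorProduct.assoc k k k B B B t) := by
  have h : ((TensorProduct.comm k B B).toLinearMap ∘ₗ LinearMap.mulLeft k r).rTensor B t =
      Algebra.TensorProduct.map (Algebra.TensorProduct.comm k B B).toAlgHom (.id k B)
        ((r ⊗ₜ[k] (1 : B)) * t) := by
    induction t with
    | zero => simp
    | add x y hx hy => simp only [map_add, mul_add, hx, hy]
    | tmul s c =>
      simp only [LinearMap.rTensor_tmul, Algebra.TensorProduct.tmul_mul_tmul, one_mul,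
        Algebra.TensorProduct.map_tmul]
      rfl
  rw [h]
  refine (FDMod.sw₁₂_eq _).trans ?_
  rw [map_mul (Algebra.TensorProduct.assoc k k k B B B)]
  exact congrArg (fun x => sw₁₂ k B (x * _)) (FDMod.assoc_rmul _)

lemma flip_lTensor {B : Type u} [Ring B] [Algebra k B] (r : B ⊗[k] B) (t : B ⊗[k] (B ⊗[k] B)) :
    ((TensorProduct.comm k B B).toLinearMap ∘ₗ LinearMap.mulLeft k r).lTensor B t =
      sw₂₃ k B (leg₂₃ r * t) := by
  induction t with
  | zero => simp
  | add x y hx hy => simp only [map_add, mul_add, hx, hy]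
  | tmul c s =>
    simp only [LinearMap.lTensor_tmul, Algebra.TensorProduct.includeRight_apply,
      Algebra.TensorProduct.tmul_mul_tmul, one_mul]
    rfl

variable [Module.Finite k H] {Q : QuasiHopf k H}

namespace QuantumDouble

variable (Q) in
/-- The regular representation of `D(H)`. -/
abbrev regRep : AlgRep k (QuantumDouble Q) := AlgRep.reg k (QuantumDouble Q)

variable (Q) in
/-- The quasi-Hopf structure on `D(H)`. -/
def quasiHopf : QuasiHopf k (QuantumDouble Q) := (tensorData Q).quasiHopf

/-- The coproduct of `D(H)` describes the action on tensor products of Yetter-Drinfeld modules. -/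
lemma tensor_toRep (X Y : AlgRep k (QuantumDouble Q)) :
    (YD.tensor (toYD X) (toYD Y)).toRep.ρ = (tensorAct X.ρ Y.ρ).comp (quasiHopf Q).Δ :=
  (tensorData Q).ten_eq' X Y

lemma R_eq_map : R Q = Algebra.TensorProduct.map (incl Q) (.id k _) (canon (gen Q)) := rfl

/-- The half braidings of the modules over `D(H)` are given by the action of `R_D`. -/
lemma half_lin (X Y : AlgRep k (QuantumDouble Q)) (t : X.V ⊗[k] Y.V) :
    ((toYD Y).half (res X)).lin t = TensorProduct.comm k X.V Y.V (tensorAct X.ρ Y.ρ (R Q) t) := by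
  rw [toYD_half]
  have h := tensorAct_comp X.ρ Y.ρ (incl Q) (.id k (QuantumDouble Q))
  rw [AlgHom.comp_id] at h
  change TensorProduct.comm k X.V Y.V (tensorAct (X.ρ.comp (incl Q)) Y.ρ (canon (gen Q)) t) = _
  rw [h, R_eq_map]; rfl

/-- `R_D` is invertible, as the half braiding of the regular module is. -/
lemma isUnit_R : IsUnit (R Q) := by
  let D := regRep Q
  have hb : Function.Bijective (LinearMap.mulLeft k (R Q)) := by
    let e := asIso ((toYD D).half (res D))
    have h : ∀ t, LinearMap.mulLeft k (R Q) t =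
        (TensorProduct.comm k D.V D.V).symm (e.hom.lin t) := fun t => by
      refine Eq.trans ?_ (congrArg (TensorProduct.comm k D.V D.V).symm (half_lin D D t)).symm
      rw [LinearEquiv.symm_apply_apply, tensorAct_lmul]; rfl
    refine ⟨fun s t hst => ?_, fun s => ⟨e.inv.lin (TensorProduct.comm k D.V D.V s), ?_⟩⟩
    · rw [h, h] at hst
      have h2 := congrArg e.inv.lin ((TensorProduct.comm k D.V D.V).symm.injective hst)
      exact (FDMod.Tw.iso e.hom e.inv e.hom_inv_id s).symm.trans
        (h2.trans (FDMod.Tw.iso e.hom e.inv e.hom_inv_id t))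
    · refine (h _).trans ?_
      refine (congrArg (TensorProduct.comm k D.V D.V).symm
        (FDMod.Tw.iso e.inv e.hom e.inv_hom_id (TensorProduct.comm k D.V D.V s))).trans ?_
      exact (TensorProduct.comm k D.V D.V).symm_apply_apply s
  obtain ⟨s, hs⟩ := hb.2 1
  have hs' : R Q * s = 1 := hs
  refine ⟨⟨R Q, s, hs', hb.1 ?_⟩, rfl⟩
  change R Q * (s * R Q) = R Q * 1
  rw [← mul_assoc, hs', one_mul, mul_one]

lemma half_lin_reg : ((toYD (regRep Q)).half (res (regRep Q))).lin =
    (TensorProduct.comm k (QuantumDouble Q) (QuantumDouble Q)).toLinearMap ∘ₗ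
      LinearMap.mulLeft k (R Q) := LinearMap.ext fun t => by
  exact (half_lin (regRep Q) (regRep Q) t).trans
    (congrArg (TensorProduct.comm k (QuantumDouble Q) (QuantumDouble Q)) (tensorAct_lmul (R Q) t))

/-- The braiding of the regular module with itself is `D(H)`-linear. -/
lemma almost_cocomm (b : QuantumDouble Q) :
    Algebra.TensorProduct.comm k _ _ ((quasiHopf Q).Δ b) * R Q = R Q * (quasiHopf Q).Δ b := by
  have h := YD.Hom.intertwines (YD.braid (toYD (regRep Q)) (toYD (regRep Q))).hom b
    ((1 : QuantumDouble Q) ⊗ₜ[k] (1 : QuantumDouble Q))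
  have h2 : ∀ t : QuantumDouble Q ⊗[k] QuantumDouble Q,
      (toYD (regRep Q) ⊗ toYD (regRep Q)).toRep.ρ b t = (quasiHopf Q).Δ b * t := fun t => by
    rw [← tensorAct_lmul]
    exact congrArg (fun f => f b t) (tensor_toRep (regRep Q) (regRep Q))
  have h1 : ∀ t : QuantumDouble Q ⊗[k] QuantumDouble Q,
      (YD.braid (toYD (regRep Q)) (toYD (regRep Q))).hom.hom.lin t =
      TensorProduct.comm k (QuantumDouble Q) (QuantumDouble Q) (R Q * t) :=
    fun t => congrArg (fun f => f t) half_lin_reg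
  have h3 : TensorProduct.comm k (QuantumDouble Q) (QuantumDouble Q)
      (R Q * ((quasiHopf Q).Δ b * 1)) =
      (quasiHopf Q).Δ b * TensorProduct.comm k (QuantumDouble Q) (QuantumDouble Q) (R Q * 1) := by
    refine (congrArg (fun t => TensorProduct.comm k (QuantumDouble Q) (QuantumDouble Q) (R Q * t))
      (h2 1)).symm.trans ?_
    refine (h1 _).symm.trans (h.trans ?_)
    exact (congrArg _ (h1 _)).trans (h2 _)
  rw [mul_one, mul_one] at h3
  have h5 : ∀ t : QuantumDouble Q ⊗[k] QuantumDouble Q,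
      Algebra.TensorProduct.comm k (QuantumDouble Q) (QuantumDouble Q)
        (TensorProduct.comm k (QuantumDouble Q) (QuantumDouble Q) t) = t :=
    (TensorProduct.comm k _ _).symm_apply_apply
  symm
  calc R Q * (quasiHopf Q).Δ b = Algebra.TensorProduct.comm k (QuantumDouble Q) (QuantumDouble Q)
        (TensorProduct.comm k (QuantumDouble Q) (QuantumDouble Q) (R Q * (quasiHopf Q).Δ b)) :=
        (h5 _).symm
    _ = Algebra.TensorProduct.comm k (QuantumDouble Q) (QuantumDouble Q)
        ((quasiHopf Q).Δ b * TensorProduct.comm k (QuantumDouble Q) (QuantumDouble Q) (R Q)) :=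
        congrArg _ h3
    _ = _ := by rw [map_mul, h5]

/-- One hexagon for `R_D` is a defining relation of `D(H)`. -/
lemma quasi_left : Algebra.TensorProduct.assoc k k k _ _ _
      (Algebra.TensorProduct.map (quasiHopf Q).Δ (.id k _) (R Q)) =
    sw₂₃ k _ (sw₁₂ k _ (quasiHopf Q).Φ.val) * leg₁₃ (R Q) * sw₂₃ k _ ((quasiHopf Q).Φ⁻¹).val *
      leg₂₃ (R Q) * (quasiHopf Q).Φ.val := by
  have h := congrArg (Algebra.TensorProduct.map (incl Q)
    (Algebra.TensorProduct.map (incl Q) (.id k (QuantumDouble Q)))) (isDoublePair Q).hex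
  simp only [map_mul] at h
  have e1 : ∀ t : H ⊗[k] (H ⊗[k] H), Algebra.TensorProduct.map (incl Q)
      (Algebra.TensorProduct.map (incl Q) (.id k (QuantumDouble Q)))
        (((incl Q).toLinearMap.lTensor H).lTensor H t) = Algebra.TensorProduct.map (incl Q)
      (Algebra.TensorProduct.map (incl Q) (incl Q)) t := fun t => by
    induction t using FDMod.ind₃ with
    | h0 => simp
    | ha x y hx hy => simp only [map_add, hx, hy]
    | ht a b c => simp
  have e2 : ∀ t : H ⊗[k] (H ⊗[k] H), Algebra.TensorProduct.map (incl Q)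
      (Algebra.TensorProduct.map (incl Q) (incl Q)) (sw₂₃ k H t) = sw₂₃ k _
      (Algebra.TensorProduct.map (incl Q) (Algebra.TensorProduct.map (incl Q) (incl Q)) t) :=
    fun t => by
    induction t using FDMod.ind₃ with
    | h0 => simp
    | ha x y hx hy => simp only [map_add, hx, hy]
    | ht a b c => simp
  have e3 : ∀ t : H ⊗[k] (H ⊗[k] H), Algebra.TensorProduct.map (incl Q)
      (Algebra.TensorProduct.map (incl Q) (incl Q)) (sw₁₂ k H t) = sw₁₂ k _
      (Algebra.TensorProduct.map (incl Q) (Algebra.TensorProduct.map (incl Q) (incl Q)) t) :=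
    fun t => by
    induction t using FDMod.ind₃ with
    | h0 => simp
    | ha x y hx hy => simp only [map_add, hx, hy]
    | ht a b c => simp
  have e4 : ∀ t : H ⊗[k] QuantumDouble Q, Algebra.TensorProduct.map (incl Q)
      (Algebra.TensorProduct.map (incl Q) (.id k (QuantumDouble Q)))
        (Algebra.TensorProduct.map (.id k H) Algebra.TensorProduct.includeRight t) =
      leg₁₃ (Algebra.TensorProduct.map (incl Q) (.id k _) t) := fun t => by
    induction t with
    | zero => simp
    | add x y hx hy => simp only [map_add, hx, hy]
    | tmul a b => simp
  have e5 : ∀ t : H ⊗[k] QuantumDouble Q, Algebra.TensorProduct.map (incl Q)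
      (Algebra.TensorProduct.map (incl Q) (.id k (QuantumDouble Q)))
        (TensorProduct.assoc k H H _ (Q.Δ.toLinearMap.rTensor _ t)) =
      Algebra.TensorProduct.assoc k k k _ _ _ (Algebra.TensorProduct.map (quasiHopf Q).Δ (.id k _)
        (Algebra.TensorProduct.map (incl Q) (.id k _) t)) := fun t => by
    induction t with
    | zero => simp
    | add x y hx hy => simp only [map_add, hx, hy]
    | tmul a b =>
      have h1 : (quasiHopf Q).Δ (incl Q a) = Algebra.TensorProduct.map (incl Q) (incl Q) (Q.Δ a) :=
        (tensorData Q).Δ_res a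
      simp only [LinearMap.rTensor_tmul, Algebra.TensorProduct.map_tmul, h1, AlgHom.coe_id, id_eq,
        AlgHom.toLinearMap_apply]
      generalize Q.Δ a = s
      induction s with
      | zero => simp
      | add x y hx hy => simp only [map_add, add_tmul, hx, hy]
      | tmul x y => simp
  rw [e1, e1, e1, e2, e2, e3, e4, e5, Algebra.TensorProduct.map_tmul, map_one] at h
  exact h

/-- The other hexagon for `R_D` says that the half braiding of a tensor product is the product of
the half braidings. -/
lemma quasi_right : Algebra.TensorProduct.map (.id k _) (quasiHopf Q).Δ (R Q) =
    sw₁₂ k _ (sw₂₃ k _ ((quasiHopf Q).Φ⁻¹).val) * leg₁₃ (R Q) * sw₁₂ k _ (quasiHopf Q).Φ.val *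
      leg₁₂ (R Q) * ((quasiHopf Q).Φ⁻¹).val := by
  have eΦ : ∀ (s : H ⊗[k] (H ⊗[k] H)) (t : QuantumDouble Q ⊗[k]
      (QuantumDouble Q ⊗[k] QuantumDouble Q)),
      FDMod.act₃ (res (regRep Q)) (res (regRep Q)) (res (regRep Q)) s t =
          Algebra.TensorProduct.map (incl Q)
        (Algebra.TensorProduct.map (incl Q) (incl Q)) s * t := fun s t => by
    change tensorAct ((Algebra.lmul k (QuantumDouble Q)).comp (incl Q))
      (tensorAct ((Algebra.lmul k (QuantumDouble Q)).comp (incl Q))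
          ((Algebra.lmul k (QuantumDouble Q)).comp (incl Q))) s t = _
    rw [tensorAct_comp, tensorAct_comp, lmul₂, lmul₂]; rfl
  -- the half braiding of a tensor product, computed from the coproduct
  have h1 : ((YD.tensor (toYD (regRep Q)) (toYD (regRep Q))).half (res (regRep Q))).lin
      ((1 : QuantumDouble Q) ⊗ₜ[k] ((1 : QuantumDouble Q) ⊗ₜ[k] (1 : QuantumDouble Q))) =
      TensorProduct.comm k (QuantumDouble Q) (QuantumDouble Q ⊗[k] QuantumDouble Q)
        (Algebra.TensorProduct.map (.id k _) (quasiHopf Q).Δ (R Q)) := by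
    rw [YD.half_eq, tensor_toRep]
    have h := tensorAct_comp (Algebra.lmul k (QuantumDouble Q))
      (Algebra.lmul k (QuantumDouble Q ⊗[k] QuantumDouble Q)) (incl Q) (quasiHopf Q).Δ
    change TensorProduct.comm k (QuantumDouble Q) (QuantumDouble Q ⊗[k] QuantumDouble Q)
      (tensorAct ((Algebra.lmul k (QuantumDouble Q)).comp (incl Q))
      ((tensorAct (Algebra.lmul k (QuantumDouble Q)) (Algebra.lmul k (QuantumDouble Q))).comp
          (quasiHopf Q).Δ)
        (canon (gen Q)) 1) = _
    rw [lmul₂, h, lmul₂, R_eq_map]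
    refine congrArg _ ((mul_one (Algebra.TensorProduct.map (incl Q) (quasiHopf Q).Δ
        (canon (gen Q)))).trans ?_)
    rw [← AlgHom.comp_apply, ← Algebra.TensorProduct.map_comp, AlgHom.id_comp, AlgHom.comp_id]
  -- the tensor product of the two half braidings
  have e2 : ∀ t, TensorProduct.assoc k (QuantumDouble Q) (QuantumDouble Q) (QuantumDouble Q)
      (((toYD (regRep Q)).half (res (regRep Q)) ▷ res (regRep Q)).lin t) =
      sw₁₂ k (QuantumDouble Q) (leg₁₂ (R Q) * Algebra.TensorProduct.assoc k k k _ _ _ t) := fun t =>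
    (congrArg (fun f : QuantumDouble Q ⊗[k] QuantumDouble Q →ₗ[k] QuantumDouble Q ⊗[k]
        QuantumDouble Q =>
      TensorProduct.assoc k (QuantumDouble Q) (QuantumDouble Q) (QuantumDouble Q)
          (f.rTensor (QuantumDouble Q) t)) half_lin_reg).trans
      (flip_rTensor (R Q) t)
  have e3 : ∀ t : QuantumDouble Q ⊗[k] (QuantumDouble Q ⊗[k] QuantumDouble Q),
      (res (regRep Q) ◁ (toYD (regRep Q)).half (res (regRep Q))).lin t =
      sw₂₃ k (QuantumDouble Q) (leg₂₃ (R Q) * t) := fun t =>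
    (congrArg (fun f : QuantumDouble Q ⊗[k] QuantumDouble Q →ₗ[k] QuantumDouble Q ⊗[k]
        QuantumDouble Q =>
      f.lTensor (QuantumDouble Q) t) half_lin_reg).trans (flip_lTensor (R Q) t)
  have h2 : TensorProduct.assoc k _ _ _
      ((tensorHB (toYD (regRep Q)).half (toYD (regRep Q)).half (res (regRep Q))).lin
        ((1 : QuantumDouble Q) ⊗ₜ[k] ((1 : QuantumDouble Q) ⊗ₜ[k] (1 : QuantumDouble Q)))) =
      ((quasiHopf Q).Φ⁻¹).val * sw₂₃ k (QuantumDouble Q) (leg₂₃ (R Q) * ((quasiHopf Q).Φ.val *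
        sw₁₂ k (QuantumDouble Q) (leg₁₂ (R Q) * ((quasiHopf Q).Φ⁻¹).val))) := by
    have s1 : (α_ (res (regRep Q)) (res (regRep Q)) (res (regRep Q))).inv.lin
        ((1 : QuantumDouble Q) ⊗ₜ[k] ((1 : QuantumDouble Q) ⊗ₜ[k] (1 : QuantumDouble Q))) =
        (TensorProduct.assoc k (QuantumDouble Q) (QuantumDouble Q) (QuantumDouble Q)).symm
          ((quasiHopf Q).Φ⁻¹).val :=
      congrArg (TensorProduct.assoc k (QuantumDouble Q) (QuantumDouble Q) (QuantumDouble Q)).symm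
        ((eΦ _ _).trans (mul_one ((quasiHopf Q).Φ⁻¹).val))
    have s2 : Algebra.TensorProduct.assoc k k k _ _ _
        ((TensorProduct.assoc k (QuantumDouble Q) (QuantumDouble Q) (QuantumDouble Q)).symm
          ((quasiHopf Q).Φ⁻¹).val) = ((quasiHopf Q).Φ⁻¹).val :=
      (TensorProduct.assoc k (QuantumDouble Q) (QuantumDouble Q)
          (QuantumDouble Q)).apply_symm_apply _
    refine ((TensorProduct.assoc k (QuantumDouble Q) (QuantumDouble Q)
      (QuantumDouble Q)).apply_symm_apply _).trans ?_
    refine (eΦ _ _).trans (congrArg (fun x => ((quasiHopf Q).Φ⁻¹).val * x) ?_)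
    refine (e3 _).trans (congrArg (fun x => sw₂₃ k (QuantumDouble Q) (leg₂₃ (R Q) * x)) ?_)
    refine (eΦ _ _).trans (congrArg (fun x => (quasiHopf Q).Φ.val * x) ?_)
    refine (e2 _).trans (congrArg (fun x => sw₁₂ k (QuantumDouble Q) (leg₁₂ (R Q) * x)) ?_)
    exact (congrArg (Algebra.TensorProduct.assoc k k k (QuantumDouble Q) (QuantumDouble Q)
      (QuantumDouble Q)) s1).trans s2
  have h3 := congrArg (TensorProduct.assoc k (QuantumDouble Q) (QuantumDouble Q)
      (QuantumDouble Q)) h1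
  rw [YD.tensor_half] at h3
  have h4 := (FDMod.sw₂₃_sw₁₂ _).symm.trans (h3.symm.trans h2)
  have h5 := congrArg (fun x => sw₁₂ k (QuantumDouble Q) (sw₂₃ k (QuantumDouble Q) x)) h4
  simp only [map_mul, FDMod.sw₁₂_inv, FDMod.sw₂₃_inv] at h5
  have e4 : sw₁₂ k (QuantumDouble Q) (leg₂₃ (R Q)) = leg₁₃ (R Q) := by
    rw [← FDMod.sw₁₂_leg₁₃, FDMod.sw₁₂_inv]
  rw [h5, e4]
  simp only [mul_assoc]

variable (Q) in
/-- The structure of a quasitriangular quasi-Hopf algebra on `D(H)`. -/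
def qt : QTQuasiHopf k (QuantumDouble Q) where
  toQuasiHopf := quasiHopf Q
  R := isUnit_R.unit
  quasi_left := quasi_left
  quasi_right := quasi_right
  almost_cocomm := almost_cocomm

lemma isStructure_qt : IsStructure Q (qt Q) where
  hom := (tensorData Q).isQuasiHopfHom
  R_eq := rfl

end QuantumDouble

end DoubleQuasitriangular

/-! ### The Drinfeld element -/

section DrinfeldElement

/-- The composite `V ⟶ V` in the definition of `R(C, c)`, for a dual pair `(V, D)`. -/
abbrev Twisted.loop {C : Type*} [Category* C] [MonoidalCategory C] [BraidedCategory C] (V D : C)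
    [ExactPairing V D] : V ⟶ V :=
  (λ_ V).inv ≫ η_ V D ▷ V ≫ (β_ V D).hom ▷ V ≫ (β_ D V).hom ▷ V ≫ (α_ V D V).hom ≫
    V ◁ ε_ V D ≫ (ρ_ V).hom

variable {k H : Type u} [Field k] [Ring H] [Algebra k H]

namespace FDMod

/-- The identity `(X ⊗ ev)(Φ · (s ⊗ v)) = X¹ b S(X²) α X³ v` for `s ∈ X ⊗ X^*` which corresponds to
the action of `b`. -/
lemma evaluation_of_toEnd {Q : QuasiHopf k H} (X : FDMod Q.toQuasiBialgebra)
    (t : H ⊗[k] (H ⊗[k] H)) (s : X.V ⊗[k] Module.Dual k X.V) (v : X.V) (b : H)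
    (hb : toEnd X.V s = X.ρ b) :
    (ρ_ X).hom.lin ((X ◁ ev X).lin (act₃ X (dual X) X t
      (TensorProduct.assoc k _ _ _ (s ⊗ₜ v)))) =
    X.ρ (LinearMap.mul' k H (TensorProduct.map (LinearMap.mulRight k b)
      (LinearMap.mul' k H ∘ₗ TensorProduct.map Q.S (LinearMap.mulLeft k Q.α)) t)) v := by
  induction t using ind₃ with
  | h0 => simp
  | ha x y hx hy => simp only [map_add, LinearMap.add_apply, hx, hy]
  | ht p q r =>
    have : ∀ s : X.V ⊗[k] Module.Dual k X.V,
      (ρ_ X).hom.lin ((X ◁ ev X).lin (act₃ X (dual X) X (p ⊗ₜ (q ⊗ₜ r))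
      (TensorProduct.assoc k _ _ _ (s ⊗ₜ v)))) =
        X.ρ p (toEnd X.V s (X.ρ (Q.S q * (Q.α * r)) v)) := by
      intro s
      induction s with
      | zero => simp
      | add x y hx hy => simp only [map_add, add_tmul, LinearMap.add_apply, hx, hy]
      | tmul w φ => simp [ev]; rfl
    rw [this, hb]; simp

variable {Q : QTQuasiHopf k H}

/-- The element `R²r¹ β S(R¹r²)`. -/
def doubleβ (Q : QTQuasiHopf k H) : H :=
  LinearMap.mul' k H (TensorProduct.map (LinearMap.mulRight k Q.β) Q.S Q.R₂₁R)

lemma toEnd_coev_double (X : FDMod Q.toQuasiBialgebra) :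
    toEnd X.V ((coev (Q := Q.toQuasiHopf) X ≫ (β_ X (dual (Q := Q.toQuasiHopf) X)).hom ≫
      (β_ (dual (Q := Q.toQuasiHopf) X) X).hom).lin (1 : k)) = X.ρ (doubleβ Q) := by
  refine (congrArg (toEnd X.V) ((FDMod.comp_lin _ _ _).trans (FDMod.braid_braid X _ _))).trans ?_
  exact toEnd_act (Q := Q.toQuasiHopf) X Q.R₂₁R _ Q.β
      ((toEnd_coev' X (1 : k)).trans (by rw [one_smul]))

/-- The element `X¹ m S(X²) α X³` for `m = R²r¹ β S(R¹r²)`. -/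
def loopElt (Q : QTQuasiHopf k H) : H :=
  LinearMap.mul' k H (TensorProduct.map (LinearMap.mulRight k (doubleβ Q))
      (LinearMap.mul' k H ∘ₗ TensorProduct.map Q.S (LinearMap.mulLeft k Q.α)) Q.Φ.val)

/-- The composite `Twisted.loop` is the action of an element of `H`. -/
lemma loop_lin (X : FDMod Q.toQuasiBialgebra) (v : X.V) :
    (Twisted.loop X (dual (Q := Q.toQuasiHopf) X)).lin v = X.ρ (loopElt Q) v := by
  have h1 : Twisted.loop X (dual (Q := Q.toQuasiHopf) X) = (λ_ X).inv ≫
      (coev (Q := Q.toQuasiHopf) X ≫ (β_ X (dual (Q := Q.toQuasiHopf) X)).hom ≫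
      (β_ (dual (Q := Q.toQuasiHopf) X) X).hom) ▷ X ≫ (α_ X _ X).hom ≫
      X ◁ ev (Q := Q.toQuasiHopf) X ≫ (ρ_ X).hom := by
    simp only [comp_whiskerRight, Category.assoc]; rfl
  rw [h1]
  refine Eq.trans ?_ (evaluation_of_toEnd (Q := Q.toQuasiHopf) X Q.Φ.val _ v (doubleβ Q)
    (toEnd_coev_double X))
  rfl

/-- Bending the composite `Twisted.loop` back gives the double braiding of `X` and `X^*` on the
coevaluation. -/
lemma loopElt_mul_β_apply (X : FDMod Q.toQuasiBialgebra) :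
    X.ρ (loopElt Q * Q.β) = X.ρ (doubleβ Q) := by
  let D := dual (Q := Q.toQuasiHopf) X
  have h := (Twisted.bend (V := X) (D := D) ((β_ X D).hom ≫ (β_ D X).hom) (Twisted.loop X D)).1
    (by unfold Twisted.loop; monoidal)
  have h2 := congrArg (fun f => toEnd X.V (FDMod.Hom.lin f (1 : k))) h
  refine Eq.trans ?_ (h2.symm.trans (toEnd_coev_double X))
  have h3 : ∀ (f : X ⟶ X) (s : X.V ⊗[k] Module.Dual k X.V),
      toEnd X.V ((f ▷ D).lin s) = f.lin ∘ₗ toEnd X.V s := fun f s => by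
    induction s with
    | zero => simp
    | add x y hx hy => simp only [map_add, LinearMap.comp_add, hx, hy]
    | tmul v φ =>
      ext w
      change toEnd X.V (f.lin v ⊗ₜ φ) w = _
      simp
  refine Eq.trans ?_ (h3 (Twisted.loop X D) ((coev (Q := Q.toQuasiHopf) X).lin (1 : k))).symm
  refine LinearMap.ext fun v => ?_
  rw [LinearMap.comp_apply, loop_lin,
    (toEnd_coev' (Q := Q.toQuasiHopf) X (1 : k)).trans (by rw [one_smul]), map_mul]
  rfl

/-- The standard dual pair `(X, X^*)`. -/
abbrev stdPairing {Q : QuasiHopf k H} (X : FDMod Q.toQuasiBialgebra) : ExactPairing X (dual X) :=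
  inferInstance

/-- The map `X ⟶ X^{**}` given by the braiding. -/
def toBidual (X : FDMod Q.toQuasiBialgebra) :
    X ≅ dual (Q := Q.toQuasiHopf) (dual (Q := Q.toQuasiHopf) X) :=
  rightDualIso (BraidedCategory.exactPairing_swap X (dual (Q := Q.toQuasiHopf) X))
    (stdPairing (Q := Q.toQuasiHopf) _)

lemma toBidual_eq (X : FDMod Q.toQuasiBialgebra) :
    (toBidual X).hom = (ρ_ X).inv ≫ X ◁ coev (Q := Q.toQuasiHopf) (dual (Q := Q.toQuasiHopf) X) ≫
      (α_ _ _ _).inv ≫ ((β_ X (dual (Q := Q.toQuasiHopf) X)).hom ≫ ev (Q := Q.toQuasiHopf) X) ▷ _ ≫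
      (λ_ _).hom := by
  unfold toBidual rightDualIso rightAdjointMate
  simp only [id_whiskerRight, MonoidalCategory.whiskerLeft_id, Category.id_comp]
  rfl

lemma coev_toBidual (X : FDMod Q.toQuasiBialgebra) :
    coev (Q := Q.toQuasiHopf) X ≫ (toBidual X).hom ▷ _ =
      coev (Q := Q.toQuasiHopf) (dual (Q := Q.toQuasiHopf) X) ≫ (β_ _ _).hom := by
  let D := dual (Q := Q.toQuasiHopf) X
  have h : (coev (Q := Q.toQuasiHopf) X ≫ (β_ D X).inv) ≫ D ◁ (toBidual X).hom =
      coev (Q := Q.toQuasiHopf) D := by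
    have := @coevaluation_comp_rightAdjointMate _ _ _ D D
        (@HasRightDual.mk _ _ _ D (dual (Q := Q.toQuasiHopf) D) (stdPairing (Q := Q.toQuasiHopf) D))
      (@HasRightDual.mk _ _ _ D X (BraidedCategory.exactPairing_swap X D)) (𝟙 D)
    simp only [id_whiskerRight, Category.comp_id] at this
    exact this
  rw [← h, Category.assoc, Category.assoc, BraidedCategory.braiding_naturality_right,
    Iso.inv_hom_id_assoc]

/-- The map `X ⟶ X^{**}` is the action of the Drinfeld element `u`. -/
lemma toBidual_lin (X : FDMod Q.toQuasiBialgebra) (v : X.V) (φ : Module.Dual k X.V) :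
    (show Module.Dual k (Module.Dual k X.V) from (toBidual X).hom.lin v) φ = φ (X.ρ Q.u v) := by
  let D := dual (Q := Q.toQuasiHopf) X
  let D' := dual (Q := Q.toQuasiHopf) D
  have key : ∀ (t : H ⊗[k] (H ⊗[k] H)) (s : Module.Dual k X.V ⊗[k] Module.Dual k
      (Module.Dual k X.V))
      (b : H) (hb : toEnd (Module.Dual k X.V) s = D.ρ b),
      (show Module.Dual k (Module.Dual k X.V) from (λ_ D').hom.lin
          ((ev (Q := Q.toQuasiHopf) X ▷ D').lin
        ((TensorProduct.comm k X.V (Module.Dual k X.V)).toLinearMap.rTensor D'.V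
        ((TensorProduct.assoc k X.V (Module.Dual k X.V) D'.V).symm
        (act₃ X D D' t (v ⊗ₜ s)))))) φ =
      φ (X.ρ ((LinearMap.mul' k H ∘ₗ (TensorProduct.comm k H H).toLinearMap ∘ₗ
    TensorProduct.map (LinearMap.mulLeft k Q.α)
      (Q.S ∘ₗ LinearMap.mul' k H ∘ₗ TensorProduct.map (LinearMap.mulRight k b) Q.S)) t) v) := by
    intro t s b hb
    induction t using ind₃ with
    | h0 => simp
    | ha x y hx hy =>
      simp only [map_add, LinearMap.add_apply] at hx hy ⊢
      exact congrArg₂ (· + ·) hx hy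
    | ht p q r =>
      have : ∀ s : Module.Dual k X.V ⊗[k] Module.Dual k (Module.Dual k X.V),
        (show Module.Dual k (Module.Dual k X.V) from (λ_ D').hom.lin
            ((ev (Q := Q.toQuasiHopf) X ▷ D').lin
        ((TensorProduct.comm k X.V (Module.Dual k X.V)).toLinearMap.rTensor D'.V
        ((TensorProduct.assoc k X.V (Module.Dual k X.V) D'.V).symm
        (act₃ X D D' (p ⊗ₜ (q ⊗ₜ r)) (v ⊗ₜ s)))))) φ =
        toEnd (Module.Dual k X.V) s (D.ρ (Q.S r) φ) (X.ρ (Q.S q * (Q.α * p)) v) := by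
        intro s
        induction s with
        | zero => simp
        | add x y hx hy =>
          simp only [map_add, tmul_add, LinearMap.add_apply] at hx hy ⊢
          exact congrArg₂ (· + ·) hx hy
        | tmul w ψ => simp [ev, D, D']; exact mul_comm _ _
      rw [this, hb]
      simp [D, Q.S_mul, mul_assoc]
      rfl
  have h := key (leg₁₂ Q.R.val * (Q.Φ⁻¹).val) ((coev (Q := Q.toQuasiHopf) D).lin (1 : k)) Q.β
    ((toEnd_coev' (Q := Q.toQuasiHopf) D (1 : k)).trans (by rw [one_smul]))
  refine Eq.trans ?_ h
  rw [toBidual_eq, comp_whiskerRight]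
  have e : ∀ s : X.V ⊗[k] (Module.Dual k X.V ⊗[k] Module.Dual k (Module.Dual k X.V)),
      ((β_ X D).hom ▷ D').lin ((α_ X D D').inv.lin s) =
        (TensorProduct.comm k X.V (Module.Dual k X.V)).toLinearMap.rTensor D'.V
        ((TensorProduct.assoc k X.V (Module.Dual k X.V) D'.V).symm
        (act₃ X D D' (leg₁₂ Q.R.val * (Q.Φ⁻¹).val) s)) := by
    intro s
    refine (braid_whiskerRight X D D' _).trans (congrArg _ ?_)
    rw [map_mul, assoc_inv_lin', ← assoc_rmul]
    exact Tw.assoc_symm X.ρ D.ρ D'.ρ _ _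
  exact congrArg (fun w => (show Module.Dual k (Module.Dual k X.V) from (λ_ D').hom.lin
    ((ev (Q := Q.toQuasiHopf) X ▷ D').lin w)) φ) (e _)

/-- As `X ⟶ X^{**}` is `H`-linear, `u h = S²(h) u`. -/
lemma u_conj_apply (X : FDMod Q.toQuasiBialgebra) (h : H) (v : X.V) :
    X.ρ (Q.u * h) v = X.ρ (Q.S (Q.S h) * Q.u) v := by
  refine (Module.forall_dual_apply_eq_zero_iff k _).1 ?_ |> sub_eq_zero.1
  intro φ
  rw [map_sub, map_mul, map_mul]
  have h1 := toBidual_lin X (X.ρ h v) φ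
  have h2 := toBidual_lin X v (φ ∘ₗ X.ρ (Q.S (Q.S h)))
  have h3 := congrArg (fun ξ => (show Module.Dual k (Module.Dual k X.V) from ξ) φ)
    ((toBidual X).hom.comm h v)
  exact sub_eq_zero.2 (h1.symm.trans (h3.trans h2))

/-- The relation `coev_X (g ⊗ id) = coev_{X^*} c`, read off in `X^{**} ⊗ X^*`. -/
lemma u_mul_β_apply (X : FDMod Q.toQuasiBialgebra) (v : X.V) (ψ : Module.Dual k X.V) :
    ψ (X.ρ (Q.u * Q.β) v) = ψ (X.ρ ((LinearMap.mul' k H ∘ₗ (TensorProduct.comm k H H).toLinearMap ∘ₗ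
      TensorProduct.map (Q.S ∘ₗ LinearMap.mulRight k Q.β) (Q.S ∘ₗ Q.S)) Q.R.val) v) := by
  let D := dual (Q := Q.toQuasiHopf) X
  let D' := dual (Q := Q.toQuasiHopf) D
  -- the pairing of `X^{**} ⊗ X^*` with `ψ ⊗ v`
  let c : Module.Dual k (Module.Dual k X.V) ⊗[k] Module.Dual k X.V →ₗ[k] k :=
    LinearMap.mul' k k ∘ₗ TensorProduct.map (LinearMap.applyₗ ψ) (LinearMap.applyₗ v)
  have h : c ((coev (Q := Q.toQuasiHopf) X ≫ (toBidual X).hom ▷ D).lin (1 : k)) =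
      c ((coev (Q := Q.toQuasiHopf) D ≫ (β_ D D').hom).lin (1 : k)) := by rw [coev_toBidual]
  have h1 : ∀ s : X.V ⊗[k] Module.Dual k X.V,
      c (((toBidual X).hom ▷ D).lin s) = ψ (X.ρ Q.u (toEnd X.V s v)) := fun s => by
    induction s with
    | zero => simp
    | add x y hx hy => simp only [map_add, LinearMap.add_apply, hx, hy]
    | tmul w φ =>
      change c ((toBidual X).hom.lin w ⊗ₜ φ) = _
      refine (congrArg (fun a => a * φ v) (toBidual_lin X w ψ)).trans ?_
      simp [mul_comm]
  have h2 : ∀ (t : H ⊗[k] H) (s : Module.Dual k X.V ⊗[k] Module.Dual k (Module.Dual k X.V)),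
      toEnd (Module.Dual k X.V) s = D.ρ Q.β →
      c (TensorProduct.comm k _ _ (tensorAct D.ρ D'.ρ t s)) =
        ψ (X.ρ ((LinearMap.mul' k H ∘ₗ (TensorProduct.comm k H H).toLinearMap ∘ₗ
          TensorProduct.map (Q.S ∘ₗ LinearMap.mulRight k Q.β) (Q.S ∘ₗ Q.S)) t) v) := by
    intro t s hs
    induction t with
    | zero => simp
    | add x y hx hy => simp only [map_add, LinearMap.add_apply, hx, hy]
    | tmul p q =>
      have : ∀ s : Module.Dual k X.V ⊗[k] Module.Dual k (Module.Dual k X.V),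
          c (TensorProduct.comm k _ _ (tensorAct D.ρ D'.ρ (p ⊗ₜ q) s)) =
            D.ρ p (toEnd (Module.Dual k X.V) s (D.ρ (Q.S q) ψ)) v := by
        intro s
        induction s with
        | zero => simp; rfl
        | add x y hx hy => simp only [map_add, LinearMap.add_apply, hx, hy]; rfl
        | tmul w ξ => simp [c, D, D']; exact Or.inl rfl
      rw [this, hs]
      simp [D, Q.S_mul]
      rfl
  have h3 := h1 ((coev (Q := Q.toQuasiHopf) X).lin (1 : k))
  rw [(toEnd_coev' (Q := Q.toQuasiHopf) X (1 : k)).trans (by rw [one_smul])] at h3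
  rw [map_mul]
  refine (h3.symm.trans h).trans ?_
  exact h2 Q.R.val _ ((toEnd_coev' (Q := Q.toQuasiHopf) D (1 : k)).trans (by rw [one_smul]))

end FDMod

namespace QTQuasiHopf
variable (Q : QTQuasiHopf k H)

/-- The algebra map which sends `t` to `n ↦ t² n S(t¹)`. -/
def twistBy : H ⊗[k] H →ₐ[k] Module.End k H :=
  Algebra.TensorProduct.lift
    (AlgHom.ofLinearMap ((LinearMap.mul k H).flip ∘ₗ Q.S)
      (by ext; simp [Q.S_one]) (fun a b => by ext; simp [Q.S_mul, mul_assoc]))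
    (Algebra.lmul k H) (fun a b => by
      change _ * _ = _ * _
      ext n
      simp [mul_assoc])

lemma twistBy_tmul (a b n : H) : Q.twistBy (a ⊗ₜ b) n = b * n * Q.S a := by
  simp [twistBy, mul_assoc]

lemma twistBy_R_injective : Function.Injective (Q.twistBy Q.R.val) := by
  refine Function.LeftInverse.injective (g := Q.twistBy (Q.R⁻¹).val) fun n => ?_
  rw [← Module.End.mul_apply, ← map_mul, Units.inv_mul, map_one, Module.End.one_apply]

/-- The element `R¹ β S(R²)`. -/
abbrev βR : H := LinearMap.mul' k H (TensorProduct.map (LinearMap.mulRight k Q.β) Q.S Q.R.val)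

lemma twistBy_βR : Q.twistBy Q.R.val Q.βR = FDMod.doubleβ Q := by
  have : ∀ s t : H ⊗[k] H, Q.twistBy s
      (LinearMap.mul' k H (TensorProduct.map (LinearMap.mulRight k Q.β) Q.S t)) =
      LinearMap.mul' k H (TensorProduct.map (LinearMap.mulRight k Q.β) Q.S
        (Algebra.TensorProduct.comm k H H s * t)) := by
    intro s t
    induction s with
    | zero => simp
    | add x y hx hy => simp only [map_add, LinearMap.add_apply, hx, hy, add_mul]
    | tmul a b =>
      induction t with
      | zero => simp
      | add x y hx hy => simp only [map_add, hx, hy, mul_add]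
      | tmul c d => simp [twistBy_tmul, Q.S_mul, mul_assoc]
  exact this _ _

variable [Module.Finite k H]

lemma u_mul (h : H) : Q.u * h = Q.S (Q.S h) * Q.u := by
  have := FDMod.u_conj_apply (Q := Q) (YD.reg (Q := Q.toQuasiHopf)) h (1 : H)
  simpa using this

lemma isUnit_u : IsUnit Q.u := by
  have hinj : Function.Injective (LinearMap.mulLeft k Q.u) := by
    rw [← LinearMap.ker_eq_bot, LinearMap.ker_eq_bot']
    intro h hh
    let X : FDMod Q.toQuasiBialgebra := YD.reg (Q := Q.toQuasiHopf)
    have h0 : (FDMod.toBidual X).hom.lin h = 0 := LinearMap.ext fun φ =>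
      (FDMod.toBidual_lin X h φ).trans ((congrArg φ hh).trans (map_zero φ))
    have := FDMod.Tw.iso (FDMod.toBidual X).hom (FDMod.toBidual X).inv
      (FDMod.toBidual X).hom_inv_id h
    rw [← this, h0, map_zero]
  obtain ⟨b, hb⟩ := LinearMap.injective_iff_surjective.1 hinj 1
  change Q.u * b = 1 at hb
  refine ⟨⟨Q.u, b, hb, hinj ?_⟩, rfl⟩
  change Q.u * (b * Q.u) = Q.u * 1
  rw [← mul_assoc, hb, one_mul, mul_one]

lemma S_S_u : Q.S (Q.S Q.u) = Q.u := Q.isUnit_u.mul_right_cancel (Q.u_mul Q.u).symm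

/-- The relation `u β = S²(R²) S(β) S(R¹)`. -/
lemma u_mul_β : Q.u * Q.β = (LinearMap.mul' k H ∘ₗ (TensorProduct.comm k H H).toLinearMap ∘ₗ
      TensorProduct.map (Q.S ∘ₗ LinearMap.mulRight k Q.β) (Q.S ∘ₗ Q.S)) Q.R.val := by
  refine (Module.forall_dual_apply_eq_zero_iff k _).1 ?_ |> sub_eq_zero.1
  intro φ
  have := FDMod.u_mul_β_apply (Q := Q) (YD.reg (Q := Q.toQuasiHopf)) (1 : H) φ
  rw [map_sub, sub_eq_zero]
  refine Eq.trans ?_ (this.trans ?_)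
  · exact congrArg φ (mul_one _).symm
  · exact congrArg φ (mul_one _)

lemma S_βR : Q.S Q.βR = Q.u * Q.β := by
  rw [u_mul_β, βR]
  induction Q.R.val with
  | zero => simp
  | add x y hx hy => simp only [map_add, hx, hy]
  | tmul a b => simp [Q.S_mul]

/-- For `w = u⁻¹`, the relation for `u β` becomes `R² u⁻¹ S(β) S(R¹) = β`. -/
lemma twistBy_S_β (w : H) (hw : w * Q.u = 1) : Q.twistBy Q.R.val (w * Q.S Q.β) = Q.β := by
  have hu : Q.u * w = 1 := by
    refine Q.isUnit_u.mul_right_cancel ?_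
    rw [mul_assoc, hw, mul_one, one_mul]
  have key : ∀ t : H ⊗[k] H, Q.u * Q.twistBy t (w * Q.S Q.β) =
      (LinearMap.mul' k H ∘ₗ (TensorProduct.comm k H H).toLinearMap ∘ₗ
      TensorProduct.map (Q.S ∘ₗ LinearMap.mulRight k Q.β) (Q.S ∘ₗ Q.S)) t := by
    intro t
    induction t with
    | zero => simp
    | add x y hx hy => simp only [map_add, LinearMap.add_apply, mul_add, hx, hy]
    | tmul a b =>
      rw [twistBy_tmul, ← mul_assoc, ← mul_assoc, ← mul_assoc, u_mul, mul_assoc _ Q.u w, hu]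
      simp [Q.S_mul, mul_assoc]
  exact Q.isUnit_u.mul_left_cancel ((key _).trans Q.u_mul_β.symm)

lemma loopElt_comm (h : H) : FDMod.loopElt Q * h = h * FDMod.loopElt Q := by
  let X : FDMod Q.toQuasiBialgebra := YD.reg (Q := Q.toQuasiHopf)
  have h1 := fun v => FDMod.loop_lin (Q := Q) X v
  have h2 := (@Twisted.loop _ _ _ _ X _ (FDMod.stdPairing (Q := Q.toQuasiHopf) X)).comm h (1 : H)
  rw [h1, h1] at h2
  change FDMod.loopElt Q * (h * 1) = h * (FDMod.loopElt Q * 1) at h2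
  rwa [mul_one, mul_one] at h2

lemma loopElt_mul_β : FDMod.loopElt Q * Q.β = FDMod.doubleβ Q := by
  have := congrArg (fun f : Module.End k H => f 1)
    (FDMod.loopElt_mul_β_apply (Q := Q) (YD.reg (Q := Q.toQuasiHopf)))
  change FDMod.loopElt Q * Q.β * 1 = FDMod.doubleβ Q * 1 at this
  rwa [mul_one, mul_one] at this

lemma S_u_mul_u_comm (h : H) : Q.S Q.u * Q.u * h = h * (Q.S Q.u * Q.u) := by
  obtain ⟨h, rfl⟩ := Q.S_bijective.2 h
  have := congrArg Q.S (Q.u_mul h)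
  rw [Q.S_mul, Q.S_mul] at this
  rw [mul_assoc, u_mul, ← mul_assoc, ← this, mul_assoc]

lemma S_u_mul_u : Q.S Q.u * Q.u = Q.u * Q.S Q.u :=
  Q.isUnit_u.mul_right_cancel ((Q.S_u_mul_u_comm Q.u).trans (mul_assoc _ _ _).symm)

lemma isUnit_S_u : IsUnit (Q.S Q.u) := by
  obtain ⟨a, ha⟩ := Q.isUnit_u
  refine ⟨⟨Q.S a.val, Q.S (a⁻¹).val, ?_, ?_⟩, congrArg Q.S ha⟩
  · rw [← Q.S_mul, Units.inv_mul, Q.S_one]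
  · rw [← Q.S_mul, Units.mul_inv, Q.S_one]

/-- The central element `u S(u)` is the one by which the composite `Twisted.loop` acts. Let `z` be
the latter. Both `β` and `z β` are of the form `R² n S(R¹)`, and this element determines `n`, whence
`R¹ β S(R²) = z u⁻¹ S(β)`. Applying `S` gives `β = β w` for the central element `w` with
`S(u) u w = S(z)`, and then `w = 1`. -/
theorem loopElt_eq : FDMod.loopElt Q = Q.u * Q.S Q.u := by
  set z := FDMod.loopElt Q with hz
  obtain ⟨a, ha⟩ := Q.isUnit_u
  have h1 : Q.βR = z * ((a⁻¹).val * Q.S Q.β) := by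
    apply Q.twistBy_R_injective
    have hc : ∀ (t : H ⊗[k] H) n, Q.twistBy t (z * n) = z * Q.twistBy t n := fun t n => by
      induction t with
      | zero => simp
      | add x y hx hy => simp only [map_add, LinearMap.add_apply, hx, hy, mul_add]
      | tmul p q => rw [twistBy_tmul, twistBy_tmul, ← mul_assoc, hz, ← Q.loopElt_comm]; simp only
          [mul_assoc]
    rw [twistBy_βR, hc, twistBy_S_β _ _ (by rw [← ha, Units.inv_mul]), Q.loopElt_mul_β]
  obtain ⟨b, hb⟩ := Q.isUnit_S_u
  have hSa : Q.S (a⁻¹).val = (b⁻¹).val := by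
    refine b.isUnit.mul_left_cancel ?_
    rw [Units.mul_inv, hb, ← Q.S_mul, ← ha, Units.inv_mul, Q.S_one]
  have hzc : ∀ h, Q.S z * h = h * Q.S z := fun h => by
    obtain ⟨h, rfl⟩ := Q.S_bijective.2 h
    rw [← Q.S_mul, ← Q.S_mul, ← Q.loopElt_comm]
  -- the element by which `S(z)` and `S(u) u` differ
  set w := (a⁻¹).val * (b⁻¹).val * Q.S z with hw
  have hab : Q.S Q.u * Q.u * ((a⁻¹).val * (b⁻¹).val) = 1 := by
    rw [← hb, ← ha, mul_assoc, a.mul_inv_cancel_left, Units.mul_inv]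
  have hwu : Q.S Q.u * Q.u * w = Q.S z := by rw [hw, ← mul_assoc, hab, one_mul]
  have hwc : ∀ h, w * h = h * w := fun h => by
    refine (Q.isUnit_S_u.mul Q.isUnit_u).mul_left_cancel ?_
    rw [← mul_assoc, hwu, ← mul_assoc, Q.S_u_mul_u_comm, mul_assoc, hwu, hzc]
  have h2 : Q.β = Q.β * w := by
    refine Q.isUnit_u.mul_left_cancel ?_
    have h4 : Q.S Q.βR = Q.S (Q.S Q.β) * (b⁻¹).val * Q.S z := by rw [h1, Q.S_mul, Q.S_mul, hSa]
    rw [← S_βR, h4, ← mul_assoc, u_mul, hw, ← ha]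
    simp only [mul_assoc, a.mul_inv_cancel_left]
  -- `β = β w` with `w` central forces `w = 1`, as `X¹ β S(X²) α X³ = 1`
  have h3 : w = 1 := by
    have key : ∀ t : H ⊗[k] (H ⊗[k] H), LinearMap.mul' k H (TensorProduct.map
        (LinearMap.mulRight k (Q.β * w)) (LinearMap.mul' k H ∘ₗ
          TensorProduct.map Q.S (LinearMap.mulLeft k Q.α)) t) =
        LinearMap.mul' k H (TensorProduct.map
        (LinearMap.mulRight k Q.β) (LinearMap.mul' k H ∘ₗ
          TensorProduct.map Q.S (LinearMap.mulLeft k Q.α)) t) * w := by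
      intro t
      induction t using FDMod.ind₃ with
      | h0 => simp
      | ha x y hx hy => simp only [map_add, hx, hy, add_mul]
      | ht p q r => simp only [TensorProduct.map_tmul, LinearMap.mulRight_apply,
          LinearMap.mul'_apply, LinearMap.comp_apply, mul_assoc, hwc]
    have := key Q.Φ.val
    rw [← h2, Q.antipode_reassoc, one_mul] at this
    exact this.symm
  refine Q.S_bijective.1 ?_
  rw [← hwu, h3, mul_one, Q.S_mul, Q.S_S_u, S_u_mul_u]

end QTQuasiHopf

end DrinfeldElement

/-! ### The equivalence of Yetter-Drinfeld modules and modules over the quantum double -/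

section DoubleModules

variable {k H : Type u} [Field k] [Ring H] [Algebra k H] [Module.Finite k H] {Q : QuasiHopf k H}

namespace QuantumDouble

lemma tensor_toRep' (V W : YD Q) (b : QuantumDouble Q) (t : V.V ⊗[k] W.V) :
    tensorAct V.toRep.ρ W.toRep.ρ ((qt Q).Δ b) t = (YD.tensor V W).toRep.ρ b t := by
  have h1 := tensor_toRep (Q := Q) V.toRep W.toRep
  refine (congrArg (fun f : QuantumDouble Q →ₐ[k] Module.End k (V.V ⊗[k] W.V) => f b t)
      h1).symm.trans ?_
  exact ten_id V W V.toRep.ρ W.toRep.ρ (fun _ _ => rfl) (fun _ _ => rfl) b t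

variable (Q) in
/-- The functor from Yetter-Drinfeld modules to modules over `D(H)`. -/
def ofYD : YD Q ⥤ FDMod (qt Q).toQuasiBialgebra where
  obj V := ⟨V.V, V.toRep.ρ⟩
  map f := ⟨f.hom.lin, YD.Hom.intertwines f⟩

instance : (ofYD Q).Faithful where
  map_injective {V W _ _} h := YD.Hom.ext (FDMod.hom_ext fun v =>
    congrArg (fun f : (ofYD Q).obj V ⟶ (ofYD Q).obj W => (f.lin : V.V →ₗ[k] W.V) v) h)

instance : (ofYD Q).Full where
  map_surjective f := ⟨YD.homOfIntertwines f.lin f.comm, rfl⟩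

instance : (ofYD Q).EssSurj where
  mem_essImage X := ⟨toYD ⟨X.V, X.ρ⟩, ⟨FDMod.isoMk (LinearEquiv.refl k X.V) fun b x =>
    (toRep_toYD_id ⟨X.V, X.ρ⟩ b x).symm⟩⟩

instance : (ofYD Q).IsEquivalence where

variable (Q) in
/-- Tensor products of Yetter-Drinfeld modules are tensor products of modules over `D(H)`. -/
def ofYDCore : (ofYD Q).CoreMonoidal where
  εIso := FDMod.isoMk (LinearEquiv.refl k k) fun b c => (unitRep_apply Q b c).symm
  μIso V W := FDMod.isoMk (LinearEquiv.refl k (V.V ⊗[k] W.V)) fun b t => tensor_toRep' V W b t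
  μIso_hom_natural_left _ _ := rfl
  μIso_hom_natural_right _ _ := rfl
  associativity X Y Z := FDMod.hom_ext fun t => by
    change (X.V ⊗[k] Y.V) ⊗[k] Z.V at t
    have e : ∀ s : H ⊗[k] (H ⊗[k] H), FDMod.act₃ X.toFDMod Y.toFDMod Z.toFDMod s =
        tensorAct X.toRep.ρ (tensorAct Y.toRep.ρ Z.toRep.ρ) (Algebra.TensorProduct.map (incl Q)
          (Algebra.TensorProduct.map (incl Q) (incl Q)) s) := fun s => by
      have e1 : ∀ V : YD Q, V.ρ = V.toRep.ρ.comp (incl Q) := fun V =>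
        AlgHom.ext fun a => (YD.toRep_incl V a).symm
      change tensorAct X.ρ (tensorAct Y.ρ Z.ρ) s = _
      rw [e1 X, e1 Y, e1 Z, tensorAct_comp, tensorAct_comp]; rfl
    have h1 : TensorProduct.map (LinearMap.id : X.V ⊗[k] Y.V →ₗ[k] X.V ⊗[k] Y.V)
        (LinearMap.id : Z.V →ₗ[k] Z.V) t = t := map_id_apply t
    have h2 : ∀ s, TensorProduct.map (LinearMap.id : X.V →ₗ[k] X.V)
        (LinearMap.id : Y.V ⊗[k] Z.V →ₗ[k] Y.V ⊗[k] Z.V) s = s := fun s => map_id_apply s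
    change FDMod.act₃ X.toFDMod Y.toFDMod Z.toFDMod Q.Φ.val (TensorProduct.assoc k X.V Y.V Z.V
      (TensorProduct.map (LinearMap.id : X.V ⊗[k] Y.V →ₗ[k] X.V ⊗[k] Y.V)
        (LinearMap.id : Z.V →ₗ[k] Z.V) t)) = TensorProduct.map (LinearMap.id : X.V →ₗ[k] X.V)
        (LinearMap.id : Y.V ⊗[k] Z.V →ₗ[k] Y.V ⊗[k] Z.V)
        (tensorAct X.toRep.ρ (tensorAct Y.toRep.ρ Z.toRep.ρ) (qt Q).Φ.val
          (TensorProduct.assoc k X.V Y.V Z.V t))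
    rw [h1, h2, e]
    rfl
  left_unitality X := FDMod.hom_ext fun t => by
    change k ⊗[k] X.V at t
    exact congrArg (TensorProduct.lid k X.V) (map_id_apply t).symm
  right_unitality X := FDMod.hom_ext fun t => by
    change X.V ⊗[k] k at t
    exact congrArg (TensorProduct.rid k X.V) (map_id_apply t).symm

instance : (ofYD Q).Monoidal := (ofYDCore Q).toMonoidal

instance : (ofYD Q).Braided where
  braided V W := FDMod.hom_ext fun t => by
    change V.V ⊗[k] W.V at t
    change (W.half V.toFDMod).lin t = TensorProduct.comm k V.V W.V
      (tensorAct V.toRep.ρ W.toRep.ρ (R Q) t)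
    have h := tensorAct_comp V.toRep.ρ W.toRep.ρ (incl Q) (.id k (QuantumDouble Q))
    have e1 : V.ρ = V.toRep.ρ.comp (incl Q) := AlgHom.ext fun a => (YD.toRep_incl V a).symm
    rw [YD.half_eq]
    refine congrArg (TensorProduct.comm k V.V W.V) ?_
    rw [AlgHom.comp_id, ← e1] at h
    rw [R_eq_map]
    exact congrArg (fun f : H ⊗[k] QuantumDouble Q →ₐ[k] Module.End k (V.V ⊗[k] W.V) => f
        (canon (gen Q)) t) h

end QuantumDouble

end DoubleModules

/-! ### Ribbon categories and the functoriality of `R(C, c)` -/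

section MapPairing
open Functor.LaxMonoidal Functor.OplaxMonoidal

variable {C : Type*} [Category* C] [MonoidalCategory C]
  {D : Type*} [Category* D] [MonoidalCategory D]

/-- Strong monoidal functors preserve dual pairs. -/
abbrev mapPairing (F : C ⥤ D) [F.Monoidal] (V W : C) [ExactPairing V W] :
    ExactPairing (F.obj V) (F.obj W) where
  coevaluation' := ε F ≫ F.map (η_ V W) ≫ δ F V W
  evaluation' := μ F W V ≫ F.map (ε_ V W) ≫ η F
  coevaluation_evaluation' := by
    have h := congrArg F.map (ExactPairing.coevaluation_evaluation V W)
    simp only [Functor.map_comp, Functor.Monoidal.map_whiskerLeft,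
        Functor.Monoidal.map_whiskerRight,
      Functor.Monoidal.map_associator_inv, Functor.Monoidal.map_leftUnitor_inv,
      Functor.Monoidal.map_rightUnitor, Category.assoc, Functor.Monoidal.μ_δ_assoc] at h
    have h2 := congrArg (fun f => F.obj W ◁ ε F ≫ μ F W (𝟙_ C) ≫ f ≫ δ F (𝟙_ C) W ≫ η F ▷ F.obj W) h
    simp only [Category.assoc, Functor.Monoidal.μ_δ_assoc] at h2
    simpa using h2
  evaluation_coevaluation' := by
    have h := congrArg F.map (ExactPairing.evaluation_coevaluation V W)
    simp only [Functor.map_comp, Functor.Monoidal.map_whiskerLeft,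
        Functor.Monoidal.map_whiskerRight,
      Functor.Monoidal.map_associator, Functor.Monoidal.map_leftUnitor,
      Functor.Monoidal.map_rightUnitor_inv, Category.assoc, Functor.Monoidal.μ_δ_assoc] at h
    have h2 := congrArg (fun f => ε F ▷ F.obj V ≫ μ F (𝟙_ C) V ≫ f ≫ δ F V (𝟙_ C) ≫ F.obj V ◁ η F) h
    simp only [Category.assoc, Functor.Monoidal.μ_δ_assoc] at h2
    simpa using h2

end MapPairing

section Uniqueness
variable {C : Type*} [Category* C] [MonoidalCategory C]

/-- A morphism out of `D ⊗ X` is determined by the morphism out of `X` which corresponds to it under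
duality. -/
lemma hom_ext_of_coev {V D X Z : C} [ExactPairing V D] {f g : D ⊗ X ⟶ Z}
    (h : η_ V D ▷ X ≫ (α_ V D X).hom ≫ V ◁ f = η_ V D ▷ X ≫ (α_ V D X).hom ≫ V ◁ g) : f = g :=
  (tensorLeftHomEquiv X V D Z).injective (congrArg (fun x => (λ_ X).inv ≫ x) h)

/-- A morphism out of `D` is determined by its composite with the coevaluation. -/
lemma hom_ext_of_coev' {V D Z : C} [ExactPairing V D] {f g : D ⟶ Z}
    (h : η_ V D ≫ V ◁ f = η_ V D ≫ V ◁ g) : f = g := by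
  have := congrArg (tensorLeftHomEquiv _ V D _).symm h
  simpa using this

/-- Two duals of an object are isomorphic, compatibly with evaluation and coevaluation. -/
lemma exists_dual_iso {V D D' : C} (p : ExactPairing V D) (q : ExactPairing V D') :
    ∃ i : D ≅ D', η_ V D ≫ V ◁ i.hom = η_ V D' ∧ i.hom ▷ V ≫ ε_ V D' = ε_ V D := by
  have h : η_ V D ≫ V ◁ (rightDualIso p q).hom = η_ V D' := by
    have := @coevaluation_comp_rightAdjointMate _ _ _ V V ⟨D'⟩ ⟨D⟩ (𝟙 V)
    simp only [id_whiskerRight, Category.comp_id] at this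
    exact this
  refine ⟨rightDualIso p q, h, ?_⟩
  apply hom_ext_of_coev (V := V)
  have e : η_ V D ▷ V ≫ (α_ V D V).hom ≫ V ◁ ((rightDualIso p q).hom ▷ V ≫ ε_ V D') =
      (η_ V D ≫ V ◁ (rightDualIso p q).hom) ▷ V ≫ (α_ V D' V).hom ≫ V ◁ ε_ V D' := by
    simp
  rw [e, h, ExactPairing.evaluation_coevaluation, ExactPairing.evaluation_coevaluation]

variable [BraidedCategory C]

/-- The composite in the definition of `R(C, c)` does not depend on the choice of the dual. -/
lemma Twisted.loop_eq (V D D' : C) [p : ExactPairing V D] [q : ExactPairing V D'] :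
    Twisted.loop V D = Twisted.loop V D' := by
  obtain ⟨i, h1, h2⟩ := exists_dual_iso p q
  have e : V ◁ i.hom ≫ (β_ V D').hom ≫ (β_ D' V).hom = ((β_ V D).hom ≫ (β_ D V).hom) ≫
      V ◁ i.hom := by
    simp
  unfold Twisted.loop
  rw [← h2, ← h1]
  calc _ = (λ_ V).inv ≫ (η_ V D ≫ ((β_ V D).hom ≫ (β_ D V).hom) ≫ V ◁ i.hom) ▷ V ≫ (α_ V D' V).hom ≫
        V ◁ ε_ V D' ≫ (ρ_ V).hom := by simp
    _ = _ := by rw [← e]; simp only [comp_whiskerRight, Category.assoc]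

lemma Twisted.loop_congr {V V' : C} (D : C) [ExactPairing V' D] (i : V ≅ V') :
    @Twisted.loop _ _ _ _ V D (exactPairingCongrLeft i) ≫ i.hom = i.hom ≫ Twisted.loop V' D := by
  let p : ExactPairing V D := exactPairingCongrLeft i
  have h1 : η_ V D = η_ V' D ≫ i.inv ▷ D := rfl
  have h2 : ε_ V D = D ◁ i.hom ≫ ε_ V' D := rfl
  have e : i.inv ▷ D ≫ (β_ V D).hom ≫ (β_ D V).hom = ((β_ V' D).hom ≫ (β_ D V').hom) ≫
      i.inv ▷ D := by
    simp
  have h3 : Twisted.loop V D = (λ_ V).inv ≫ (η_ V D ≫ (β_ V D).hom ≫ (β_ D V).hom) ▷ V ≫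
      (α_ V D V).hom ≫ V ◁ ε_ V D ≫ (ρ_ V).hom := by
    unfold Twisted.loop; simp only [comp_whiskerRight, Category.assoc]
  rw [h3, h1, h2, Category.assoc (η_ V' D), e]
  calc _ = (λ_ V).inv ≫ (η_ V' D ≫ (β_ V' D).hom ≫ (β_ D V').hom) ▷ V ≫
        ((i.inv ▷ D) ▷ V ≫ (V ⊗ D) ◁ i.hom) ≫ (α_ V D V').hom ≫ V ◁ ε_ V' D ≫ (ρ_ V).hom ≫
            i.hom := by
        simp
    _ = (λ_ V).inv ≫ ((η_ V' D ≫ (β_ V' D).hom ≫ (β_ D V').hom) ▷ V ≫ (V' ⊗ D) ◁ i.hom) ≫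
        (α_ V' D V').hom ≫ (i.inv ▷ (D ⊗ V') ≫ V ◁ ε_ V' D) ≫ (ρ_ V).hom ≫ i.hom := by
        rw [← whisker_exchange]; simp
    _ = (λ_ V).inv ≫ (𝟙_ C ◁ i.hom ≫ (η_ V' D ≫ (β_ V' D).hom ≫ (β_ D V').hom) ▷ V') ≫
        (α_ V' D V').hom ≫ (V' ◁ ε_ V' D ≫ i.inv ▷ 𝟙_ C) ≫ (ρ_ V).hom ≫ i.hom := by
        rw [whisker_exchange, whisker_exchange]
    _ = _ := by simp [Twisted.loop]

lemma Twisted.rib_iff {X : Twisted C} (D : C) [ExactPairing X.obj D] :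
    Twisted.rib C X ↔ X.η.inv ≫ X.η.inv = Twisted.loop X.obj D :=
  ⟨fun ⟨D', _, h⟩ => h.trans (Twisted.loop_eq X.obj D' D), fun h => ⟨D, inferInstance, h⟩⟩

lemma Twisted.rib_of_iso {X Y : Twisted C} (i : X.obj ≅ Y.obj)
    (h : i.hom ≫ Y.η.hom = X.η.hom ≫ i.hom) (hY : Twisted.rib C Y) : Twisted.rib C X := by
  obtain ⟨D, p, hD⟩ := hY
  refine ⟨D, exactPairingCongrLeft i, ?_⟩
  rw [← cancel_mono i.hom]
  refine Eq.trans ?_ (Twisted.loop_congr D i).symm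
  have h' : X.η.inv ≫ i.hom = i.hom ≫ Y.η.inv := by
    rw [Iso.inv_comp_eq, ← Category.assoc, ← h]; simp
  rw [Category.assoc, h', ← Category.assoc, h', Category.assoc, hD]

end Uniqueness

section RibbRibbon

variable {C : Type u} [Category.{v} C] [MonoidalCategory C] [BraidedCategory C]

/-- A twist is compatible with duals if this holds for one choice of duals. -/
lemma Twist.isRibbon_of {T : Twist C} (h : ∀ X : C, ∃ (D : C) (_ : ExactPairing X D),
    η_ X D ≫ (T.θ X).hom ▷ D = η_ X D ≫ X ◁ (T.θ D).hom) : T.IsRibbon := by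
  refine ⟨fun X => ?_, fun X _ => ?_⟩
  · obtain ⟨D, p, -⟩ := h X
    exact ⟨⟨D⟩⟩
  · obtain ⟨D, p, hD⟩ := h X
    obtain ⟨i, hi, -⟩ := exists_dual_iso p (inferInstance : ExactPairing X (Xᘁ))
    apply hom_ext_of_coev' (V := X)
    rw [coevaluation_comp_rightAdjointMate, ← hi, Category.assoc, Category.assoc,
      ← MonoidalCategory.whiskerLeft_comp, T.natural, MonoidalCategory.whiskerLeft_comp,
      ← Category.assoc, ← hD, Category.assoc, ← whisker_exchange]

lemma Twist.IsRibbon.coev {T : Twist C} (h : T.IsRibbon) (X D : C) [p : ExactPairing X D] :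
    η_ X D ≫ (T.θ X).hom ▷ D = η_ X D ≫ X ◁ (T.θ D).hom := by
  let _ : HasRightDual X := ⟨D⟩
  have := h.2 X
  exact (coevaluation_comp_rightAdjointMate (T.θ X).hom).symm.trans
    (congrArg (fun f => η_ X D ≫ X ◁ f) this.symm)

namespace Twisted

/-- The twist `(f ⊗ g) c_{W,V} c_{V,W}` of a tensor product. -/
def twistTensor {V W : C} (f : V ⟶ V) (g : W ⟶ W) : V ⊗ W ⟶ V ⊗ W :=
  (β_ V W).hom ≫ (β_ W V).hom ≫ (f ⊗ₘ g)

lemma twistTensor_nat {V W V' W' : C} {f : V ⟶ V} {g : W ⟶ W} {f' : V' ⟶ V'} {g' : W' ⟶ W'}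
    {a : V ⟶ V'} {b : W ⟶ W'} (ha : a ≫ f' = f ≫ a) (hb : b ≫ g' = g ≫ b) :
    (a ⊗ₘ b) ≫ twistTensor f' g' = twistTensor f g ≫ (a ⊗ₘ b) := by
  rw [twistTensor, twistTensor, Category.assoc, Category.assoc, tensorHom_comp_tensorHom, ← hb,
    ← ha, ← tensorHom_comp_tensorHom]
  have := congrArg (fun x => x ≫ (f' ⊗ₘ g')) (double_nat a b)
  simpa only [Category.assoc] using this

lemma twistTensor_assoc {X Y Z : C} (f : X ≅ X) (g : Y ≅ Y) (h : Z ≅ Z) :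
    (α_ X Y Z).hom ≫ twistTensor f.hom (twistTensor g.hom h.hom) =
      twistTensor (twistTensor f.hom g.hom) h.hom ≫ (α_ X Y Z).hom :=
  assoc_comm (⟨X, f⟩ : Twisted C) ⟨Y, g⟩ ⟨Z, h⟩

lemma twistTensor_braid {V W : C} (f : V ⟶ V) (g : W ⟶ W) :
    (β_ V W).hom ≫ twistTensor g f = twistTensor f g ≫ (β_ V W).hom := by
  simp [twistTensor]

/-- The condition defining `R(C, c)` says that the coevaluation is invariant under the twists. -/
lemma rib_iff_coev {X : Twisted C} {D : C} [ExactPairing X.obj D] (ζ : D ≅ D)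
    (h : η_ X.obj D ≫ X.η.hom ▷ D = η_ X.obj D ≫ X.obj ◁ ζ.hom) :
    rib C X ↔ η_ X.obj D ≫ twistTensor X.η.hom ζ.hom = η_ X.obj D :=
  (rib_iff D).trans (rib_eq_iff X.η ζ h)

/-- The dual of an object of `R(C, c)` lies in `R(C, c)`. -/
lemma rib_dual {X : Twisted C} {D : C} [ExactPairing X.obj D] (ζ : D ≅ D)
    (h : η_ X.obj D ≫ X.η.hom ▷ D = η_ X.obj D ≫ X.obj ◁ ζ.hom) (hX : rib C X) :
    rib C ⟨D, ζ⟩ := by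
  have h1 := (rib_iff_coev ζ h).1 hX
  let p : ExactPairing D X.obj := BraidedCategory.exactPairing_swap X.obj D
  have hc : η_ D X.obj = η_ X.obj D ≫ (β_ D X.obj).inv := rfl
  have h2 : η_ D X.obj ≫ ζ.hom ▷ X.obj = η_ D X.obj ≫ D ◁ X.η.hom := by
    rw [hc, Category.assoc, ← BraidedCategory.braiding_inv_naturality_right, ← Category.assoc, ← h,
      Category.assoc, Category.assoc, BraidedCategory.braiding_inv_naturality_left]
  refine (@rib_iff_coev _ _ _ _ ⟨D, ζ⟩ X.obj p X.η h2).2 ?_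
  have h3 : twistTensor ζ.hom X.η.hom =
      (β_ D X.obj).hom ≫ twistTensor X.η.hom ζ.hom ≫ (β_ D X.obj).inv := by
    rw [← Category.assoc, twistTensor_braid, Category.assoc, Iso.hom_inv_id, Category.comp_id]
  change η_ D X.obj ≫ twistTensor ζ.hom X.η.hom = η_ D X.obj
  rw [h3, hc, Category.assoc, Iso.inv_hom_id_assoc, ← Category.assoc, h1]

/-- The evaluation is invariant under the twists. -/
lemma rib_ev {X : Twisted C} {D : C} [ExactPairing X.obj D] (ζ : D ≅ D)
    (h : η_ X.obj D ≫ X.η.hom ▷ D = η_ X.obj D ≫ X.obj ◁ ζ.hom) (hX : rib C X) :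
    twistTensor ζ.hom X.η.hom ≫ ε_ X.obj D = ε_ X.obj D := by
  have h1 := (rib_iff_coev ζ h).1 hX
  obtain ⟨V, e⟩ := X
  change ExactPairing V D at *
  change η_ V D ≫ twistTensor e.hom ζ.hom = η_ V D at h1
  change twistTensor ζ.hom e.hom ≫ ε_ V D = ε_ V D
  have hz := ExactPairing.evaluation_coevaluation V D
  have unitTwist : ∀ {V : C} (f : V ⟶ V), twistTensor f (𝟙 (𝟙_ C)) = f ▷ 𝟙_ C ∧
      twistTensor (𝟙 (𝟙_ C)) f = 𝟙_ C ◁ f := fun f => by simp [twistTensor]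
  apply hom_ext_of_coev (V := V)
  rw [← cancel_mono (e.hom ▷ 𝟙_ C)]
  -- the twist of `V ⊗ (V^* ⊗ V)`, followed by the evaluation
  have h2 : twistTensor e.hom (twistTensor ζ.hom e.hom) ≫ V ◁ ε_ V D =
      V ◁ (twistTensor ζ.hom e.hom ≫ ε_ V D) ≫ e.hom ▷ 𝟙_ C := by
    have := double_nat (𝟙 V) (twistTensor ζ.hom e.hom ≫ ε_ V D)
    rw [id_tensorHom] at this
    rw [twistTensor, MonoidalCategory.tensorHom_def', Category.assoc, Category.assoc,
        Category.assoc,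
      ← whisker_exchange, ← MonoidalCategory.whiskerLeft_comp_assoc, ← Category.assoc,
      ← Category.assoc, ← this]
    simp
  have h3 : η_ V D ▷ V ≫ twistTensor (twistTensor e.hom ζ.hom) e.hom =
      𝟙_ C ◁ e.hom ≫ η_ V D ▷ V := by
    have := twistTensor_nat (f := 𝟙 _) (g := e.hom) (f' := twistTensor e.hom ζ.hom) (g' := e.hom)
      (a := η_ V D) (b := 𝟙 V) (h1.trans (Category.id_comp _).symm) (by simp)
    rwa [tensorHom_id, (unitTwist _).2] at this
  have h4 := twistTensor_assoc e ζ e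
  calc _ = η_ V D ▷ V ≫ ((α_ V D V).hom ≫ twistTensor e.hom (twistTensor ζ.hom e.hom)) ≫
        V ◁ ε_ V D := by simp only [Category.assoc]; rw [h2]
    _ = (η_ V D ▷ V ≫ twistTensor (twistTensor e.hom ζ.hom) e.hom) ≫ (α_ V D V).hom ≫
        V ◁ ε_ V D := by rw [h4]; simp only [Category.assoc]
    _ = _ := by rw [h3, Category.assoc, hz]; simp

end Twisted

/-- The dual of `(V, η_V)` in `R(C, c)` is `V^*` with the dual of `η_V`. -/
lemma Ribb.exists_dual (X : Ribb C) : ∃ (D : Ribb C) (_ : ExactPairing X D),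
    η_ X D ≫ ((Ribb.twist C).θ X).hom ▷ D = η_ X D ≫ X ◁ ((Ribb.twist C).θ D).hom := by
  obtain ⟨D, p, -⟩ := X.property
  obtain ⟨ζ, hζ⟩ := Twisted.exists_mate (D := D) X.obj.η
  let D' : Ribb C := ⟨⟨D, ζ⟩, Twisted.rib_dual ζ hζ X.property⟩
  let c : 𝟙_ (Ribb C) ⟶ X ⊗ D' := ObjectProperty.homMk ⟨η_ X.obj.obj D,
    ((Twisted.rib_iff_coev ζ hζ).1 X.property).trans (Category.id_comp _).symm⟩
  let e : D' ⊗ X ⟶ 𝟙_ (Ribb C) := ObjectProperty.homMk ⟨ε_ X.obj.obj D,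
    (Category.comp_id _).trans (Twisted.rib_ev ζ hζ X.property).symm⟩
  let q : ExactPairing X D' :=
    { coevaluation' := c
      evaluation' := e
      coevaluation_evaluation' := ObjectProperty.hom_ext _ (Twisted.Hom.ext (by
        change (𝟙 D ⊗ₘ η_ X.obj.obj D) ≫ (α_ D X.obj.obj D).inv ≫ (ε_ X.obj.obj D ⊗ₘ 𝟙 D) =
          (ρ_ D).hom ≫ (λ_ D).inv
        rw [id_tensorHom, tensorHom_id, ExactPairing.coevaluation_evaluation]))
      evaluation_coevaluation' := ObjectProperty.hom_ext _ (Twisted.Hom.ext (by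
        change (η_ X.obj.obj D ⊗ₘ 𝟙 X.obj.obj) ≫ (α_ X.obj.obj D X.obj.obj).hom ≫
          (𝟙 X.obj.obj ⊗ₘ ε_ X.obj.obj D) = (λ_ X.obj.obj).hom ≫ (ρ_ X.obj.obj).inv
        rw [id_tensorHom, tensorHom_id, ExactPairing.evaluation_coevaluation])) }
  refine ⟨D', q, ObjectProperty.hom_ext _ (Twisted.Hom.ext ?_)⟩
  change η_ X.obj.obj D ≫ (X.obj.η.hom ⊗ₘ 𝟙 D) = η_ X.obj.obj D ≫ (𝟙 X.obj.obj ⊗ₘ ζ.hom)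
  rw [id_tensorHom, tensorHom_id, hζ]

variable (C) in
/-- `R(C, c)` is a ribbon category: the evaluation and the coevaluation are invariant under the
twists, so the duals of `C` are duals in `R(C, c)`. -/
lemma Ribb.isRibbon : (Ribb.twist C).IsRibbon := Twist.isRibbon_of Ribb.exists_dual

end RibbRibbon

section Equivalences
open Functor.LaxMonoidal Functor.OplaxMonoidal

universe v₁ v₂ v₃ u₁ u₂ u₃

variable {C : Type u₁} [Category.{v₁} C] [MonoidalCategory C] [BraidedCategory C]
  {D : Type u₂} [Category.{v₂} D] [MonoidalCategory D] [BraidedCategory D]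
  {E : Type u₃} [Category.{v₃} E] [MonoidalCategory E] [BraidedCategory E]

/-- The compatibility with duals in the definition of a ribbon equivalence is automatic. -/
lemma ribbonEquivalent_of (T : Twist C) (T' : Twist D) (F : C ⥤ D) [F.IsEquivalence] [F.Braided]
    (h : ∀ V : C, F.map (T.θ V).hom = (T'.θ (F.obj V)).hom) : RibbonEquivalent T T' :=
  ⟨F.asEquivalence, (inferInstance : F.Braided), h, fun V W _ => ⟨mapPairing F V W, rfl, rfl⟩⟩

lemma RibbonEquivalent.trans {T : Twist C} {T' : Twist D} {T'' : Twist E}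
    (h : RibbonEquivalent T T') (h' : RibbonEquivalent T' T'') : RibbonEquivalent T T'' := by
  obtain ⟨e, he, h1, -⟩ := h
  obtain ⟨e', he', h1', -⟩ := h'
  refine ribbonEquivalent_of T T'' (e.functor ⋙ e'.functor) fun V => ?_
  exact (congrArg e'.functor.map (h1 V)).trans (h1' _)

/-- A category which is equivalent, with its twist, to a ribbon category is a ribbon category. -/
lemma RibbonEquivalent.isRibbon {T : Twist C} {T' : Twist D} (h : RibbonEquivalent T T')
    (hT : T.IsRibbon) : T'.IsRibbon := by
  obtain ⟨e, he, h1, -⟩ := h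
  refine Twist.isRibbon_of fun Y => ?_
  let F := e.functor
  let X := e.inverse.obj Y
  let i : Y ≅ F.obj X := (e.counitIso.app Y).symm
  let _ : HasRightDual X := (hT.1 X).some
  let p : ExactPairing (F.obj X) (F.obj (Xᘁ)) := mapPairing F X (Xᘁ)
  have hp : η_ (F.obj X) (F.obj (Xᘁ)) = ε F ≫ F.map (η_ X (Xᘁ)) ≫ δ F X (Xᘁ) := rfl
  have h2 : η_ (F.obj X) (F.obj (Xᘁ)) ≫ (T'.θ (F.obj X)).hom ▷ F.obj (Xᘁ) =
      η_ (F.obj X) (F.obj (Xᘁ)) ≫ F.obj X ◁ (T'.θ (F.obj (Xᘁ))).hom := by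
    have h3 := congrArg (fun f => ε F ≫ F.map f ≫ δ F X (Xᘁ)) (hT.coev X (Xᘁ))
    simp only [Functor.map_comp, Category.assoc] at h3
    rw [hp, ← h1, ← h1]
    simpa only [Category.assoc, ← δ_natural_left, ← δ_natural_right] using h3
  let q : ExactPairing Y (F.obj (Xᘁ)) := exactPairingCongrLeft i
  have hq : η_ Y (F.obj (Xᘁ)) = η_ (F.obj X) (F.obj (Xᘁ)) ≫ i.inv ▷ F.obj (Xᘁ) := rfl
  refine ⟨F.obj (Xᘁ), q, ?_⟩
  rw [hq, Category.assoc, Category.assoc, ← comp_whiskerRight, T'.natural, comp_whiskerRight,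
    ← Category.assoc, h2, Category.assoc, whisker_exchange]

/-- Reversing the tensor product does not change a balanced category, up to equivalence: the tensor
products are identified by the braiding. -/
lemma ribbonEquivalent_mop {C : Type u} [Category.{v} C] [MonoidalCategory C] [BraidedCategory C]
    (T : Twist C) : RibbonEquivalent T T.mop ∧ RibbonEquivalent T.mop T := by
  have : (mopFunctor C).IsEquivalence := (MonoidalOpposite.mopEquiv C).isEquivalence_functor
  have : (unmopFunctor C).IsEquivalence := (MonoidalOpposite.mopEquiv C).isEquivalence_inverse
  exact ⟨ribbonEquivalent_of T T.mop (mopFunctor C) fun V => rfl,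
    ribbonEquivalent_of T.mop T (unmopFunctor C) fun V => rfl⟩

end Equivalences

section RibbMap
open Functor.LaxMonoidal Functor.OplaxMonoidal

universe v₁ v₂ u₁ u₂

variable {C : Type u₁} [Category.{v₁} C] [MonoidalCategory C] [BraidedCategory C]
  {D : Type u₂} [Category.{v₂} D] [MonoidalCategory D] [BraidedCategory D]
  (F : C ⥤ D) [F.Braided]

/-- Braided monoidal functors preserve the composite in the definition of `R(C, c)`. -/
lemma Twisted.map_loop (V W : C) [ExactPairing V W] :
    F.map (Twisted.loop V W) = @Twisted.loop D _ _ _ (F.obj V) (F.obj W) (mapPairing F V W) := by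
  let p := mapPairing F V W
  have h1 : η_ (F.obj V) (F.obj W) = ε F ≫ F.map (η_ V W) ≫ δ F V W := rfl
  have h2 : ε_ (F.obj V) (F.obj W) = μ F W V ≫ F.map (ε_ V W) ≫ Functor.OplaxMonoidal.η F := rfl
  unfold Twisted.loop
  rw [h1, h2]
  simp only [Functor.map_comp, Functor.Monoidal.map_whiskerLeft, Functor.Monoidal.map_whiskerRight,
    Functor.Monoidal.map_associator, Functor.Monoidal.map_leftUnitor_inv,
    Functor.Monoidal.map_rightUnitor, Functor.map_braiding, Category.assoc, comp_whiskerRight,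
    MonoidalCategory.whiskerLeft_comp, Functor.Monoidal.μ_δ_assoc,
        Functor.Monoidal.whiskerRight_μ_δ_assoc]

/-- The image of an object of `R(C, c)` under a braided monoidal functor. -/
def Ribb.mapObj (X : Ribb C) : Ribb D where
  obj := ⟨F.obj X.obj.obj, F.mapIso X.obj.η⟩
  property := by
    obtain ⟨W, p, h⟩ := X.property
    refine ⟨F.obj W, mapPairing F X.obj.obj W, ?_⟩
    have h2 := congrArg F.map h
    rw [Functor.map_comp] at h2
    exact h2.trans (Twisted.map_loop F X.obj.obj W)

/-- The functor on the categories `R(C, c)` induced by a braided monoidal functor. -/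
def Ribb.map : Ribb C ⥤ Ribb D where
  obj := Ribb.mapObj F
  map {X Y} f := ObjectProperty.homMk ⟨F.map f.hom.hom, by
    change F.map f.hom.hom ≫ F.map Y.obj.η.hom = F.map X.obj.η.hom ≫ F.map f.hom.hom
    rw [← F.map_comp, ← F.map_comp, f.hom.comm]⟩
  map_id X := ObjectProperty.hom_ext _ (Twisted.Hom.ext (F.map_id _))
  map_comp f g := ObjectProperty.hom_ext _ (Twisted.Hom.ext (F.map_comp _ _))

/-- Isomorphisms of objects of `R(C, c)`. -/
def Ribb.isoMk {X Y : Ribb C} (e : X.obj.obj ≅ Y.obj.obj)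
    (h : e.hom ≫ Y.obj.η.hom = X.obj.η.hom ≫ e.hom) : X ≅ Y :=
  (Twisted.rib C).isoMk (Twisted.isoMk e h)

lemma Ribb.hom_ext {X Y : Ribb C} {f g : X ⟶ Y} (h : f.hom.hom = g.hom.hom) : f = g :=
  ObjectProperty.hom_ext _ (Twisted.Hom.ext h)

/-- The induced functor is monoidal. -/
def Ribb.mapCore : (Ribb.map F).CoreMonoidal where
  εIso := Ribb.isoMk (Functor.Monoidal.εIso F) (by
    change ε F ≫ F.map (𝟙 (𝟙_ C)) = 𝟙 _ ≫ ε F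
    simp)
  μIso X Y := Ribb.isoMk (Functor.Monoidal.μIso F X.obj.obj Y.obj.obj) (by
    change μ F X.obj.obj Y.obj.obj ≫ F.map ((β_ X.obj.obj Y.obj.obj).hom ≫
      (β_ Y.obj.obj X.obj.obj).hom ≫ (X.obj.η.hom ⊗ₘ Y.obj.η.hom)) =
      ((β_ (F.obj X.obj.obj) (F.obj Y.obj.obj)).hom ≫ (β_ (F.obj Y.obj.obj) (F.obj X.obj.obj)).hom ≫
        (F.map X.obj.η.hom ⊗ₘ F.map Y.obj.η.hom)) ≫ μ F X.obj.obj Y.obj.obj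
    simp only [Functor.map_comp, Category.assoc, Functor.LaxMonoidal.μ_natural,
      Functor.LaxBraided.braided_assoc])
  μIso_hom_natural_left {X Y} f Z := Ribb.hom_ext (by
    change (F.map f.hom.hom ⊗ₘ 𝟙 (F.obj Z.obj.obj)) ≫ μ F Y.obj.obj Z.obj.obj =
      μ F X.obj.obj Z.obj.obj ≫ F.map (f.hom.hom ⊗ₘ 𝟙 Z.obj.obj)
    simp)
  μIso_hom_natural_right {X Y} Z f := Ribb.hom_ext (by
    change (𝟙 (F.obj Z.obj.obj) ⊗ₘ F.map f.hom.hom) ≫ μ F Z.obj.obj Y.obj.obj =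
      μ F Z.obj.obj X.obj.obj ≫ F.map (𝟙 Z.obj.obj ⊗ₘ f.hom.hom)
    simp)
  associativity X Y Z := Ribb.hom_ext (by
    change (μ F X.obj.obj Y.obj.obj ⊗ₘ 𝟙 (F.obj Z.obj.obj)) ≫ μ F (X.obj.obj ⊗ Y.obj.obj)
        Z.obj.obj ≫
      F.map (α_ X.obj.obj Y.obj.obj Z.obj.obj).hom = (α_ _ _ _).hom ≫
      (𝟙 (F.obj X.obj.obj) ⊗ₘ μ F Y.obj.obj Z.obj.obj) ≫ μ F X.obj.obj (Y.obj.obj ⊗ Z.obj.obj)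
    simp)
  left_unitality X := Ribb.hom_ext (by
    change (λ_ (F.obj X.obj.obj)).hom = (ε F ⊗ₘ 𝟙 (F.obj X.obj.obj)) ≫ μ F (𝟙_ C) X.obj.obj ≫
      F.map (λ_ X.obj.obj).hom
    simp)
  right_unitality X := Ribb.hom_ext (by
    change (ρ_ (F.obj X.obj.obj)).hom = (𝟙 (F.obj X.obj.obj) ⊗ₘ ε F) ≫ μ F X.obj.obj (𝟙_ C) ≫
      F.map (ρ_ X.obj.obj).hom
    simp)

instance : (Ribb.map F).Monoidal := (Ribb.mapCore F).toMonoidal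

instance : (Ribb.map F).Braided where
  braided X Y := Ribb.hom_ext (by
    change μ F X.obj.obj Y.obj.obj ≫ F.map (β_ X.obj.obj Y.obj.obj).hom =
      (β_ (F.obj X.obj.obj) (F.obj Y.obj.obj)).hom ≫ μ F Y.obj.obj X.obj.obj
    exact Functor.LaxBraided.braided _ _)

variable [F.IsEquivalence]

instance : (Ribb.map F).Faithful where
  map_injective {X Y _ _} h := Ribb.hom_ext (F.map_injective
    (congrArg (fun a : (Ribb.map F).obj X ⟶ (Ribb.map F).obj Y => a.hom.hom) h))

instance : (Ribb.map F).Full where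
  map_surjective {X Y} f := by
    let g : F.obj X.obj.obj ⟶ F.obj Y.obj.obj := f.hom.hom
    refine ⟨ObjectProperty.homMk ⟨F.preimage g, F.map_injective ?_⟩, Ribb.hom_ext
        (F.map_preimage g)⟩
    rw [F.map_comp, F.map_comp, F.map_preimage]
    exact f.hom.comm

/-- A braided equivalence of categories with duals induces an equivalence of the categories
`R(C, c)`. -/
lemma Ribb.map_isEquivalence (hD : ∀ Y : D, Nonempty (HasRightDual Y)) :
    (Ribb.map F).IsEquivalence where
  essSurj := ⟨fun Y => by
    let V := F.objPreimage Y.obj.obj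
    let i : F.obj V ≅ Y.obj.obj := F.objObjPreimageIso Y.obj.obj
    let η : V ≅ V := F.preimageIso (i ≪≫ Y.obj.η ≪≫ i.symm)
    have hη : F.map η.hom = i.hom ≫ Y.obj.η.hom ≫ i.inv := F.map_preimage _
    let _ : HasRightDual (F.obj V) := (hD _).some
    -- the condition on `η` refers to a dual of `V`, which is obtained from one of `F V`
    have adj : F ⊣ F.inv := F.asEquivalence.toAdjunction
    let _ : HasRightDual V := hasRightDualOfEquivalence adj V
    have hr : Twisted.rib C ⟨V, η⟩ := by
      refine ⟨Vᘁ, inferInstance, F.map_injective ?_⟩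
      refine Eq.trans ?_ (Twisted.map_loop F V (Vᘁ)).symm
      have h1 : Twisted.rib D ⟨F.obj V, F.mapIso η⟩ := Twisted.rib_of_iso i (by
        change i.hom ≫ Y.obj.η.hom = F.map η.hom ≫ i.hom
        rw [hη]; simp) Y.property
      rw [F.map_comp]
      exact (@Twisted.rib_iff _ _ _ _ ⟨F.obj V, F.mapIso η⟩ (F.obj (Vᘁ)) (mapPairing F V (Vᘁ))).1 h1
    exact ⟨⟨⟨V, η⟩, hr⟩, ⟨Ribb.isoMk i (by
      change i.hom ≫ Y.obj.η.hom = F.map η.hom ≫ i.hom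
      rw [hη]; simp)⟩⟩⟩

/-- A braided equivalence of categories with duals induces an equivalence of ribbon categories. -/
lemma Ribb.ribbonEquivalent (F : C ⥤ D) [F.Braided] [F.IsEquivalence]
    (hD : ∀ Y : D, Nonempty (HasRightDual Y)) :
    RibbonEquivalent (Ribb.twist C) (Ribb.twist D) :=
  have := Ribb.map_isEquivalence F hD
  ribbonEquivalent_of _ _ (Ribb.map F) fun _ => rfl

end RibbMap

/-! ### The centre of the reversed category of modules -/

section HalfBraidings

variable {C : Type u} [Category.{v} C] [MonoidalCategory C]

/-- The compatibility of a half braiding with the unit object follows from the remaining axioms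
and invertibility. -/
lemma halfBraiding_unit {X : C} (b : HalfBraiding X) :
    (b.β (𝟙_ C)).hom = (ρ_ X).hom ≫ (λ_ X).inv := by
  have h1 := b.monoidal (𝟙_ C) (𝟙_ C)
  have h2 := b.naturality (λ_ (𝟙_ C)).hom
  have h3 : (b.β (𝟙_ C)).hom ▷ 𝟙_ C ≫ (λ_ X).hom ▷ 𝟙_ C = (α_ X (𝟙_ C) (𝟙_ C)).hom ≫
      X ◁ (λ_ (𝟙_ C)).hom := by
    have e : (b.β (𝟙_ C)).hom = (ρ_ _).inv ≫ (b.β (𝟙_ C)).hom ▷ 𝟙_ C ≫ (ρ_ _).hom := by simp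
    rw [h1] at h2
    have h4 : X ◁ (λ_ (𝟙_ C)).hom ≫ (b.β (𝟙_ C)).hom =
        ((α_ X (𝟙_ C) (𝟙_ C)).inv ≫ (b.β (𝟙_ C)).hom ▷ 𝟙_ C ≫ (λ_ X).hom ▷ 𝟙_ C) ≫
          (b.β (𝟙_ C)).hom := by
      rw [h2]
      simp only [Category.assoc]
      refine congrArg _ (congrArg _ ?_)
      calc _ = 𝟙 _ ⊗≫ (𝟙_ C ◁ (b.β (𝟙_ C)).hom) ⊗≫ 𝟙 _ := by monoidal
        _ = _ := by monoidal
    rw [cancel_mono] at h4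
    rw [h4]; simp
  have h5 : ((b.β (𝟙_ C)).hom ≫ (λ_ X).hom) ▷ 𝟙_ C = (ρ_ X).hom ▷ 𝟙_ C := by
    rw [comp_whiskerRight, h3]; simp
  have h6 : (b.β (𝟙_ C)).hom ≫ (λ_ X).hom = (ρ_ X).hom :=
    (MonoidalCategory.whiskerRight_iff _ _).1 h5
  rw [← h6]; simp

/-- A half braiding in the reversed category, read in `C`. -/
lemma isHB_of_halfBraiding {X : Cᴹᵒᵖ} (b : HalfBraiding X) :
    IsHB (V := X.unmop) fun U => (b.β (.mop U)).hom.unmop where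
  nat f := congrArg Quiver.Hom.unmop (b.naturality f.mop)
  unit := congrArg Quiver.Hom.unmop (halfBraiding_unit b)
  ten U W := (congrArg Quiver.Hom.unmop (b.monoidal (.mop W) (.mop U))).trans (by simp)

end HalfBraidings

section CenterModules

variable {k H : Type u} [Field k] [Ring H] [Algebra k H] [Module.Finite k H] {Q : QuasiHopf k H}

namespace YD

variable (Q) in
/-- The Yetter-Drinfeld module of an object of the centre of the reversed category of modules. -/
def ofCenterObj (Z : Center (FDMod Q.toQuasiBialgebra)ᴹᵒᵖ) : YD Q :=
  ofHB Z.1.unmop (fun U => (Z.2.β (.mop U)).hom.unmop) (isHB_of_halfBraiding Z.2)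

lemma ofCenterObj_half (Z : Center (FDMod Q.toQuasiBialgebra)ᴹᵒᵖ)
    (U : FDMod Q.toQuasiBialgebra) :
    (ofCenterObj Q Z).half U = (Z.2.β (.mop U)).hom.unmop :=
  congrFun (ofHB_half _ _ _) U

variable (Q) in
/-- The functor from the centre of the reversed category of modules to reversed
Yetter-Drinfeld modules. -/
def ofCenter : Center (FDMod Q.toQuasiBialgebra)ᴹᵒᵖ ⥤ (YD Q)ᴹᵒᵖ where
  obj Z := .mop (ofCenterObj Q Z)
  map {Z W} f := Quiver.Hom.mop (homMk (V := ofCenterObj Q Z) (W := ofCenterObj Q W) f.f.unmop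
    fun U => by
      rw [ofCenterObj_half, ofCenterObj_half]
      exact congrArg Quiver.Hom.unmop (f.comm (.mop U)).symm)

instance : (ofCenter Q).Faithful where
  map_injective h := Center.ext _ _ (MonoidalOpposite.hom_ext
    (congrArg (fun f => Hom.hom (Quiver.Hom.unmop f)) h))

instance : (ofCenter Q).Full where
  map_surjective {Z W} f := ⟨⟨(Hom.hom f.unmop).mop, fun U => MonoidalOpposite.hom_ext (by
    have h := Hom.half f.unmop U.unmop
    have e1 := ofCenterObj_half Z U.unmop
    have e2 := ofCenterObj_half W U.unmop
    exact (((congrArg (_ ≫ ·) e2).symm.trans h.symm).trans (congrArg (· ≫ _) e1)))⟩, rfl⟩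

/-- The object of the centre given by a Yetter-Drinfeld module. -/
def toCenterObj (V : YD Q) : Center (FDMod Q.toQuasiBialgebra)ᴹᵒᵖ :=
  ⟨.mop V.toFDMod,
    { β := fun U => (asIso (V.half U.unmop)).mop
      monoidal := fun U W => MonoidalOpposite.hom_ext ((V.half_isHB.ten W.unmop U.unmop).trans
        (by simp))
      naturality := fun f => MonoidalOpposite.hom_ext (V.half_isHB.nat f.unmop) }⟩

instance : (ofCenter Q).EssSurj where
  mem_essImage V := ⟨toCenterObj V.unmop, ⟨Iso.mop (isoMk (V := ofCenterObj Q (toCenterObj V.unmop))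
    (W := V.unmop) (Iso.refl V.unmop.toFDMod) fun U => by
      rw [ofCenterObj_half]
      change V.unmop.half U ≫ 𝟙 _ ▷ U = U ◁ 𝟙 _ ≫ V.unmop.half U
      simp)⟩⟩

instance : (ofCenter Q).IsEquivalence where

variable (Q) in
/-- Tensor products in the centre correspond to tensor products of Yetter-Drinfeld modules. -/
def ofCenterCore : (ofCenter Q).CoreMonoidal where
  εIso := Iso.mop (isoMk (V := one) (W := ofCenterObj Q (𝟙_ _)) (Iso.refl (𝟙_ _)) fun U => by
    rw [ofCenterObj_half, one_half]
    change ((ρ_ U).hom ≫ (λ_ U).inv) ≫ 𝟙 (𝟙_ _) ▷ U = U ◁ 𝟙 (𝟙_ _) ≫ (ρ_ U).hom ≫ (λ_ U).inv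
    simp)
  μIso Z W := Iso.mop (isoMk (V := tensor (ofCenterObj Q W) (ofCenterObj Q Z))
      (W := ofCenterObj Q (Z ⊗ W)) (Iso.refl (W.1.unmop ⊗ Z.1.unmop)) fun U => by
    rw [ofCenterObj_half, tensor_half, funext (ofCenterObj_half W), funext (ofCenterObj_half Z)]
    refine (congrArg (_ ≫ ·) (id_whiskerRight (W.1.unmop ⊗ Z.1.unmop) U)).trans
      ((Category.comp_id _).trans ?_)
    refine Eq.trans ?_ (congrArg (· ≫ _) (whiskerLeft_id U (W.1.unmop ⊗ Z.1.unmop))).symm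
    refine Eq.trans ?_ (Category.id_comp _).symm
    simp [tensorHB, Center.tensor_β]; rfl)
  μIso_hom_natural_left f Z := MonoidalOpposite.hom_ext (Hom.ext (by
    change (𝟙 Z.1.unmop ⊗ₘ f.f.unmop) ≫ 𝟙 _ = 𝟙 _ ≫ Z.1.unmop ◁ f.f.unmop
    rw [Category.comp_id, Category.id_comp, id_tensorHom]))
  μIso_hom_natural_right Z f := MonoidalOpposite.hom_ext (Hom.ext (by
    change (f.f.unmop ⊗ₘ 𝟙 Z.1.unmop) ≫ 𝟙 _ = 𝟙 _ ≫ f.f.unmop ▷ Z.1.unmop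
    rw [Category.comp_id, Category.id_comp, tensorHom_id]))
  associativity X Y Z := MonoidalOpposite.hom_ext (Hom.ext (by
    change (𝟙 Z.1.unmop ⊗ₘ 𝟙 (Y.1.unmop ⊗ X.1.unmop)) ≫ 𝟙 _ ≫
        (α_ Z.1.unmop Y.1.unmop X.1.unmop).inv =
      (α_ Z.1.unmop Y.1.unmop X.1.unmop).inv ≫ (𝟙 (Z.1.unmop ⊗ Y.1.unmop) ⊗ₘ 𝟙 X.1.unmop) ≫ 𝟙 _
    rw [id_tensorHom_id, id_tensorHom_id, Category.id_comp, Category.id_comp, Category.comp_id]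
    exact (Category.comp_id _).symm))
  left_unitality X := MonoidalOpposite.hom_ext (Hom.ext (by
    change (ρ_ X.1.unmop).hom = (𝟙 X.1.unmop ⊗ₘ 𝟙 (𝟙_ _)) ≫ 𝟙 _ ≫ (ρ_ X.1.unmop).hom
    rw [id_tensorHom_id, Category.id_comp, Category.id_comp]))
  right_unitality X := MonoidalOpposite.hom_ext (Hom.ext (by
    change (λ_ X.1.unmop).hom = (𝟙 (𝟙_ _) ⊗ₘ 𝟙 X.1.unmop) ≫ 𝟙 _ ≫ (λ_ X.1.unmop).hom
    rw [id_tensorHom_id, Category.id_comp, Category.id_comp]))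

instance : (ofCenter Q).Monoidal := (ofCenterCore Q).toMonoidal

instance : (ofCenter Q).Braided where
  braided Z W := MonoidalOpposite.hom_ext (Hom.ext (by
    change 𝟙 _ ≫ (Z.2.β W.1).hom.unmop = (ofCenterObj Q Z).half W.1.unmop ≫ 𝟙 _
    rw [Category.id_comp, ofCenterObj_half]
    exact (Category.comp_id _).symm))

variable (Q) in
/-- The two reversals of the tensor product cancel, up to the equivalences given by the braiding. -/
lemma ribbonEquivalent_center :
    RibbonEquivalent (Ribb.twist (Center (FDMod Q.toQuasiBialgebra)ᴹᵒᵖ)) (Ribb.twist (YD Q)) := by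
  have : (unmopFunctor (YD Q)).IsEquivalence :=
    (MonoidalOpposite.mopEquiv (YD Q)).isEquivalence_inverse
  exact Ribb.ribbonEquivalent (ofCenter Q ⋙ unmopFunctor (YD Q)) fun V => ⟨⟨dual V⟩⟩

end YD

end CenterModules

/-! ### Modules over `H(θ)` -/

section RibbonExtension

variable {k H : Type u} [Field k] [Ring H] [Algebra k H] {Q : QTQuasiHopf k H}

namespace Theta

lemma incl_mul_θ (a : H) : incl Q a * θ Q = θ Q * incl Q a := by
  have h := congrArg (RingQuot.mkAlgHom k (ThetaRel Q)) (Polynomial.X_mul_C a).symm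
  rw [map_mul, map_mul] at h
  exact h

variable (Q) in
lemma θ_mul_θ : θ Q * θ Q = incl Q (Q.u * Q.S Q.u) := by
  have h := RingQuot.mkAlgHom_rel k (ThetaRel.sq (Q := Q))
  rw [pow_two, map_mul] at h
  exact h

lemma eq_incl_add (x : Theta Q) : ∃ a b, x = incl Q a + incl Q b * θ Q := by
  obtain ⟨p, rfl⟩ := RingQuot.mkAlgHom_surjective k (ThetaRel Q) x
  have key : ∀ (n : ℕ) (c : H), ∃ a b, RingQuot.mkAlgHom k (ThetaRel Q)
      (Polynomial.C c * Polynomial.X ^ n) = incl Q a + incl Q b * θ Q := by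
    intro n c
    induction n with
    | zero => exact ⟨c, 0, by rw [pow_zero, mul_one, map_zero, zero_mul, add_zero]; rfl⟩
    | succ n ih =>
      obtain ⟨a, b, h⟩ := ih
      refine ⟨b * (Q.u * Q.S Q.u), a, ?_⟩
      rw [pow_succ, ← mul_assoc, map_mul, h, map_mul (incl Q), ← θ_mul_θ]
      change (incl Q a + incl Q b * θ Q) * θ Q = _
      rw [add_mul, mul_assoc, add_comm]
  induction p using Polynomial.induction_on with
  | C a => exact ⟨a, 0, by rw [map_zero, zero_mul, add_zero]; rfl⟩
  | add p q hp hq =>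
    obtain ⟨a, b, h⟩ := hp
    obtain ⟨c, d, h'⟩ := hq
    refine ⟨a + c, b + d, ?_⟩
    rw [map_add, h, h', map_add, map_add]
    noncomm_ring
  | monomial n a _ => exact key (n + 1) a

instance [Module.Finite k H] : Module.Finite k (Theta Q) :=
  Module.Finite.of_surjective ((incl Q).toLinearMap.coprod
    (LinearMap.mulRight k (θ Q) ∘ₗ (incl Q).toLinearMap)) fun x => by
      obtain ⟨a, b, h⟩ := eq_incl_add x
      exact ⟨(a, b), h.symm⟩

lemma θ_central (x : Theta Q) : θ Q * x = x * θ Q := by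
  obtain ⟨a, b, rfl⟩ := eq_incl_add x
  rw [mul_add, add_mul, ← incl_mul_θ, ← mul_assoc, ← incl_mul_θ]

section
variable {B : Type u} [Ring B] [Algebra k B]

/-- The evaluation of polynomials at an element which commutes with the image of `f`. -/
def eval (f : H →ₐ[k] B) (t : B) (h1 : ∀ a, f a * t = t * f a) : Polynomial H →ₐ[k] B :=
  { Polynomial.eval₂RingHom' f.toRingHom t h1 with
    commutes' := fun r => (Polynomial.eval₂_C _ _).trans (f.commutes r) }

/-- The universal property of `H(θ)`. -/
def lift (f : H →ₐ[k] B) (t : B) (h1 : ∀ a, f a * t = t * f a)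
    (h2 : t * t = f (Q.u * Q.S Q.u)) : Theta Q →ₐ[k] B :=
  RingQuot.liftAlgHom k ⟨eval f t h1, fun x y h => by
    induction h with
    | sq =>
      rw [pow_two, map_mul]
      exact ((congrArg₂ (· * ·) (Polynomial.eval₂_X _ _) (Polynomial.eval₂_X _ _)).trans h2).trans
        (Polynomial.eval₂_C _ _).symm⟩

variable (f : H →ₐ[k] B) (t : B) (h1 : ∀ a, f a * t = t * f a)
    (h2 : t * t = f (Q.u * Q.S Q.u))

lemma lift_incl (a : H) : lift f t h1 h2 (incl Q a) = f a :=
  (RingQuot.liftAlgHom_mkAlgHom_apply k _ _ _).trans (Polynomial.eval₂_C _ _)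

lemma lift_θ : lift f t h1 h2 (θ Q) = t :=
  (RingQuot.liftAlgHom_mkAlgHom_apply k _ _ _).trans (Polynomial.eval₂_X _ _)

lemma algHom_ext {f g : Theta Q →ₐ[k] B} (h1 : ∀ a, f (incl Q a) = g (incl Q a))
    (h2 : f (θ Q) = g (θ Q)) : f = g := AlgHom.ext fun x => by
  obtain ⟨a, b, rfl⟩ := eq_incl_add x
  rw [map_add, map_add, map_mul, map_mul, h1, h1, h2]

end

lemma intertwines_of {X Y : AlgRep k (Theta Q)} {f : X.V →ₗ[k] Y.V}
    (h1 : ∀ a v, f (X.ρ (incl Q a) v) = Y.ρ (incl Q a) (f v))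
    (h2 : ∀ v, f (X.ρ (θ Q) v) = Y.ρ (θ Q) (f v)) : X.Intertwines Y f := fun x v => by
  obtain ⟨a, b, rfl⟩ := eq_incl_add x
  simp only [map_add, map_mul, LinearMap.add_apply, Module.End.mul_apply, h1, h2]

variable [Module.Finite k H]

/-- By definition `η_V⁻²` is the action of `u S(u)`. -/
lemma η_inv_sq (X : Ribb (FDMod Q.toQuasiBialgebra)) :
    (X.obj.η.inv.lin * X.obj.η.inv.lin : Module.End k X.obj.obj.V) =
      X.obj.obj.ρ (Q.u * Q.S Q.u) := by
  have h := (Twisted.rib_iff (FDMod.dual (Q := Q.toQuasiHopf) X.obj.obj)).1 X.property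
  refine LinearMap.ext fun v => ?_
  refine (congrArg (fun f => FDMod.Hom.lin f v) h).trans ?_
  rw [FDMod.loop_lin, QTQuasiHopf.loopElt_eq]

/-- An object `(V, η_V)` of `R(_H M)` is a module over `H(θ)`, on which `θ` acts by `η_V⁻¹`. -/
def toRep (X : Ribb (FDMod Q.toQuasiBialgebra)) : AlgRep k (Theta Q) where
  V := X.obj.obj.V
  ρ := lift X.obj.obj.ρ X.obj.η.inv.lin
    (fun a => LinearMap.ext fun v => (X.obj.η.inv.comm a v).symm) (η_inv_sq X)

lemma toRep_incl (X : Ribb (FDMod Q.toQuasiBialgebra)) (a : H) :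
    (toRep X).ρ (incl Q a) = X.obj.obj.ρ a :=
  lift_incl X.obj.obj.ρ X.obj.η.inv.lin _ (η_inv_sq X) a

lemma toRep_θ (X : Ribb (FDMod Q.toQuasiBialgebra)) : (toRep X).ρ (θ Q) = X.obj.η.inv.lin :=
  lift_θ X.obj.obj.ρ X.obj.η.inv.lin _ (η_inv_sq X)

/-- `θ` is invertible, as its square `u S(u)` is. -/
lemma isUnit_θ : IsUnit (θ Q) := by
  have h := ((QTQuasiHopf.isUnit_u Q).mul (QTQuasiHopf.isUnit_S_u Q)).map (incl Q)
  rw [← θ_mul_θ] at h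
  exact ((Commute.refl (θ Q)).isUnit_mul_iff.1 h).1

variable (Q) in
/-- The unit `θ`. -/
def θu : (Theta Q)ˣ := (isUnit_θ (Q := Q)).unit

/-- The underlying `H`-module of an `H(θ)`-module. -/
abbrev res (X : AlgRep k (Theta Q)) : FDMod Q.toQuasiBialgebra := ⟨X.V, X.ρ.comp (incl Q)⟩

/-- The action of `θ`. -/
def θIso (X : AlgRep k (Theta Q)) : res X ≅ res X :=
  FDMod.isoMk (unitAct X.ρ (θu Q)) fun a v => by
    change X.ρ (θ Q) (X.ρ (incl Q a) v) = X.ρ (incl Q a) (X.ρ (θ Q) v)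
    rw [← Module.End.mul_apply, ← Module.End.mul_apply, ← map_mul, ← map_mul, incl_mul_θ]

/-- The object of `R(_H M)` given by a module over `H(θ)`. -/
def ofRep (X : AlgRep k (Theta Q)) : Ribb (FDMod Q.toQuasiBialgebra) where
  obj := ⟨res X, (θIso X).symm⟩
  property := ⟨FDMod.dual (Q := Q.toQuasiHopf) (res X),
    FDMod.stdPairing (Q := Q.toQuasiHopf) (res X), FDMod.hom_ext fun v => by
    refine Eq.trans ?_ (FDMod.loop_lin (res X) v).symm
    rw [QTQuasiHopf.loopElt_eq]
    change X.ρ (θ Q) (X.ρ (θ Q) v) = X.ρ (incl Q (Q.u * Q.S Q.u)) v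
    rw [← θ_mul_θ, map_mul]; rfl⟩

lemma toRep_ofRep (X : AlgRep k (Theta Q)) : (toRep (ofRep X)).ρ = X.ρ :=
  algHom_ext (fun a => toRep_incl _ a) (toRep_θ _)

lemma toRep_ofRep_id (X : AlgRep k (Theta Q)) (b : Theta Q) (x : X.V) :
    X.ρ b x = (toRep (ofRep X)).ρ b x :=
  congrArg (fun f : Theta Q →ₐ[k] Module.End k X.V => f b x) (toRep_ofRep X).symm

lemma hom_intertwines {X Y : Ribb (FDMod Q.toQuasiBialgebra)} (f : X ⟶ Y) :
    (toRep X).Intertwines (toRep Y) f.hom.hom.lin :=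
  intertwines_of (fun a v => by rw [toRep_incl, toRep_incl]; exact f.hom.hom.comm a v) fun v => by
    rw [toRep_θ, toRep_θ]
    have h : X.obj.η.inv ≫ f.hom.hom = f.hom.hom ≫ Y.obj.η.inv := by
      rw [Iso.inv_comp_eq, ← Category.assoc, ← f.hom.comm, Category.assoc, Iso.hom_inv_id,
        Category.comp_id]
    exact congrArg (fun g => FDMod.Hom.lin g v) h

/-- An intertwiner is a morphism of the corresponding objects. -/
def homOfIntertwines {X Y : Ribb (FDMod Q.toQuasiBialgebra)} (f : X.obj.obj.V →ₗ[k] Y.obj.obj.V)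
    (hf : (toRep X).Intertwines (toRep Y) f) : X ⟶ Y :=
  let g : X.obj.obj ⟶ Y.obj.obj := ⟨f, fun a v =>
    (congrArg (fun ρ => f (ρ v)) (toRep_incl X a)).symm.trans ((hf (incl Q a) v).trans
      (congrArg (fun ρ => ρ (f v)) (toRep_incl Y a)))⟩
  have h : X.obj.η.inv ≫ g = g ≫ Y.obj.η.inv := FDMod.hom_ext fun v =>
    (congrArg (fun ρ => f (ρ v)) (toRep_θ X)).symm.trans ((hf (θ Q) v).trans
      (congrArg (fun ρ => ρ (f v)) (toRep_θ Y)))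
  ObjectProperty.homMk ⟨g, by
    rw [Iso.inv_comp_eq, ← Category.assoc, Iso.eq_comp_inv] at h
    exact h⟩

end Theta

end RibbonExtension

/-! ### Tensor products and duals of modules over `H(θ)` -/

section RibbonExtension

variable {k H : Type u} [Field k] [Ring H] [Algebra k H] [Module.Finite k H] {Q : QTQuasiHopf k H}

namespace Theta

/-- The dual of `(V, η_V)` is `V^*` with the transpose of `η_V`. -/
def ribbDual (X : Ribb (FDMod Q.toQuasiBialgebra)) : Ribb (FDMod Q.toQuasiBialgebra) where
  obj := ⟨FDMod.dual (Q := Q.toQuasiHopf) X.obj.obj,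
    ⟨FDMod.transpose (Q := Q.toQuasiHopf) X.obj.η.hom,
      FDMod.transpose (Q := Q.toQuasiHopf) X.obj.η.inv,
      FDMod.hom_ext fun φ => by
        have h : ∀ v, X.obj.η.hom.lin (X.obj.η.inv.lin v) = v := fun v =>
          congrArg (fun f => FDMod.Hom.lin f v) X.obj.η.inv_hom_id
        exact LinearMap.ext fun v => congrArg (show Module.Dual k X.obj.obj.V from φ) (h v),
      FDMod.hom_ext fun φ => by
        have h : ∀ v, X.obj.η.inv.lin (X.obj.η.hom.lin v) = v := fun v =>
          congrArg (fun f => FDMod.Hom.lin f v) X.obj.η.hom_inv_id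
        exact LinearMap.ext fun v => congrArg (show Module.Dual k X.obj.obj.V from φ) (h v)⟩⟩
  property := Twisted.rib_dual _
    (coev_of_ev (FDMod.transpose_ev (Q := Q.toQuasiHopf) X.obj.η.hom)) X.property

/-- The evaluation. -/
def ribbEv (X : Ribb (FDMod Q.toQuasiBialgebra)) : ribbDual X ⊗ X ⟶ 𝟙_ (Ribb _) :=
  ObjectProperty.homMk ⟨FDMod.ev (Q := Q.toQuasiHopf) X.obj.obj, (Category.comp_id _).trans
    (Twisted.rib_ev (D := FDMod.dual (Q := Q.toQuasiHopf) X.obj.obj) (ribbDual X).obj.η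
      (coev_of_ev (FDMod.transpose_ev (Q := Q.toQuasiHopf) X.obj.η.hom)) X.property).symm⟩

/-- The coevaluation. -/
def ribbCoev (X : Ribb (FDMod Q.toQuasiBialgebra)) : 𝟙_ (Ribb _) ⟶ X ⊗ ribbDual X :=
  ObjectProperty.homMk ⟨FDMod.coev (Q := Q.toQuasiHopf) X.obj.obj,
    ((Twisted.rib_iff_coev (D := FDMod.dual (Q := Q.toQuasiHopf) X.obj.obj) (ribbDual X).obj.η
      (coev_of_ev (FDMod.transpose_ev (Q := Q.toQuasiHopf) X.obj.η.hom))).1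
        X.property).trans (Category.id_comp _).symm⟩

/-- The transpose of a morphism. -/
def ribbTranspose {X Y : Ribb (FDMod Q.toQuasiBialgebra)} (f : X ⟶ Y) : ribbDual Y ⟶ ribbDual X :=
  ObjectProperty.homMk ⟨FDMod.transpose (Q := Q.toQuasiHopf) f.hom.hom, FDMod.hom_ext fun φ => by
    have h : ∀ v, Y.obj.η.hom.lin (f.hom.hom.lin v) = f.hom.hom.lin (X.obj.η.hom.lin v) := fun v =>
      congrArg (fun f => FDMod.Hom.lin f v) f.hom.comm
    exact LinearMap.ext fun v => congrArg (show Module.Dual k Y.obj.obj.V from φ) (h v).symm⟩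

/-- An `H(θ)`-linear map as a morphism of `R(_H M)`. -/
def homTo (X : AlgRep k (Theta Q)) (V : Ribb (FDMod Q.toQuasiBialgebra))
    (f : X.V →ₗ[k] V.obj.obj.V) (hf : X.Intertwines (toRep V) f) : ofRep X ⟶ V :=
  homOfIntertwines (X := ofRep X) (Y := V) f fun b x => by rw [toRep_ofRep]; exact hf b x

/-- The action of `H(θ)` on a tensor product of two modules. -/
def ten (X Y : AlgRep k (Theta Q)) : Theta Q →ₐ[k] Module.End k (X.V ⊗[k] Y.V) :=
  (toRep (ofRep X ⊗ ofRep Y)).ρ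

lemma ten_to {X Y : AlgRep k (Theta Q)} {V W : Ribb (FDMod Q.toQuasiBialgebra)}
    {f : X.V →ₗ[k] V.obj.obj.V} {g : Y.V →ₗ[k] W.obj.obj.V} (hf : X.Intertwines (toRep V) f)
    (hg : Y.Intertwines (toRep W) g) (b : Theta Q) (t : X.V ⊗[k] Y.V) :
    TensorProduct.map f g (ten X Y b t) = (toRep (V ⊗ W)).ρ b (TensorProduct.map f g t) :=
  hom_intertwines (homTo X V f hf ⊗ₘ homTo Y W g hg) b t

lemma ten_id (V W : Ribb (FDMod Q.toQuasiBialgebra)) (σ : Theta Q →ₐ[k] Module.End k V.obj.obj.V)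
    (τ : Theta Q →ₐ[k] Module.End k W.obj.obj.V) (hσ : ∀ b x, σ b x = (toRep V).ρ b x)
    (hτ : ∀ b x, τ b x = (toRep W).ρ b x) (b : Theta Q) (t : V.obj.obj.V ⊗[k] W.obj.obj.V) :
    ten ⟨V.obj.obj.V, σ⟩ ⟨W.obj.obj.V, τ⟩ b t = (toRep (V ⊗ W)).ρ b t := by
  have h1 := ten_to (X := ⟨V.obj.obj.V, σ⟩) (Y := ⟨W.obj.obj.V, τ⟩) (V := V) (W := W)
    (f := LinearMap.id) (g := LinearMap.id) hσ hτ b t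
  exact (QuantumDouble.map_id_apply _).symm.trans
    (h1.trans (congrArg _ (QuantumDouble.map_id_apply _)))

/-- The action of `H(θ)` on the dual of a module. -/
def dual (X : AlgRep k (Theta Q)) : Theta Q →ₐ[k] Module.End k (Module.Dual k X.V) :=
  (toRep (ribbDual (ofRep X))).ρ

variable (Q) in
/-- The action of `H(θ)` on the unit object. -/
def unitRep : Theta Q →ₐ[k] Module.End k k := (toRep (𝟙_ (Ribb (FDMod Q.toQuasiBialgebra)))).ρ

variable (Q) in
/-- The counit of `H(θ)`. -/
def counit : Theta Q →ₐ[k] k :=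
  lift Q.ε 1 (fun a => by rw [mul_one, one_mul]) (by
    have h := congrArg (fun f : Module.End k k => f 1)
      (η_inv_sq (𝟙_ (Ribb (FDMod Q.toQuasiBialgebra))))
    exact (mul_one (1 : k)).trans (h.trans (mul_one (Q.ε (Q.u * Q.S Q.u)))))

lemma counit_incl (a : H) : counit Q (incl Q a) = Q.ε a := lift_incl _ _ _ _ a

lemma counit_θ : counit Q (θ Q) = 1 := by
  unfold counit
  exact lift_θ _ _ _ _

variable (Q) in
lemma unitRep_apply (b : Theta Q) (c : k) : unitRep Q b c = counit Q b * c := by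
  have h : unitRep Q = (Algebra.lmul k k).comp (counit Q) := algHom_ext
    (fun a => (toRep_incl _ a).trans (congrArg (Algebra.lmul k k) (counit_incl a).symm))
    ((toRep_θ _).trans (LinearMap.ext fun c =>
      (one_mul c).symm.trans (congrArg (fun x : k => x * c) counit_θ.symm)))
  rw [h]; rfl

variable (Q) in
/-- The actions of `H(θ)` on tensor products and duals. -/
def tensorData : TensorData Q.toQuasiHopf (incl Q) where
  one := counit Q
  ten := ten
  dual := dual
  one_res := counit_incl
  ten_res X Y a := by
    refine (toRep_incl (ofRep X ⊗ ofRep Y) a).trans ?_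
    change tensorAct (X.ρ.comp (incl Q)) (Y.ρ.comp (incl Q)) (Q.Δ a) = _
    rw [tensorAct_comp]; rfl
  dual_res X a φ := congrArg (fun f : Module.End k (Module.Dual k X.V) => f φ)
    (toRep_incl (ribbDual (ofRep X)) a)
  ten_nat {X Y X' Y'} f g hf hg b t := ten_to (V := ofRep X') (W := ofRep Y') (f := f) (g := g)
    (fun b x => by rw [toRep_ofRep]; exact hf b x)
        (fun b x => by rw [toRep_ofRep]; exact hg b x) b t
  dual_nat {X Y} f hf b φ :=
    (hom_intertwines (ribbTranspose (homTo X (ofRep Y) f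
      (fun b x => by rw [toRep_ofRep]; exact hf b x))) b φ).symm
  assoc X Y Z b t := by
    have h1 := ten_id (ofRep X ⊗ ofRep Y) (ofRep Z) (ten X Y) Z.ρ (fun _ _ => rfl)
      (toRep_ofRep_id Z)
    have h2 := ten_id (ofRep X) (ofRep Y ⊗ ofRep Z) X.ρ (ten Y Z) (toRep_ofRep_id X)
      (fun _ _ => rfl)
    have e : ∀ s : H ⊗[k] (H ⊗[k] H), FDMod.act₃ (res X) (res Y) (res Z) s =
        tensorAct X.ρ (tensorAct Y.ρ Z.ρ) (Algebra.TensorProduct.map (incl Q)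
          (Algebra.TensorProduct.map (incl Q) (incl Q)) s) := fun s => by
      change tensorAct (X.ρ.comp (incl Q)) (tensorAct (Y.ρ.comp (incl Q)) (Z.ρ.comp (incl Q))) s = _
      rw [tensorAct_comp, tensorAct_comp]; rfl
    have h3 := hom_intertwines (α_ (ofRep X) (ofRep Y) (ofRep Z)).hom b t
    rw [← e]
    exact (congrArg (α_ (res X) (res Y) (res Z)).hom.lin (h1 b t)).trans (h3.trans (h2 b _).symm)
  lid X b t := by
    have h1 := ten_id (𝟙_ _) (ofRep X) ((Algebra.lmul k k).comp (counit Q)) X.ρ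
      (fun b c => (unitRep_apply Q b c).symm) (toRep_ofRep_id X)
    have h3 := hom_intertwines (λ_ (ofRep X)).hom b t
    rw [toRep_ofRep] at h3
    exact (congrArg (TensorProduct.lid k X.V) (h1 b t)).trans h3
  rid X b t := by
    have h1 := ten_id (ofRep X) (𝟙_ _) X.ρ ((Algebra.lmul k k).comp (counit Q)) (toRep_ofRep_id X)
      (fun b c => (unitRep_apply Q b c).symm)
    have h3 := hom_intertwines (ρ_ (ofRep X)).hom b t
    rw [toRep_ofRep] at h3
    exact (congrArg (TensorProduct.rid k X.V) (h1 b t)).trans h3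
  ev X b t := by
    have h1 := ten_id (ribbDual (ofRep X)) (ofRep X) (dual X) X.ρ (fun _ _ => rfl)
        (toRep_ofRep_id X)
    have h3 := hom_intertwines (ribbEv (ofRep X)) b t
    exact (congrArg (FDMod.ev (Q := Q.toQuasiHopf) (res X)).lin (h1 b t)).trans
      (h3.trans (unitRep_apply Q b _))
  coev X b := by
    have h1 := ten_id (ofRep X) (ribbDual (ofRep X)) X.ρ (dual X) (toRep_ofRep_id X)
        (fun _ _ => rfl)
    have h3 := hom_intertwines (ribbCoev (ofRep X)) b (1 : k)
    refine (h1 b _).trans (h3.symm.trans ?_)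
    exact (congrArg (FDMod.coev (Q := Q.toQuasiHopf) (res X)).lin (unitRep_apply Q b 1)).trans
      (map_smul (FDMod.coev (Q := Q.toQuasiHopf) (res X)).lin (counit Q b) (1 : k))

end Theta

end RibbonExtension

/-! ### The ribbon structure of `H(θ)` -/

section RibbonExtension

variable {k H : Type u} [Field k] [Ring H] [Algebra k H] {Q : QTQuasiHopf k H}

namespace Theta

/-- The image of the inclusion on the second tensor power. -/
abbrev incl₂ : H ⊗[k] H →ₐ[k] Theta Q ⊗[k] Theta Q := Algebra.TensorProduct.map (incl Q) (incl Q)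

/-- The inclusion on the third tensor power. -/
abbrev incl₃ : H ⊗[k] (H ⊗[k] H) →ₐ[k] Theta Q ⊗[k] (Theta Q ⊗[k] Theta Q) :=
  Algebra.TensorProduct.map (incl Q) incl₂

variable (Q) in
/-- The `R`-matrix of `H(θ)`, the image of that of `H`. -/
def R : (Theta Q ⊗[k] Theta Q)ˣ := Units.map incl₂.toRingHom.toMonoidHom Q.R

lemma R_val : (R Q).val = incl₂ Q.R.val := rfl

lemma comm_incl₂ (t : H ⊗[k] H) : Algebra.TensorProduct.comm k _ _ (incl₂ (Q := Q) t) =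
    incl₂ (Algebra.TensorProduct.comm k _ _ t) := by
  induction t with
  | zero => simp
  | add x y hx hy => simp only [map_add, hx, hy]
  | tmul a b => simp

lemma R₂₁R_val : Algebra.TensorProduct.comm k _ _ (R Q).val * (R Q).val =
    incl₂ Q.R₂₁R := by
  rw [R_val, comm_incl₂, ← map_mul]; rfl

lemma θθ_central (t : Theta Q ⊗[k] Theta Q) : (θ Q ⊗ₜ[k] θ Q) * t = t * (θ Q ⊗ₜ[k] θ Q) := by
  induction t with
  | zero => simp
  | add x y hx hy => rw [mul_add, add_mul, hx, hy]
  | tmul a b => simp [θ_central]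

lemma incl₃_sw₂₃ (t : H ⊗[k] (H ⊗[k] H)) : incl₃ (Q := Q) (sw₂₃ k H t) = sw₂₃ k _ (incl₃ t) := by
  induction t using FDMod.ind₃ with
  | h0 => simp
  | ha x y hx hy => simp only [map_add, hx, hy]
  | ht a b c => simp

lemma incl₃_sw₁₂ (t : H ⊗[k] (H ⊗[k] H)) : incl₃ (Q := Q) (sw₁₂ k H t) = sw₁₂ k _ (incl₃ t) := by
  induction t using FDMod.ind₃ with
  | h0 => simp
  | ha x y hx hy => simp only [map_add, hx, hy]
  | ht a b c => simp

lemma incl₃_leg₂₃ (t : H ⊗[k] H) : incl₃ (Q := Q) (leg₂₃ t) = leg₂₃ (incl₂ t) := by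
  simp

lemma incl₃_leg₁₃ (t : H ⊗[k] H) : incl₃ (Q := Q) (leg₁₃ t) = leg₁₃ (incl₂ t) := by
  induction t with
  | zero => simp
  | add x y hx hy => simp only [map_add, hx, hy]
  | tmul a b => simp

lemma incl₃_leg₁₂ (t : H ⊗[k] H) : incl₃ (Q := Q) (leg₁₂ t) = leg₁₂ (incl₂ t) := by
  induction t with
  | zero => simp
  | add x y hx hy => simp only [map_add, hx, hy]
  | tmul a b => simp

lemma isUnit_R₂₁R : IsUnit (incl₂ (Q := Q) Q.R₂₁R) := by
  rw [← R₂₁R_val]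
  exact ((R Q).isUnit.map (Algebra.TensorProduct.comm k _ _)).mul (R Q).isUnit

variable [Module.Finite k H]

variable (Q) in
/-- The quasi-Hopf structure on `H(θ)`. -/
def quasiHopf : QuasiHopf k (Theta Q) := (tensorData Q).quasiHopf

lemma Δ_incl (a : H) : (quasiHopf Q).Δ (incl Q a) =
    Algebra.TensorProduct.map (incl Q) (incl Q) (Q.Δ a) := (tensorData Q).Δ_res a

/-- `Δ(θ) R₂₁ R = θ ⊗ θ`: this is the definition of the automorphism of a tensor product in
`R(_H M)`, for the square of the regular module. -/
lemma Δ_θ : (quasiHopf Q).Δ (θ Q) * incl₂ Q.R₂₁R = θ Q ⊗ₜ[k] θ Q := by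
  let X := AlgRep.reg k (Theta Q)
  let Y := ofRep X
  let Z : Y.obj.obj ⊗ Y.obj.obj ≅ Y.obj.obj ⊗ Y.obj.obj :=
    β_ Y.obj.obj Y.obj.obj ≪≫ β_ Y.obj.obj Y.obj.obj ≪≫ (Y.obj.η ⊗ᵢ Y.obj.η)
  have h1 : ((β_ Y.obj.obj Y.obj.obj).hom ≫ (β_ Y.obj.obj Y.obj.obj).hom) ≫ Z.inv =
      Y.obj.η.inv ⊗ₘ Y.obj.η.inv := by
    rw [Iso.comp_inv_eq]
    simp [Z]
  have h2 := congrArg (fun f => FDMod.Hom.lin f ((1 : Theta Q) ⊗ₜ[k] (1 : Theta Q))) h1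
  have h3 : ∀ t : Theta Q ⊗[k] Theta Q, Z.inv.lin t = (quasiHopf Q).Δ (θ Q) * t :=
    fun t => by
    rw [← tensorAct_lmul]
    have h := congrArg (fun f : Theta Q →ₐ[k] Module.End k (Theta Q ⊗[k] Theta Q) => f (θ Q) t)
      ((tensorData Q).ten_eq' X X)
    exact (congrArg (fun f : Module.End k (Theta Q ⊗[k] Theta Q) => f t)
        (toRep_θ (Y ⊗ Y))).symm.trans h
  have h4 : ((β_ Y.obj.obj Y.obj.obj).hom ≫ (β_ Y.obj.obj Y.obj.obj).hom).lin
      ((1 : Theta Q) ⊗ₜ[k] (1 : Theta Q)) = incl₂ Q.R₂₁R := by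
    refine (FDMod.braid_braid Y.obj.obj Y.obj.obj _).trans ?_
    change tensorAct ((Algebra.lmul k (Theta Q)).comp (incl Q))
      ((Algebra.lmul k (Theta Q)).comp (incl Q)) Q.R₂₁R 1 = _
    rw [tensorAct_comp]
    exact (tensorAct_lmul _ _).trans (mul_one _)
  have h5 : (quasiHopf Q).Δ (θ Q) * incl₂ Q.R₂₁R = (θ Q * 1) ⊗ₜ[k] (θ Q * 1) :=
    ((congrArg (fun t => (quasiHopf Q).Δ (θ Q) * t) h4).symm.trans (h3 _).symm).trans h2
  rwa [mul_one] at h5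

/-- For `θ` this follows from the symmetry of `Δ(θ) R₂₁ R = θ ⊗ θ`. -/
lemma almost_cocomm (x : Theta Q) :
    Algebra.TensorProduct.comm k _ _ ((quasiHopf Q).Δ x) * (R Q).val =
      (R Q).val * (quasiHopf Q).Δ x := by
  have h1 : ∀ a, Algebra.TensorProduct.comm k _ _ ((quasiHopf Q).Δ (incl Q a)) * (R Q).val =
      (R Q).val * (quasiHopf Q).Δ (incl Q a) := fun a => by
    rw [Δ_incl, comm_incl₂, R_val, ← map_mul, ← map_mul, Q.almost_cocomm]
  have h2 : Algebra.TensorProduct.comm k _ _ ((quasiHopf Q).Δ (θ Q)) * (R Q).val =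
      (R Q).val * (quasiHopf Q).Δ (θ Q) := by
    rw [← isUnit_R₂₁R.mul_left_inj, mul_assoc, mul_assoc, Δ_θ, ← θθ_central, ← R₂₁R_val]
    have h := congrArg (Algebra.TensorProduct.comm k (Theta Q) (Theta Q)) (Δ_θ (Q := Q))
    rw [map_mul, ← R₂₁R_val, map_mul] at h
    have e : Algebra.TensorProduct.comm k (Theta Q) (Theta Q)
        (Algebra.TensorProduct.comm k (Theta Q) (Theta Q) (R Q).val) = (R Q).val :=
      (TensorProduct.comm k _ _).symm_apply_apply _
    rw [e, Algebra.TensorProduct.comm_tmul] at h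
    rw [← h]
    simp only [mul_assoc]
  obtain ⟨a, b, rfl⟩ := eq_incl_add x
  rw [map_add, map_add, add_mul, mul_add, h1, map_mul, map_mul, mul_assoc, h2, ← mul_assoc, h1,
    mul_assoc]

lemma quasi_left : Algebra.TensorProduct.assoc k k k _ _ _
      (Algebra.TensorProduct.map (quasiHopf Q).Δ (.id k _) (R Q).val) =
    sw₂₃ k _ (sw₁₂ k _ (quasiHopf Q).Φ.val) * leg₁₃ (R Q).val * sw₂₃ k _ ((quasiHopf Q).Φ⁻¹).val *
      leg₂₃ (R Q).val * (quasiHopf Q).Φ.val := by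
  have h := congrArg (incl₃ (Q := Q)) Q.quasi_left
  simp only [map_mul, incl₃_sw₂₃, incl₃_sw₁₂, incl₃_leg₁₃, incl₃_leg₂₃] at h
  refine Eq.trans ?_ h
  rw [R_val]
  generalize Q.R.val = t
  induction t with
  | zero => simp
  | add x y hx hy => simp only [map_add, hx, hy]
  | tmul a b =>
    simp only [Algebra.TensorProduct.map_tmul, Δ_incl, AlgHom.coe_id, id_eq]
    generalize Q.Δ a = s
    induction s with
    | zero => simp
    | add x y hx hy => simp only [map_add, add_tmul, hx, hy]
    | tmul x y => simp

lemma quasi_right : Algebra.TensorProduct.map (.id k _) (quasiHopf Q).Δ (R Q).val =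
    sw₁₂ k _ (sw₂₃ k _ ((quasiHopf Q).Φ⁻¹).val) * leg₁₃ (R Q).val * sw₁₂ k _ (quasiHopf Q).Φ.val *
      leg₁₂ (R Q).val * ((quasiHopf Q).Φ⁻¹).val := by
  have h := congrArg (incl₃ (Q := Q)) Q.quasi_right
  simp only [map_mul, incl₃_sw₂₃, incl₃_sw₁₂, incl₃_leg₁₃, incl₃_leg₁₂] at h
  refine Eq.trans ?_ h
  rw [R_val]
  generalize Q.R.val = t
  induction t with
  | zero => simp
  | add x y hx hy => simp only [map_add, hx, hy]
  | tmul a b => simp [Δ_incl]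

variable (Q) in
/-- The quasitriangular quasi-Hopf structure on `H(θ)`. -/
def qt : QTQuasiHopf k (Theta Q) where
  toQuasiHopf := quasiHopf Q
  R := R Q
  quasi_left := quasi_left
  quasi_right := quasi_right
  almost_cocomm := almost_cocomm

/-- The automorphism of a dual in `R(_H M)` is the transpose. -/
lemma S_θ : (quasiHopf Q).S (θ Q) = θ Q := TensorData.dual_ext fun φ => by
  refine ((tensorData Q).apply_S φ (θ Q)).trans ?_
  refine (congrArg (fun f : Module.End k (Module.Dual k (Theta Q)) => f φ (1 : Theta Q))
    (toRep_θ (ribbDual (ofRep (AlgRep.reg k (Theta Q)))))).trans ?_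
  exact congrArg φ (mul_one (θ Q))

variable (Q) in
/-- The ribbon element `θ⁻¹`. -/
def ribbonElement : RibbonElement (qt Q) where
  η := (θu Q)⁻¹
  central x := Commute.units_inv_left (u := θu Q) (θ_central x)
  comul := by
    have h1 := Δ_θ (Q := Q)
    have h2 : (qt Q).R₂₁R = incl₂ Q.R₂₁R := R₂₁R_val
    have h3 : (quasiHopf Q).Δ ((θu Q)⁻¹).val * (quasiHopf Q).Δ (θ Q) = 1 := by
      rw [← map_mul]; exact (congrArg _ (θu Q).inv_mul).trans (map_one _)
    have h4 : (θ Q ⊗ₜ[k] θ Q) * (((θu Q)⁻¹).val ⊗ₜ[k] ((θu Q)⁻¹).val) =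
        (1 : Theta Q ⊗[k] Theta Q) := by
      rw [Algebra.TensorProduct.tmul_mul_tmul]
      exact congrArg₂ (· ⊗ₜ[k] ·) (θu Q).mul_inv (θu Q).mul_inv
    have h5 : (θ Q ⊗ₜ[k] θ Q) * (quasiHopf Q).Δ ((θu Q)⁻¹).val = incl₂ Q.R₂₁R := by
      rw [θθ_central, ← h1, ← mul_assoc, h3, one_mul]
    have h6 : (((θu Q)⁻¹).val ⊗ₜ[k] ((θu Q)⁻¹).val) * (θ Q ⊗ₜ[k] θ Q) =
        (1 : Theta Q ⊗[k] Theta Q) := by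
      rw [← θθ_central, h4]
    rw [h2, ← h5, ← mul_assoc, h6, one_mul]; rfl
  antipode := by
    have h : (quasiHopf Q).S ((θu Q)⁻¹).val * θ Q = 1 := by
      have := (quasiHopf Q).S_mul (θ Q) ((θu Q)⁻¹).val
      rw [S_θ] at this
      rw [← this]
      exact (congrArg _ (θu Q).mul_inv).trans (quasiHopf Q).S_one
    exact Units.eq_inv_of_mul_eq_one_right (u := θu Q) h

lemma isStructure : IsStructure Q (qt Q) (ribbonElement Q) where
  hom := (tensorData Q).isQuasiHopfHom
  R_eq := rfl
  comul := (congrArg (fun t => (quasiHopf Q).Δ (θ Q) * t) R₂₁R_val).trans Δ_θ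
  counit := counit_θ
  antipode := S_θ
  ribbon := congrArg Units.val (inv_inv (θu Q))

end Theta

end RibbonExtension

/-! ### The equivalence of `R(_H M)` and modules over `H(θ)` -/

section RibbonModules

variable {k H : Type u} [Field k] [Ring H] [Algebra k H] [Module.Finite k H] {Q : QTQuasiHopf k H}

namespace Theta

lemma tensor_toRep (V W : Ribb (FDMod Q.toQuasiBialgebra)) (b : Theta Q)
    (t : V.obj.obj.V ⊗[k] W.obj.obj.V) :
    tensorAct (toRep V).ρ (toRep W).ρ ((qt Q).Δ b) t = (toRep (V ⊗ W)).ρ b t := by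
  refine (congrArg (fun f : Theta Q →ₐ[k] Module.End k (V.obj.obj.V ⊗[k] W.obj.obj.V) => f b t)
    ((tensorData Q).ten_eq' (toRep V) (toRep W))).symm.trans ?_
  exact ten_id V W (toRep V).ρ (toRep W).ρ (fun _ _ => rfl) (fun _ _ => rfl) b t

variable (Q) in
/-- The functor from `R(_H M)` to modules over `H(θ)`. -/
def ofRibb : Ribb (FDMod Q.toQuasiBialgebra) ⥤ FDMod (qt Q).toQuasiBialgebra where
  obj V := ⟨(toRep V).V, (toRep V).ρ⟩
  map f := ⟨f.hom.hom.lin, hom_intertwines f⟩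

instance : (ofRibb Q).Faithful where
  map_injective {V W _ _} h := Ribb.hom_ext (FDMod.hom_ext fun v =>
    congrArg (fun f : (ofRibb Q).obj V ⟶ (ofRibb Q).obj W =>
      (f.lin : V.obj.obj.V →ₗ[k] W.obj.obj.V) v) h)

instance : (ofRibb Q).Full where
  map_surjective f := ⟨homOfIntertwines f.lin f.comm, rfl⟩

instance : (ofRibb Q).EssSurj where
  mem_essImage X := ⟨ofRep ⟨X.V, X.ρ⟩, ⟨FDMod.isoMk (LinearEquiv.refl k X.V) fun b x =>
    (toRep_ofRep_id ⟨X.V, X.ρ⟩ b x).symm⟩⟩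

instance : (ofRibb Q).IsEquivalence where

/-- The action of `H(θ)` on `V`. -/
def act (V : Ribb (FDMod Q.toQuasiBialgebra)) : Theta Q →ₐ[k] Module.End k V.obj.obj.V :=
  (toRep V).ρ

lemma ρ_eq (V : Ribb (FDMod Q.toQuasiBialgebra)) : V.obj.obj.ρ = (act V).comp (incl Q) :=
  AlgHom.ext fun a => (toRep_incl V a).symm

variable (Q) in
/-- Tensor products in `R(_H M)` are tensor products of modules over `H(θ)`. -/
def ofRibbCore : (ofRibb Q).CoreMonoidal where
  εIso := FDMod.isoMk (LinearEquiv.refl k k) fun b c => (unitRep_apply Q b c).symm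
  μIso V W := FDMod.isoMk (LinearEquiv.refl k (V.obj.obj.V ⊗[k] W.obj.obj.V))
    fun b t => tensor_toRep V W b t
  μIso_hom_natural_left _ _ := rfl
  μIso_hom_natural_right _ _ := rfl
  associativity X Y Z := FDMod.hom_ext fun t => by
    change (X.obj.obj.V ⊗[k] Y.obj.obj.V) ⊗[k] Z.obj.obj.V at t
    have e : ∀ s : H ⊗[k] (H ⊗[k] H), FDMod.act₃ X.obj.obj Y.obj.obj Z.obj.obj s =
        tensorAct (act X) (tensorAct (act Y) (act Z))
          (Algebra.TensorProduct.map (incl Q)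
          (Algebra.TensorProduct.map (incl Q) (incl Q)) s) := fun s => by
      change tensorAct X.obj.obj.ρ (tensorAct Y.obj.obj.ρ Z.obj.obj.ρ) s = _
      rw [ρ_eq X, ρ_eq Y, ρ_eq Z, tensorAct_comp, tensorAct_comp]; rfl
    have h1 : TensorProduct.map (LinearMap.id : X.obj.obj.V ⊗[k] Y.obj.obj.V →ₗ[k] _)
        (LinearMap.id : Z.obj.obj.V →ₗ[k] Z.obj.obj.V) t = t := QuantumDouble.map_id_apply t
    have h2 : ∀ s, TensorProduct.map (LinearMap.id : X.obj.obj.V →ₗ[k] X.obj.obj.V)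
        (LinearMap.id : Y.obj.obj.V ⊗[k] Z.obj.obj.V →ₗ[k] _) s = s :=
      fun s => QuantumDouble.map_id_apply s
    change FDMod.act₃ X.obj.obj Y.obj.obj Z.obj.obj Q.Φ.val
      (TensorProduct.assoc k X.obj.obj.V Y.obj.obj.V Z.obj.obj.V
      (TensorProduct.map (LinearMap.id : X.obj.obj.V ⊗[k] Y.obj.obj.V →ₗ[k] _)
        (LinearMap.id : Z.obj.obj.V →ₗ[k] Z.obj.obj.V) t)) =
        TensorProduct.map (LinearMap.id : X.obj.obj.V →ₗ[k] X.obj.obj.V)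
        (LinearMap.id : Y.obj.obj.V ⊗[k] Z.obj.obj.V →ₗ[k] _)
        (tensorAct (act X) (tensorAct (act Y) (act Z)) (qt Q).Φ.val
          (TensorProduct.assoc k X.obj.obj.V Y.obj.obj.V Z.obj.obj.V t))
    rw [h1, h2, e]
    rfl
  left_unitality X := FDMod.hom_ext fun t => by
    change k ⊗[k] X.obj.obj.V at t
    exact congrArg (TensorProduct.lid k X.obj.obj.V) (QuantumDouble.map_id_apply t).symm
  right_unitality X := FDMod.hom_ext fun t => by
    change X.obj.obj.V ⊗[k] k at t
    exact congrArg (TensorProduct.rid k X.obj.obj.V) (QuantumDouble.map_id_apply t).symm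

instance : (ofRibb Q).Monoidal := (ofRibbCore Q).toMonoidal

instance : (ofRibb Q).Braided where
  braided V W := FDMod.hom_ext fun t => by
    change V.obj.obj.V ⊗[k] W.obj.obj.V at t
    change TensorProduct.comm k V.obj.obj.V W.obj.obj.V
        (tensorAct V.obj.obj.ρ W.obj.obj.ρ Q.R.val t) =
      TensorProduct.comm k V.obj.obj.V W.obj.obj.V
      (tensorAct (act V) (act W) (incl₂ Q.R.val) t)
    rw [ρ_eq V, ρ_eq W, tensorAct_comp]; rfl

variable (Q) in
/-- The category of modules over `H(θ)` is the category `R` of the category of `H`-modules. -/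
lemma ribbonEquivalent :
    RibbonEquivalent (Ribb.twist (FDMod Q.toQuasiBialgebra)) (ribbonElement Q).twist :=
  ribbonEquivalent_of _ _ (ofRibb Q) fun V => FDMod.hom_ext fun v => by
    change V.obj.obj.V at v
    -- both sides are inverse to the action of `θ`
    have h1 : V.obj.η.inv.lin (V.obj.η.hom.lin v) = v :=
      congrArg (fun f => FDMod.Hom.lin f v) V.obj.η.hom_inv_id
    have h2 : ∀ w, (toRep V).ρ ((θu Q)⁻¹).val (V.obj.η.inv.lin w) = w := fun w => by
      have h := congrArg (toRep V).ρ (θu Q).inv_mul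
      rw [map_mul, map_one] at h
      have h' : (toRep V).ρ (θu Q).val = V.obj.η.inv.lin := toRep_θ V
      rw [h'] at h
      exact congrArg (fun f : Module.End k V.obj.obj.V => f w) h
    exact (h2 _).symm.trans (congrArg _ h1)

end Theta

end RibbonModules

end QH

end

theorem mainTheorem9 {k H : Type u} [Field k] [Ring H] [Algebra k H] [Module.Finite k H]
    (Q : QH.QuasiHopf k H) :
    ∃ QD : QH.QTQuasiHopf k (QH.QuantumDouble Q), QH.QuantumDouble.IsStructure Q QD ∧
    ∃ (Qθ : QH.QTQuasiHopf k (QH.Theta QD)) (v : QH.RibbonElement Qθ),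
      QH.Theta.IsStructure QD Qθ v ∧
      (QH.RibbRight.twist (QH.FDMod Q.toQuasiBialgebra)).IsRibbon ∧
      (QH.Ribb.twist (QH.YD Q)).IsRibbon ∧
      v.twist.IsRibbon ∧
      QH.RibbonEquivalent (QH.RibbRight.twist (QH.FDMod Q.toQuasiBialgebra))
        (QH.Ribb.twist (QH.YD Q)) ∧
      QH.RibbonEquivalent (QH.Ribb.twist (QH.YD Q)) v.twist := by
  have hYD : (QH.Ribb.twist (QH.YD Q)).IsRibbon := QH.Ribb.isRibbon _
  have m := QH.ribbonEquivalent_mop (QH.Ribb.twist (CategoryTheory.Center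
    (CategoryTheory.MonoidalOpposite (QH.FDMod Q.toQuasiBialgebra))))
  have e := (QH.Ribb.ribbonEquivalent (QH.QuantumDouble.ofYD Q)
    fun Y => ⟨⟨QH.FDMod.dual (Q := (QH.QuantumDouble.qt Q).toQuasiHopf) Y⟩⟩).trans
      (QH.Theta.ribbonEquivalent (QH.QuantumDouble.qt Q))
  exact ⟨QH.QuantumDouble.qt Q, QH.QuantumDouble.isStructure_qt, QH.Theta.qt _,
    QH.Theta.ribbonElement _, QH.Theta.isStructure, m.1.isRibbon (QH.Ribb.isRibbon _), hYD,
    e.isRibbon hYD, m.2.trans (QH.YD.ribbonEquivalent_center Q), e⟩
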